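/- Let $\alpha,\beta>0$, $\theta_0=(\alpha,\beta)$, and let $X_1,\dots,X_n$ be i.i.d. with the Beta$(\alpha,\beta)$ distribution, whose density is $f(x\mid\alpha,\beta)=\frac{\Gamma(\alpha+\beta)}{\Gamma(\alpha)\Gamma(\beta)}x^{\alpha-1}(1-x)^{\beta-1}$, $0<x<1$, both parameters being unknown. Let $\hat\theta_n(X)$ be the maximum likelihood estimator, i.e. a measurable function of the data which almost surely maximises $\theta\mapsto\prod_{i=1}^n f(X_i\mid\theta)$ over $\Theta=(0,\infty)^2$. Let $I(\theta_0)$ be the expected Fisher information matrix of one observation, $[I(\theta_0)]_{rs}=\mathrm E\left[\frac{\partial}{\partial\theta_r}\log f(X_1|\theta_0)\,\frac{\partial}{\partial\theta_s}\log f(X_1|\theta_0)\right]$, and $[I(\theta_0)]^{1/2}$ its positive semidefinite square root. Let $\Psi_j$ be the $j$-th derivative of the digamma function $\Psi=\Gamma'/\Gamma$. Put $m=\min\{\alpha,\beta\}$, $\epsilon=m/2$, and for $(x,y)\in\{(\alpha,\beta),(\beta,\alpha)\}$ \begin{align*} \delta_I&=\Psi_1(\alpha)\Psi_1(\beta)-\Psi_1(\alpha+\beta)(\Psi_1(\alpha)+\Psi_1(\beta)),\\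 C_1(x,y)&=\Psi_3(x)+\Psi_3(x+y)+3[\Psi_1(x)]^2+3[\Psi_1(x+y)]^2,\\ C_2(x,y)&=\Psi_1(x)-\Psi_1(x+y)+\sqrt{\delta_I},\qquad C_3(x,y)=C_1(x,y)[C_2(y,x)]^2,\\ C_4(x,y)&=\frac{6x}{(y-\epsilon)^4}+\frac{x\pi^4}{15}+\frac{6}{(x+y-\epsilon)^3}+7.26,\\ M_B&=\frac1{\delta_I}\max\left\{\Psi_1(\alpha+\beta),\ \Psi_1(m)-\Psi_1(\alpha+\beta)\right\},\\ \Delta&=\delta_I\,[C_2(\alpha,\beta)+C_2(\beta,\alpha)],\\ G_1&=\left(\Psi_1(\beta)+\sqrt{\delta_I}\right)C_4(\beta,\alpha),\qquad G_2=\left(\Psi_1(\alpha)+\sqrt{\delta_I}\right)C_4(\alpha,\beta),\\ V_1&=\left[C_2(\beta,\alpha)^4C_1(\alpha,\beta)+\Psi_1(\alpha+\beta)^4C_1(\beta,\alpha)\right]^{1/2}+\left[C_2(\alpha,\beta)^4C_1(\beta,\alpha)+\Psi_1(\alpha+\beta)^4C_1(\alpha,\beta)\right]^{1/2},\\ V_2&=\Big\{\Psi_1(\alpha+\beta)^2\left(C_3(\alpha,\beta)+C_3(\beta,\alpha)\right)+2\sqrt{C_1(\alpha,\beta)C_1(\beta,\alpha)}\left[\Psi_1(\alpha+\beta)^4+C_2(\alpha,\beta)^2C_2(\beta,\alpha)^2\right]\Big\}^{1/2},\\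 \gamma_B&=\frac{4M_B}{\sqrt n\,\Delta}V_1+\frac{\sqrt{24}\,M_B}{\sqrt n\,\Delta}V_2+\frac{\Psi_1(\beta)+\Psi_1(\alpha)-2\Psi_1(\alpha+\beta)}{\delta_I},\\ \omega_B&=1-\frac{8M_B}{n\epsilon^2}-\frac{2M_B(G_1+G_2)}{\sqrt{n\Delta}}. \end{align*} Assume that the sample size satisfies $$n\ \ge\ \frac4{m^2}\left(P+\sqrt{P^2+8M_B}\right)^2,\qquad P=\frac{m M_B G_1+G_2}{2\sqrt{\Delta}},\qquad\text{and}\qquad \omega_B>0 .$$ (a) The mean squared error $\mathrm{MSE}=\mathrm E\left[\sum_{j=1}^2(\hat\theta_n(X)_j-\theta_{0,j})^2\right]$ is finite and $$\sqrt{\mathrm{MSE}}\le\sqrt{\frac{\gamma_B}{n\omega_B}}\qquad\text{and}\qquad \mathrm{MSE}\le\sqrt{\frac{\gamma_B}{n\omega_B}} .$$ (b) Let $Z\sim N_2(0,I_{2\times2})$ and let $h:\mathbb R^2\to\mathbb R$ be three times differentiable with bounded partial derivatives of orders one, two and three. Write $\|h\|=\sup|h|\in[0,\infty]$ and let $\|h\|_k$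 be the largest supremum norm of a partial derivative of $h$ of order $k$, $k=1,2,3$. Then (the right-hand side being $\infty$ if $h$ is unbounded) \begin{align*} &\left|\mathrm E\,h\left(\sqrt n\,[I(\theta_0)]^{1/2}(\hat\theta_n(X)-\theta_0)\right)-\mathrm E\,h(Z)\right|\ \le\ \frac{2\|h\|_2}{\sqrt n\,\Delta}V_1+\frac{\sqrt6\,\|h\|_2}{\sqrt n\,\Delta}V_2\\ &\quad+\frac{32\cdot 8^{3/4}\,\|h\|_3}{3\sqrt n\,\Delta^{3/2}}\Big\{\left[C_2(\beta,\alpha)^3+\Psi_1(\alpha+\beta)^3\right]C_1(\alpha,\beta)^{3/4}+\left[C_2(\alpha,\beta)^3+\Psi_1(\alpha+\beta)^3\right]C_1(\beta,\alpha)^{3/4}\Big\}\\ &\quad+\frac{8\|h\|\gamma_B}{n m^2\omega_B}+\frac{\|h\|_1\gamma_B(G_1+G_2)}{2\sqrt n\,\omega_B\sqrt{\Delta}} . \end{align*} -/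

import Mathlib

open MeasureTheory ProbabilityTheory
open scoped ENNReal MatrixOrder

noncomputable section

/-- The Euclidean plane, in which the parameter `θ = (α, β)` lives. -/
abbrev Plane : Type := EuclideanSpace ℝ (Fin 2)

/-- The partial derivative of `g` in the `i`-th coordinate. -/
def partialDeriv (i : Fin 2) (g : Plane → ℝ) : Plane → ℝ :=
  fun x => fderiv ℝ g x (EuclideanSpace.single i 1)

/-! ### The class of test functions -/

/-- The supremum norm, with value `∞` for an unbounded function. -/
def supNorm (g : Plane → ℝ) : ℝ≥0∞ := ⨆ x, ‖g x‖ₑ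

/-- The largest supremum norm of a first-order partial derivative. -/
def supNorm₁ (h : Plane → ℝ) : ℝ≥0∞ := ⨆ i, supNorm (partialDeriv i h)

/-- The largest supremum norm of a second-order partial derivative. -/
def supNorm₂ (h : Plane → ℝ) : ℝ≥0∞ :=
  ⨆ i, ⨆ j, supNorm (partialDeriv i (partialDeriv j h))

/-- The largest supremum norm of a third-order partial derivative. -/
def supNorm₃ (h : Plane → ℝ) : ℝ≥0∞ :=
  ⨆ i, ⨆ j, ⨆ k, supNorm (partialDeriv i (partialDeriv j (partialDeriv k h)))

/-- The class `H` of three times differentiable functions with bounded derivatives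
(of orders one, two and three; the function itself need not be bounded). -/
structure IsTestFunction (h : Plane → ℝ) : Prop where
  differentiable_one : Differentiable ℝ h
  differentiable_two : Differentiable ℝ (fderiv ℝ h)
  differentiable_three : Differentiable ℝ (fderiv ℝ (fderiv ℝ h))
  bounded_one : supNorm₁ h < ∞
  bounded_two : supNorm₂ h < ∞
  bounded_three : supNorm₃ h < ∞

/-! ### The Beta model -/

/-- The open parameter space `Θ = (0, ∞)²`. -/
def betaParamSpace : Set Plane := {θ | 0 < θ 0 ∧ 0 < θ 1}

/-- The likelihood `L(θ; x) = ∏ i, f(xᵢ | θ)` of a sample of size `n`. -/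
def betaLikelihood {n : ℕ} (x : Fin n → ℝ) (θ : Plane) : ℝ :=
  ∏ i, betaPDFReal (θ 0) (θ 1) (x i)

/-- `θ` is a maximum likelihood estimate for the sample `x`. -/
def IsBetaMLE {n : ℕ} (x : Fin n → ℝ) (θ : Plane) : Prop :=
  θ ∈ betaParamSpace ∧ ∀ θ' ∈ betaParamSpace, betaLikelihood x θ' ≤ betaLikelihood x θ

/-- The score `∂/∂θᵣ log f(x | θ)` of one observation. -/
def betaScore (r : Fin 2) (x : ℝ) (θ : Plane) : ℝ :=
  partialDeriv r (fun t => Real.log (betaPDFReal (t 0) (t 1) x)) θ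

/-- The expected Fisher information matrix of one observation,
`[I(θ)]ᵣₛ = E[∂ᵣ log f(X | θ) ∂ₛ log f(X | θ)]` with `X ∼ Beta(θ)`. -/
def betaFisherInfo (θ : Plane) : Matrix (Fin 2) (Fin 2) ℝ :=
  Matrix.of fun r s => ∫ x, betaScore r x θ * betaScore s x θ ∂(betaMeasure (θ 0) (θ 1))

/-- The standardised estimator `√n [I(θ₀)]^{1/2} (t - θ₀)`, with the positive semidefinite
square root of the Fisher information matrix. -/
def betaStandardise (n : ℕ) (θ₀ t : Plane) : Plane :=
  √(n : ℝ) • Matrix.toEuclideanLin (CFC.sqrt (betaFisherInfo θ₀)) (t - θ₀)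

/-! ### The constants of the bound -/

/-- `Ψⱼ`, the `j`-th derivative of the digamma function `Ψ = Γ' / Γ`. -/
def polygamma (j : ℕ) (z : ℝ) : ℝ := iteratedDeriv j (logDeriv Real.Gamma) z

/-- `δ_I`; it is symmetric in `α` and `β`. -/
def betaDelta (α β : ℝ) : ℝ :=
  polygamma 1 α * polygamma 1 β - polygamma 1 (α + β) * (polygamma 1 α + polygamma 1 β)

/-- `C₁(x, y)`. -/
def betaC₁ (x y : ℝ) : ℝ :=
  polygamma 3 x + polygamma 3 (x + y) + 3 * polygamma 1 x ^ 2 + 3 * polygamma 1 (x + y) ^ 2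

/-- `C₂(x, y)`, for `(x, y) = (α, β)` or `(x, y) = (β, α)`. -/
def betaC₂ (x y : ℝ) : ℝ :=
  polygamma 1 x - polygamma 1 (x + y) + √(betaDelta x y)

/-- `C₃(x, y)`. -/
def betaC₃ (x y : ℝ) : ℝ := betaC₁ x y * betaC₂ y x ^ 2

/-- `C₄(x, y)`, with its parameter `ε`. -/
def betaC₄ (ε x y : ℝ) : ℝ :=
  6 * x / (y - ε) ^ 4 + x * Real.pi ^ 4 / 15 + 6 / (x + y - ε) ^ 3 + 7.26

/-- `M_B`. -/
def betaM (α β : ℝ) : ℝ :=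
  1 / betaDelta α β *
    max (polygamma 1 (α + β)) (polygamma 1 (min α β) - polygamma 1 (α + β))

/-- The expression `δ_I [C₂(α, β) + C₂(β, α)]`. -/
def betaDC (α β : ℝ) : ℝ := betaDelta α β * (betaC₂ α β + betaC₂ β α)

/-- The sum of two square roots that occurs in `γ_B` and in the bound. -/
def betaV₁ (α β : ℝ) : ℝ :=
  √(betaC₂ β α ^ 4 * betaC₁ α β + polygamma 1 (α + β) ^ 4 * betaC₁ β α) +
    √(betaC₂ α β ^ 4 * betaC₁ β α + polygamma 1 (α + β) ^ 4 * betaC₁ α β)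

/-- The single square root that occurs in `γ_B` and in the bound. -/
def betaV₂ (α β : ℝ) : ℝ :=
  √(polygamma 1 (α + β) ^ 2 * (betaC₃ α β + betaC₃ β α) +
    2 * √(betaC₁ α β * betaC₁ β α) *
      (polygamma 1 (α + β) ^ 4 + betaC₂ α β ^ 2 * betaC₂ β α ^ 2))

/-- The expression `(Ψ₁(β) + √δ_I) C₄(β, α)`; the other summand of `ω_B` is the same
expression with `α` and `β` interchanged. -/
def betaG (ε α β : ℝ) : ℝ := (polygamma 1 β + √(betaDelta α β)) * betaC₄ ε β α

/-- `γ_B`. -/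
def betaGamma (n : ℕ) (α β : ℝ) : ℝ :=
  4 * betaM α β / (√n * betaDC α β) * betaV₁ α β +
    betaM α β * √24 / (√n * betaDC α β) * betaV₂ α β +
    (polygamma 1 β + polygamma 1 α - 2 * polygamma 1 (α + β)) / betaDelta α β

/-- `ω_B`. -/
def betaOmega (n : ℕ) (ε α β : ℝ) : ℝ :=
  1 - 8 * betaM α β / (n * ε ^ 2) -
    2 * betaM α β * (betaG ε α β + betaG ε β α) / √(n * betaDC α β)

/-- The fraction that occurs twice in the sample size threshold, `m = min {α, β}`, `ε = m / 2`. -/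
def betaThresholdTerm (α β : ℝ) : ℝ :=
  (min α β * betaM α β * betaG (min α β / 2) α β + betaG (min α β / 2) β α) /
    (2 * √(betaDC α β))

/-- The sample size threshold. -/
def betaThreshold (α β : ℝ) : ℝ :=
  4 / min α β ^ 2 *
    (betaThresholdTerm α β + √(betaThresholdTerm α β ^ 2 + 8 * betaM α β)) ^ 2

end

open MeasureTheory ProbabilityTheory
open scoped ENNReal MatrixOrder

/-! ### The digamma function and its derivatives -/

/-! The polygamma functions are, up to sign and factorial, the sums `hurwitzSum`, and the Beta laws
form an exponential family with log-partition function `logBeta`. Tilting by a combination of scores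
stays inside the family, so its moment generating function is the exponential of a Bregman
divergence of `logBeta` (`mgf_scoreComb`). This yields the Fisher matrix, the fourth moments and
Chernoff bounds. A maximum likelihood estimate solves the score equations, hence the score sum at
the true parameter equals n times the increment of the mean score from the truth to the estimate
(`sum_scoreComb_eq_of_isBetaMLE`). Everything about the estimator is read off from this identity.

Mean squared error. If the mean score is small in the dual Fisher norm, convexity of `logBeta`
confines the error to a region where the quadratic approximation is valid. There the squared error
is at most that of the linear approximation plus a third-order term
(`sq_add_sq_le_of_fisherDual_lt`), with expectation τ/n + O(n^(-3/2)), where τ is the trace of the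
inverse information. The complementary event is exponentially unlikely (`measureReal_scoreDual_ge`),
but the estimator is unbounded on it. There the estimate is controlled by the reciprocal sample
variance (`add_le_of_score_eq`), hence by a negative power of the product of successive differences
of the observations. That product has negative moments, and Hölder's inequality finishes the bad
event (`setLIntegral_sq_error_le`).

It remains to absorb the remainders. Positivity of ω says in particular that a constant K =
`betaDrift` is at most √n. Together with the sample size threshold this forces n to exceed a large
multiple of the squared curvature constant (`sampleDemand_mul_curvature_sq_le`), and the remainders
add up to at most (τ/n)(K/√n) (`sample_size_bounds`). Since τ ≤ γ and 1 + K/√n ≤ 1/ω, the mean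
squared error is at most γ/(nω). It is also at most 1, which gives the second inequality of (a).

Normal approximation. The score sum, standardised by the inverse square root of the information, is
compared with the Gaussian by Lindeberg's replacement
(`IsTestFunction.abs_integral_convPow_sub_le`). The bracket with the powers of C₁ bounds its third
moments and is large enough to absorb those of the Gaussian. The standardised estimator differs from
the standardised score by a Taylor remainder that is quadratic in the error when both coordinates of
the error are below m/2; otherwise twice the supremum of |h| is charged to the squared error, as in
Markov's inequality. Both contributions are multiples of the mean squared error, so (a) gives the
last two terms of (b). The terms with second derivatives of h are nonnegative surplus, and so are V₁
and V₂ in γ. -/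

/-- The sum `∑ 1 / (x + k) ^ j` over the natural numbers `k`. -/
noncomputable def hurwitzSum (j : ℕ) (x : ℝ) : ℝ := ∑' k : ℕ, 1 / (x + k) ^ j

theorem add_natCast_pos {x : ℝ} (hx : 0 < x) (k : ℕ) : 0 < x + k := by positivity

theorem summable_one_div_add_pow {j : ℕ} (hj : 2 ≤ j) {x : ℝ} (hx : 0 < x) :
    Summable fun k : ℕ => 1 / (x + k) ^ j := by
  have h := (Real.summable_one_div_nat_add_rpow x j).2 (by exact_mod_cast hj)
  refine h.congr fun k => ?_
  rw [abs_of_pos (by positivity), Real.rpow_natCast, add_comm]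

theorem hurwitzSum_pos {j : ℕ} (hj : 2 ≤ j) {x : ℝ} (hx : 0 < x) : 0 < hurwitzSum j x :=
  (summable_one_div_add_pow hj hx).tsum_pos (fun k => by positivity) 0 (by positivity)

theorem hurwitzSum_eq_add {j : ℕ} (hj : 2 ≤ j) {x : ℝ} (hx : 0 < x) :
    hurwitzSum j x = 1 / x ^ j + hurwitzSum j (x + 1) := by
  rw [hurwitzSum, (summable_one_div_add_pow hj hx).tsum_eq_zero_add]
  simp only [Nat.cast_zero, add_zero, hurwitzSum]
  congr 1
  refine tsum_congr fun k => ?_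
  push_cast
  ring_nf

theorem hurwitzSum_anti {j : ℕ} (hj : 2 ≤ j) {x y : ℝ} (hx : 0 < x) (hxy : x ≤ y) :
    hurwitzSum j y ≤ hurwitzSum j x := by
  have hy := hx.trans_le hxy
  refine Summable.tsum_le_tsum (fun k => ?_) (summable_one_div_add_pow hj hy)
    (summable_one_div_add_pow hj hx)
  have : 0 < x + k := by positivity
  gcongr

theorem hurwitzSum_strictAnti {j : ℕ} (hj : 2 ≤ j) {x y : ℝ} (hx : 0 < x) (hxy : x < y) :
    hurwitzSum j y < hurwitzSum j x := by
  have hy := hx.trans hxy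
  refine Summable.tsum_lt_tsum (i := 0) (fun k => ?_) ?_ (summable_one_div_add_pow hj hy)
    (summable_one_div_add_pow hj hx)
  · have : 0 < x + k := by positivity
    gcongr
  · simp only [Nat.cast_zero, add_zero]
    gcongr

/-- Termwise differentiation: on the half-line beyond x / 2 the derivatives of the terms are
dominated by their absolute values at the left end, which are summable. -/
theorem hasDerivAt_hurwitzSum {j : ℕ} (hj : 2 ≤ j) {x : ℝ} (hx : 0 < x) :
    HasDerivAt (hurwitzSum j) (-j * hurwitzSum (j + 1) x) x := by
  have hx2 : 0 < x / 2 := by positivity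
  have key := hasDerivAt_tsum_of_isPreconnected (𝕜 := ℝ) (F := ℝ)
    (u := fun k : ℕ => j * (1 / (x / 2 + k) ^ (j + 1))) (g := fun (k : ℕ) z => 1 / (z + k) ^ j)
    (g' := fun (k : ℕ) z => -j * (1 / (z + k) ^ (j + 1))) (t := Set.Ioi (x / 2)) (y₀ := x) (y := x)
    ((summable_one_div_add_pow (by omega) hx2).mul_left _) isOpen_Ioi isPreconnected_Ioi
    ?_ ?_ (by simp; linarith) (summable_one_div_add_pow hj hx) (by simp; linarith)
  · rw [tsum_mul_left] at key
    exact key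
  · intro k z hz
    have hz0 : 0 < z + k := add_natCast_pos (hx2.trans hz) k
    have h1 : HasDerivAt (fun z : ℝ => (z + k) ^ j) (j * (z + k) ^ (j - 1)) z := by
      have := ((hasDerivAt_id z).add_const (k : ℝ)).pow j
      rw [mul_one] at this
      exact this
    have := h1.inv (by positivity)
    simp only [one_div]
    refine this.congr_deriv ?_
    obtain ⟨i, rfl⟩ : ∃ i, j = i + 1 := ⟨j - 1, by omega⟩
    simp only [Nat.add_sub_cancel]
    field_simp
    ring
  · intro k z hz
    have h1 : x / 2 < z := hz
    have hz0 : 0 < z + k := add_natCast_pos (hx2.trans h1) k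
    have : 0 < x / 2 + k := by positivity
    rw [Real.norm_eq_abs, neg_mul, abs_neg, abs_of_nonneg (by positivity)]
    gcongr

/-- A series bounded termwise by the differences of a null sequence is bounded by its
first term. -/
theorem tsum_le_of_le_sub {a b : ℕ → ℝ} (ha : Summable a) (h : ∀ k, a k ≤ b k - b (k + 1))
    (hb : Filter.Tendsto b Filter.atTop (nhds 0)) : ∑' k, a k ≤ b 0 := by
  have h1 : Filter.Tendsto (fun n => b 0 - b n) Filter.atTop (nhds (b 0 - 0)) :=
    tendsto_const_nhds.sub hb
  rw [sub_zero] at h1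
  refine le_of_tendsto_of_tendsto' ha.hasSum.tendsto_sum_nat h1 fun n => ?_
  calc ∑ i ∈ Finset.range n, a i ≤ ∑ i ∈ Finset.range n, (b i - b (i + 1)) :=
        Finset.sum_le_sum fun i _ => h i
    _ = b 0 - b n := Finset.sum_range_sub' b n

/-- The digamma function. -/
noncomputable def digamma (x : ℝ) : ℝ := logDeriv Real.Gamma x

theorem differentiableAt_Gamma_of_pos {x : ℝ} (hx : 0 < x) : DifferentiableAt ℝ Real.Gamma x :=
  Real.differentiableAt_Gamma fun m => by
    have : (0 : ℝ) ≤ m := m.cast_nonneg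
    linarith

theorem hasDerivAt_log_Gamma {x : ℝ} (hx : 0 < x) :
    HasDerivAt (fun y => Real.log (Real.Gamma y)) (digamma x) x :=
  ((differentiableAt_Gamma_of_pos hx).hasDerivAt).log (Real.Gamma_pos_of_pos hx).ne'

/-- The functional equation makes the chord of log Γ over a unit interval explicit. By log-convexity
the derivatives at its two ends lie on either side of it, as in the Bohr–Mollerup argument. -/
theorem slope_log_Gamma {x : ℝ} (hx : 0 < x) :
    slope (Real.log ∘ Real.Gamma) x (x + 1) = Real.log x := by
  simp only [slope_def_field, Function.comp]
  rw [Real.Gamma_add_one hx.ne', Real.log_mul hx.ne' (Real.Gamma_pos_of_pos hx).ne']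
  simp

theorem digamma_le_log {x : ℝ} (hx : 0 < x) : digamma x ≤ Real.log x := by
  rw [← slope_log_Gamma hx]
  exact Real.convexOn_log_Gamma.le_slope_of_hasDerivAt hx (by simp; linarith) (by linarith)
    (hasDerivAt_log_Gamma hx)

theorem log_le_digamma_add_one {x : ℝ} (hx : 0 < x) : Real.log x ≤ digamma (x + 1) := by
  rw [← slope_log_Gamma hx]
  exact Real.convexOn_log_Gamma.slope_le_of_hasDerivAt hx (by simp; linarith) (by linarith)
    (hasDerivAt_log_Gamma (by linarith))

theorem digamma_add_one {x : ℝ} (hx : 0 < x) : digamma (x + 1) = digamma x + 1 / x := by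
  have h1 : HasDerivAt (fun y => Real.log (Real.Gamma (y + 1))) (digamma (x + 1)) x := by
    have := (hasDerivAt_log_Gamma (x := x + 1) (by linarith)).comp x
      ((hasDerivAt_id x).add_const 1)
    rw [mul_one] at this
    exact this
  have h2 : HasDerivAt (fun y => Real.log (Real.Gamma y) + Real.log y) (digamma x + x⁻¹) x :=
    (hasDerivAt_log_Gamma hx).add (Real.hasDerivAt_log hx.ne')
  have h3 : (fun y => Real.log (Real.Gamma (y + 1))) =ᶠ[nhds x]
      fun y => Real.log (Real.Gamma y) + Real.log y := by
    filter_upwards [lt_mem_nhds hx] with y hy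
    rw [Real.Gamma_add_one hy.ne', Real.log_mul hy.ne' (Real.Gamma_pos_of_pos hy).ne', add_comm]
  rw [one_div]
  exact h1.unique (h2.congr_of_eventuallyEq h3)

theorem digamma_add_natCast {x : ℝ} (hx : 0 < x) (n : ℕ) :
    digamma (x + n) = digamma x + ∑ k ∈ Finset.range n, 1 / (x + k) := by
  induction n with
  | zero => simp
  | succ n ih =>
    rw [Finset.sum_range_succ, Nat.cast_succ, ← add_assoc, digamma_add_one (by positivity), ih]
    ring

/-- Squeezed between log(x + n) - 1/(x + n) - log n and log(x + n) - log n. The limit does not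
depend on x, which is what determines differences of digamma values. -/
theorem tendsto_digamma_sub_log {x : ℝ} (hx : 0 < x) :
    Filter.Tendsto (fun n : ℕ => digamma (x + n) - Real.log n) Filter.atTop (nhds 0) := by
  have hlog : ∀ y : ℝ, 0 < y → Filter.Tendsto (fun n : ℕ => Real.log (y + n) - Real.log n)
      Filter.atTop (nhds 0) := by
    intro y hy
    have h1 : Filter.Tendsto (fun n : ℕ => y / n + 1) Filter.atTop (nhds (0 + 1)) :=
      (tendsto_const_div_atTop_nhds_zero_nat y).add tendsto_const_nhds
    have h2 := h1.log (by norm_num)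
    simp only [zero_add, Real.log_one] at h2
    refine h2.congr' ?_
    filter_upwards [Filter.eventually_gt_atTop 0] with n hn
    have : (0 : ℝ) < n := by exact_mod_cast hn
    rw [← Real.log_div (by positivity) (by positivity)]
    congr 1
    field_simp
  have hinv : Filter.Tendsto (fun n : ℕ => 1 / (x + n)) Filter.atTop (nhds 0) := by
    simp only [one_div]
    exact (Filter.tendsto_atTop_add_const_left _ x
      tendsto_natCast_atTop_atTop).inv_tendsto_atTop
  refine tendsto_of_tendsto_of_tendsto_of_le_of_le (by simpa only [sub_zero] using (hlog x hx).sub hinv)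
    (hlog x hx) ?_ ?_
  · intro n
    have h1 := log_le_digamma_add_one (x := x + n) (by positivity)
    rw [digamma_add_one (by positivity)] at h1
    simp only
    linarith
  · intro n
    have := digamma_le_log (x := x + n) (by positivity)
    simp only
    linarith

theorem summable_sub_div_mul {x y : ℝ} (hx : 0 < x) (hy : 0 < y) :
    Summable fun k : ℕ => (1 / (x + k) - 1 / (y + k)) := by
  have hm : 0 < min x y := lt_min hx hy
  refine Summable.of_norm_bounded (((summable_one_div_add_pow le_rfl hm)).mul_left |y - x|)
    fun k => ?_
  have h1 : 0 < x + k := by positivity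
  have h2 : 0 < y + k := by positivity
  have h3 : 0 < min x y + k := by positivity
  have h4 : 1 / (x + k) - 1 / (y + k) = (y - x) * (1 / ((x + k) * (y + k))) := by
    field_simp; ring
  rw [h4, norm_mul, Real.norm_eq_abs, Real.norm_eq_abs,
    abs_of_nonneg (a := 1 / ((x + k) * (y + k))) (by positivity), sq]
  gcongr
  · exact min_le_left _ _
  · exact min_le_right _ _

/-- The recurrence shifts both arguments by n; the shifted values have the same asymptotics, so only
the finite sums survive in the limit. -/
theorem digamma_sub_digamma {x y : ℝ} (hx : 0 < x) (hy : 0 < y) :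
    digamma y - digamma x = ∑' k : ℕ, (1 / (x + k) - 1 / (y + k)) := by
  have h1 := (summable_sub_div_mul hx hy).hasSum.tendsto_sum_nat
  refine tendsto_nhds_unique (f := fun n : ℕ =>
    ∑ k ∈ Finset.range n, (1 / (x + k) - 1 / (y + k))) (l := Filter.atTop) ?_ h1
  have h2 := ((tendsto_digamma_sub_log hx).sub (tendsto_digamma_sub_log hy)).const_add
    (digamma y - digamma x)
  rw [sub_zero, add_zero] at h2
  refine h2.congr fun n => ?_
  rw [Finset.sum_sub_distrib, digamma_add_natCast hx, digamma_add_natCast hy]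
  ring

/-- The remainder coefficient of the first-order expansion of the digamma function. -/
noncomputable def digammaRem (x d : ℝ) : ℝ := ∑' k : ℕ, 1 / ((x + k) ^ 2 * (x + k + d))

theorem summable_digammaRem {x d : ℝ} (hx : 0 < x) (hd : 0 < x + d) :
    Summable fun k : ℕ => 1 / ((x + k) ^ 2 * (x + k + d)) := by
  have hm : 0 < min x (x + d) := lt_min hx hd
  refine Summable.of_nonneg_of_le (fun k => ?_) (fun k => ?_)
    (summable_one_div_add_pow (j := 3) (by norm_num) hm)
  · have : 0 < x + k + d := by have : 0 < x + d + k := by positivity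
                               linarith
    positivity
  · have h3 : 0 < min x (x + d) + k := by positivity
    rw [show (min x (x + d) + (k : ℝ)) ^ 3 = (min x (x + d) + k) ^ 2 * (min x (x + d) + k) by ring]
    have h4 : min x (x + d) + k ≤ x + k + d := by
      have := min_le_right x (x + d); linarith
    gcongr
    exact min_le_left _ _

/-- An exact identity, summed from 1/y - 1/(y + d) = d/y² - d²/(y²(y + d)). All Taylor estimates of
the likelihood equations rest on it. -/
theorem digamma_add_sub {x d : ℝ} (hx : 0 < x) (hd : 0 < x + d) :
    digamma (x + d) - digamma x = d * hurwitzSum 2 x - d ^ 2 * digammaRem x d := by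
  rw [digamma_sub_digamma hx hd, hurwitzSum, digammaRem, ← tsum_mul_left, ← tsum_mul_left,
    ← ((summable_one_div_add_pow le_rfl hx).mul_left d).tsum_sub
      ((summable_digammaRem hx hd).mul_left _)]
  refine tsum_congr fun k => ?_
  have h1 : 0 < x + k := by positivity
  have h2 : 0 < x + k + d := by
    have : 0 < x + d + k := by positivity
    linarith
  have h3 : x + d + k ≠ 0 := by linarith
  field_simp
  ring

theorem digammaRem_nonneg {x d : ℝ} (hx : 0 < x) (hd : 0 < x + d) : 0 ≤ digammaRem x d :=
  tsum_nonneg fun k => by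
    have : 0 < x + d + k := by positivity
    have : 0 < x + k + d := by linarith
    positivity

/-- A shift of at least -t x shrinks each x + k + d by at most the factor 1 - t relative to x + k,
because t x ≤ t (x + k). -/
theorem digammaRem_le {x d t : ℝ} (hx : 0 < x) (ht0 : 0 ≤ t) (ht : t < 1) (hd : -(t * x) ≤ d) :
    digammaRem x d ≤ hurwitzSum 3 x / (1 - t) := by
  have hxd : 0 < x + d := by nlinarith
  rw [digammaRem, hurwitzSum, ← tsum_div_const]
  refine (summable_digammaRem hx hxd).tsum_le_tsum (fun k => ?_)
    ((summable_one_div_add_pow (by norm_num) hx).div_const _)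
  have h1 : 0 < x + k := by positivity
  rw [div_div, show (x + (k : ℝ)) ^ 3 * (1 - t) = (x + k) ^ 2 * ((x + k) * (1 - t)) by ring]
  have h2 : 0 < 1 - t := by linarith
  have h3 : (0 : ℝ) ≤ k := k.cast_nonneg
  gcongr
  nlinarith [mul_nonneg h3 ht0]

theorem hasDerivAt_digamma {x : ℝ} (hx : 0 < x) : HasDerivAt digamma (hurwitzSum 2 x) x := by
  rw [hasDerivAt_iff_isLittleO]
  have h1 : (fun y => digamma y - digamma x - (y - x) • hurwitzSum 2 x) =O[nhds x]
      fun y => (y - x) ^ 2 := by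
    refine Asymptotics.IsBigO.of_bound (hurwitzSum 3 x / (1 - 1 / 2)) ?_
    filter_upwards [lt_mem_nhds (show x / 2 < x by linarith)] with y hy
    have h := digamma_add_sub (x := x) (d := y - x) hx (by linarith)
    have h0 := digammaRem_nonneg (x := x) (d := y - x) hx (by linarith)
    have h2 := digammaRem_le (x := x) (d := y - x) (t := 1 / 2) hx (by norm_num) (by norm_num)
      (by linarith)
    rw [add_sub_cancel] at h
    rw [h, smul_eq_mul, sub_sub_cancel_left, norm_neg, norm_mul, mul_comm, Real.norm_eq_abs,
      abs_of_nonneg h0]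
    gcongr
  refine h1.trans_isLittleO ?_
  simpa using Asymptotics.isLittleO_pow_sub_sub x (m := 2) (by norm_num)

theorem polygamma_zero (x : ℝ) : polygamma 0 x = digamma x := rfl

theorem polygamma_succ_eq {j : ℕ} {f : ℝ → ℝ} {f' x : ℝ} (hx : 0 < x)
    (h : ∀ y, 0 < y → polygamma j y = f y) (hf : HasDerivAt f f' x) :
    polygamma (j + 1) x = f' := by
  have : iteratedDeriv j (logDeriv Real.Gamma) =ᶠ[nhds x] f := by
    filter_upwards [lt_mem_nhds hx] with y hy using h y hy
  rw [polygamma, iteratedDeriv_succ, this.deriv_eq, hf.deriv]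

theorem polygamma_one {x : ℝ} (hx : 0 < x) : polygamma 1 x = hurwitzSum 2 x :=
  polygamma_succ_eq hx (fun y _ => polygamma_zero y) (hasDerivAt_digamma hx)

theorem polygamma_two {x : ℝ} (hx : 0 < x) : polygamma 2 x = -2 * hurwitzSum 3 x :=
  polygamma_succ_eq hx (fun _ hy => polygamma_one hy)
    (by simpa using hasDerivAt_hurwitzSum (j := 2) le_rfl hx)

theorem polygamma_three {x : ℝ} (hx : 0 < x) : polygamma 3 x = 6 * hurwitzSum 4 x :=
  polygamma_succ_eq hx (fun _ hy => polygamma_two hy)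
    (((hasDerivAt_hurwitzSum (j := 3) (by norm_num) hx).const_mul (-2)).congr_deriv
      (by push_cast; ring))

theorem digamma_strictMono {x y : ℝ} (hx : 0 < x) (hxy : x < y) : digamma x < digamma y := by
  have hy := hx.trans hxy
  rw [← sub_pos, digamma_sub_digamma hx hy]
  have hlt : ∀ k : ℕ, 0 < 1 / (x + k) - 1 / (y + k) := fun k => by
    have : 0 < x + k := by positivity
    have := one_div_lt_one_div_of_lt this (show x + k < y + k by linarith)
    linarith
  exact (summable_sub_div_mul hx hy).tsum_pos (fun k => (hlt k).le) 0 (hlt 0)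

/-! ### Elementary bounds for the polygamma functions -/

/-- Telescoping: to bound the sum by a function vanishing at infinity, it suffices to compare one
unit difference of that function with one term. -/
theorem hurwitzSum_le_of_sub {j : ℕ} (hj : 2 ≤ j) {F : ℝ → ℝ} {x c : ℝ} (hx : 0 < x)
    (h : ∀ v, 0 < v → c * (1 / v ^ j) ≤ F v - F (v + 1))
    (hF : Filter.Tendsto F Filter.atTop (nhds 0)) : c * hurwitzSum j x ≤ F x := by
  have := tsum_le_of_le_sub (a := fun k : ℕ => c * (1 / (x + k) ^ j)) (b := fun k : ℕ => F (x + k))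
    ((summable_one_div_add_pow hj hx).mul_left c)
    (fun k => by
      have := h (x + k) (by positivity)
      rwa [add_assoc, ← Nat.cast_succ] at this)
    (hF.comp (Filter.tendsto_atTop_add_const_left _ x tendsto_natCast_atTop_atTop))
  rw [tsum_mul_left] at this
  simpa [hurwitzSum] using this

theorem le_hurwitzSum_of_sub {j : ℕ} (hj : 2 ≤ j) {F : ℝ → ℝ} {x c : ℝ} (hx : 0 < x)
    (h : ∀ v, 0 < v → F v - F (v + 1) ≤ c * (1 / v ^ j))
    (hF : Filter.Tendsto F Filter.atTop (nhds 0)) : F x ≤ c * hurwitzSum j x := by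
  have := hurwitzSum_le_of_sub (c := -c) (F := fun v => -F v) hj hx
    (fun v hv => by have := h v hv; linarith) (by simpa using hF.neg)
  linarith

theorem tendsto_const_div_pow_atTop (c : ℝ) {j : ℕ} (hj : j ≠ 0) :
    Filter.Tendsto (fun v : ℝ => c / v ^ j) Filter.atTop (nhds 0) :=
  tendsto_const_nhds.div_atTop (Filter.tendsto_pow_atTop hj)

theorem tendsto_zero_of_le_div {F : ℝ → ℝ} {c : ℝ} (h0 : ∀ v, 1 ≤ v → 0 ≤ F v)
    (h : ∀ v, 1 ≤ v → F v ≤ c / v) : Filter.Tendsto F Filter.atTop (nhds 0) := by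
  have h1 := tendsto_const_div_pow_atTop c (j := 1) one_ne_zero
  simp only [pow_one] at h1
  refine tendsto_of_tendsto_of_tendsto_of_le_of_le' tendsto_const_nhds h1 ?_ ?_
  · filter_upwards [Filter.eventually_ge_atTop 1] with v hv using h0 v hv
  · filter_upwards [Filter.eventually_ge_atTop 1] with v hv using h v hv

/-- The majorant keeps the first term and replaces the others by the midpoint integral 1/(x + 1/2).
-/
theorem hurwitzSum_two_le {x : ℝ} (hx : 0 < x) :
    hurwitzSum 2 x ≤ 1 / x ^ 2 + 2 / (2 * x + 1) := by
  have := hurwitzSum_le_of_sub (j := 2) (c := 1) le_rfl hx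
    (F := fun x => 1 / x ^ 2 + 2 / (2 * x + 1))
    (fun v hv => ?_) (tendsto_zero_of_le_div (c := 2) (fun v hv => by positivity) fun v hv => ?_)
  · simpa using this
  · rw [← sub_nonneg]
    have : 1 / v ^ 2 + 2 / (2 * v + 1) - (1 / (v + 1) ^ 2 + 2 / (2 * (v + 1) + 1)) -
        1 * (1 / v ^ 2) = 1 / ((v + 1) ^ 2 * (2 * v + 1) * (2 * v + 3)) := by
      field_simp
      ring
    rw [this]
    positivity
  · have hv0 : 0 < v := by linarith
    have h1 : 1 / v ^ 2 ≤ 1 / v := by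
      rw [div_le_div_iff₀ (by positivity) hv0]; nlinarith
    have h2 : 2 / (2 * v + 1) ≤ 1 / v := by
      rw [div_le_div_iff₀ (by positivity) hv0]; nlinarith
    have h3 : 2 / v = 1 / v + 1 / v := by ring
    linarith

theorem two_mul_hurwitzSum_three_le {x : ℝ} (hx : 0 < x) :
    2 * hurwitzSum 3 x ≤ (x ^ 2 + 2 * x + 2) / (x ^ 3 * (x + 1)) := by
  refine hurwitzSum_le_of_sub (j := 3) (c := 2) (by norm_num) hx
    (F := fun x => (x ^ 2 + 2 * x + 2) / (x ^ 3 * (x + 1)))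
    (fun v hv => ?_) (tendsto_zero_of_le_div (c := 4) (fun v hv => by positivity) fun v hv => ?_)
  · rw [← sub_nonneg]
    have : (v ^ 2 + 2 * v + 2) / (v ^ 3 * (v + 1)) -
        ((v + 1) ^ 2 + 2 * (v + 1) + 2) / ((v + 1) ^ 3 * (v + 1 + 1)) - 2 * (1 / v ^ 3) =
        2 / (v * (v + 1) ^ 3 * (v + 2)) := by
      field_simp
      ring
    rw [this]
    positivity
  · have hv0 : 0 < v := by linarith
    rw [div_le_div_iff₀ (by positivity) hv0]
    nlinarith [pow_pos hv0 2, pow_pos hv0 3, pow_pos hv0 4, pow_le_pow_right₀ hv (show 2 ≤ 3 by norm_num),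
     pow_le_pow_right₀ hv (show 1 ≤ 3 by norm_num)]

/-- The minorant is fitted to `hurwitzSum_two_le`: multiplied by x it is exactly that majorant plus
1/(2x²), which is what `hurwitzSum_two_add_le` needs. -/
theorem le_two_mul_hurwitzSum_three {x : ℝ} (hx : 0 < x) :
    3 / (2 * x ^ 3) + 2 / (x * (2 * x + 1)) ≤ 2 * hurwitzSum 3 x := by
  refine le_hurwitzSum_of_sub (j := 3) (c := 2) (by norm_num) hx
    (F := fun x => 3 / (2 * x ^ 3) + 2 / (x * (2 * x + 1)))
    (fun v hv => ?_) (tendsto_zero_of_le_div (c := 3) (fun v hv => by positivity) fun v hv => ?_)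
  · rw [← sub_nonneg]
    have : 2 * (1 / v ^ 3) - (3 / (2 * v ^ 3) + 2 / (v * (2 * v + 1)) -
        (3 / (2 * (v + 1) ^ 3) + 2 / ((v + 1) * (2 * (v + 1) + 1)))) =
        (8 * v ^ 3 + 25 * v ^ 2 + 17 * v + 3) /
          (2 * v ^ 3 * (v + 1) ^ 3 * (2 * v + 1) * (2 * v + 3)) := by
      field_simp
      ring
    rw [this]
    positivity
  · have hv0 : 0 < v := by linarith
    have h1 : 3 / (2 * v ^ 3) ≤ 3 / (2 * v) := by
      gcongr
      nlinarith [pow_le_pow_right₀ hv (show 1 ≤ 3 by norm_num)]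
    have h2 : 2 / (v * (2 * v + 1)) ≤ 1 / v := by
      rw [div_le_div_iff₀ (by positivity) hv0]; nlinarith
    have h3 : 3 / v = 3 / (2 * v) + 1 / v + 1 / (2 * v) := by field_simp; ring
    have : 0 < 1 / (2 * v) := by positivity
    linarith

/-- The inequality behind the monotonicity of `x Ψ₁(x) - 1 / (2 x)`. -/
theorem hurwitzSum_two_add_le {x : ℝ} (hx : 0 < x) :
    hurwitzSum 2 x + 1 / (2 * x ^ 2) ≤ 2 * x * hurwitzSum 3 x := by
  have h1 := hurwitzSum_two_le hx
  have h2 := mul_le_mul_of_nonneg_left (le_two_mul_hurwitzSum_three hx) hx.le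
  have h3 : x * (3 / (2 * x ^ 3) + 2 / (x * (2 * x + 1))) =
      1 / x ^ 2 + 2 / (2 * x + 1) + 1 / (2 * x ^ 2) := by
    field_simp
    ring
  linarith

theorem hurwitzSum_two_le_inv_sq {x : ℝ} (hx : 0 < x) :
    hurwitzSum 2 x ≤ 1 / x ^ 2 + 5 / 3 := by
  have h1 := hurwitzSum_eq_add (j := 2) (by norm_num) hx
  have h2 := hurwitzSum_anti (j := 2) (by norm_num) one_pos (show 1 ≤ x + 1 by linarith)
  have h3 := hurwitzSum_two_le one_pos
  norm_num at h3
  linarith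

/-- Each ratio x/(x + k) increases with x. Together with `mul_hurwitzSum_two_anti` this confines the
quotient of two values of Ψ₁ between the first and the second power of the inverse quotient of the
arguments. -/
theorem sq_mul_hurwitzSum_two_mono {x y : ℝ} (hx : 0 < x) (hxy : x ≤ y) :
    x ^ 2 * hurwitzSum 2 x ≤ y ^ 2 * hurwitzSum 2 y := by
  have hy := hx.trans_le hxy
  rw [hurwitzSum, hurwitzSum, ← tsum_mul_left, ← tsum_mul_left]
  refine Summable.tsum_le_tsum (fun k => ?_) ((summable_one_div_add_pow le_rfl hx).mul_left _)
    ((summable_one_div_add_pow le_rfl hy).mul_left _)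
  have hk : (0 : ℝ) ≤ k := k.cast_nonneg
  rw [mul_one_div, mul_one_div, ← div_pow, ← div_pow]
  have : x / (x + k) ≤ y / (y + k) := by
    rw [div_le_div_iff₀ (by positivity) (by positivity)]
    nlinarith
  gcongr

/-- The derivative is nonpositive by `hurwitzSum_two_add_le`. The correction 1/(2x) turns positivity
of the Fisher determinant into the quantitative bound `fisherDet_lower`. -/
theorem mul_hurwitzSum_two_sub_anti {x y : ℝ} (hx : 0 < x) (hxy : x ≤ y) :
    y * hurwitzSum 2 y - 1 / (2 * y) ≤ x * hurwitzSum 2 x - 1 / (2 * x) := by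
  have hd : ∀ z : ℝ, 0 < z → HasDerivAt (fun z => z * hurwitzSum 2 z - 1 / (2 * z))
      (1 * hurwitzSum 2 z + z * (-(2 : ℕ) * hurwitzSum (2 + 1) z) + 1 / (2 * z ^ 2)) z := by
    intro z hz
    have h1 := (hasDerivAt_id z).mul (hasDerivAt_hurwitzSum (j := 2) le_rfl hz)
    have h2 : HasDerivAt (fun z : ℝ => 1 / (2 * z)) (-(1 / (2 * z ^ 2))) z := by
      have := ((hasDerivAt_inv hz.ne').const_mul (1 / 2 : ℝ))
      refine (this.congr_of_eventuallyEq ?_).congr_deriv ?_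
      · filter_upwards [lt_mem_nhds hz] with w hw
        field_simp
      · field_simp
    refine (h1.sub h2).congr_deriv ?_
    simp only [id]
    ring
  have : AntitoneOn (fun z => z * hurwitzSum 2 z - 1 / (2 * z)) (Set.Ioi 0) := by
    refine antitoneOn_of_deriv_nonpos (convex_Ioi 0)
      (fun z hz => (hd z hz).continuousAt.continuousWithinAt)
      (fun z hz => ?_) fun z hz => ?_
    · rw [interior_Ioi] at hz
      exact (hd z hz).differentiableAt.differentiableWithinAt
    · rw [interior_Ioi] at hz
      rw [(hd z hz).deriv]
      have := hurwitzSum_two_add_le (x := z) hz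
      push_cast
      norm_num
      norm_num at this
      linarith
  exact this hx (hx.trans_le hxy) hxy

theorem mul_hurwitzSum_two_anti {x y : ℝ} (hx : 0 < x) (hxy : x ≤ y) :
    y * hurwitzSum 2 y ≤ x * hurwitzSum 2 x := by
  have h1 := mul_hurwitzSum_two_sub_anti hx hxy
  have h2 : 1 / (2 * y) ≤ 1 / (2 * x) := by gcongr
  linarith

/-! ### The Beta distribution as an exponential family -/

/-- The logarithm of the Beta function. -/
noncomputable def logBeta (a b : ℝ) : ℝ :=
  Real.log (Real.Gamma a) + Real.log (Real.Gamma b) - Real.log (Real.Gamma (a + b))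

theorem exp_logBeta {a b : ℝ} (ha : 0 < a) (hb : 0 < b) : Real.exp (logBeta a b) = beta a b := by
  rw [logBeta, Real.exp_sub, Real.exp_add, Real.exp_log (Real.Gamma_pos_of_pos ha),
    Real.exp_log (Real.Gamma_pos_of_pos hb), Real.exp_log (Real.Gamma_pos_of_pos (by linarith)),
    beta]

theorem log_betaPDFReal {a b x : ℝ} (ha : 0 < a) (hb : 0 < b) (hx0 : 0 < x) (hx1 : x < 1) :
    Real.log (betaPDFReal a b x) =
      (a - 1) * Real.log x + (b - 1) * Real.log (1 - x) - logBeta a b := by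
  have h1 : 0 < 1 - x := by linarith
  rw [betaPDFReal, if_pos ⟨hx0, hx1⟩, ← exp_logBeta ha hb, Real.log_mul (by positivity)
    (by positivity), Real.log_mul (by positivity) (by positivity), Real.log_rpow hx0,
    Real.log_rpow h1, one_div, Real.log_inv, Real.log_exp]
  ring

theorem betaPDFReal_eq_exp {a b x : ℝ} (ha : 0 < a) (hb : 0 < b) (hx0 : 0 < x) (hx1 : x < 1) :
    betaPDFReal a b x =
      Real.exp ((a - 1) * Real.log x + (b - 1) * Real.log (1 - x) - logBeta a b) := by
  rw [← log_betaPDFReal ha hb hx0 hx1, Real.exp_log (betaPDFReal_pos hx0 hx1 ha hb)]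

theorem measurable_betaPDF (α β : ℝ) : Measurable (betaPDF α β) :=
  (measurable_betaPDFReal α β).ennreal_ofReal

theorem ae_mem_Ioo_betaMeasure (α β : ℝ) : ∀ᵐ x ∂betaMeasure α β, 0 < x ∧ x < 1 := by
  rw [betaMeasure, ae_withDensity_iff (measurable_betaPDF α β)]
  refine Filter.Eventually.of_forall fun x hx => ?_
  by_contra h
  exact hx (by rw [betaPDF, betaPDFReal, if_neg h, ENNReal.ofReal_zero])

/-- The linear combination with coefficients `c₁`, `c₂` of the score functions of the Beta
distribution. -/
noncomputable def scoreComb (α β c₁ c₂ x : ℝ) : ℝ :=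
  c₁ * (Real.log x - (digamma α - digamma (α + β))) +
    c₂ * (Real.log (1 - x) - (digamma β - digamma (α + β)))

theorem measurable_scoreComb (α β c₁ c₂ : ℝ) : Measurable (scoreComb α β c₁ c₂) := by
  unfold scoreComb
  fun_prop

/-- The Bregman divergence of the logarithm of the Beta function. -/
noncomputable def logBetaRem (α β v₁ v₂ : ℝ) : ℝ :=
  logBeta (α + v₁) (β + v₂) - logBeta α β - v₁ * (digamma α - digamma (α + β)) -
    v₂ * (digamma β - digamma (α + β))

/-- Exponential tilting: a Beta density times the exponential of a score combination is, up to the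
constant on the right, the Beta density with shifted parameters. -/
theorem lintegral_exp_scoreComb {α β c₁ c₂ t : ℝ} (hα : 0 < α) (hβ : 0 < β)
    (h1 : 0 < α + t * c₁) (h2 : 0 < β + t * c₂) :
    ∫⁻ x, ENNReal.ofReal (Real.exp (t * scoreComb α β c₁ c₂ x)) ∂betaMeasure α β =
      ENNReal.ofReal (Real.exp (logBetaRem α β (t * c₁) (t * c₂))) := by
  have hm := measurable_scoreComb α β c₁ c₂
  rw [betaMeasure, lintegral_withDensity_eq_lintegral_mul _ (measurable_betaPDF α β)
    (by fun_prop)]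
  calc ∫⁻ x, (betaPDF α β * fun x => ENNReal.ofReal (Real.exp (t * scoreComb α β c₁ c₂ x))) x
      = ∫⁻ x, ENNReal.ofReal (Real.exp (logBetaRem α β (t * c₁) (t * c₂))) *
          betaPDF (α + t * c₁) (β + t * c₂) x := by
        refine lintegral_congr fun x => ?_
        simp only [Pi.mul_apply, betaPDF]
        by_cases hx : 0 < x ∧ x < 1
        · rw [← ENNReal.ofReal_mul (betaPDFReal_pos hx.1 hx.2 hα hβ).le,
            ← ENNReal.ofReal_mul (Real.exp_pos _).le, betaPDFReal_eq_exp hα hβ hx.1 hx.2,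
            betaPDFReal_eq_exp h1 h2 hx.1 hx.2, ← Real.exp_add, ← Real.exp_add]
          congr 2
          simp only [scoreComb, logBetaRem]
          ring
        · simp [betaPDFReal, if_neg hx]
    _ = _ := by
        rw [lintegral_const_mul _ (measurable_betaPDF _ _), lintegral_betaPDF_eq_one h1 h2, mul_one]

theorem integrable_exp_scoreComb {α β c₁ c₂ t : ℝ} (hα : 0 < α) (hβ : 0 < β)
    (h1 : 0 < α + t * c₁) (h2 : 0 < β + t * c₂) :
    Integrable (fun x => Real.exp (t * scoreComb α β c₁ c₂ x)) (betaMeasure α β) := by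
  have hm := measurable_scoreComb α β c₁ c₂
  refine ⟨by fun_prop, ?_⟩
  rw [hasFiniteIntegral_iff_ofReal (Filter.Eventually.of_forall fun x => (Real.exp_pos _).le),
    lintegral_exp_scoreComb hα hβ h1 h2]
  exact ENNReal.ofReal_lt_top

theorem mgf_scoreComb {α β c₁ c₂ t : ℝ} (hα : 0 < α) (hβ : 0 < β)
    (h1 : 0 < α + t * c₁) (h2 : 0 < β + t * c₂) :
    mgf (scoreComb α β c₁ c₂) (betaMeasure α β) t =
      Real.exp (logBetaRem α β (t * c₁) (t * c₂)) := by
  have hm := measurable_scoreComb α β c₁ c₂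
  rw [mgf, integral_eq_lintegral_of_nonneg_ae
    (Filter.Eventually.of_forall fun x => (Real.exp_pos _).le) (by fun_prop),
    lintegral_exp_scoreComb hα hβ h1 h2, ENNReal.toReal_ofReal (Real.exp_pos _).le]

theorem eventually_add_mul_pos {a c : ℝ} (ha : 0 < a) : ∀ᶠ t in nhds (0 : ℝ), 0 < a + t * c := by
  have : ContinuousAt (fun t : ℝ => a + t * c) 0 := by fun_prop
  exact this.eventually (lt_mem_nhds (by simpa using ha))

theorem zero_mem_interior_integrableExpSet_scoreComb {α β : ℝ} (hα : 0 < α) (hβ : 0 < β)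
    (c₁ c₂ : ℝ) :
    (0 : ℝ) ∈ interior (integrableExpSet (scoreComb α β c₁ c₂) (betaMeasure α β)) := by
  rw [mem_interior_iff_mem_nhds]
  filter_upwards [eventually_add_mul_pos hα, eventually_add_mul_pos hβ] with t h1 h2 using
    integrable_exp_scoreComb hα hβ h1 h2

theorem memLp_scoreComb {α β : ℝ} (hα : 0 < α) (hβ : 0 < β) (c₁ c₂ : ℝ) (p : NNReal) :
    MemLp (scoreComb α β c₁ c₂) p (betaMeasure α β) :=
  memLp_of_mem_interior_integrableExpSet
    (zero_mem_interior_integrableExpSet_scoreComb hα hβ c₁ c₂) p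

theorem integrable_scoreComb_pow {α β : ℝ} (hα : 0 < α) (hβ : 0 < β) (c₁ c₂ : ℝ) (j : ℕ) :
    Integrable (fun x => scoreComb α β c₁ c₂ x ^ j) (betaMeasure α β) :=
  integrable_pow_of_mem_interior_integrableExpSet
    (zero_mem_interior_integrableExpSet_scoreComb hα hβ c₁ c₂) j

/-- The derivative of `logBetaRem` along a line. -/
noncomputable def logBetaRemDeriv (α β c₁ c₂ t : ℝ) : ℝ :=
  c₁ * (digamma (α + t * c₁) - digamma α) + c₂ * (digamma (β + t * c₂) - digamma β) -
    (c₁ + c₂) * (digamma (α + β + t * (c₁ + c₂)) - digamma (α + β))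

/-- The derivative of order `j + 1` of `logBetaRem` along a line, up to a constant. -/
noncomputable def hurwitzForm (j : ℕ) (α β c₁ c₂ t : ℝ) : ℝ :=
  c₁ ^ j * hurwitzSum j (α + t * c₁) + c₂ ^ j * hurwitzSum j (β + t * c₂) -
    (c₁ + c₂) ^ j * hurwitzSum j (α + β + t * (c₁ + c₂))

theorem hasDerivAt_add_mul (a c t : ℝ) : HasDerivAt (fun t : ℝ => a + t * c) c t := by
  simpa using ((hasDerivAt_id t).mul_const c).const_add a

theorem hasDerivAt_logBetaRem {α β c₁ c₂ t : ℝ} (h1 : 0 < α + t * c₁) (h2 : 0 < β + t * c₂) :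
    HasDerivAt (fun t => logBetaRem α β (t * c₁) (t * c₂)) (logBetaRemDeriv α β c₁ c₂ t) t := by
  have h3 : 0 < α + β + t * (c₁ + c₂) := by linarith
  have d1 := (hasDerivAt_log_Gamma h1).comp t (hasDerivAt_add_mul α c₁ t)
  have d2 := (hasDerivAt_log_Gamma h2).comp t (hasDerivAt_add_mul β c₂ t)
  have d3 := (hasDerivAt_log_Gamma h3).comp t (hasDerivAt_add_mul (α + β) (c₁ + c₂) t)
  have d4 : HasDerivAt (fun t : ℝ => logBeta α β + t * (c₁ * (digamma α - digamma (α + β)) +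
      c₂ * (digamma β - digamma (α + β)))) _ t := hasDerivAt_add_mul _ _ t
  refine ((((d1.add d2).sub d3).sub d4).congr_of_eventuallyEq
    (Filter.Eventually.of_forall fun u => ?_)).congr_deriv ?_
  · simp only [logBetaRem, logBeta, Pi.sub_apply, Pi.add_apply, Function.comp]
    rw [show α + u * c₁ + (β + u * c₂) = α + β + u * (c₁ + c₂) by ring]
    ring
  · simp only [logBetaRemDeriv]
    ring

theorem hasDerivAt_logBetaRemDeriv {α β c₁ c₂ t : ℝ} (h1 : 0 < α + t * c₁)
    (h2 : 0 < β + t * c₂) :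
    HasDerivAt (logBetaRemDeriv α β c₁ c₂) (hurwitzForm 2 α β c₁ c₂ t) t := by
  have h3 : 0 < α + β + t * (c₁ + c₂) := by linarith
  have d1 := (((hasDerivAt_digamma h1).comp t (hasDerivAt_add_mul α c₁ t)).sub_const
    (digamma α)).const_mul c₁
  have d2 := (((hasDerivAt_digamma h2).comp t (hasDerivAt_add_mul β c₂ t)).sub_const
    (digamma β)).const_mul c₂
  have d3 := (((hasDerivAt_digamma h3).comp t (hasDerivAt_add_mul (α + β) (c₁ + c₂) t)).sub_const
    (digamma (α + β))).const_mul (c₁ + c₂)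
  refine ((d1.add d2).sub d3).congr_deriv ?_
  simp only [hurwitzForm]
  ring

theorem hasDerivAt_hurwitzForm {j : ℕ} (hj : 2 ≤ j) {α β c₁ c₂ t : ℝ} (h1 : 0 < α + t * c₁)
    (h2 : 0 < β + t * c₂) :
    HasDerivAt (hurwitzForm j α β c₁ c₂) (-j * hurwitzForm (j + 1) α β c₁ c₂ t) t := by
  have h3 : 0 < α + β + t * (c₁ + c₂) := by linarith
  have d1 := ((hasDerivAt_hurwitzSum hj h1).comp t (hasDerivAt_add_mul α c₁ t)).const_mul (c₁ ^ j)
  have d2 := ((hasDerivAt_hurwitzSum hj h2).comp t (hasDerivAt_add_mul β c₂ t)).const_mul (c₂ ^ j)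
  have d3 := ((hasDerivAt_hurwitzSum hj h3).comp t
    (hasDerivAt_add_mul (α + β) (c₁ + c₂) t)).const_mul ((c₁ + c₂) ^ j)
  refine ((d1.add d2).sub d3).congr_deriv ?_
  simp only [hurwitzForm]
  ring

theorem iteratedDeriv_succ_of_eventually {M M₁ : ℝ → ℝ} {M₂ x : ℝ} {j : ℕ}
    (h : iteratedDeriv j M =ᶠ[nhds x] M₁) (h1 : HasDerivAt M₁ M₂ x) :
    iteratedDeriv (j + 1) M x = M₂ := by
  rw [iteratedDeriv_succ, h.deriv_eq, h1.deriv]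

theorem logBetaRem_zero (α β : ℝ) : logBetaRem α β 0 0 = 0 := by simp [logBetaRem]

theorem logBetaRemDeriv_zero (α β c₁ c₂ : ℝ) : logBetaRemDeriv α β c₁ c₂ 0 = 0 := by
  simp [logBetaRemDeriv]

/-- The first, second and fourth moments of a random variable whose moment generating function
is the exponential of a multiple of `logBetaRem` along a line. -/
theorem moments_of_mgf_eq {Ω : Type*} [MeasurableSpace Ω] {μ : Measure Ω} {Y : Ω → ℝ} {N : ℝ}
    {α β : ℝ} (hα : 0 < α) (hβ : 0 < β) (c₁ c₂ : ℝ)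
    (h0 : (0 : ℝ) ∈ interior (integrableExpSet Y μ))
    (hY : ∀ᶠ t in nhds (0 : ℝ), mgf Y μ t = Real.exp (N * logBetaRem α β (t * c₁) (t * c₂))) :
    (∫ ω, Y ω ∂μ) = 0 ∧
    (∫ ω, Y ω ^ 2 ∂μ) = N * hurwitzForm 2 α β c₁ c₂ 0 ∧
    (∫ ω, Y ω ^ 4 ∂μ) =
      6 * (N * hurwitzForm 4 α β c₁ c₂ 0) + 3 * (N * hurwitzForm 2 α β c₁ c₂ 0) ^ 2 := by
  set M := mgf Y μ with hM
  set g := fun t => N * logBetaRem α β (t * c₁) (t * c₂) with hg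
  set g₁ := fun t => N * logBetaRemDeriv α β c₁ c₂ t with hg1
  set g₂ := fun t => N * hurwitzForm 2 α β c₁ c₂ t with hg2
  set g₃ := fun t => N * hurwitzForm 3 α β c₁ c₂ t with hg3
  set g₄ := fun t => N * hurwitzForm 4 α β c₁ c₂ t with hg4
  have ev : ∀ᶠ t in nhds (0 : ℝ), 0 < α + t * c₁ ∧ 0 < β + t * c₂ :=
    (eventually_add_mul_pos hα).and (eventually_add_mul_pos hβ)
  have dg : ∀ t, (0 < α + t * c₁ ∧ 0 < β + t * c₂) →
      HasDerivAt g (g₁ t) t ∧ HasDerivAt g₁ (g₂ t) t ∧ HasDerivAt g₂ (-2 * g₃ t) t ∧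
        HasDerivAt g₃ (-3 * g₄ t) t := fun t ht =>
    ⟨(hasDerivAt_logBetaRem ht.1 ht.2).const_mul N,
      (hasDerivAt_logBetaRemDeriv ht.1 ht.2).const_mul N,
      ((hasDerivAt_hurwitzForm (j := 2) le_rfl ht.1 ht.2).const_mul N).congr_deriv
        (by simp [hg3]; ring),
      ((hasDerivAt_hurwitzForm (j := 3) (by norm_num) ht.1 ht.2).const_mul N).congr_deriv
        (by simp [hg4]; ring)⟩
  -- The derivatives of exp ∘ g are needed on a neighbourhood of zero, since each is differentiated
  -- again; only the fourth is evaluated at zero alone, where g and its first derivative vanish.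
  have e0 : iteratedDeriv 0 M =ᶠ[nhds 0] fun t => Real.exp (g t) := by
    filter_upwards [hY] with t ht
    rw [iteratedDeriv_zero, ht]
  have e1 : iteratedDeriv 1 M =ᶠ[nhds 0] fun t => g₁ t * Real.exp (g t) := by
    filter_upwards [ev, e0.eventually_nhds] with t ht h
    refine iteratedDeriv_succ_of_eventually h ((dg t ht).1.exp.congr_deriv (by ring))
  have e2 : iteratedDeriv 2 M =ᶠ[nhds 0] fun t => (g₂ t + g₁ t ^ 2) * Real.exp (g t) := by
    filter_upwards [ev, e1.eventually_nhds] with t ht h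
    obtain ⟨d0, d1, d2, d3⟩ := dg t ht
    exact iteratedDeriv_succ_of_eventually h ((d1.mul d0.exp).congr_deriv (by ring))
  have e3 : iteratedDeriv 3 M =ᶠ[nhds 0]
      fun t => (-2 * g₃ t + 3 * g₁ t * g₂ t + g₁ t ^ 3) * Real.exp (g t) := by
    filter_upwards [ev, e2.eventually_nhds] with t ht h
    obtain ⟨d0, d1, d2, d3⟩ := dg t ht
    exact iteratedDeriv_succ_of_eventually h
      (((d2.add (d1.pow 2)).mul d0.exp).congr_deriv (by simp; ring))
  have e4 : iteratedDeriv 4 M 0 = 6 * g₄ 0 + 3 * g₂ 0 ^ 2 := by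
    obtain ⟨d0, d1, d2, d3⟩ := dg 0 (by simpa using ⟨hα, hβ⟩)
    refine iteratedDeriv_succ_of_eventually e3
      (((((d3.const_mul (-2)).add ((d1.const_mul 3).mul d2)).add (d1.pow 3)).mul
        d0.exp).congr_deriv ?_)
    have h1 : g₁ 0 = 0 := by simp [hg1, logBetaRemDeriv_zero]
    have h2 : g 0 = 0 := by simp [hg, logBetaRem_zero]
    simp [h1, h2]
    ring
  have h1 : g₁ 0 = 0 := by simp [hg1, logBetaRemDeriv_zero]
  have h2 : g 0 = 0 := by simp [hg, logBetaRem_zero]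
  refine ⟨?_, ?_, ?_⟩
  · have := iteratedDeriv_mgf_zero h0 1
    rw [← hM, e1.eq_of_nhds, h1] at this
    simpa using this.symm
  · have := iteratedDeriv_mgf_zero h0 2
    rw [← hM, e2.eq_of_nhds, h1, h2] at this
    simpa using this.symm
  · have := iteratedDeriv_mgf_zero h0 4
    rw [← hM, e4] at this
    simpa using this.symm

/-- The first, second and fourth moments of a linear combination of the score functions. -/
theorem moments_scoreComb {α β : ℝ} (hα : 0 < α) (hβ : 0 < β) (c₁ c₂ : ℝ) :
    (∫ x, scoreComb α β c₁ c₂ x ∂betaMeasure α β) = 0 ∧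
    (∫ x, scoreComb α β c₁ c₂ x ^ 2 ∂betaMeasure α β) = hurwitzForm 2 α β c₁ c₂ 0 ∧
    (∫ x, scoreComb α β c₁ c₂ x ^ 4 ∂betaMeasure α β) =
      6 * hurwitzForm 4 α β c₁ c₂ 0 + 3 * hurwitzForm 2 α β c₁ c₂ 0 ^ 2 := by
  have := moments_of_mgf_eq (N := 1) hα hβ c₁ c₂
    (zero_mem_interior_integrableExpSet_scoreComb hα hβ c₁ c₂) (by
      filter_upwards [eventually_add_mul_pos hα, eventually_add_mul_pos hβ] with t h1 h2
      rw [one_mul, mgf_scoreComb hα hβ h1 h2])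
  simpa only [one_mul] using this

/-! ### The Fisher information matrix and its square root -/

theorem differentiableAt_logBeta {θ : Plane} (h : θ ∈ betaParamSpace) :
    DifferentiableAt ℝ (fun t : Plane => logBeta (t 0) (t 1)) θ := by
  have hc : ∀ i : Fin 2, DifferentiableAt ℝ (fun t : Plane => t i) θ := fun i => by fun_prop
  have h0 := (hasDerivAt_log_Gamma h.1).differentiableAt.comp θ (hc 0)
  have h1 := (hasDerivAt_log_Gamma h.2).differentiableAt.comp θ (hc 1)
  have h2 := (hasDerivAt_log_Gamma (add_pos h.1 h.2)).differentiableAt.comp θ ((hc 0).add (hc 1))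
  exact (h0.add h1).sub h2

theorem eventually_mem_betaParamSpace {θ : Plane} (h : θ ∈ betaParamSpace) :
    ∀ᶠ t in nhds θ, t ∈ betaParamSpace := by
  have hc : ∀ i : Fin 2, ContinuousAt (fun t : Plane => t i) θ := fun i => by fun_prop
  exact ((hc 0).eventually (lt_mem_nhds h.1)).and ((hc 1).eventually (lt_mem_nhds h.2))

theorem partialDeriv_eq_of_hasDerivAt {g : Plane → ℝ} {θ : Plane} {i : Fin 2} {g' : ℝ}
    (hg : DifferentiableAt ℝ g θ)
    (h : HasDerivAt (fun t : ℝ => g (θ + t • EuclideanSpace.single i 1)) g' 0) :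
    partialDeriv i g θ = g' := by
  have h1 : HasDerivAt (fun t : ℝ => θ + t • (EuclideanSpace.single i 1 : Plane))
      (EuclideanSpace.single i 1 : Plane) 0 := by
    simpa using ((hasDerivAt_id (0 : ℝ)).smul_const (EuclideanSpace.single i 1 : Plane)).const_add θ
  have h2 : HasFDerivAt g (fderiv ℝ g θ) (θ + (0 : ℝ) • (EuclideanSpace.single i 1 : Plane)) := by
    simpa using hg.hasFDerivAt
  exact (h2.comp_hasDerivAt (0 : ℝ) h1).unique h

/-- Along a line in the parameter space the log-density is affine with slope `scoreComb`, minus a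
Bregman divergence whose derivative vanishes at the base point. -/
theorem betaScore_eq {α β : ℝ} (hα : 0 < α) (hβ : 0 < β) {x : ℝ} (hx0 : 0 < x) (hx1 : x < 1) :
    betaScore 0 x !₂[α, β] = scoreComb α β 1 0 x ∧
      betaScore 1 x !₂[α, β] = scoreComb α β 0 1 x := by
  have hθ : (!₂[α, β] : Plane) ∈ betaParamSpace := ⟨by simpa using hα, by simpa using hβ⟩
  have hev : (fun t : Plane => Real.log (betaPDFReal (t 0) (t 1) x)) =ᶠ[nhds !₂[α, β]]
      fun t => (t 0 - 1) * Real.log x + (t 1 - 1) * Real.log (1 - x) - logBeta (t 0) (t 1) := by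
    filter_upwards [eventually_mem_betaParamSpace hθ] with t ht
    exact log_betaPDFReal ht.1 ht.2 hx0 hx1
  have hd : DifferentiableAt ℝ (fun t : Plane => (t 0 - 1) * Real.log x +
      (t 1 - 1) * Real.log (1 - x) - logBeta (t 0) (t 1)) !₂[α, β] := by
    refine DifferentiableAt.sub ?_ (differentiableAt_logBeta hθ)
    fun_prop
  have main : ∀ (i : Fin 2) (c₁ c₂ : ℝ), (EuclideanSpace.single i 1 : Plane) = !₂[c₁, c₂] →
      betaScore i x !₂[α, β] = scoreComb α β c₁ c₂ x := by
    intro i c₁ c₂ hi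
    rw [betaScore, partialDeriv, hev.fderiv_eq]
    refine partialDeriv_eq_of_hasDerivAt hd ?_
    rw [hi]
    have h1 : HasDerivAt (fun t => logBetaRem α β (t * c₁) (t * c₂)) 0 0 := by
      have := hasDerivAt_logBetaRem (α := α) (β := β) (c₁ := c₁) (c₂ := c₂) (t := 0)
        (by simpa using hα) (by simpa using hβ)
      rwa [logBetaRemDeriv_zero] at this
    have h2 := (hasDerivAt_add_mul ((α - 1) * Real.log x + (β - 1) * Real.log (1 - x) -
      logBeta α β) (scoreComb α β c₁ c₂ x) 0).sub h1
    rw [sub_zero] at h2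
    refine h2.congr_of_eventuallyEq (Filter.Eventually.of_forall fun t => ?_)
    simp [scoreComb, logBetaRem]
    ring
  constructor
  · refine main 0 1 0 ?_
    ext j; fin_cases j <;> simp
  · refine main 1 0 1 ?_
    ext j; fin_cases j <;> simp

theorem scoreComb_eq (α β c₁ c₂ x : ℝ) :
    scoreComb α β c₁ c₂ x = c₁ * scoreComb α β 1 0 x + c₂ * scoreComb α β 0 1 x := by
  simp [scoreComb]

/-- Polarisation reduces the mixed moment to second moments of single score combinations. -/
theorem integral_scoreComb_mul {α β : ℝ} (hα : 0 < α) (hβ : 0 < β) :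
    ∫ x, scoreComb α β 1 0 x * scoreComb α β 0 1 x ∂betaMeasure α β = -hurwitzSum 2 (α + β) := by
  have h : ∀ x, scoreComb α β 1 0 x * scoreComb α β 0 1 x =
      1 / 2 * (scoreComb α β 1 1 x ^ 2 - scoreComb α β 1 0 x ^ 2 - scoreComb α β 0 1 x ^ 2) := by
    intro x
    rw [scoreComb_eq α β 1 1]
    ring
  simp_rw [h]
  have hi : Integrable (fun x => scoreComb α β 1 1 x ^ 2 - scoreComb α β 1 0 x ^ 2)
      (betaMeasure α β) :=
    (integrable_scoreComb_pow hα hβ 1 1 2).sub (integrable_scoreComb_pow hα hβ 1 0 2)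
  rw [integral_const_mul, integral_sub hi (integrable_scoreComb_pow hα hβ 0 1 2),
    integral_sub (integrable_scoreComb_pow hα hβ 1 1 2) (integrable_scoreComb_pow hα hβ 1 0 2),
    (moments_scoreComb hα hβ 1 1).2.1, (moments_scoreComb hα hβ 1 0).2.1,
    (moments_scoreComb hα hβ 0 1).2.1]
  simp [hurwitzForm]
  ring

theorem betaFisherInfo_eq {α β : ℝ} (hα : 0 < α) (hβ : 0 < β) :
    betaFisherInfo !₂[α, β] = !![hurwitzSum 2 α - hurwitzSum 2 (α + β), -hurwitzSum 2 (α + β);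
      -hurwitzSum 2 (α + β), hurwitzSum 2 β - hurwitzSum 2 (α + β)] := by
  have h0 := (moments_scoreComb hα hβ 1 0).2.1
  have h1 := (moments_scoreComb hα hβ 0 1).2.1
  have h2 := integral_scoreComb_mul hα hβ
  have hae : ∀ᵐ x ∂betaMeasure α β, betaScore 0 x !₂[α, β] = scoreComb α β 1 0 x ∧
      betaScore 1 x !₂[α, β] = scoreComb α β 0 1 x := by
    filter_upwards [ae_mem_Ioo_betaMeasure α β] with x hx using betaScore_eq hα hβ hx.1 hx.2
  have e00 : ∫ x, betaScore 0 x !₂[α, β] * betaScore 0 x !₂[α, β] ∂betaMeasure α β =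
      hurwitzSum 2 α - hurwitzSum 2 (α + β) := by
    rw [← show hurwitzForm 2 α β 1 0 0 = hurwitzSum 2 α - hurwitzSum 2 (α + β) by
      simp [hurwitzForm], ← h0]
    exact integral_congr_ae (hae.mono fun x hx => by simp only [hx.1]; ring)
  have e11 : ∫ x, betaScore 1 x !₂[α, β] * betaScore 1 x !₂[α, β] ∂betaMeasure α β =
      hurwitzSum 2 β - hurwitzSum 2 (α + β) := by
    rw [← show hurwitzForm 2 α β 0 1 0 = hurwitzSum 2 β - hurwitzSum 2 (α + β) by
      simp [hurwitzForm], ← h1]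
    exact integral_congr_ae (hae.mono fun x hx => by simp only [hx.2]; ring)
  have e01 : ∫ x, betaScore 0 x !₂[α, β] * betaScore 1 x !₂[α, β] ∂betaMeasure α β =
      -hurwitzSum 2 (α + β) := by
    rw [← h2]
    exact integral_congr_ae (hae.mono fun x hx => by simp only [hx.1, hx.2])
  have e10 : ∫ x, betaScore 1 x !₂[α, β] * betaScore 0 x !₂[α, β] ∂betaMeasure α β =
      -hurwitzSum 2 (α + β) := by
    rw [← e01]
    exact integral_congr_ae (Filter.Eventually.of_forall fun x => mul_comm _ _)
  have hθ0 : (!₂[α, β] : Plane) 0 = α := by simp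
  have hθ1 : (!₂[α, β] : Plane) 1 = β := by simp
  ext r s
  rw [betaFisherInfo, Matrix.of_apply, hθ0, hθ1]
  fin_cases r <;> fin_cases s <;> simp [e00, e11, e01, e10]

theorem posSemidef_fin_two {a b c : ℝ} (ha : 0 ≤ a) (hc : 0 ≤ c) (h : b ^ 2 ≤ a * c) :
    (!![a, b; b, c] : Matrix (Fin 2) (Fin 2) ℝ).PosSemidef := by
  refine Matrix.PosSemidef.of_dotProduct_mulVec_nonneg ?_ fun x => ?_
  · ext i j; fin_cases i <;> fin_cases j <;> simp
  · simp [Matrix.mulVec, dotProduct, Fin.sum_univ_two]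
    set y := x 0
    set z := x 1
    rcases ha.eq_or_lt with h0 | h0
    · have hb : b = 0 := by
        rw [← h0, zero_mul] at h
        exact pow_eq_zero_iff two_ne_zero |>.1 (le_antisymm h (sq_nonneg b))
      rw [← h0, hb]
      nlinarith [mul_nonneg hc (sq_nonneg z)]
    · have : 0 ≤ a * (y * (a * y + b * z) + z * (b * y + c * z)) := by
        nlinarith [sq_nonneg (a * y + b * z), mul_nonneg (sub_nonneg.2 h) (sq_nonneg z)]
      exact nonneg_of_mul_nonneg_right this h0

/-- The square root of a positive definite `2 × 2` matrix. -/
theorem sqrt_fin_two {a b c : ℝ} (ha : 0 < a) (hc : 0 < c) (h : 0 < a * c - b ^ 2) :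
    CFC.sqrt (!![a, b; b, c] : Matrix (Fin 2) (Fin 2) ℝ) =
      (1 / √(a + c + 2 * √(a * c - b ^ 2))) •
        !![a + √(a * c - b ^ 2), b; b, c + √(a * c - b ^ 2)] := by
  set r := √(a * c - b ^ 2) with hr
  have hr0 : 0 < r := Real.sqrt_pos.2 h
  have hr2 : r ^ 2 = a * c - b ^ 2 := Real.sq_sqrt h.le
  set k := √(a + c + 2 * r) with hk
  have hk0 : 0 < k := Real.sqrt_pos.2 (by positivity)
  have hk2 : k ^ 2 = a + c + 2 * r := Real.sq_sqrt (by positivity)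
  -- Cayley–Hamilton: if r² = det A, then (A + r I)² = (tr A + 2 r) A.
  refine CFC.sqrt_unique ?_ ?_
  · have hkk : 1 / k * (1 / k) = 1 / (a + c + 2 * r) := by rw [← hk2]; field_simp
    have hne : a + c + 2 * r ≠ 0 := by positivity
    rw [Matrix.smul_mul, Matrix.mul_smul, smul_smul, hkk]
    ext i j
    fin_cases i <;> fin_cases j <;>
      simp <;> field_simp <;>
      nlinarith [hr2]
  · refine Matrix.PosSemidef.nonneg ?_
    refine (posSemidef_fin_two (by positivity) (by positivity) ?_).smul (by positivity)
    nlinarith [mul_pos ha hr0, mul_pos hc hr0]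

/-! ### The score equations -/

/-- The increment of the mean of `scoreComb` when the parameter is shifted by `(d₁, d₂)`. -/
noncomputable def scoreShift (α β c₁ c₂ d₁ d₂ : ℝ) : ℝ :=
  c₁ * (digamma (α + d₁) - digamma α) + c₂ * (digamma (β + d₂) - digamma β) -
    (c₁ + c₂) * (digamma (α + β + (d₁ + d₂)) - digamma (α + β))

theorem logBetaRemDeriv_eq_scoreShift (α β c₁ c₂ t : ℝ) :
    logBetaRemDeriv α β c₁ c₂ t = scoreShift α β c₁ c₂ (t * c₁) (t * c₂) := by
  rw [logBetaRemDeriv, scoreShift, mul_add]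

/-- Here F is the log-likelihood on the line through θ in the direction (c₁, c₂). It has a local
maximum at 0 because the parameter space is open, and its divergence part has no first-order term.
-/
theorem sum_scoreComb_eq_zero_of_isBetaMLE {n : ℕ} {x : Fin n → ℝ} {θ : Plane}
    (h : IsBetaMLE x θ) (hx : ∀ i, 0 < x i ∧ x i < 1) (c₁ c₂ : ℝ) :
    ∑ i, scoreComb (θ 0) (θ 1) c₁ c₂ (x i) = 0 := by
  obtain ⟨⟨h0, h1⟩, hmax⟩ := h
  set F : ℝ → ℝ := fun t => ∑ i, (Real.log (betaPDFReal (θ 0) (θ 1) (x i)) +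
    t * scoreComb (θ 0) (θ 1) c₁ c₂ (x i) - logBetaRem (θ 0) (θ 1) (t * c₁) (t * c₂)) with hF
  have hFL : ∀ t, 0 < θ 0 + t * c₁ → 0 < θ 1 + t * c₂ →
      F t = Real.log (betaLikelihood x !₂[θ 0 + t * c₁, θ 1 + t * c₂]) := by
    intro t ht0 ht1
    simp only [betaLikelihood, Matrix.cons_val_zero, Matrix.cons_val_one,
      Matrix.cons_val_fin_one]
    rw [Real.log_prod fun i _ => (betaPDFReal_pos (hx i).1 (hx i).2 ht0 ht1).ne']
    refine Finset.sum_congr rfl fun i _ => ?_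
    rw [log_betaPDFReal ht0 ht1 (hx i).1 (hx i).2, log_betaPDFReal h0 h1 (hx i).1 (hx i).2]
    simp only [scoreComb, logBetaRem]
    ring
  have hloc : IsLocalMax F 0 := by
    filter_upwards [eventually_add_mul_pos (c := c₁) h0, eventually_add_mul_pos (c := c₂) h1]
      with t ht0 ht1
    rw [hFL t ht0 ht1, hFL 0 (by simpa using h0) (by simpa using h1)]
    refine Real.log_le_log ?_ ?_
    · exact Finset.prod_pos fun i _ => betaPDFReal_pos (hx i).1 (hx i).2 (by simpa using ht0)
        (by simpa using ht1)
    · refine (hmax _ ⟨by simpa using ht0, by simpa using ht1⟩).trans (le_of_eq ?_)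
      simp [betaLikelihood]
  have hd : HasDerivAt F (∑ i, scoreComb (θ 0) (θ 1) c₁ c₂ (x i)) 0 := by
    have h2 : HasDerivAt (fun t => logBetaRem (θ 0) (θ 1) (t * c₁) (t * c₂)) 0 0 := by
      have := hasDerivAt_logBetaRem (α := θ 0) (β := θ 1) (c₁ := c₁) (c₂ := c₂) (t := 0)
        (by simpa using h0) (by simpa using h1)
      rwa [logBetaRemDeriv_zero] at this
    refine HasDerivAt.fun_sum fun i _ => ?_
    have := (hasDerivAt_add_mul (Real.log (betaPDFReal (θ 0) (θ 1) (x i)))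
      (scoreComb (θ 0) (θ 1) c₁ c₂ (x i)) 0).sub h2
    rwa [sub_zero] at this
  exact hloc.hasDerivAt_eq_zero hd

/-- At a maximum likelihood estimate the sum of the scores at `(α, β)` is determined by the
estimation error. -/
theorem sum_scoreComb_eq_of_isBetaMLE {n : ℕ} {x : Fin n → ℝ} {θ : Plane}
    (h : IsBetaMLE x θ) (hx : ∀ i, 0 < x i ∧ x i < 1) (α β c₁ c₂ : ℝ) :
    ∑ i, scoreComb α β c₁ c₂ (x i) = n * scoreShift α β c₁ c₂ (θ 0 - α) (θ 1 - β) := by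
  have h1 := sum_scoreComb_eq_zero_of_isBetaMLE h hx c₁ c₂
  have h2 : ∑ i, scoreComb α β c₁ c₂ (x i) - ∑ i, scoreComb (θ 0) (θ 1) c₁ c₂ (x i) =
      ∑ _i : Fin n, scoreShift α β c₁ c₂ (θ 0 - α) (θ 1 - β) := by
    rw [← Finset.sum_sub_distrib]
    refine Finset.sum_congr rfl fun i _ => ?_
    simp only [scoreComb, scoreShift]
    rw [show α + (θ 0 - α) = θ 0 by ring, show β + (θ 1 - β) = θ 1 by ring,
      show α + β + (θ 0 - α + (θ 1 - β)) = θ 0 + θ 1 by ring]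
    ring
  rw [h1, sub_zero] at h2
  simpa using h2

/-! ### The Fisher information as a quadratic form -/

/-- The quadratic form of the Fisher information matrix. -/
noncomputable def fisherForm (α β d₁ d₂ : ℝ) : ℝ :=
  hurwitzSum 2 α * d₁ ^ 2 + hurwitzSum 2 β * d₂ ^ 2 - hurwitzSum 2 (α + β) * (d₁ + d₂) ^ 2

/-- The determinant of the Fisher information matrix. -/
noncomputable def fisherDet (α β : ℝ) : ℝ :=
  hurwitzSum 2 α * hurwitzSum 2 β - hurwitzSum 2 (α + β) * (hurwitzSum 2 α + hurwitzSum 2 β)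

/-- The quadratic form of the inverse of the Fisher information matrix. -/
noncomputable def fisherDual (α β u₁ u₂ : ℝ) : ℝ :=
  ((hurwitzSum 2 β - hurwitzSum 2 (α + β)) * u₁ ^ 2 + 2 * hurwitzSum 2 (α + β) * (u₁ * u₂) +
    (hurwitzSum 2 α - hurwitzSum 2 (α + β)) * u₂ ^ 2) / fisherDet α β

theorem hurwitzForm_two_zero (α β c₁ c₂ : ℝ) :
    hurwitzForm 2 α β c₁ c₂ 0 = fisherForm α β c₁ c₂ := by
  simp [hurwitzForm, fisherForm]
  ring

theorem fisherDet_comm (α β : ℝ) : fisherDet α β = fisherDet β α := by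
  rw [fisherDet, fisherDet, add_comm β α]
  ring

theorem betaDelta_eq_fisherDet {α β : ℝ} (hα : 0 < α) (hβ : 0 < β) :
    betaDelta α β = fisherDet α β := by
  rw [betaDelta, fisherDet, polygamma_one hα, polygamma_one hβ, polygamma_one (by linarith)]

section
variable {α β : ℝ} (hα : 0 < α) (hβ : 0 < β)

theorem hurwitzSum_two_add_lt (hα : 0 < α) (hβ : 0 < β) :
    hurwitzSum 2 (α + β) < hurwitzSum 2 α :=
  hurwitzSum_strictAnti le_rfl hα (by linarith)

theorem hurwitzSum_two_add_lt' (hα : 0 < α) (hβ : 0 < β) :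
    hurwitzSum 2 (α + β) < hurwitzSum 2 β :=
  hurwitzSum_strictAnti le_rfl hβ (by linarith)

/-- A lower bound for the determinant of the Fisher information. -/
theorem fisherDet_lower (hα : 0 < α) (hβ : 0 < β) :
    (hurwitzSum 2 β - hurwitzSum 2 (α + β)) * (β / (2 * α ^ 2 * (α + β))) ≤ fisherDet α β := by
  have hs : 0 < α + β := by linarith
  have h1 := mul_hurwitzSum_two_sub_anti hα (show α ≤ α + β by linarith)
  have h2 := mul_hurwitzSum_two_anti hβ (show β ≤ α + β by linarith)
  have hq := hurwitzSum_two_add_lt' hα hβ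
  have hw := hurwitzSum_pos (j := 2) le_rfl hs
  rw [fisherDet]
  set p := hurwitzSum 2 α
  set q := hurwitzSum 2 β
  set w := hurwitzSum 2 (α + β)
  -- Two monotonicity facts enter at different places: `h3` uses the sharper one, with the
  -- correction 1/(2x), between α and α + β, while `h4` needs only the plain one between β and α +
  -- β.
  have h3 : β / (2 * α ^ 2 * (α + β)) ≤ p - (α + β) * w / α := by
    have : β / (2 * α ^ 2 * (α + β)) = (1 / (2 * α) - 1 / (2 * (α + β))) / α := by
      field_simp; ring
    rw [this, div_le_iff₀ hα, sub_mul, div_mul_cancel₀ _ hα.ne']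
    linarith
  have h4 : w * q ≤ (α + β) * w / α * (q - w) := by
    rw [div_mul_eq_mul_div, le_div_iff₀ hα]
    nlinarith
  calc (q - w) * (β / (2 * α ^ 2 * (α + β))) ≤ (q - w) * (p - (α + β) * w / α) := by
        gcongr
    _ ≤ p * q - w * (p + q) := by nlinarith

theorem fisherDet_pos (hα : 0 < α) (hβ : 0 < β) : 0 < fisherDet α β := by
  have hq := hurwitzSum_two_add_lt' hα hβ
  refine lt_of_lt_of_le ?_ (fisherDet_lower hα hβ)
  have : 0 < hurwitzSum 2 β - hurwitzSum 2 (α + β) := by linarith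
  positivity

theorem fisherDet_eq (α β : ℝ) : fisherDet α β =
    (hurwitzSum 2 α - hurwitzSum 2 (α + β)) * (hurwitzSum 2 β - hurwitzSum 2 (α + β)) -
      hurwitzSum 2 (α + β) ^ 2 := by
  rw [fisherDet]; ring

/-- Completing the square: multiplied by the diagonal entry p - w, the form is a square plus the
determinant times d₂². -/
theorem fisherForm_nonneg (hα : 0 < α) (hβ : 0 < β) (d₁ d₂ : ℝ) : 0 ≤ fisherForm α β d₁ d₂ := by
  have hp := hurwitzSum_two_add_lt hα hβ
  have hδ := fisherDet_pos hα hβ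
  rw [fisherDet_eq] at hδ
  rw [fisherForm]
  set p := hurwitzSum 2 α
  set q := hurwitzSum 2 β
  set w := hurwitzSum 2 (α + β)
  have : 0 ≤ (p - w) * (p * d₁ ^ 2 + q * d₂ ^ 2 - w * (d₁ + d₂) ^ 2) := by
    nlinarith [sq_nonneg ((p - w) * d₁ - w * d₂), mul_nonneg hδ.le (sq_nonneg d₂)]
  exact nonneg_of_mul_nonneg_right this (by linarith)

theorem fisherDual_nonneg (hα : 0 < α) (hβ : 0 < β) (u₁ u₂ : ℝ) : 0 ≤ fisherDual α β u₁ u₂ := by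
  have hp := hurwitzSum_two_add_lt hα hβ
  have hδ := fisherDet_pos hα hβ
  refine div_nonneg ?_ hδ.le
  rw [fisherDet_eq] at hδ
  set p := hurwitzSum 2 α
  set q := hurwitzSum 2 β
  set w := hurwitzSum 2 (α + β)
  have : 0 ≤ (p - w) * ((q - w) * u₁ ^ 2 + 2 * w * (u₁ * u₂) + (p - w) * u₂ ^ 2) := by
    nlinarith [sq_nonneg ((p - w) * u₂ + w * u₁), mul_nonneg hδ.le (sq_nonneg u₁)]
  exact nonneg_of_mul_nonneg_right this (by linarith)

/-- The Cauchy–Schwarz inequality for the Fisher information and its inverse. -/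
theorem sq_le_fisherDual_mul_fisherForm (hα : 0 < α) (hβ : 0 < β) (u₁ u₂ d₁ d₂ : ℝ) :
    (u₁ * d₁ + u₂ * d₂) ^ 2 ≤ fisherDual α β u₁ u₂ * fisherForm α β d₁ d₂ := by
  have hδ := fisherDet_pos hα hβ
  rw [fisherDual, fisherForm, div_mul_eq_mul_div, le_div_iff₀ hδ, fisherDet_eq]
  set p := hurwitzSum 2 α
  set q := hurwitzSum 2 β
  set w := hurwitzSum 2 (α + β)
  -- After multiplication by the determinant, the two sides differ by the square of u₁ (I d)₂ - u₂
  -- (I d)₁, which is the second hint.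
  nlinarith [sq_nonneg (((q - w) * u₁ + w * u₂) * (-w * d₁ + (q - w) * d₂) -
    (w * u₁ + (p - w) * u₂) * ((p - w) * d₁ - w * d₂)),
    sq_nonneg (u₁ * (-w * d₁ + (q - w) * d₂) - u₂ * ((p - w) * d₁ - w * d₂))]

theorem sq_fst_le (hα : 0 < α) (hβ : 0 < β) (d₁ d₂ : ℝ) :
    d₁ ^ 2 ≤ (hurwitzSum 2 β - hurwitzSum 2 (α + β)) / fisherDet α β * fisherForm α β d₁ d₂ := by
  have := sq_le_fisherDual_mul_fisherForm hα hβ 1 0 d₁ d₂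
  simpa [fisherDual] using this

theorem sq_snd_le (hα : 0 < α) (hβ : 0 < β) (d₁ d₂ : ℝ) :
    d₂ ^ 2 ≤ (hurwitzSum 2 α - hurwitzSum 2 (α + β)) / fisherDet α β * fisherForm α β d₁ d₂ := by
  have := sq_le_fisherDual_mul_fisherForm hα hβ 0 1 d₁ d₂
  simpa [fisherDual] using this

theorem sq_add_le (hα : 0 < α) (hβ : 0 < β) (d₁ d₂ : ℝ) :
    (d₁ + d₂) ^ 2 ≤
      (hurwitzSum 2 α + hurwitzSum 2 β) / fisherDet α β * fisherForm α β d₁ d₂ := by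
  have := sq_le_fisherDual_mul_fisherForm hα hβ 1 1 d₁ d₂
  simp only [fisherDual, one_mul, one_pow, mul_one] at this
  convert this using 3
  ring

end

/-! ### Local analysis of the score equations -/

/-- Termwise: u³/(y²(y + u)) increases in u as long as y + u is positive. -/
theorem cube_mul_digammaRem_mono {x u v : ℝ} (hx : 0 < x) (hu : 0 < x + u) (huv : u ≤ v) :
    u ^ 3 * digammaRem x u ≤ v ^ 3 * digammaRem x v := by
  have hv : 0 < x + v := by linarith
  rw [digammaRem, digammaRem, ← tsum_mul_left, ← tsum_mul_left]
  refine Summable.tsum_le_tsum (fun k => ?_) ((summable_digammaRem hx hu).mul_left _)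
    ((summable_digammaRem hx hv).mul_left _)
  have hk : (0 : ℝ) ≤ k := k.cast_nonneg
  have h1 : 0 < x + k := by positivity
  have h2 : 0 < x + k + u := by linarith
  have h3 : 0 < x + k + v := by linarith
  generalize x + (k : ℝ) = y at h1 h2 h3
  have h4 : u ^ 3 * (y + v) ≤ v ^ 3 * (y + u) := by
    have h5 : 0 ≤ y * (v ^ 2 + u * v + u ^ 2) + u * v * (u + v) := by
      have h6 : 0 ≤ v ^ 2 + u * v + u ^ 2 := by nlinarith [sq_nonneg (u + v)]
      rcases le_total 0 u with h | h
      · have : 0 ≤ v := h.trans huv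
        positivity
      · have h7 : 0 ≤ (y + u) * (v ^ 2 + u * v + u ^ 2) := mul_nonneg h2.le h6
        have h8 : 0 ≤ (-u) ^ 3 := by have : 0 ≤ -u := by linarith
                                     positivity
        nlinarith
    nlinarith [mul_nonneg (sub_nonneg.2 huv) h5]
  rw [mul_one_div, mul_one_div, div_le_div_iff₀ (by positivity) (by positivity)]
  nlinarith [mul_le_mul_of_nonneg_left h4 (sq_nonneg y)]

theorem digammaRem_anti {x y u : ℝ} (hx : 0 < x) (hu : 0 < x + u) (hxy : x ≤ y) :
    digammaRem y u ≤ digammaRem x u := by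
  refine Summable.tsum_le_tsum (fun k => ?_) (summable_digammaRem (hx.trans_le hxy) (by linarith))
    (summable_digammaRem hx hu)
  have hk : (0 : ℝ) ≤ k := k.cast_nonneg
  have h1 : 0 < x + k := by positivity
  have h2 : 0 < x + k + u := by linarith
  gcongr

/-- The cubic remainder of the expansion of the log-likelihood equation in the direction of the
error. -/
noncomputable def cubicRem (α β d₁ d₂ : ℝ) : ℝ :=
  d₁ ^ 3 * digammaRem α d₁ + d₂ ^ 3 * digammaRem β d₂ -
    (d₁ + d₂) ^ 3 * digammaRem (α + β) (d₁ + d₂)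

theorem cubicRem_comm (α β d₁ d₂ : ℝ) : cubicRem α β d₁ d₂ = cubicRem β α d₂ d₁ := by
  rw [cubicRem, cubicRem, add_comm β α, add_comm d₂ d₁]
  ring

/-- If d₁ and d₂ have the same sign, `cubicRem` is a difference of two quantities of one sign, so
the larger of them bounds it. If the signs are opposite, the third term lies between the first two
by monotonicity, and the sum of their absolute values suffices. -/
theorem abs_cubicRem_le_max {α β d₁ d₂ : ℝ} (hα : 0 < α) (hβ : 0 < β) (h1 : 0 < α + d₁)
    (h2 : 0 < β + d₂) :
    |cubicRem α β d₁ d₂| ≤ max (|d₁| ^ 3 * digammaRem α d₁ + |d₂| ^ 3 * digammaRem β d₂)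
      (|d₁ + d₂| ^ 3 * digammaRem (α + β) (d₁ + d₂)) := by
  have hs : 0 < α + β := by linarith
  have hsd : 0 < α + β + (d₁ + d₂) := by linarith
  have r1 := digammaRem_nonneg hα h1
  have r2 := digammaRem_nonneg hβ h2
  have r3 := digammaRem_nonneg hs hsd
  have main : ∀ {α β d₁ d₂ : ℝ}, 0 < α → 0 < β → 0 < α + d₁ → 0 < β + d₂ → 0 ≤ d₁ → d₂ ≤ 0 →
      |cubicRem α β d₁ d₂| ≤ |d₁| ^ 3 * digammaRem α d₁ + |d₂| ^ 3 * digammaRem β d₂ := by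
    intro α β d₁ d₂ hα hβ h1 h2 hd1 hd2
    have hs : 0 < α + β := by linarith
    have hsd : 0 < α + β + (d₁ + d₂) := by linarith
    have r1 := digammaRem_nonneg hα h1
    have r2 := digammaRem_nonneg hβ h2
    have r3 := digammaRem_nonneg hs hsd
    have p1 : 0 ≤ d₁ ^ 3 := by positivity
    have p2 : d₂ ^ 3 ≤ 0 := by
      have : 0 ≤ (-d₂) ^ 3 := by have : 0 ≤ -d₂ := by linarith
                                 positivity
      nlinarith
    have hc1 : (d₁ + d₂) ^ 3 * digammaRem (α + β) (d₁ + d₂) ≤ d₁ ^ 3 * digammaRem α d₁ := by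
      have c1 := cube_mul_digammaRem_mono hs hsd (show d₁ + d₂ ≤ d₁ by linarith)
      have c2 := digammaRem_anti (u := d₁) hα h1 (show α ≤ α + β by linarith)
      exact c1.trans (mul_le_mul_of_nonneg_left c2 p1)
    have hc2 : d₂ ^ 3 * digammaRem β d₂ ≤ (d₁ + d₂) ^ 3 * digammaRem (α + β) (d₁ + d₂) := by
      have c1 := cube_mul_digammaRem_mono (u := d₂) (v := d₁ + d₂) hs (by linarith) (by linarith)
      have c2 := digammaRem_anti (u := d₂) hβ h2 (show β ≤ α + β by linarith)
      exact (mul_le_mul_of_nonpos_left c2 p2).trans c1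
    rw [cubicRem, abs_of_nonneg hd1, abs_of_nonpos hd2, abs_le]
    have m1 := mul_nonneg p1 r1
    have m2 := mul_nonpos_of_nonpos_of_nonneg p2 r2
    have e2 : (-d₂) ^ 3 = -d₂ ^ 3 := by ring
    rw [e2]
    constructor <;> linarith
  rcases le_total 0 d₁ with hd1 | hd1 <;> rcases le_total 0 d₂ with hd2 | hd2
  · have p1 : 0 ≤ d₁ ^ 3 * digammaRem α d₁ := by positivity
    have p2 : 0 ≤ d₂ ^ 3 * digammaRem β d₂ := by positivity
    have p3 : 0 ≤ (d₁ + d₂) ^ 3 * digammaRem (α + β) (d₁ + d₂) := by positivity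
    rw [cubicRem, abs_of_nonneg hd1, abs_of_nonneg hd2, abs_of_nonneg (add_nonneg hd1 hd2),
      abs_le, le_max_iff]
    constructor
    · rw [neg_le, neg_sub]
      exact (sub_le_self _ (by linarith)).trans (le_max_right _ _)
    · left; linarith
  · exact (main hα hβ h1 h2 hd1 hd2).trans (le_max_left _ _)
  · rw [cubicRem_comm]
    refine (main hβ hα h2 h1 hd2 hd1).trans ?_
    rw [add_comm]
    exact le_max_left _ _
  · have q1 : 0 ≤ -d₁ := by linarith
    have q2 : 0 ≤ -d₂ := by linarith
    have p1 : 0 ≤ (-d₁) ^ 3 * digammaRem α d₁ := by positivity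
    have p2 : 0 ≤ (-d₂) ^ 3 * digammaRem β d₂ := by positivity
    have q3 : 0 ≤ -(d₁ + d₂) := by linarith
    have p3 : 0 ≤ (-(d₁ + d₂)) ^ 3 * digammaRem (α + β) (d₁ + d₂) := by positivity
    have e : cubicRem α β d₁ d₂ = (-(d₁ + d₂)) ^ 3 * digammaRem (α + β) (d₁ + d₂) -
      ((-d₁) ^ 3 * digammaRem α d₁ + (-d₂) ^ 3 * digammaRem β d₂) := by rw [cubicRem]; ring
    rw [e, abs_of_nonpos hd1, abs_of_nonpos hd2, abs_of_nonpos (add_nonpos hd1 hd2), abs_le]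
    constructor
    · rw [neg_le, neg_sub]
      exact (sub_le_self _ p3).trans (le_max_left _ _)
    · exact (sub_le_self _ (by linarith)).trans (le_max_right _ _)

theorem scoreShift_self {α β d₁ d₂ : ℝ} (hα : 0 < α) (hβ : 0 < β) (h1 : 0 < α + d₁)
    (h2 : 0 < β + d₂) :
    scoreShift α β d₁ d₂ d₁ d₂ = fisherForm α β d₁ d₂ - cubicRem α β d₁ d₂ := by
  rw [scoreShift, digamma_add_sub hα h1, digamma_add_sub hβ h2,
    digamma_add_sub (add_pos hα hβ) (by linarith), fisherForm, cubicRem]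
  ring

theorem scoreShift_eq (α β c₁ c₂ d₁ d₂ : ℝ) : scoreShift α β c₁ c₂ d₁ d₂ =
    c₁ * scoreShift α β 1 0 d₁ d₂ + c₂ * scoreShift α β 0 1 d₁ d₂ := by
  simp only [scoreShift]
  ring

/-- Convexity of `logBeta`: the derivative along the segment is the Fisher form at the intermediate
parameter. -/
theorem scoreShift_line_mono {α β d₁ d₂ t : ℝ} (hα : 0 < α) (hβ : 0 < β) (h1 : 0 < α + d₁)
    (h2 : 0 < β + d₂) (ht0 : 0 ≤ t) (ht1 : t ≤ 1) :
    scoreShift α β d₁ d₂ (t * d₁) (t * d₂) ≤ scoreShift α β d₁ d₂ d₁ d₂ := by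
  have hpos : ∀ u ∈ Set.Icc (0 : ℝ) 1, 0 < α + u * d₁ ∧ 0 < β + u * d₂ := by
    intro u hu
    obtain ⟨hu0, hu1⟩ := hu
    constructor
    · rcases hu0.eq_or_lt with h | h
      · simpa [← h] using hα
      · nlinarith
    · rcases hu0.eq_or_lt with h | h
      · simpa [← h] using hβ
      · nlinarith
  have hmono : MonotoneOn (logBetaRemDeriv α β d₁ d₂) (Set.Icc 0 1) := by
    refine monotoneOn_of_deriv_nonneg (convex_Icc 0 1) (fun u hu => ?_) (fun u hu => ?_)
      fun u hu => ?_
    · exact (hasDerivAt_logBetaRemDeriv (hpos u hu).1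
        (hpos u hu).2).continuousAt.continuousWithinAt
    · have hu' := interior_subset hu
      exact (hasDerivAt_logBetaRemDeriv (hpos u hu').1
        (hpos u hu').2).differentiableAt.differentiableWithinAt
    · have hu' := interior_subset hu
      obtain ⟨p1, p2⟩ := hpos u hu'
      rw [(hasDerivAt_logBetaRemDeriv p1 p2).deriv]
      have := fisherForm_nonneg p1 p2 d₁ d₂
      rw [fisherForm, show α + u * d₁ + (β + u * d₂) = α + β + u * (d₁ + d₂) by ring] at this
      rw [hurwitzForm]
      linarith
  have := hmono (Set.mem_Icc.2 ⟨ht0, ht1⟩) (Set.right_mem_Icc.2 zero_le_one) ht1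
  simpa [logBetaRemDeriv_eq_scoreShift] using this

/-- The asymptotic variance of the first coordinate of the maximum likelihood estimator. -/
noncomputable def estVar (α β : ℝ) : ℝ :=
  (hurwitzSum 2 β - hurwitzSum 2 (α + β)) / fisherDet α β

/-- The asymptotic variance of the sum of the coordinates of the maximum likelihood estimator. -/
noncomputable def estVarSum (α β : ℝ) : ℝ := (hurwitzSum 2 α + hurwitzSum 2 β) / fisherDet α β

theorem estVar_pos {α β : ℝ} (hα : 0 < α) (hβ : 0 < β) : 0 < estVar α β :=
  div_pos (sub_pos.2 (hurwitzSum_two_add_lt' hα hβ)) (fisherDet_pos hα hβ)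

theorem estVarSum_pos {α β : ℝ} (hα : 0 < α) (hβ : 0 < β) : 0 < estVarSum α β :=
  div_pos (add_pos (hurwitzSum_pos le_rfl hα) (hurwitzSum_pos le_rfl hβ)) (fisherDet_pos hα hβ)

theorem sq_fst_le_estVar {α β : ℝ} (hα : 0 < α) (hβ : 0 < β) (d₁ d₂ : ℝ) :
    d₁ ^ 2 ≤ estVar α β * fisherForm α β d₁ d₂ := sq_fst_le hα hβ d₁ d₂

theorem sq_snd_le_estVar {α β : ℝ} (hα : 0 < α) (hβ : 0 < β) (d₁ d₂ : ℝ) :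
    d₂ ^ 2 ≤ estVar β α * fisherForm α β d₁ d₂ := by
  rw [estVar, fisherDet_comm, add_comm β α]
  exact sq_snd_le hα hβ d₁ d₂

/-- A bound for the third derivatives of the log-likelihood in the local metric, which also
controls the size of the region where the quadratic approximation is used. -/
noncomputable def curvature (α β : ℝ) : ℝ :=
  max (max (20 / 17 * (hurwitzSum 3 α * (estVar α β * √(estVar α β)) +
      hurwitzSum 3 β * (estVar β α * √(estVar β α))))
    (20 / 17 * (hurwitzSum 3 (α + β) * (estVarSum α β * √(estVarSum α β)))))
    (max (10 / 3 * √(estVar α β) / α) (10 / 3 * √(estVar β α) / β))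

theorem curvature_pos {α β : ℝ} (hα : 0 < α) (hβ : 0 < β) : 0 < curvature α β := by
  have := estVar_pos hα hβ
  exact lt_of_lt_of_le (by positivity) ((le_max_left _ _).trans (le_max_right _ _))

theorem abs_cube_le_of_sq_le {d v Q : ℝ} (hv : 0 ≤ v) (hQ : 0 ≤ Q) (h : d ^ 2 ≤ v * Q) :
    |d| ^ 3 ≤ v * √v * (Q * √Q) := by
  have h1 : |d| ≤ √v * √Q := by rw [← Real.sqrt_mul hv]; exact Real.abs_le_sqrt h
  calc |d| ^ 3 ≤ (√v * √Q) ^ 3 := by gcongr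
    _ = √v ^ 2 * √v * (√Q ^ 2 * √Q) := by ring
    _ = _ := by rw [Real.sq_sqrt hv, Real.sq_sqrt hQ]

section
variable {α β d₁ d₂ : ℝ}

/-- The last two entries of `curvature` are made for this: √v/(2κ) ≤ 3α/20 as soon as κ ≥
(10/3)√v/α. A relative error of 3/20 costs the factor 1/(1 - 3/20) = 20/17 in the remainders. -/
theorem abs_fst_le_of_fisherForm_le (hα : 0 < α) (hβ : 0 < β)
    (hQ : fisherForm α β d₁ d₂ ≤ 1 / (2 * curvature α β) ^ 2) : |d₁| ≤ 3 / 20 * α := by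
  have hκ := curvature_pos hα hβ
  have hv := estVar_pos hα hβ
  have h1 := sq_fst_le_estVar hα hβ d₁ d₂
  have h2 : 10 / 3 * √(estVar α β) / α ≤ curvature α β :=
    (le_max_left _ _).trans (le_max_right _ _)
  have h3 : |d₁| ≤ √(estVar α β) * (1 / (2 * curvature α β)) := by
    rw [← abs_of_nonneg (a := √(estVar α β) * (1 / (2 * curvature α β))) (by positivity)]
    refine sq_le_sq.1 (h1.trans ?_)
    rw [mul_pow, Real.sq_sqrt hv.le, div_pow, one_pow]
    gcongr
  refine h3.trans ?_
  rw [div_le_iff₀ hα] at h2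
  rw [mul_one_div, div_le_iff₀ (by positivity)]
  linarith

theorem curvature_comm (α β : ℝ) : curvature α β = curvature β α := by
  rw [curvature, curvature, add_comm β α, estVarSum, estVarSum, fisherDet_comm β α,
    add_comm (hurwitzSum 2 β)]
  congr 1
  · congr 2
    ring
  · exact max_comm _ _

theorem fisherForm_comm (α β d₁ d₂ : ℝ) : fisherForm α β d₁ d₂ = fisherForm β α d₂ d₁ := by
  rw [fisherForm, fisherForm, add_comm β α]
  ring

theorem abs_snd_le_of_fisherForm_le (hα : 0 < α) (hβ : 0 < β)
    (hQ : fisherForm α β d₁ d₂ ≤ 1 / (2 * curvature α β) ^ 2) : |d₂| ≤ 3 / 20 * β := by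
  rw [fisherForm_comm, curvature_comm] at hQ
  exact abs_fst_le_of_fisherForm_le hβ hα hQ

theorem digammaRem_le_of_abs_le {x d : ℝ} (hx : 0 < x) (hd : |d| ≤ 3 / 20 * x) :
    digammaRem x d ≤ 20 / 17 * hurwitzSum 3 x := by
  have := digammaRem_le (t := 3 / 20) hx (by norm_num) (by norm_num) (neg_le_of_abs_le hd)
  refine this.trans (le_of_eq ?_)
  ring

theorem add_pos_of_abs_le {x d : ℝ} (hx : 0 < x) (hd : |d| ≤ 3 / 20 * x) : 0 < x + d := by
  have := neg_le_of_abs_le hd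
  linarith

theorem abs_add_le_of_abs_le {α β d₁ d₂ : ℝ} (h1 : |d₁| ≤ 3 / 20 * α) (h2 : |d₂| ≤ 3 / 20 * β) :
    |d₁ + d₂| ≤ 3 / 20 * (α + β) := (abs_add_le d₁ d₂).trans (by linarith)

/-- By Cauchy–Schwarz each cubed displacement is at most the 3/2 power of its asymptotic variance
times that of the Fisher form. The first two entries of `curvature` are the resulting constants for
the two alternatives of `abs_cubicRem_le_max`. -/
theorem abs_cubicRem_le (hα : 0 < α) (hβ : 0 < β)
    (hQ : fisherForm α β d₁ d₂ ≤ 1 / (2 * curvature α β) ^ 2) :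
    |cubicRem α β d₁ d₂| ≤
      curvature α β * (fisherForm α β d₁ d₂ * √(fisherForm α β d₁ d₂)) := by
  have a1 := abs_fst_le_of_fisherForm_le hα hβ hQ
  have a2 := abs_snd_le_of_fisherForm_le hα hβ hQ
  have a3 := abs_add_le_of_abs_le a1 a2
  have hs : 0 < α + β := by linarith
  have hQ0 := fisherForm_nonneg hα hβ d₁ d₂
  have c1 := abs_cube_le_of_sq_le (estVar_pos hα hβ).le hQ0 (sq_fst_le_estVar hα hβ d₁ d₂)
  have c2 := abs_cube_le_of_sq_le (estVar_pos hβ hα).le hQ0 (sq_snd_le_estVar hα hβ d₁ d₂)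
  have c3 := abs_cube_le_of_sq_le (estVarSum_pos hα hβ).le hQ0 (sq_add_le hα hβ d₁ d₂)
  have r1 := digammaRem_le_of_abs_le hα a1
  have r2 := digammaRem_le_of_abs_le hβ a2
  have r3 := digammaRem_le_of_abs_le hs a3
  have n1 := digammaRem_nonneg hα (add_pos_of_abs_le hα a1)
  have n2 := digammaRem_nonneg hβ (add_pos_of_abs_le hβ a2)
  have n3 := digammaRem_nonneg hs (add_pos_of_abs_le hs a3)
  have v1 := estVar_pos hα hβ
  have v2 := estVar_pos hβ hα
  have v3 := estVarSum_pos hα hβ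
  have hQ3 : 0 ≤ fisherForm α β d₁ d₂ * √(fisherForm α β d₁ d₂) := by positivity
  refine (abs_cubicRem_le_max hα hβ (add_pos_of_abs_le hα a1) (add_pos_of_abs_le hβ a2)).trans
    (max_le ?_ ?_)
  · have m1 := mul_le_mul c1 r1 n1 (by positivity)
    have m2 := mul_le_mul c2 r2 n2 (by positivity)
    refine (add_le_add m1 m2).trans ?_
    refine le_trans (le_of_eq ?_) (mul_le_mul_of_nonneg_right
      ((le_max_left _ _).trans (le_max_left _ _)) hQ3)
    ring
  · have m3 := mul_le_mul c3 r3 n3 (by positivity)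
    refine m3.trans ?_
    refine le_trans (le_of_eq ?_) (mul_le_mul_of_nonneg_right
      ((le_max_right _ _).trans (le_max_left _ _)) hQ3)
    ring

theorem fisherForm_smul (α β t d₁ d₂ : ℝ) :
    fisherForm α β (t * d₁) (t * d₂) = t ^ 2 * fisherForm α β d₁ d₂ := by
  rw [fisherForm, fisherForm]
  ring

theorem scoreShift_smul (α β t c₁ c₂ d₁ d₂ : ℝ) :
    scoreShift α β (t * c₁) (t * c₂) d₁ d₂ = t * scoreShift α β c₁ c₂ d₁ d₂ := by
  rw [scoreShift, scoreShift]
  ring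

theorem scoreShift_self_le (hα : 0 < α) (hβ : 0 < β) :
    scoreShift α β d₁ d₂ d₁ d₂ ≤
      √(fisherDual α β (scoreShift α β 1 0 d₁ d₂) (scoreShift α β 0 1 d₁ d₂)) *
        √(fisherForm α β d₁ d₂) := by
  rw [← Real.sqrt_mul (fisherDual_nonneg hα hβ _ _)]
  refine (le_abs_self _).trans (Real.abs_le_sqrt ?_)
  rw [scoreShift_eq α β d₁ d₂]
  have := sq_le_fisherDual_mul_fisherForm hα hβ (scoreShift α β 1 0 d₁ d₂)
    (scoreShift α β 0 1 d₁ d₂) d₁ d₂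
  convert this using 2
  ring

/-- If the mean score is small, then the error of the estimator is small. -/
theorem fisherForm_le_of_fisherDual_lt (hα : 0 < α) (hβ : 0 < β) (h1 : 0 < α + d₁)
    (h2 : 0 < β + d₂)
    (hN : fisherDual α β (scoreShift α β 1 0 d₁ d₂) (scoreShift α β 0 1 d₁ d₂) <
      1 / (4 * curvature α β) ^ 2) :
    fisherForm α β d₁ d₂ ≤ 1 / (2 * curvature α β) ^ 2 := by
  by_contra! hlt
  have hκ := curvature_pos hα hβ
  set κ := curvature α β with hκdef
  set Q := fisherForm α β d₁ d₂ with hQdef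
  have hQ0 : 0 < Q := lt_trans (by positivity) hlt
  have hq0 : 0 < √Q := Real.sqrt_pos.2 hQ0
  have hq : 1 / (2 * κ) < √Q := by
    refine Real.lt_sqrt_of_sq_lt ?_
    rwa [div_pow, one_pow]
  -- An error outside the region is shrunk along its ray to the boundary. There the quadratic part
  -- beats the cubic one and leaves at least 1/(8κ²). Monotonicity along the ray transfers this
  -- lower bound to the full error, where Cauchy–Schwarz and the hypothesis give a strictly smaller
  -- value.
  set t := 1 / (2 * κ * √Q) with ht
  have ht0 : 0 < t := by positivity
  have ht1 : t ≤ 1 := by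
    rw [ht, div_le_one (by positivity)]
    rw [div_lt_iff₀ (by positivity)] at hq
    linarith
  have htQ : fisherForm α β (t * d₁) (t * d₂) = 1 / (2 * κ) ^ 2 := by
    rw [fisherForm_smul, ← hQdef, ht]
    have : √Q ^ 2 = Q := Real.sq_sqrt hQ0.le
    field_simp
    rw [this]
  have hsq : √(1 / (2 * κ) ^ 2) = 1 / (2 * κ) := by
    rw [← one_pow 2, ← div_pow, one_pow, Real.sqrt_sq (by positivity)]
  have hpos : 0 < α + t * d₁ ∧ 0 < β + t * d₂ := by constructor <;> nlinarith
  have k1 := abs_cubicRem_le hα hβ (d₁ := t * d₁) (d₂ := t * d₂) (le_of_eq htQ)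
  rw [htQ, hsq] at k1
  have k2 := scoreShift_self hα hβ hpos.1 hpos.2
  rw [htQ, scoreShift_smul] at k2
  have k3 := scoreShift_line_mono hα hβ h1 h2 ht0.le ht1
  have k4 := scoreShift_self_le (d₁ := d₁) (d₂ := d₂) hα hβ
  have k5 : √(fisherDual α β (scoreShift α β 1 0 d₁ d₂) (scoreShift α β 0 1 d₁ d₂)) <
      1 / (4 * κ) := by
    rw [Real.sqrt_lt' (by positivity), div_pow, one_pow]
    exact hN
  have k6 : t * scoreShift α β d₁ d₂ d₁ d₂ < t * (1 / (4 * κ) * √Q) := by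
    refine mul_lt_mul_of_pos_left (k4.trans_lt ?_) ht0
    exact mul_lt_mul_of_pos_right k5 hq0
  have k7 : t * (1 / (4 * κ) * √Q) = 1 / (8 * κ ^ 2) := by rw [ht]; field_simp; norm_num
  have k8 : 1 / (2 * κ) ^ 2 - κ * (1 / (2 * κ) ^ 2 * (1 / (2 * κ))) = 1 / (8 * κ ^ 2) := by
    field_simp; norm_num
  have k9 := mul_le_mul_of_nonneg_left k3 ht0.le
  have := le_of_abs_le k1
  linarith

end

/-- The first coordinate of the inverse Fisher information matrix applied to `(u₁, u₂)`. -/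
noncomputable def estLin (α β u₁ u₂ : ℝ) : ℝ :=
  ((hurwitzSum 2 β - hurwitzSum 2 (α + β)) * u₁ + hurwitzSum 2 (α + β) * u₂) / fisherDet α β

/-- The trace of the inverse of the Fisher information matrix. -/
noncomputable def estTrace (α β : ℝ) : ℝ := estVar α β + estVar β α

/-- A bound for the effect of the third derivatives on the estimation error. -/
noncomputable def thirdRatio (α β : ℝ) : ℝ :=
  40 / 17 * (hurwitzSum 2 β * max (hurwitzSum 3 α) (2 * hurwitzSum 3 (α + β)) +
    hurwitzSum 2 α * max (hurwitzSum 3 β) (2 * hurwitzSum 3 (α + β))) / fisherDet α β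

theorem estTrace_pos {α β : ℝ} (hα : 0 < α) (hβ : 0 < β) : 0 < estTrace α β :=
  add_pos (estVar_pos hα hβ) (estVar_pos hβ hα)

theorem thirdRatio_pos {α β : ℝ} (hα : 0 < α) (hβ : 0 < β) : 0 < thirdRatio α β := by
  have := fisherDet_pos hα hβ
  have := hurwitzSum_pos (j := 2) le_rfl hα
  have := hurwitzSum_pos (j := 2) le_rfl hβ
  have h3 := hurwitzSum_pos (j := 3) (by norm_num) hα
  have h4 := hurwitzSum_pos (j := 3) (by norm_num) hβ
  have := lt_max_of_lt_left (c := 2 * hurwitzSum 3 (α + β)) h3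
  have := lt_max_of_lt_left (c := 2 * hurwitzSum 3 (α + β)) h4
  unfold thirdRatio
  positivity

/-- The remainder of the linear approximation of the score equation. -/
theorem abs_scoreShift_sub_le {α β d₁ d₂ : ℝ} (hα : 0 < α) (hβ : 0 < β) (h1 : 0 < α + d₁)
    (h2 : 0 < β + d₂) {b : ℝ} (hb1 : digammaRem α d₁ ≤ b)
    (hb2 : 2 * digammaRem (α + β) (d₁ + d₂) ≤ b) :
    |scoreShift α β 1 0 d₁ d₂ - (hurwitzSum 2 α * d₁ - hurwitzSum 2 (α + β) * (d₁ + d₂))| ≤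
      b * (d₁ ^ 2 + d₂ ^ 2) := by
  have hs : 0 < α + β := by linarith
  have hsd : 0 < α + β + (d₁ + d₂) := by linarith
  have e : scoreShift α β 1 0 d₁ d₂ - (hurwitzSum 2 α * d₁ - hurwitzSum 2 (α + β) * (d₁ + d₂)) =
      (d₁ + d₂) ^ 2 * digammaRem (α + β) (d₁ + d₂) - d₁ ^ 2 * digammaRem α d₁ := by
    rw [scoreShift, digamma_add_sub hα h1, digamma_add_sub hs hsd]
    ring
  have r1 := digammaRem_nonneg hα h1
  have r3 := digammaRem_nonneg hs hsd
  have hb : 0 ≤ b := r1.trans hb1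
  have m1 : d₁ ^ 2 * digammaRem α d₁ ≤ b * (d₁ ^ 2 + d₂ ^ 2) := by
    rw [mul_comm]
    exact mul_le_mul hb1 (by nlinarith [sq_nonneg d₂]) (sq_nonneg _) hb
  have m2 : (d₁ + d₂) ^ 2 * digammaRem (α + β) (d₁ + d₂) ≤ b * (d₁ ^ 2 + d₂ ^ 2) := by
    have : (d₁ + d₂) ^ 2 ≤ 2 * (d₁ ^ 2 + d₂ ^ 2) := by nlinarith [sq_nonneg (d₁ - d₂)]
    calc (d₁ + d₂) ^ 2 * digammaRem (α + β) (d₁ + d₂)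
        ≤ 2 * (d₁ ^ 2 + d₂ ^ 2) * digammaRem (α + β) (d₁ + d₂) := by gcongr
      _ = 2 * digammaRem (α + β) (d₁ + d₂) * (d₁ ^ 2 + d₂ ^ 2) := by ring
      _ ≤ _ := by gcongr
  have m3 : 0 ≤ d₁ ^ 2 * digammaRem α d₁ := by positivity
  have m4 : 0 ≤ (d₁ + d₂) ^ 2 * digammaRem (α + β) (d₁ + d₂) := by positivity
  rw [e, abs_le]
  constructor <;> linarith

theorem scoreShift_comm (α β c₁ c₂ d₁ d₂ : ℝ) :
    scoreShift α β c₁ c₂ d₁ d₂ = scoreShift β α c₂ c₁ d₂ d₁ := by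
  rw [scoreShift, scoreShift, add_comm β α, add_comm c₂ c₁, add_comm d₂ d₁]
  ring

/-- With w = d + e one has |w|² ≥ |d|² + 2 d·e, and each coordinate of d is at most |d|. -/
theorem sq_add_sq_le_of_abs_sub {d₁ d₂ w₁ w₂ e₁ e₂ J : ℝ} (h1 : d₁ = w₁ - e₁) (h2 : d₂ = w₂ - e₂)
    (h : 2 * (|e₁| + |e₂|) ≤ J * (d₁ ^ 2 + d₂ ^ 2)) :
    d₁ ^ 2 + d₂ ^ 2 ≤
      w₁ ^ 2 + w₂ ^ 2 + J * ((d₁ ^ 2 + d₂ ^ 2) * √(d₁ ^ 2 + d₂ ^ 2)) := by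
  have hs : ∀ a b : ℝ, |a| ≤ √(a ^ 2 + b ^ 2) := fun a b =>
    Real.abs_le_sqrt (by nlinarith [sq_nonneg b])
  have s1 := hs d₁ d₂
  have s2 := hs d₂ d₁
  rw [add_comm (d₂ ^ 2)] at s2
  set r := √(d₁ ^ 2 + d₂ ^ 2)
  have hr : 0 ≤ r := Real.sqrt_nonneg _
  have h3 : -(2 * (d₁ * e₁ + d₂ * e₂)) ≤ r * (J * (d₁ ^ 2 + d₂ ^ 2)) := by
    calc -(2 * (d₁ * e₁ + d₂ * e₂)) ≤ 2 * (|d₁| * |e₁| + |d₂| * |e₂|) := by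
          have a1 := neg_abs_le (d₁ * e₁)
          have a2 := neg_abs_le (d₂ * e₂)
          rw [abs_mul] at a1 a2
          linarith
      _ ≤ 2 * (r * |e₁| + r * |e₂|) := by gcongr
      _ = r * (2 * (|e₁| + |e₂|)) := by ring
      _ ≤ _ := by gcongr
  have h4 : w₁ = d₁ + e₁ := by linarith
  have h5 : w₂ = d₂ + e₂ := by linarith
  rw [h4, h5]
  nlinarith [sq_nonneg e₁, sq_nonneg e₂]

/-- The error of the linear approximation of the estimation error. -/
theorem sq_add_sq_le_of_fisherForm_le {α β d₁ d₂ : ℝ} (hα : 0 < α) (hβ : 0 < β)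
    (hQ : fisherForm α β d₁ d₂ ≤ 1 / (2 * curvature α β) ^ 2) :
    d₁ ^ 2 + d₂ ^ 2 ≤ estLin α β (scoreShift α β 1 0 d₁ d₂) (scoreShift α β 0 1 d₁ d₂) ^ 2 +
      estLin β α (scoreShift α β 0 1 d₁ d₂) (scoreShift α β 1 0 d₁ d₂) ^ 2 +
      thirdRatio α β * ((d₁ ^ 2 + d₂ ^ 2) * √(d₁ ^ 2 + d₂ ^ 2)) := by
  have a1 := abs_fst_le_of_fisherForm_le hα hβ hQ
  have a2 := abs_snd_le_of_fisherForm_le hα hβ hQ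
  have a3 := abs_add_le_of_abs_le a1 a2
  have hs : 0 < α + β := by linarith
  have p1 := add_pos_of_abs_le hα a1
  have p2 := add_pos_of_abs_le hβ a2
  have r1 := digammaRem_le_of_abs_le hα a1
  have r2 := digammaRem_le_of_abs_le hβ a2
  have r3 := digammaRem_le_of_abs_le hs a3
  have b1 := abs_scoreShift_sub_le (b := 20 / 17 * max (hurwitzSum 3 α) (2 * hurwitzSum 3 (α + β)))
    hα hβ p1 p2 (r1.trans (by gcongr; exact le_max_left _ _))
    (by have := le_max_right (hurwitzSum 3 α) (2 * hurwitzSum 3 (α + β)); linarith)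
  have b2 := abs_scoreShift_sub_le (b := 20 / 17 * max (hurwitzSum 3 β) (2 * hurwitzSum 3 (α + β)))
    hβ hα p2 p1 (r2.trans (by gcongr; exact le_max_left _ _))
    (by rw [add_comm β α, add_comm d₂ d₁]
        have := le_max_right (hurwitzSum 3 β) (2 * hurwitzSum 3 (α + β)); linarith)
  rw [scoreShift_comm β α, add_comm β α, add_comm d₂ d₁, add_comm (d₂ ^ 2)] at b2
  have hδ := fisherDet_pos hα hβ
  have hp := hurwitzSum_two_add_lt hα hβ
  have hq := hurwitzSum_two_add_lt' hα hβ
  have hw := hurwitzSum_pos (j := 2) le_rfl hs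
  have hδeq := fisherDet_eq α β
  have hc := fisherDet_comm β α
  have hJ : thirdRatio α β = 40 / 17 * (hurwitzSum 2 β * max (hurwitzSum 3 α)
    (2 * hurwitzSum 3 (α + β)) + hurwitzSum 2 α * max (hurwitzSum 3 β)
      (2 * hurwitzSum 3 (α + β))) / fisherDet α β := rfl
  rw [hJ, estLin, estLin, add_comm β α, hc]
  set p := hurwitzSum 2 α
  set q := hurwitzSum 2 β
  set w := hurwitzSum 2 (α + β)
  set δ := fisherDet α β
  set u₁ := scoreShift α β 1 0 d₁ d₂
  set u₂ := scoreShift α β 0 1 d₁ d₂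
  set m₁ := max (hurwitzSum 3 α) (2 * hurwitzSum 3 (α + β))
  set m₂ := max (hurwitzSum 3 β) (2 * hurwitzSum 3 (α + β))
  set R₁ := u₁ - (p * d₁ - w * (d₁ + d₂)) with hR1
  set R₂ := u₂ - (q * d₂ - w * (d₁ + d₂)) with hR2
  refine sq_add_sq_le_of_abs_sub (e₁ := ((q - w) * R₁ + w * R₂) / δ)
    (e₂ := ((p - w) * R₂ + w * R₁) / δ) ?_ ?_ ?_
  · rw [hR1, hR2, ← sub_div, eq_div_iff hδ.ne', hδeq]
    ring
  · rw [hR1, hR2, ← sub_div, eq_div_iff hδ.ne', hδeq]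
    ring
  · rw [abs_div, abs_div, abs_of_pos hδ]
    have c1 : |(q - w) * R₁ + w * R₂| ≤ (q - w) * |R₁| + w * |R₂| := by
      refine (abs_add_le _ _).trans ?_
      rw [abs_mul, abs_mul, abs_of_pos (sub_pos.2 hq), abs_of_pos hw]
    have c2 : |(p - w) * R₂ + w * R₁| ≤ (p - w) * |R₂| + w * |R₁| := by
      refine (abs_add_le _ _).trans ?_
      rw [abs_mul, abs_mul, abs_of_pos (sub_pos.2 hp), abs_of_pos hw]
    have hp0 : 0 < p := hw.trans hp
    have hq0 : 0 < q := hw.trans hq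
    have c3 := mul_le_mul_of_nonneg_left b1 hq0.le
    have c4 := mul_le_mul_of_nonneg_left b2 hp0.le
    rw [← add_div, ← mul_div_assoc, div_mul_eq_mul_div]
    refine div_le_div_of_nonneg_right ?_ hδ.le
    linarith

/-- A bootstrap: q ≤ m + κq² with κq ≤ 1/2 gives q ≤ 2m, and reinserting gives q ≤ m(1 + 4κm). The
constant 28 is the slope of the chord of (1 + 4z)³ over [0, 1/4]. -/
theorem sqrt_le_of_sub_le {κ q m : ℝ} (hκ : 0 < κ) (hq : 0 ≤ q) (hqκ : κ * q ≤ 1 / 2)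
    (h : q ^ 2 - κ * q ^ 3 ≤ m * q) (hm : 0 ≤ m) (hmκ : κ * m ≤ 1 / 4) :
    q ^ 3 ≤ m ^ 3 + 28 * κ * m ^ 4 := by
  rcases hq.eq_or_lt with h0 | h0
  · rw [← h0]
    simp only [ne_eq, OfNat.ofNat_ne_zero, not_false_eq_true, zero_pow]
    positivity
  have h1 : q - κ * q ^ 2 ≤ m := by
    by_contra! hlt
    nlinarith
  have h2 : q ≤ 2 * m := by nlinarith
  have h3 : q ≤ m * (1 + 4 * (κ * m)) := by nlinarith [pow_le_pow_left₀ hq h2 2]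
  have h4 : (1 + 4 * (κ * m)) ^ 3 ≤ 1 + 28 * (κ * m) := by
    have : 0 ≤ κ * m := by positivity
    generalize κ * m = z at *
    nlinarith [mul_nonneg this (sub_nonneg.2 hmκ), mul_nonneg (mul_nonneg this this)
      (sub_nonneg.2 hmκ)]
  calc q ^ 3 ≤ (m * (1 + 4 * (κ * m))) ^ 3 := by gcongr
    _ = m ^ 3 * (1 + 4 * (κ * m)) ^ 3 := by ring
    _ ≤ m ^ 3 * (1 + 28 * (κ * m)) := by gcongr
    _ = _ := by ring

/-- The squared error is bounded by the squared linear approximation, up to terms of higher order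
in the mean score. -/
theorem sq_add_sq_le_of_fisherDual_lt {α β d₁ d₂ : ℝ} (hα : 0 < α) (hβ : 0 < β) (h1 : 0 < α + d₁)
    (h2 : 0 < β + d₂) {u₁ u₂ : ℝ} (hu1 : scoreShift α β 1 0 d₁ d₂ = u₁)
    (hu2 : scoreShift α β 0 1 d₁ d₂ = u₂)
    (hN : fisherDual α β u₁ u₂ < 1 / (4 * curvature α β) ^ 2) :
    d₁ ^ 2 + d₂ ^ 2 ≤ estLin α β u₁ u₂ ^ 2 + estLin β α u₂ u₁ ^ 2 +
      thirdRatio α β * (estTrace α β * √(estTrace α β) *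
        (√(fisherDual α β u₁ u₂) ^ 3 + 28 * curvature α β * √(fisherDual α β u₁ u₂) ^ 4)) := by
  subst hu1 hu2
  have hκ := curvature_pos hα hβ
  have hQ := fisherForm_le_of_fisherDual_lt hα hβ h1 h2 hN
  have hQ0 := fisherForm_nonneg hα hβ d₁ d₂
  have hN0 := fisherDual_nonneg hα hβ (scoreShift α β 1 0 d₁ d₂) (scoreShift α β 0 1 d₁ d₂)
  have hτ := estTrace_pos hα hβ
  have hJ := thirdRatio_pos hα hβ
  refine (sq_add_sq_le_of_fisherForm_le hα hβ hQ).trans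
    (add_le_add_right (mul_le_mul_of_nonneg_left ?_ hJ.le) _)
  have hτQ : d₁ ^ 2 + d₂ ^ 2 ≤ estTrace α β * fisherForm α β d₁ d₂ := by
    rw [estTrace, add_mul]
    exact add_le_add (sq_fst_le_estVar hα hβ d₁ d₂) (sq_snd_le_estVar hα hβ d₁ d₂)
  have k1 := scoreShift_self_le (d₁ := d₁) (d₂ := d₂) hα hβ
  rw [scoreShift_self hα hβ h1 h2] at k1
  have k2 := abs_cubicRem_le hα hβ hQ
  have hQ1 : √(fisherForm α β d₁ d₂) ≤ 1 / (2 * curvature α β) := by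
    rw [Real.sqrt_le_left (by positivity), div_pow, one_pow]
    exact hQ
  have hN1 : √(fisherDual α β (scoreShift α β 1 0 d₁ d₂) (scoreShift α β 0 1 d₁ d₂)) ≤
      1 / (4 * curvature α β) := by
    rw [Real.sqrt_le_left (by positivity), div_pow, one_pow]
    exact hN.le
  set Q := fisherForm α β d₁ d₂
  set N := fisherDual α β (scoreShift α β 1 0 d₁ d₂) (scoreShift α β 0 1 d₁ d₂)
  set κ := curvature α β
  have hq2 : √Q ^ 2 = Q := Real.sq_sqrt hQ0
  have k3 : √Q ^ 3 ≤ √N ^ 3 + 28 * κ * √N ^ 4 := by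
    refine sqrt_le_of_sub_le hκ (Real.sqrt_nonneg _) ?_ ?_ (Real.sqrt_nonneg _) ?_
    · rw [le_div_iff₀ (by positivity)] at hQ1; linarith
    · have := le_of_abs_le k2
      rw [pow_succ √Q 2, hq2]
      linarith
    · rw [le_div_iff₀ (by positivity)] at hN1; linarith
  have k4 : (d₁ ^ 2 + d₂ ^ 2) * √(d₁ ^ 2 + d₂ ^ 2) ≤
      estTrace α β * √(estTrace α β) * √Q ^ 3 := by
    calc (d₁ ^ 2 + d₂ ^ 2) * √(d₁ ^ 2 + d₂ ^ 2)
        ≤ (estTrace α β * Q) * √(estTrace α β * Q) := by gcongr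
      _ = estTrace α β * √(estTrace α β) * (√Q ^ 2 * √Q) := by
          rw [Real.sqrt_mul hτ.le, hq2]; ring
      _ = _ := by ring
  refine k4.trans ?_
  gcongr

/-- A bound for the logarithm of the moment generating function of a standardised score. -/
theorem logBetaRem_le {α β c₁ c₂ t : ℝ} (hα : 0 < α) (hβ : 0 < β)
    (hc : fisherForm α β c₁ c₂ = 1) (ht0 : 0 ≤ t) (ht : t ≤ 1 / (2 * curvature α β)) :
    (0 < α + t * c₁ ∧ 0 < β + t * c₂) ∧
      logBetaRem α β (t * c₁) (t * c₂) ≤ t ^ 2 / 2 + curvature α β * t ^ 3 / 3 := by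
  have hκ := curvature_pos hα hβ
  have hform : ∀ u ∈ Set.Icc 0 t, fisherForm α β (u * c₁) (u * c₂) ≤
      1 / (2 * curvature α β) ^ 2 := by
    intro u hu
    rw [fisherForm_smul, hc, mul_one, ← one_div_pow]
    have := hu.1
    have := hu.2.trans ht
    gcongr
  have hpos : ∀ u ∈ Set.Icc 0 t, 0 < α + u * c₁ ∧ 0 < β + u * c₂ := fun u hu =>
    ⟨add_pos_of_abs_le hα (abs_fst_le_of_fisherForm_le hα hβ (hform u hu)),
      add_pos_of_abs_le hβ (abs_snd_le_of_fisherForm_le hα hβ (hform u hu))⟩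
  refine ⟨hpos t ⟨ht0, le_rfl⟩, ?_⟩
  have hd : ∀ u ∈ Set.Icc 0 t, HasDerivAt (fun u => u ^ 2 / 2 + curvature α β * u ^ 3 / 3 -
      logBetaRem α β (u * c₁) (u * c₂)) (u + curvature α β * u ^ 2 -
        logBetaRemDeriv α β c₁ c₂ u) u := by
    intro u hu
    have d1 := ((hasDerivAt_pow 2 u).div_const 2).add
      (((hasDerivAt_pow 3 u).const_mul (curvature α β)).div_const 3)
    refine (d1.sub (hasDerivAt_logBetaRem (hpos u hu).1 (hpos u hu).2)).congr_deriv ?_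
    simp
    ring
  -- In a unit direction `scoreShift_self` and `abs_cubicRem_le` bound the derivative of the
  -- divergence by u + κu²; monotonicity of the difference integrates this bound.
  have hmono : MonotoneOn (fun u => u ^ 2 / 2 + curvature α β * u ^ 3 / 3 -
      logBetaRem α β (u * c₁) (u * c₂)) (Set.Icc 0 t) := by
    refine monotoneOn_of_deriv_nonneg (convex_Icc 0 t)
      (fun u hu => (hd u hu).continuousAt.continuousWithinAt)
      (fun u hu => (hd u (interior_subset hu)).differentiableAt.differentiableWithinAt)
      fun u hu => ?_
    have hu' := interior_subset hu
    rw [interior_Icc] at hu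
    have hu0 : 0 < u := hu.1
    rw [(hd u hu').deriv, logBetaRemDeriv_eq_scoreShift]
    obtain ⟨p1, p2⟩ := hpos u hu'
    have k1 := scoreShift_self hα hβ p1 p2
    have k2 := abs_cubicRem_le hα hβ (hform u hu')
    rw [fisherForm_smul, hc, mul_one] at k1 k2
    rw [scoreShift_smul] at k1
    rw [Real.sqrt_sq hu0.le] at k2
    have k3 := neg_le_of_abs_le k2
    have k4 : u * scoreShift α β c₁ c₂ (u * c₁) (u * c₂) ≤
        u * (u + curvature α β * u ^ 2) := by nlinarith
    have := le_of_mul_le_mul_left k4 hu0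
    linarith
  have := hmono (Set.left_mem_Icc.2 ht0) (Set.right_mem_Icc.2 ht0) ht0
  simp [logBetaRem_zero] at this
  linarith

/-! ### Moments of the mean score of a sample -/

/-- The sum of a linear combination of the scores over a sample. -/
noncomputable def scoreSum (α β c₁ c₂ : ℝ) {n : ℕ} (x : Fin n → ℝ) : ℝ :=
  ∑ i, scoreComb α β c₁ c₂ (x i)

theorem scoreSum_eq (α β c₁ c₂ : ℝ) {n : ℕ} (x : Fin n → ℝ) :
    scoreSum α β c₁ c₂ x = c₁ * scoreSum α β 1 0 x + c₂ * scoreSum α β 0 1 x := by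
  simp only [scoreSum, Finset.mul_sum, ← Finset.sum_add_distrib]
  exact Finset.sum_congr rfl fun i _ => scoreComb_eq α β c₁ c₂ (x i)

section
variable {Ω : Type*} [MeasurableSpace Ω] {μ : Measure Ω} {α β : ℝ} {n : ℕ}
  {X : Fin n → Ω → ℝ}

theorem aemeasurable_sample (hlaw : ∀ i, HasLaw (X i) (betaMeasure α β) μ) :
    AEMeasurable (fun ω i => X i ω) μ := aemeasurable_pi_lambda _ fun i => (hlaw i).aemeasurable

theorem mgf_scoreSum (hα : 0 < α) (hβ : 0 < β) (hlaw : ∀ i, HasLaw (X i) (betaMeasure α β) μ)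
    (hind : iIndepFun X μ) {c₁ c₂ t : ℝ} (h1 : 0 < α + t * c₁) (h2 : 0 < β + t * c₂) :
    mgf (fun ω => scoreSum α β c₁ c₂ fun i => X i ω) μ t =
      Real.exp (n * logBetaRem α β (t * c₁) (t * c₂)) := by
  have hm := measurable_scoreComb α β c₁ c₂
  have hY : iIndepFun (fun i => scoreComb α β c₁ c₂ ∘ X i) μ :=
    hind.comp (fun _ => scoreComb α β c₁ c₂) fun _ => hm
  have h3 := hY.mgf_sum₀ (t := t) (fun i => hm.comp_aemeasurable (hlaw i).aemeasurable) Finset.univ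
  have h4 : ∀ i, mgf (scoreComb α β c₁ c₂ ∘ X i) μ t =
      Real.exp (logBetaRem α β (t * c₁) (t * c₂)) := fun i => by
    rw [← mgf_scoreComb hα hβ h1 h2]
    exact (hlaw i).integral_comp (f := fun x => Real.exp (t * scoreComb α β c₁ c₂ x))
      (by fun_prop)
  simp only [h4, Finset.prod_const, Finset.card_univ, Fintype.card_fin] at h3
  rw [Real.exp_nat_mul, ← h3]
  congr 1
  ext ω
  simp [scoreSum]

variable [IsProbabilityMeasure μ]

theorem integrable_exp_scoreSum (hα : 0 < α) (hβ : 0 < β)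
    (hlaw : ∀ i, HasLaw (X i) (betaMeasure α β) μ)
    (hind : iIndepFun X μ) {c₁ c₂ t : ℝ} (h1 : 0 < α + t * c₁) (h2 : 0 < β + t * c₂) :
    Integrable (fun ω => Real.exp (t * scoreSum α β c₁ c₂ fun i => X i ω)) μ := by
  rw [← mgf_pos_iff, mgf_scoreSum hα hβ hlaw hind h1 h2]
  exact Real.exp_pos _

theorem zero_mem_interior_scoreSum (hα : 0 < α) (hβ : 0 < β)
    (hlaw : ∀ i, HasLaw (X i) (betaMeasure α β) μ) (hind : iIndepFun X μ) (c₁ c₂ : ℝ) :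
    (0 : ℝ) ∈ interior (integrableExpSet (fun ω => scoreSum α β c₁ c₂ fun i => X i ω) μ) := by
  rw [mem_interior_iff_mem_nhds]
  filter_upwards [eventually_add_mul_pos hα, eventually_add_mul_pos hβ] with t h1 h2 using
    integrable_exp_scoreSum hα hβ hlaw hind h1 h2

theorem integrable_scoreSum_pow (hα : 0 < α) (hβ : 0 < β)
    (hlaw : ∀ i, HasLaw (X i) (betaMeasure α β) μ) (hind : iIndepFun X μ) (c₁ c₂ : ℝ) (j : ℕ) :
    Integrable (fun ω => (scoreSum α β c₁ c₂ fun i => X i ω) ^ j) μ :=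
  integrable_pow_of_mem_interior_integrableExpSet
    (zero_mem_interior_scoreSum hα hβ hlaw hind c₁ c₂) j

theorem integral_scoreSum_sq (hα : 0 < α) (hβ : 0 < β)
    (hlaw : ∀ i, HasLaw (X i) (betaMeasure α β) μ) (hind : iIndepFun X μ) (c₁ c₂ : ℝ) :
    ∫ ω, (scoreSum α β c₁ c₂ fun i => X i ω) ^ 2 ∂μ = n * fisherForm α β c₁ c₂ := by
  rw [← hurwitzForm_two_zero]
  refine (moments_of_mgf_eq hα hβ c₁ c₂ (zero_mem_interior_scoreSum hα hβ hlaw hind c₁ c₂) ?_).2.1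
  filter_upwards [eventually_add_mul_pos hα, eventually_add_mul_pos hβ] with t h1 h2 using
    mgf_scoreSum hα hβ hlaw hind h1 h2

theorem fisherForm_neg (α β c₁ c₂ : ℝ) : fisherForm α β (-c₁) (-c₂) = fisherForm α β c₁ c₂ := by
  rw [fisherForm, fisherForm]
  ring

theorem scoreSum_neg (α β c₁ c₂ : ℝ) (x : Fin n → ℝ) :
    scoreSum α β (-c₁) (-c₂) x = -scoreSum α β c₁ c₂ x := by
  rw [scoreSum_eq, scoreSum_eq α β c₁]
  ring

/-- The Chernoff bound for a standardised score. -/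
theorem measureReal_le_scoreSum_le (hα : 0 < α) (hβ : 0 < β)
    (hlaw : ∀ i, HasLaw (X i) (betaMeasure α β) μ) (hind : iIndepFun X μ) {c₁ c₂ : ℝ}
    (hc : fisherForm α β c₁ c₂ = 1) {a l : ℝ} (hl0 : 0 ≤ l) (hl : l ≤ 1 / 2) :
    μ.real {ω | n * (a / curvature α β) ≤ scoreSum α β c₁ c₂ fun i => X i ω} ≤
      Real.exp (-(n / curvature α β ^ 2 * (l * a - l ^ 2 / 2 - l ^ 3 / 3))) := by
  have hκ := curvature_pos hα hβ
  set κ := curvature α β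
  have ht : l / κ ≤ 1 / (2 * κ) := by
    rw [div_le_div_iff₀ hκ (by positivity)]
    nlinarith
  obtain ⟨⟨p1, p2⟩, hD⟩ := logBetaRem_le hα hβ hc (t := l / κ) (by positivity) ht
  refine (measure_ge_le_exp_mul_mgf _ (t := l / κ) (by positivity)
    (integrable_exp_scoreSum hα hβ hlaw hind p1 p2)).trans ?_
  rw [mgf_scoreSum hα hβ hlaw hind p1 p2, ← Real.exp_add]
  refine Real.exp_le_exp.2 ?_
  have := mul_le_mul_of_nonneg_left hD (Nat.cast_nonneg (α := ℝ) n)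
  refine (add_le_add_right this _).trans (le_of_eq ?_)
  change -(l / κ) * (n * (a / κ)) + n * ((l / κ) ^ 2 / 2 + κ * (l / κ) ^ 3 / 3) = _
  field_simp
  ring

theorem one_add_sq_add_pow_four_le_cosh (x : ℝ) :
    1 + x ^ 2 / 2 + x ^ 4 / 24 ≤ Real.cosh x := by
  have h := Real.hasSum_cosh x
  have := h.summable.sum_le_tsum (Finset.range 3) (fun i _ =>
    div_nonneg (Even.pow_nonneg (even_two_mul i) x) (Nat.cast_nonneg _))
  rw [h.tsum_eq] at this
  simpa [Finset.sum_range_succ, Nat.factorial] using this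

/-- A bound for the fourth moment of a standardised score. -/
theorem integral_scoreSum_pow_four_le (hα : 0 < α) (hβ : 0 < β)
    (hlaw : ∀ i, HasLaw (X i) (betaMeasure α β) μ) (hind : iIndepFun X μ) {c₁ c₂ : ℝ}
    (hc : fisherForm α β c₁ c₂ = 1) (hn : 2200 * curvature α β ^ 2 ≤ n) :
    ∫ ω, (scoreSum α β c₁ c₂ fun i => X i ω) ^ 4 ∂μ ≤ 3.87 * (n : ℝ) ^ 2 := by
  have hκ := curvature_pos hα hβ
  have hn0 : (0 : ℝ) < n := lt_of_lt_of_le (by positivity) hn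
  set κ := curvature α β
  set r := √(n : ℝ) with hr
  have hr0 : 0 < r := Real.sqrt_pos.2 hn0
  have hr2 : r ^ 2 = n := Real.sq_sqrt hn0.le
  -- Since 46² < 2200. Then κ/√n ≤ 1/46, and the cubic correction in the exponent is at most 1/138.
  have hκr : 46 * κ ≤ r := by
    rw [hr]
    refine Real.le_sqrt_of_sq_le ?_
    nlinarith [sq_nonneg κ]
  have ht : 1 / r ≤ 1 / (2 * κ) := by gcongr; linarith
  have hexp : ∀ b₁ b₂ : ℝ, fisherForm α β b₁ b₂ = 1 →
      Integrable (fun ω => Real.exp (1 / r * scoreSum α β b₁ b₂ fun i => X i ω)) μ ∧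
      ∫ ω, Real.exp (1 / r * scoreSum α β b₁ b₂ fun i => X i ω) ∂μ ≤
        Real.exp (1 / 2 + 1 / 138) := by
    intro b₁ b₂ hb
    obtain ⟨⟨p1, p2⟩, hD⟩ := logBetaRem_le hα hβ hb (t := 1 / r) (by positivity) ht
    refine ⟨integrable_exp_scoreSum hα hβ hlaw hind p1 p2, ?_⟩
    have := mgf_scoreSum hα hβ hlaw hind p1 p2
    rw [mgf] at this
    rw [this]
    refine Real.exp_le_exp.2 ?_
    refine (mul_le_mul_of_nonneg_left hD hn0.le).trans ?_
    rw [← hr2]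
    have e : r ^ 2 * ((1 / r) ^ 2 / 2 + curvature α β * (1 / r) ^ 3 / 3) =
        1 / 2 + κ / r / 3 := by
      change r ^ 2 * ((1 / r) ^ 2 / 2 + κ * (1 / r) ^ 3 / 3) = _
      field_simp
    rw [e]
    have : κ / r ≤ 1 / 46 := by rw [div_le_div_iff₀ hr0 (by norm_num)]; linarith
    linarith
  obtain ⟨i1, e1⟩ := hexp c₁ c₂ hc
  obtain ⟨i2, e2⟩ := hexp (-c₁) (-c₂) (by rw [fisherForm_neg, hc])
  simp only [scoreSum_neg] at i2 e2
  set S := fun ω => scoreSum α β c₁ c₂ fun i => X i ω with hS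
  have hS2 : Integrable (fun ω => S ω ^ 2) μ := integrable_scoreSum_pow hα hβ hlaw hind c₁ c₂ 2
  have hS4 : Integrable (fun ω => S ω ^ 4) μ := integrable_scoreSum_pow hα hβ hlaw hind c₁ c₂ 4
  have hS2i : ∫ ω, S ω ^ 2 ∂μ = n := by
    have := integral_scoreSum_sq hα hβ hlaw hind c₁ c₂
    rw [hc, mul_one] at this
    exact this
  -- The fourth moment is extracted from the expectation of cosh(S/√n): the second moment is known
  -- exactly, so what remains is at most 24 n² (exp(1/2 + 1/138) - 3/2).
  have hpt : ∀ ω, 1 + S ω ^ 2 / (2 * n) + S ω ^ 4 / (24 * n ^ 2) ≤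
      (Real.exp (1 / r * S ω) + Real.exp (1 / r * -S ω)) / 2 := by
    intro ω
    have := one_add_sq_add_pow_four_le_cosh (1 / r * S ω)
    rw [Real.cosh_eq] at this
    refine le_trans (le_of_eq ?_) (this.trans (le_of_eq ?_))
    · rw [← hr2]
      field_simp
    · ring_nf
  have j1 : Integrable (fun ω => 1 + S ω ^ 2 / (2 * n)) μ :=
    (integrable_const 1).add (hS2.div_const (2 * n))
  have j2 : Integrable (fun ω => Real.exp (1 / r * S ω)) μ := i1
  have j3 : Integrable (fun ω => Real.exp (1 / r * -S ω)) μ := i2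
  have h_mono := integral_mono (μ := μ) (j1.add (hS4.div_const (24 * (n : ℝ) ^ 2)))
    ((j2.add j3).div_const 2) hpt
  rw [integral_add' j1 (hS4.div_const _), integral_add (integrable_const 1) (hS2.div_const _),
    integral_div, integral_div, integral_div, integral_add' j2 j3, hS2i] at h_mono
  simp only [integral_const, probReal_univ, smul_eq_mul, mul_one] at h_mono
  have hexpb : Real.exp (1 / 2 + 1 / 138) ≤ 1.66111 := by
    have h1 := Real.exp_bound' (x := 1 / 2 + 1 / 138) (by norm_num) (by norm_num) (n := 6)
      (by norm_num)
    refine h1.trans ?_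
    norm_num [Finset.sum_range_succ, Nat.factorial]
  have hfin : (∫ ω, S ω ^ 4 ∂μ) / (24 * (n : ℝ) ^ 2) ≤ 0.16111 := by
    have : (n : ℝ) / (2 * n) = 1 / 2 := by field_simp
    rw [this] at h_mono
    linarith
  rw [div_le_iff₀ (by positivity)] at hfin
  refine hfin.trans ?_
  nlinarith [sq_nonneg (n : ℝ)]

end

/-- Four directions of unit length for the Fisher information, at angles of 45 degrees. -/
theorem exists_directions {α β : ℝ} (hα : 0 < α) (hβ : 0 < β) :
    ∃ c : Fin 4 → ℝ × ℝ, (∀ j, fisherForm α β (c j).1 (c j).2 = 1) ∧ ∀ u₁ u₂ : ℝ,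
      fisherDual α β u₁ u₂ ^ 2 = 2 / 3 * ∑ j, ((c j).1 * u₁ + (c j).2 * u₂) ^ 4 ∧
      fisherDual α β u₁ u₂ =
        ((c 0).1 * u₁ + (c 0).2 * u₂) ^ 2 + ((c 1).1 * u₁ + (c 1).2 * u₂) ^ 2 ∧
      ∃ j, 0.85 * fisherDual α β u₁ u₂ ≤ ((c j).1 * u₁ + (c j).2 * u₂) ^ 2 := by
  have hA : 0 < hurwitzSum 2 α - hurwitzSum 2 (α + β) :=
    sub_pos.2 (hurwitzSum_two_add_lt hα hβ)
  have hδ := fisherDet_pos hα hβ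
  have hδeq := fisherDet_eq α β
  have hform : ∀ d₁ d₂, fisherForm α β d₁ d₂ =
      (hurwitzSum 2 α - hurwitzSum 2 (α + β)) * d₁ ^ 2 - 2 * hurwitzSum 2 (α + β) * (d₁ * d₂) +
        (hurwitzSum 2 β - hurwitzSum 2 (α + β)) * d₂ ^ 2 := fun d₁ d₂ => by
    rw [fisherForm]; ring
  have hdual : ∀ u₁ u₂, fisherDual α β u₁ u₂ = ((hurwitzSum 2 β - hurwitzSum 2 (α + β)) * u₁ ^ 2 +
      2 * hurwitzSum 2 (α + β) * (u₁ * u₂) +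
      (hurwitzSum 2 α - hurwitzSum 2 (α + β)) * u₂ ^ 2) / fisherDet α β := fun _ _ => rfl
  simp only [hform, hdual]
  set w := hurwitzSum 2 (α + β)
  set A := hurwitzSum 2 α - w
  set B := hurwitzSum 2 β - w
  set δ := fisherDet α β
  set k := √A with hk
  set l := √δ with hl
  have hk0 : 0 < k := Real.sqrt_pos.2 hA
  have hl0 : 0 < l := Real.sqrt_pos.2 hδ
  have hk2 : A = k ^ 2 := (Real.sq_sqrt hA.le).symm
  have hl2 : δ = l ^ 2 := (Real.sq_sqrt hδ.le).symm
  have hB : B = (l ^ 2 + w ^ 2) / k ^ 2 := by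
    rw [eq_div_iff (by positivity)]
    nlinarith
  set z := √2 with hz
  have hz0 : 0 < z := by positivity
  have hz2 : z ^ 2 = 2 := Real.sq_sqrt (by norm_num)
  have hz4 : z ^ 4 = 4 := by rw [show z ^ 4 = (z ^ 2) ^ 2 by ring, hz2]; norm_num
  rw [hk2, hl2, hB]
  -- In the Cholesky coordinates a, b the dual form is a² + b²; the four directions are the two axes
  -- and the two diagonals.
  have key : ∀ u₁ u₂ : ℝ, ∃ a b : ℝ, (l ^ 2 + w ^ 2) / k ^ 2 * u₁ ^ 2 + 2 * w * (u₁ * u₂) +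
      k ^ 2 * u₂ ^ 2 = (a ^ 2 + b ^ 2) * l ^ 2 ∧ 1 / k * u₁ = a ∧ w / (k * l) * u₁ + k / l * u₂ = b := by
    intro u₁ u₂
    refine ⟨_, _, ?_, rfl, rfl⟩
    field_simp
    ring
  refine ⟨![(1 / k, 0), (w / (k * l), k / l), ((1 / k + w / (k * l)) / z, k / l / z),
    ((1 / k - w / (k * l)) / z, -(k / l) / z)], ?_, fun u₁ u₂ => ?_⟩
  · intro j
    fin_cases j
    · simp; field_simp
    · simp; field_simp; ring
    · simp; field_simp; rw [hz2]; ring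
    · simp; field_simp; rw [hz2]; ring
  obtain ⟨a, b, hab, ha, hb⟩ := key u₁ u₂
  have hN : ((l ^ 2 + w ^ 2) / k ^ 2 * u₁ ^ 2 + 2 * w * (u₁ * u₂) + k ^ 2 * u₂ ^ 2) / l ^ 2 =
      a ^ 2 + b ^ 2 := by
    rw [hab]
    field_simp
  have h2 : (1 / k + w / (k * l)) / z * u₁ + k / l / z * u₂ = (a + b) / z := by
    rw [← ha, ← hb]; ring
  have h3 : (1 / k - w / (k * l)) / z * u₁ + -(k / l) / z * u₂ = (a - b) / z := by
    rw [← ha, ← hb]; ring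
  rw [hN]
  refine ⟨?_, ?_, ?_⟩
  · simp only [Fin.sum_univ_four, Matrix.cons_val]
    rw [h2, h3, zero_mul, add_zero, ha, hb, div_pow, div_pow, hz4]
    ring
  · simp only [Matrix.cons_val]
    rw [zero_mul, add_zero, ha, hb]
  -- Some direction is within 22.5 degrees of the vector up to sign, and cos² 22.5° > 0.85.
  -- Algebraically, `m1` and `m2` add up to (2 (0.85² - 0.85) + 1/4)(a² + b²)², whose coefficient is
  -- negative.
  · by_contra! hlt
    have l0 := hlt 0
    have l1 := hlt 1
    have l2 := hlt 2
    have l3 := hlt 3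
    simp only [Matrix.cons_val] at l0 l1 l2 l3
    rw [zero_mul, add_zero, ha] at l0
    rw [hb] at l1
    rw [h2, div_pow, hz2] at l2
    rw [h3, div_pow, hz2] at l3
    have m1 : 0 < (0.85 * (a ^ 2 + b ^ 2) - a ^ 2) * (0.85 * (a ^ 2 + b ^ 2) - b ^ 2) :=
      mul_pos (by linarith) (by linarith)
    have m2 : 0 < (0.85 * (a ^ 2 + b ^ 2) - (a + b) ^ 2 / 2) *
        (0.85 * (a ^ 2 + b ^ 2) - (a - b) ^ 2 / 2) := mul_pos (by linarith) (by linarith)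
    nlinarith [sq_nonneg (a ^ 2 + b ^ 2)]

section
variable {Ω : Type*} [MeasurableSpace Ω] {μ : Measure Ω} [IsProbabilityMeasure μ] {α β : ℝ} {n : ℕ}
  {X : Fin n → Ω → ℝ}

/-- The quadratic form of the inverse Fisher information at the sum of the scores. -/
noncomputable def scoreDual (α β : ℝ) {n : ℕ} (x : Fin n → ℝ) : ℝ :=
  fisherDual α β (scoreSum α β 1 0 x) (scoreSum α β 0 1 x)

theorem integrable_scoreDual (hα : 0 < α) (hβ : 0 < β)
    (hlaw : ∀ i, HasLaw (X i) (betaMeasure α β) μ) (hind : iIndepFun X μ) :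
    Integrable (fun ω => scoreDual α β fun i => X i ω) μ ∧
      ∫ ω, scoreDual α β (fun i => X i ω) ∂μ = 2 * n := by
  obtain ⟨c, hc, h⟩ := exists_directions hα hβ
  have e : ∀ ω, scoreDual α β (fun i => X i ω) =
      (scoreSum α β (c 0).1 (c 0).2 fun i => X i ω) ^ 2 +
        (scoreSum α β (c 1).1 (c 1).2 fun i => X i ω) ^ 2 := fun ω => by
    rw [scoreDual, (h _ _).2.1, ← scoreSum_eq, ← scoreSum_eq]
  simp only [e]
  have i1 := integrable_scoreSum_pow hα hβ hlaw hind (c 0).1 (c 0).2 2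
  have i2 := integrable_scoreSum_pow hα hβ hlaw hind (c 1).1 (c 1).2 2
  refine ⟨i1.add i2, ?_⟩
  rw [integral_add i1 i2, integral_scoreSum_sq hα hβ hlaw hind, hc,
    integral_scoreSum_sq hα hβ hlaw hind, hc]
  ring

/-- The squared dual form is two thirds of a sum of four fourth powers, so the constant is (2/3) · 4
· 3.87. -/
theorem integrable_scoreDual_sq (hα : 0 < α) (hβ : 0 < β)
    (hlaw : ∀ i, HasLaw (X i) (betaMeasure α β) μ) (hind : iIndepFun X μ) :
    Integrable (fun ω => scoreDual α β (fun i => X i ω) ^ 2) μ ∧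
      (2200 * curvature α β ^ 2 ≤ n →
        ∫ ω, scoreDual α β (fun i => X i ω) ^ 2 ∂μ ≤ 10.32 * (n : ℝ) ^ 2) := by
  obtain ⟨c, hc, h⟩ := exists_directions hα hβ
  have e : ∀ ω, scoreDual α β (fun i => X i ω) ^ 2 =
      2 / 3 * ∑ j, (scoreSum α β (c j).1 (c j).2 fun i => X i ω) ^ 4 := fun ω => by
    rw [scoreDual, (h _ _).1]
    simp only [← scoreSum_eq]
  simp only [e]
  have i1 := fun j => integrable_scoreSum_pow hα hβ hlaw hind (c j).1 (c j).2 4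
  refine ⟨(integrable_finsetSum _ fun j _ => i1 j).const_mul _, fun hn => ?_⟩
  rw [integral_const_mul, integral_finsetSum _ fun j _ => i1 j]
  have := Finset.sum_le_sum fun j (_ : j ∈ Finset.univ) =>
    integral_scoreSum_pow_four_le hα hβ hlaw hind (hc j) hn
  simp only [Finset.sum_const, Finset.card_univ, Fintype.card_fin] at this
  norm_num at this ⊢
  linarith

/-- The mean score is small with large probability. -/
theorem measureReal_scoreDual_ge (hα : 0 < α) (hβ : 0 < β)
    (hlaw : ∀ i, HasLaw (X i) (betaMeasure α β) μ) (hind : iIndepFun X μ) :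
    μ.real {ω | n ^ 2 * (1 / (4 * curvature α β) ^ 2) ≤ scoreDual α β fun i => X i ω} ≤
      8 * Real.exp (-(0.0232 * (n / curvature α β ^ 2))) := by
  obtain ⟨c, hc, h⟩ := exists_directions hα hβ
  have hκ := curvature_pos hα hβ
  set κ := curvature α β with hκdef
  -- The level 0.2304 lies just below √0.85 / 4, so on the bad event one of the four directions,
  -- with one of the two signs, exceeds it. The eight events give the factor 8.
  set E : ℝ × ℝ → Set Ω := fun b => {ω | n * (0.2304 / κ) ≤ scoreSum α β b.1 b.2 fun i => X i ω}
    with hE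
  have hsub : {ω | n ^ 2 * (1 / (4 * κ) ^ 2) ≤ scoreDual α β fun i => X i ω} ⊆
      ⋃ j, (E (c j) ∪ E (-c j)) := by
    intro ω hω
    obtain ⟨j, hj⟩ := (h (scoreSum α β 1 0 fun i => X i ω) (scoreSum α β 0 1 fun i => X i ω)).2.2
    rw [← scoreSum_eq] at hj
    have h1 : (n * (0.2304 / κ)) ^ 2 ≤ (scoreSum α β (c j).1 (c j).2 fun i => X i ω) ^ 2 := by
      refine le_trans ?_ hj
      have h2 : n ^ 2 * (1 / (4 * κ) ^ 2) ≤ scoreDual α β fun i => X i ω := hω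
      rw [scoreDual] at h2
      refine le_trans ?_ (mul_le_mul_of_nonneg_left h2 (by norm_num))
      have : (n * (0.2304 / κ)) ^ 2 = 0.2304 ^ 2 * 16 * (n ^ 2 * (1 / (4 * κ) ^ 2)) := by
        field_simp
        ring
      rw [this]
      gcongr
      norm_num
    refine Set.mem_iUnion.2 ⟨j, ?_⟩
    have h3 := sq_le_sq.1 h1
    rw [abs_of_nonneg (by positivity)] at h3
    rcases le_abs.1 h3 with h4 | h4
    · exact Or.inl h4
    · refine Or.inr ?_
      change n * (0.2304 / κ) ≤ scoreSum α β (-c j).1 (-c j).2 fun i => X i ω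
      rwa [Prod.fst_neg, Prod.snd_neg, scoreSum_neg]
  have hb : ∀ b : ℝ × ℝ, fisherForm α β b.1 b.2 = 1 →
      μ.real (E b) ≤ Real.exp (-(0.0232 * (n / κ ^ 2))) := by
    intro b hb
    -- At l = 0.21 the exponent 0.2304 l - l²/2 - l³/3 exceeds 0.0232.
    refine (measureReal_le_scoreSum_le hα hβ hlaw hind hb (l := 0.21) (by norm_num)
      (by norm_num)).trans (Real.exp_le_exp.2 (neg_le_neg ?_))
    rw [← hκdef, mul_comm]
    gcongr
    norm_num
  calc μ.real {ω | n ^ 2 * (1 / (4 * κ) ^ 2) ≤ scoreDual α β fun i => X i ω}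
      ≤ μ.real (⋃ j, (E (c j) ∪ E (-c j))) := measureReal_mono hsub
    _ ≤ ∑ j, μ.real (E (c j) ∪ E (-c j)) := measureReal_iUnion_fintype_le _
    _ ≤ ∑ _j : Fin 4, (2 * Real.exp (-(0.0232 * (n / κ ^ 2)))) := by
        refine Finset.sum_le_sum fun j _ => (measureReal_union_le _ _).trans ?_
        have e1 := hb (c j) (hc j)
        have e2 := hb (-c j) (by rw [Prod.fst_neg, Prod.snd_neg, fisherForm_neg, hc])
        linarith
    _ = _ := by
        simp only [Finset.sum_const, Finset.card_univ, Fintype.card_fin]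
        norm_num
        ring

theorem estLin_eq_scoreSum (α β : ℝ) (x : Fin n → ℝ) :
    estLin α β (scoreSum α β 1 0 x) (scoreSum α β 0 1 x) =
      scoreSum α β ((hurwitzSum 2 β - hurwitzSum 2 (α + β)) / fisherDet α β)
        (hurwitzSum 2 (α + β) / fisherDet α β) x := by
  rw [scoreSum_eq α β (_ / _), estLin]
  ring

theorem fisherForm_estLin {α β : ℝ} (hα : 0 < α) (hβ : 0 < β) :
    fisherForm α β ((hurwitzSum 2 β - hurwitzSum 2 (α + β)) / fisherDet α β)
      (hurwitzSum 2 (α + β) / fisherDet α β) = estVar α β := by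
  have hδ := fisherDet_pos hα hβ
  rw [fisherForm, estVar]
  field_simp
  rw [fisherDet]
  ring

/-- The squared norm of the linear approximation of the estimation error, for a score sum. -/
noncomputable def linSq (α β : ℝ) {n : ℕ} (x : Fin n → ℝ) : ℝ :=
  estLin α β (scoreSum α β 1 0 x) (scoreSum α β 0 1 x) ^ 2 +
    estLin β α (scoreSum α β 0 1 x) (scoreSum α β 1 0 x) ^ 2

/-- The coordinates of the inverse information applied to the score sum are score sums in the
directions of the rows of the inverse, and the Fisher form of such a row is the matching asymptotic
variance. -/
theorem integrable_linSq (hα : 0 < α) (hβ : 0 < β)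
    (hlaw : ∀ i, HasLaw (X i) (betaMeasure α β) μ) (hind : iIndepFun X μ) :
    Integrable (fun ω => linSq α β fun i => X i ω) μ ∧
      ∫ ω, linSq α β (fun i => X i ω) ∂μ = n * estTrace α β := by
  have e : ∀ x : Fin n → ℝ, linSq α β x =
      scoreSum α β ((hurwitzSum 2 β - hurwitzSum 2 (α + β)) / fisherDet α β)
        (hurwitzSum 2 (α + β) / fisherDet α β) x ^ 2 +
      scoreSum α β (hurwitzSum 2 (α + β) / fisherDet α β)
        ((hurwitzSum 2 α - hurwitzSum 2 (α + β)) / fisherDet α β) x ^ 2 := fun x => by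
    rw [linSq, estLin_eq_scoreSum, scoreSum_eq α β (_ / fisherDet α β) (_ / fisherDet α β),
      scoreSum_eq α β (_ / fisherDet α β) ((hurwitzSum 2 α - _) / fisherDet α β), estLin,
      fisherDet_comm β α, add_comm β α]
    ring
  have f2 : fisherForm α β (hurwitzSum 2 (α + β) / fisherDet α β)
      ((hurwitzSum 2 α - hurwitzSum 2 (α + β)) / fisherDet α β) = estVar β α := by
    rw [← fisherForm_estLin hβ hα, fisherForm_comm, fisherDet_comm β α, add_comm β α]
  simp only [e]
  have i1 := integrable_scoreSum_pow hα hβ hlaw hind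
    ((hurwitzSum 2 β - hurwitzSum 2 (α + β)) / fisherDet α β)
    (hurwitzSum 2 (α + β) / fisherDet α β) 2
  have i2 := integrable_scoreSum_pow hα hβ hlaw hind
    (hurwitzSum 2 (α + β) / fisherDet α β)
    ((hurwitzSum 2 α - hurwitzSum 2 (α + β)) / fisherDet α β) 2
  refine ⟨i1.add i2, ?_⟩
  rw [integral_add i1 i2, integral_scoreSum_sq hα hβ hlaw hind,
    integral_scoreSum_sq hα hβ hlaw hind, fisherForm_estLin hα hβ, f2, estTrace]
  ring

/-- A majorant of the squared error on the event that the mean score is small. -/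
noncomputable def goodMajorant (α β : ℝ) {n : ℕ} (x : Fin n → ℝ) : ℝ :=
  linSq α β x / n ^ 2 + thirdRatio α β * (estTrace α β * √(estTrace α β)) *
    (1.14 / √n / n ^ 2 * scoreDual α β x +
      (√n / 4.56 + 28 * curvature α β) / n ^ 4 * scoreDual α β x ^ 2)

theorem goodMajorant_nonneg (hα : 0 < α) (hβ : 0 < β) (x : Fin n → ℝ) :
    0 ≤ goodMajorant α β x := by
  have := fisherDual_nonneg hα hβ (scoreSum α β 1 0 x) (scoreSum α β 0 1 x)
  have := thirdRatio_pos hα hβ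
  have := estTrace_pos hα hβ
  have := curvature_pos hα hβ
  unfold goodMajorant linSq scoreDual
  positivity

/-- The expectation of the squared error on the event that the mean score is small. -/
theorem integral_goodMajorant_le (hα : 0 < α) (hβ : 0 < β)
    (hlaw : ∀ i, HasLaw (X i) (betaMeasure α β) μ) (hind : iIndepFun X μ)
    (hn : 2200 * curvature α β ^ 2 ≤ n) :
    Integrable (fun ω => goodMajorant α β fun i => X i ω) μ ∧
      ∫ ω, goodMajorant α β (fun i => X i ω) ∂μ ≤ estTrace α β / n +
        11 * thirdRatio α β * (estTrace α β * √(estTrace α β)) / (n * √n) := by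
  obtain ⟨i1, e1⟩ := integrable_linSq hα hβ hlaw hind
  obtain ⟨i2, e2⟩ := integrable_scoreDual hα hβ hlaw hind
  obtain ⟨i3, e3⟩ := integrable_scoreDual_sq hα hβ hlaw hind
  have j1 := i1.div_const ((n : ℝ) ^ 2)
  have j2 := i2.const_mul (1.14 / √n / (n : ℝ) ^ 2)
  have j3 := i3.const_mul ((√n / 4.56 + 28 * curvature α β) / (n : ℝ) ^ 4)
  have j23 : Integrable (fun ω => 1.14 / √n / (n : ℝ) ^ 2 * scoreDual α β (fun i => X i ω) +
    (√n / 4.56 + 28 * curvature α β) / (n : ℝ) ^ 4 * scoreDual α β (fun i => X i ω) ^ 2) μ :=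
    j2.add j3
  have j4 := j23.const_mul (thirdRatio α β * (estTrace α β * √(estTrace α β)))
  refine ⟨j1.add j4, ?_⟩
  unfold goodMajorant
  have hκ := curvature_pos hα hβ
  have hn0 : (0 : ℝ) < n := lt_of_lt_of_le (by positivity) hn
  rw [integral_add j1 j4, integral_const_mul, integral_add j2 j3, integral_const_mul,
    integral_const_mul, integral_div, e1, e2]
  have hJ := thirdRatio_pos hα hβ
  have hτ := estTrace_pos hα hβ
  set κ := curvature α β
  set r := √(n : ℝ) with hr
  have hr0 : 0 < r := Real.sqrt_pos.2 hn0
  have hr2 : (n : ℝ) = r ^ 2 := (Real.sq_sqrt hn0.le).symm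
  have hκr : 46 * κ ≤ r := by
    rw [hr]
    refine Real.le_sqrt_of_sq_le ?_
    nlinarith [sq_nonneg κ]
  have h1 : n * estTrace α β / (n : ℝ) ^ 2 = estTrace α β / n := by field_simp
  -- The first two moments of the dual form, 2n and at most 10.32 n², give 2.28 + (1/4.56 + 28/46) ·
  -- 10.32 < 11.
  have h2 : 1.14 / r / (n : ℝ) ^ 2 * (2 * n) + (r / 4.56 + 28 * κ) / (n : ℝ) ^ 4 *
      ∫ ω, scoreDual α β (fun i => X i ω) ^ 2 ∂μ ≤ 11 / (n * r) := by
    refine (add_le_add_right (mul_le_mul_of_nonneg_left (e3 hn) (by positivity)) _).trans ?_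
    have h3 : (r / 4.56 + 28 * κ) / (n : ℝ) ^ 4 * (10.32 * (n : ℝ) ^ 2) ≤
        (r / 4.56 + 28 * (r / 46)) / (n : ℝ) ^ 4 * (10.32 * (n : ℝ) ^ 2) := by
      have : κ ≤ r / 46 := by rw [le_div_iff₀ (by norm_num)]; linarith
      gcongr
    refine (add_le_add_right h3 _).trans ?_
    have h4 : 1.14 / r / (n : ℝ) ^ 2 * (2 * n) + (r / 4.56 + 28 * (r / 46)) / (n : ℝ) ^ 4 *
        (10.32 * (n : ℝ) ^ 2) = (2.28 + (1 / 4.56 + 28 / 46) * 10.32 : ℝ) / (n * r) := by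
      rw [hr2]
      field_simp
      ring
    rw [h4]
    gcongr
    norm_num
  rw [h1]
  refine (add_le_add_right (mul_le_mul_of_nonneg_left h2 (by positivity)) _).trans (le_of_eq ?_)
  ring

/-- The squared error of the maximum likelihood estimator is at most the majorant if the mean
score is small. -/
theorem sq_error_le_goodMajorant (hα : 0 < α) (hβ : 0 < β) (hn : 0 < n) {x : Fin n → ℝ}
    {d₁ d₂ : ℝ} (h1 : 0 < α + d₁) (h2 : 0 < β + d₂)
    (hs : ∀ c₁ c₂, scoreSum α β c₁ c₂ x = n * scoreShift α β c₁ c₂ d₁ d₂)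
    (hN : scoreDual α β x < n ^ 2 * (1 / (4 * curvature α β) ^ 2)) :
    d₁ ^ 2 + d₂ ^ 2 ≤ goodMajorant α β x := by
  have hn0 : (0 : ℝ) < n := by exact_mod_cast hn
  set u₁ := scoreShift α β 1 0 d₁ d₂ with hu1
  set u₂ := scoreShift α β 0 1 d₁ d₂ with hu2
  have eD : scoreDual α β x = n ^ 2 * fisherDual α β u₁ u₂ := by
    rw [scoreDual, hs, hs, fisherDual, fisherDual]
    ring
  have eL : linSq α β x = n ^ 2 * (estLin α β u₁ u₂ ^ 2 + estLin β α u₂ u₁ ^ 2) := by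
    rw [linSq, hs, hs, estLin, estLin, estLin, estLin]
    ring
  rw [eD] at hN
  have hN' := lt_of_mul_lt_mul_left hN (by positivity)
  refine (sq_add_sq_le_of_fisherDual_lt hα hβ h1 h2 hu1.symm hu2.symm hN').trans ?_
  have hN0 := fisherDual_nonneg hα hβ u₁ u₂
  have hJ := thirdRatio_pos hα hβ
  have hτ := estTrace_pos hα hβ
  rw [goodMajorant, eD, eL]
  set N := fisherDual α β u₁ u₂
  set m := √N with hm
  have hm0 : 0 ≤ m := Real.sqrt_nonneg _
  have hm2 : N = m ^ 2 := (Real.sq_sqrt hN0).symm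
  set r := √(n : ℝ) with hr
  have hr0 : 0 < r := Real.sqrt_pos.2 hn0
  have e1 : (n : ℝ) ^ 2 * (estLin α β u₁ u₂ ^ 2 + estLin β α u₂ u₁ ^ 2) / n ^ 2 =
      estLin α β u₁ u₂ ^ 2 + estLin β α u₂ u₁ ^ 2 := by field_simp
  have e2 : 1.14 / r / (n : ℝ) ^ 2 * (n ^ 2 * N) + (r / 4.56 + 28 * curvature α β) / (n : ℝ) ^ 4 *
      (n ^ 2 * N) ^ 2 = 1.14 / r * N + (r / 4.56 + 28 * curvature α β) * N ^ 2 := by field_simp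
  rw [e1, e2, ← mul_assoc]
  -- A weighted AM–GM inequality trades the odd power for even ones, whose expectations are
  -- available. The weight 4.56 is close to √20.64, which balances the two resulting expectations.
  have e3 : m ^ 3 ≤ 1.14 / r * N + r / 4.56 * N ^ 2 := by
    have : 1.14 / r * N + r / 4.56 * N ^ 2 - m ^ 3 =
        m ^ 2 / (4.56 * r) * (r * m - 2.28) ^ 2 := by
      rw [hm2]
      field_simp
      ring
    have h3 : 0 ≤ m ^ 2 / (4.56 * r) * (r * m - 2.28) ^ 2 := by positivity
    linarith
  have e4 : m ^ 4 = N ^ 2 := by rw [hm2]; ring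
  have e5 : m ^ 3 + 28 * curvature α β * m ^ 4 ≤
      1.14 / r * N + (r / 4.56 + 28 * curvature α β) * N ^ 2 := by
    rw [e4]
    linarith
  have := mul_le_mul_of_nonneg_left e5
    (show 0 ≤ thirdRatio α β * (estTrace α β * √(estTrace α β)) by positivity)
  linarith

end

/-! ### A deterministic bound for the maximum likelihood estimator -/

/-- On (0, 1] the second derivative of log is at most -1. In the proof the derivative of f has the
sign of z - a, so f is smallest at a. -/
theorem log_le_add_sub_sq {a b : ℝ} (ha : 0 < a) (ha1 : a ≤ 1) (hb : 0 < b) (hb1 : b ≤ 1) :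
    Real.log b ≤ Real.log a + (b - a) / a - (b - a) ^ 2 / 2 := by
  set f : ℝ → ℝ := fun z => (z - a) / a - (z - a) ^ 2 / 2 - Real.log z with hf
  have hd : ∀ z, 0 < z → HasDerivAt f ((z - a) * (1 / (a * z) - 1)) z := by
    intro z hz
    have h1 := (((hasDerivAt_id z).sub_const a).div_const a).sub
      ((((hasDerivAt_id z).sub_const a).pow 2).div_const 2)
    refine (h1.sub (Real.hasDerivAt_log hz.ne')).congr_deriv ?_
    simp
    field_simp
    ring
  have hsgn : ∀ z, 0 < z → z ≤ 1 → 0 ≤ 1 / (a * z) - 1 := by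
    intro z hz hz1
    rw [sub_nonneg, le_div_iff₀ (by positivity)]
    nlinarith
  have hfa : f a = -Real.log a := by simp [hf]
  suffices h : f a ≤ f b by
    rw [hfa] at h
    simp only [hf] at h
    linarith
  rcases le_total a b with hab | hab
  · have hmono : MonotoneOn f (Set.Icc a b) := by
      refine monotoneOn_of_deriv_nonneg (convex_Icc a b)
        (fun z hz => (hd z (ha.trans_le hz.1)).continuousAt.continuousWithinAt)
        (fun z hz => (hd z (ha.trans_le (interior_subset hz).1)).differentiableAt.differentiableWithinAt)
        fun z hz => ?_
      have hz' := interior_subset hz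
      have hz0 := ha.trans_le hz'.1
      rw [(hd z hz0).deriv]
      exact mul_nonneg (sub_nonneg.2 hz'.1) (hsgn z hz0 (hz'.2.trans hb1))
    exact hmono (Set.left_mem_Icc.2 hab) (Set.right_mem_Icc.2 hab) hab
  · have hanti : AntitoneOn f (Set.Icc b a) := by
      refine antitoneOn_of_deriv_nonpos (convex_Icc b a)
        (fun z hz => (hd z (hb.trans_le hz.1)).continuousAt.continuousWithinAt)
        (fun z hz => (hd z (hb.trans_le (interior_subset hz).1)).differentiableAt.differentiableWithinAt)
        fun z hz => ?_
      have hz' := interior_subset hz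
      have hz0 := hb.trans_le hz'.1
      rw [(hd z hz0).deriv]
      exact mul_nonpos_of_nonpos_of_nonneg (sub_nonpos.2 hz'.2) (hsgn z hz0 (hz'.2.trans ha1))
    exact hanti (Set.left_mem_Icc.2 hab) (Set.right_mem_Icc.2 hab) hab

theorem exp_digamma_ge {x : ℝ} (_hx : 0 < x) : x - 1 ≤ Real.exp (digamma x) := by
  rcases le_or_gt x 1 with h | h
  · exact (by linarith : x - 1 ≤ 0).trans (Real.exp_pos _).le
  · have h1 := log_le_digamma_add_one (x := x - 1) (by linarith)
    rw [sub_add_cancel] at h1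
    calc x - 1 = Real.exp (Real.log (x - 1)) := (Real.exp_log (by linarith)).symm
      _ ≤ _ := Real.exp_le_exp.2 h1

/-- Jensen's inequality with the quadratic gain of `log_le_add_sub_sq`; the linear terms average to
zero. -/
theorem mean_log_le {n : ℕ} (hn : 0 < n) {x : Fin n → ℝ} (hx : ∀ i, 0 < x i ∧ x i < 1) {m : ℝ}
    (hm : m = (∑ i, x i) / n) :
    (∑ i, Real.log (x i)) / n ≤ Real.log m - (∑ i, (x i - m) ^ 2) / n / 2 := by
  have hn0 : (0 : ℝ) < n := by exact_mod_cast hn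
  have : NeZero n := ⟨hn.ne'⟩
  have hm0 : 0 < m := by
    rw [hm]
    exact div_pos (Finset.sum_pos (fun i _ => (hx i).1) Finset.univ_nonempty) hn0
  have hm1 : m ≤ 1 := by
    rw [hm, div_le_one hn0]
    calc ∑ i, x i ≤ ∑ _i : Fin n, (1 : ℝ) := Finset.sum_le_sum fun i _ => (hx i).2.le
      _ = n := by simp
  have h1 := Finset.sum_le_sum fun i (_ : i ∈ Finset.univ) =>
    log_le_add_sub_sq hm0 hm1 (hx i).1 (hx i).2.le
  have h2 : ∑ i, (x i - m) / m = 0 := by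
    rw [← Finset.sum_div, Finset.sum_sub_distrib]
    simp only [Finset.sum_const, Finset.card_univ, Fintype.card_fin, nsmul_eq_mul]
    rw [show ∑ i, x i = n * m by rw [hm]; field_simp]
    simp
  rw [Finset.sum_sub_distrib, Finset.sum_add_distrib, h2, ← Finset.sum_div] at h1
  simp only [Finset.sum_const, Finset.card_univ, Fintype.card_fin, nsmul_eq_mul] at h1
  rw [div_le_iff₀ hn0]
  refine h1.trans (le_of_eq ?_)
  field_simp
  ring

/-- The sum of the coordinates of a solution of the score equations is bounded in terms of the
sample variance. -/
theorem add_le_of_score_eq {n : ℕ} (hn : 0 < n) {x : Fin n → ℝ} (hx : ∀ i, 0 < x i ∧ x i < 1)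
    {a b : ℝ} (ha : 0 < a) (hb : 0 < b)
    (h1 : ∑ i, scoreComb a b 1 0 (x i) = 0) (h2 : ∑ i, scoreComb a b 0 1 (x i) = 0) {m v : ℝ}
    (hm : m = (∑ i, x i) / n) (hv : v = (∑ i, (x i - m) ^ 2) / n) (hv0 : 0 < v) :
    a + b ≤ 2 + 4 / v := by
  have hn0 : (0 : ℝ) < n := by exact_mod_cast hn
  have : NeZero n := ⟨hn.ne'⟩
  have k1 : digamma a - digamma (a + b) = (∑ i, Real.log (x i)) / n := by
    simp only [scoreComb, one_mul, zero_mul, add_zero, Finset.sum_sub_distrib, Finset.sum_const,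
      Finset.card_univ, Fintype.card_fin, nsmul_eq_mul] at h1
    rw [eq_div_iff hn0.ne']
    linarith
  have k2 : digamma b - digamma (a + b) = (∑ i, Real.log (1 - x i)) / n := by
    simp only [scoreComb, one_mul, zero_mul, zero_add, Finset.sum_sub_distrib, Finset.sum_const,
      Finset.card_univ, Fintype.card_fin, nsmul_eq_mul] at h2
    rw [eq_div_iff hn0.ne']
    linarith
  have l1 := mean_log_le hn hx hm
  have l2 := mean_log_le hn (x := fun i => 1 - x i) (m := 1 - m)
    (fun i => ⟨by linarith [(hx i).2], by linarith [(hx i).1]⟩) (by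
      rw [Finset.sum_sub_distrib, hm]
      simp only [Finset.sum_const, Finset.card_univ, Fintype.card_fin, nsmul_eq_mul, mul_one]
      field_simp)
  have e2 : ∀ i, (1 - x i - (1 - m)) ^ 2 = (x i - m) ^ 2 := fun i => by ring
  simp only [e2] at l2
  rw [← hv, ← k1] at l1
  rw [← hv, ← k2] at l2
  have hm0 : 0 < m := by
    rw [hm]
    exact div_pos (Finset.sum_pos (fun i _ => (hx i).1) Finset.univ_nonempty) hn0
  have hm1 : m < 1 := by
    rw [hm, div_lt_one hn0]
    calc ∑ i, x i < ∑ _i : Fin n, (1 : ℝ) :=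
          Finset.sum_lt_sum_of_nonempty Finset.univ_nonempty fun i _ => (hx i).2
      _ = n := by simp
  -- The score equations are exponentiated; when `g1` and `g2` are added, the weights m and 1 - m
  -- disappear and the factor exp(-v/2) stays.
  have g1 : Real.exp (digamma a) ≤ Real.exp (digamma (a + b)) * (m * Real.exp (-(v / 2))) := by
    rw [← Real.exp_log hm0, ← Real.exp_add, ← Real.exp_add]
    exact Real.exp_le_exp.2 (by linarith)
  have g2 : Real.exp (digamma b) ≤
      Real.exp (digamma (a + b)) * ((1 - m) * Real.exp (-(v / 2))) := by
    rw [← Real.exp_log (sub_pos.2 hm1), ← Real.exp_add, ← Real.exp_add]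
    exact Real.exp_le_exp.2 (by linarith)
  have g3 : Real.exp (digamma (a + b)) ≤ a + b := by
    calc _ ≤ Real.exp (Real.log (a + b)) := Real.exp_le_exp.2 (digamma_le_log (by linarith))
      _ = a + b := Real.exp_log (by linarith)
  have g4 : Real.exp (-(v / 2)) ≤ 1 / (1 + v / 2) := by
    rw [Real.exp_neg, ← one_div]
    gcongr
    have := Real.add_one_le_exp (v / 2)
    linarith
  -- The bounds exp ψ(a) ≥ a - 1, exp ψ(b) ≥ b - 1 and exp ψ(a + b) ≤ a + b turn this into a linear
  -- inequality for a + b, which is informative because 1/(1 + v/2) < 1.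
  have g5 : a + b - 2 ≤ (a + b) * (1 / (1 + v / 2)) := by
    have := exp_digamma_ge ha
    have := exp_digamma_ge hb
    have hE := Real.exp_pos (-(v / 2))
    calc a + b - 2 ≤ Real.exp (digamma (a + b)) * Real.exp (-(v / 2)) := by linarith
      _ ≤ _ := by gcongr
  rw [mul_one_div, le_div_iff₀ (by positivity)] at g5
  have e : 2 + 4 / v = (2 * v + 4) / v := by field_simp
  rw [e, le_div_iff₀ hv0]
  linarith

/-- The product of the successive differences of a sample. -/
noncomputable def diffProd {N : ℕ} (x : Fin (N + 1) → ℝ) : ℝ :=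
  ∏ i : Fin N, |x i.succ - x i.castSucc|

theorem sum_sq_diff_le {N : ℕ} (x : Fin (N + 1) → ℝ) (m : ℝ) :
    ∑ i : Fin N, (x i.succ - x i.castSucc) ^ 2 ≤ 4 * ∑ i, (x i - m) ^ 2 := by
  have h1 : ∑ i : Fin N, (x i.succ - x i.castSucc) ^ 2 ≤
      ∑ i : Fin N, (2 * (x i.succ - m) ^ 2 + 2 * (x i.castSucc - m) ^ 2) :=
    Finset.sum_le_sum fun i _ => by
      nlinarith [sq_nonneg ((x i.succ - m) + (x i.castSucc - m))]
  rw [Finset.sum_add_distrib, ← Finset.mul_sum, ← Finset.mul_sum] at h1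
  have h2 := Fin.sum_univ_succ fun i => (x i - m) ^ 2
  have h3 := Fin.sum_univ_castSucc fun i => (x i - m) ^ 2
  have := sq_nonneg (x 0 - m)
  have := sq_nonneg (x (Fin.last N) - m)
  linarith

/-- The sample variance is bounded below by a power of the product of successive differences. -/
theorem diffProd_rpow_le {N : ℕ} (hN : 4 ≤ N) (x : Fin (N + 1) → ℝ) (m : ℝ) :
    1 / 5 * diffProd x ^ (2 / N : ℝ) ≤ (∑ i, (x i - m) ^ 2) / ((N + 1 : ℕ) : ℝ) := by
  have hN4 : (4 : ℝ) ≤ N := by exact_mod_cast hN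
  have hN0 : (0 : ℝ) < N := by linarith
  have h1 := Real.geom_mean_le_arith_mean_weighted Finset.univ (fun _ : Fin N => (1 / N : ℝ))
    (fun i => (x i.succ - x i.castSucc) ^ 2) (fun i _ => by positivity)
    (by simp [hN0.ne']) fun i _ => by positivity
  have h2 : ∏ i : Fin N, ((x i.succ - x i.castSucc) ^ 2) ^ (1 / N : ℝ) =
      diffProd x ^ (2 / N : ℝ) := by
    rw [diffProd, ← Real.finsetProd_rpow _ _ fun i _ => abs_nonneg _]
    refine Finset.prod_congr rfl fun i _ => ?_
    rw [← sq_abs, ← Real.rpow_natCast, ← Real.rpow_mul (abs_nonneg _)]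
    congr 1
    push_cast
    ring
  rw [h2, ← Finset.mul_sum] at h1
  have h3 := sum_sq_diff_le x m
  set S := ∑ i, (x i - m) ^ 2
  have hS : 0 ≤ S := Finset.sum_nonneg fun i _ => sq_nonneg _
  have h4 : diffProd x ^ (2 / N : ℝ) ≤ 1 / N * (4 * S) := h1.trans (by gcongr)
  push_cast
  rw [le_div_iff₀ (by positivity)]
  -- The condition N ≥ 4 enters as 4 (N + 1) ≤ 5 N.
  have h5 : 1 / 5 * (1 / N * (4 * S)) * (N + 1) ≤ S := by
    have : 1 / 5 * (1 / N * (4 * S)) * (N + 1) = S * (4 * (N + 1) / (5 * N)) := by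
      field_simp
    rw [this]
    refine mul_le_of_le_one_right hS ?_
    rw [div_le_one (by positivity)]
    linarith
  refine le_trans ?_ h5
  gcongr

theorem diffProd_le_one {N : ℕ} {x : Fin (N + 1) → ℝ} (hx : ∀ i, 0 < x i ∧ x i < 1) :
    diffProd x ≤ 1 := by
  refine Finset.prod_le_one (fun i _ => abs_nonneg _) fun i _ => ?_
  have h1 := hx i.succ
  have h2 := hx i.castSucc
  rw [abs_le]
  constructor <;> linarith

/-- The squared error of a solution of the score equations is bounded by a negative power of the
product of successive differences. -/
theorem sq_error_le_diffProd {N : ℕ} (hN : 4 ≤ N) {x : Fin (N + 1) → ℝ}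
    (hx : ∀ i, 0 < x i ∧ x i < 1) {a b : ℝ} (ha : 0 < a) (hb : 0 < b)
    (h1 : ∑ i, scoreComb a b 1 0 (x i) = 0) (h2 : ∑ i, scoreComb a b 0 1 (x i) = 0)
    (hD : 0 < diffProd x) {α β : ℝ} (hα : 0 < α) (hβ : 0 < β) :
    (a - α) ^ 2 + (b - β) ^ 2 ≤ (484 + α ^ 2 + β ^ 2) * diffProd x ^ (-(4 / N) : ℝ) := by
  have hv := diffProd_rpow_le hN x ((∑ i, x i) / ((N + 1 : ℕ) : ℝ))
  have hDN : 0 < diffProd x ^ (2 / N : ℝ) := Real.rpow_pos_of_pos hD _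
  have hs := add_le_of_score_eq (Nat.succ_pos N) hx ha hb h1 h2 rfl rfl
    (lt_of_lt_of_le (by positivity) hv)
  set E := diffProd x ^ (2 / N : ℝ) with hE
  have hE1 : E ≤ 1 := Real.rpow_le_one hD.le (diffProd_le_one hx) (by positivity)
  have e4 : diffProd x ^ (-(4 / N) : ℝ) = (1 / E) ^ 2 := by
    rw [hE, one_div, ← Real.rpow_neg hD.le, ← Real.rpow_natCast, ← Real.rpow_mul hD.le]
    congr 1
    push_cast
    ring
  -- Since E ≤ 1, the bound 2 + 20/E is at most 22/E, and 484 = 22².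
  have h3 : a + b ≤ 22 * (1 / E) := by
    refine hs.trans ?_
    have k1 : 4 / ((∑ i, (x i - (∑ i, x i) / ((N + 1 : ℕ) : ℝ)) ^ 2) / ((N + 1 : ℕ) : ℝ)) ≤
        4 / (1 / 5 * E) := by gcongr
    have k2 : 4 / (1 / 5 * E) = 20 * (1 / E) := by field_simp; norm_num
    have k3 : 1 ≤ 1 / E := by rw [le_div_iff₀ hDN]; linarith
    linarith
  have k3 : 1 ≤ 1 / E := by rw [le_div_iff₀ hDN]; linarith
  rw [e4]
  have h4 : (a + b) ^ 2 ≤ 484 * (1 / E) ^ 2 := by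
    have := pow_le_pow_left₀ (by positivity) h3 2
    nlinarith
  have h5 : 1 ≤ (1 / E) ^ 2 := one_le_pow₀ k3
  have h6 : α ^ 2 + β ^ 2 ≤ (α ^ 2 + β ^ 2) * (1 / E) ^ 2 := le_mul_of_one_le_right (by positivity) h5
  nlinarith [mul_pos ha hb, mul_pos ha hα, mul_pos hb hβ]

/-! ### Negative moments of the successive differences -/

/-- Jensen's inequality: the divergence is the logarithm of the mean of exp Y for a centred Y, and
exp Y ≥ 1 + Y. -/
theorem logBetaRem_nonneg {α β v₁ v₂ : ℝ} (hα : 0 < α) (hβ : 0 < β) (h1 : 0 < α + v₁)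
    (h2 : 0 < β + v₂) : 0 ≤ logBetaRem α β v₁ v₂ := by
  have := isProbabilityMeasureBeta hα hβ
  have h := mgf_scoreComb (c₁ := v₁) (c₂ := v₂) (t := 1) hα hβ (by simpa) (by simpa)
  have hi := integrable_exp_scoreComb (c₁ := v₁) (c₂ := v₂) (t := 1) hα hβ (by simpa) (by simpa)
  have h0 := integrable_scoreComb_pow hα hβ v₁ v₂ 1
  simp only [pow_one] at h0
  rw [← Real.one_le_exp_iff]
  simp only [mgf, one_mul] at h hi
  rw [← h]
  calc (1 : ℝ) = ∫ x, (scoreComb α β v₁ v₂ x + 1) ∂betaMeasure α β := by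
        rw [integral_add h0 (integrable_const _), (moments_scoreComb hα hβ v₁ v₂).1]
        simp
    _ ≤ _ := integral_mono (h0.add (integrable_const _)) hi fun x => Real.add_one_le_exp _

theorem digamma_two_sub_one : digamma 2 - digamma 1 = 1 := by
  have := digamma_add_one (x := 1) one_pos
  norm_num at this
  linarith

theorem logBeta_comm (a b : ℝ) : logBeta a b = logBeta b a := by
  rw [logBeta, logBeta, add_comm b a]
  ring

/-- The tangent at second argument 1, where B(α, 1) = 1/α; its slope ψ(1) - ψ(α + 1) lies between -1
and 0 for α ≤ 1. -/
theorem neg_log_le_logBeta {α β : ℝ} (hα : 0 < α) (hβ : 0 < β) (h : α ≤ 1) :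
    -Real.log α - max (β - 1) 0 ≤ logBeta α β := by
  have h1 := logBetaRem_nonneg (v₁ := 0) (v₂ := β - 1) hα one_pos (by simpa) (by simpa)
  have h2 : logBeta α 1 = -Real.log α := by
    rw [logBeta, Real.Gamma_one, Real.log_one, Real.Gamma_add_one hα.ne',
      Real.log_mul hα.ne' (Real.Gamma_pos_of_pos hα).ne']
    ring
  rw [logBetaRem, h2] at h1
  have h3 : digamma (α + 1) ≤ digamma 2 := by
    rcases eq_or_lt_of_le h with rfl | h
    · norm_num
    · exact (digamma_strictMono (by linarith) (by linarith)).le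
  have h4 : digamma 1 < digamma (α + 1) := digamma_strictMono one_pos (by linarith)
  have h5 := digamma_two_sub_one
  simp only [add_zero, zero_mul, sub_zero, add_sub_cancel] at h1
  rcases le_total (β - 1) 0 with hb | hb
  · rw [max_eq_right hb]
    nlinarith
  · rw [max_eq_left hb]
    nlinarith

theorem neg_le_logBeta {α β : ℝ} (hα : 1 ≤ α) (hβ : 1 ≤ β) :
    -(α - 1) - (β - 1) ≤ logBeta α β := by
  have h1 := logBetaRem_nonneg (v₁ := α - 1) (v₂ := β - 1) one_pos one_pos (by linarith)
    (by linarith)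
  have h2 : logBeta 1 1 = 0 := by
    rw [logBeta, Real.Gamma_one, one_add_one_eq_two, Real.Gamma_two]
    simp
  have h5 := digamma_two_sub_one
  rw [logBetaRem, h2, one_add_one_eq_two] at h1
  simp only [add_sub_cancel] at h1
  nlinarith

/-- `min {α, β, 1}`. -/
noncomputable def cappedMin (α β : ℝ) : ℝ := min (min α β) 1

theorem cappedMin_pos {α β : ℝ} (hα : 0 < α) (hβ : 0 < β) : 0 < cappedMin α β :=
  lt_min (lt_min hα hβ) one_pos

/-- The factor `cappedMin` matters: it cancels the 4/m produced by integrating powers with exponent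
m/4 - 1, so the bound on the difference kernel does not blow up when a parameter is small. -/
theorem one_div_beta_le {α β : ℝ} (hα : 0 < α) (hβ : 0 < β) :
    1 / beta α β ≤ cappedMin α β * Real.exp (max (α - 1) 0 + max (β - 1) 0) := by
  have key : -logBeta α β ≤ Real.log (cappedMin α β) + (max (α - 1) 0 + max (β - 1) 0) := by
    have ha := le_max_right (α - 1) 0
    have hb := le_max_right (β - 1) 0
    have ha' := le_max_left (α - 1) 0
    have hb' := le_max_left (β - 1) 0
    rcases le_total α β with h | h
    · rw [cappedMin, min_eq_left h]
      rcases le_total α 1 with h1 | h1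
      · rw [min_eq_left h1]
        linarith [neg_log_le_logBeta hα hβ h1]
      · rw [min_eq_right h1, Real.log_one]
        linarith [neg_le_logBeta h1 (h1.trans h)]
    · rw [cappedMin, min_eq_right h]
      rcases le_total β 1 with h1 | h1
      · rw [min_eq_left h1, logBeta_comm]
        linarith [neg_log_le_logBeta hβ hα h1]
      · rw [min_eq_right h1, Real.log_one]
        linarith [neg_le_logBeta (h1.trans h) h1]
  rw [← exp_logBeta hα hβ, one_div, ← Real.exp_neg, ← Real.exp_log (cappedMin_pos hα hβ),
    ← Real.exp_add]
  exact Real.exp_le_exp.2 key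

/-- The function `u ^ (s - 1)` on the unit interval. -/
noncomputable def unitPow (s u : ℝ) : ℝ≥0∞ :=
  (Set.Ioo (0 : ℝ) 1).indicator (fun u => ENNReal.ofReal (u ^ (s - 1))) u

theorem measurable_unitPow (s : ℝ) : Measurable (unitPow s) :=
  Measurable.indicator (by fun_prop) measurableSet_Ioo

theorem lintegral_unitPow {s : ℝ} (hs : 0 < s) : ∫⁻ u, unitPow s u = ENNReal.ofReal (1 / s) := by
  unfold unitPow
  have hint : IntegrableOn (fun x : ℝ => x ^ (s - 1)) (Set.Ioo 0 1) := by
    have := (intervalIntegral.intervalIntegrable_rpow' (a := 0) (b := 1) (r := s - 1)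
      (by linarith)).1
    exact this.mono_set Set.Ioo_subset_Ioc_self
  rw [lintegral_indicator measurableSet_Ioo, ← ofReal_integral_eq_lintegral_ofReal hint]
  · congr 1
    rw [← integral_Ioc_eq_integral_Ioo, ← intervalIntegral.integral_of_le zero_le_one,
      integral_rpow (Or.inl (by linarith))]
    simp [hs.ne']
  · filter_upwards [ae_restrict_mem measurableSet_Ioo] with x hx
    exact Real.rpow_nonneg hx.1.le _

/-- Both exponents are nonpositive, so replacing the larger of the two bases by the smaller one only
increases the product, which then is a single power with exponent m/4 - 1. -/
theorem rpow_mul_rpow_le {x d m : ℝ} (hx : 0 < x) (hx1 : x < 1) (hd : 0 < d) (hm : 0 < m)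
    (hm1 : m ≤ 1) :
    ENNReal.ofReal (x ^ (m - 1) * d ^ (-(3 / 4 * m))) ≤ unitPow (m / 4) x + unitPow (m / 4) d := by
  rw [unitPow, Set.indicator_of_mem (Set.mem_Ioo.2 ⟨hx, hx1⟩)]
  have hc : ∀ u : ℝ, 0 < u → u ^ (m / 4 - 1) = u ^ (m - 1) * u ^ (-(3 / 4 * m)) := fun u hu => by
    rw [← Real.rpow_add hu]
    congr 1
    ring
  rcases le_or_gt x d with h | h
  · refine le_add_of_le_left (ENNReal.ofReal_le_ofReal ?_)
    rw [hc x hx]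
    exact mul_le_mul_of_nonneg_left (Real.rpow_le_rpow_of_nonpos hx h (by linarith)) (by positivity)
  · refine le_add_of_le_right ?_
    rw [unitPow, Set.indicator_of_mem (Set.mem_Ioo.2 ⟨hd, h.trans hx1⟩), hc d hd]
    exact ENNReal.ofReal_le_ofReal (mul_le_mul_of_nonneg_right
      (Real.rpow_le_rpow_of_nonpos hd h.le (by linarith)) (by positivity))

/-- Inserting 1 = x + (1 - x) separates the singularities at the two endpoints, because the m-th
powers of x and 1 - x are at most 1. -/
theorem rpow_mul_one_sub_rpow_le {x a b m : ℝ} (hx : 0 < x) (hx1 : x < 1) (hm : 0 < m)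
    (ha : m ≤ a) (hb : m ≤ b) :
    x ^ (a - 1) * (1 - x) ^ (b - 1) ≤ x ^ (m - 1) + (1 - x) ^ (m - 1) := by
  have hy : 0 < 1 - x := by linarith
  have h1 : x ^ (a - 1) ≤ x ^ (m - 1) :=
    Real.rpow_le_rpow_of_exponent_ge hx hx1.le (by linarith)
  have h2 : (1 - x) ^ (b - 1) ≤ (1 - x) ^ (m - 1) :=
    Real.rpow_le_rpow_of_exponent_ge hy (by linarith) (by linarith)
  have h3 : x ^ (m - 1) * x ≤ 1 := by
    rw [← Real.rpow_add_one hx.ne', sub_add_cancel]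
    exact Real.rpow_le_one hx.le hx1.le hm.le
  have h4 : (1 - x) ^ (m - 1) * (1 - x) ≤ 1 := by
    rw [← Real.rpow_add_one hy.ne', sub_add_cancel]
    exact Real.rpow_le_one hy.le (by linarith) hm.le
  have hA := Real.rpow_pos_of_pos hx (m - 1)
  have hB := Real.rpow_pos_of_pos hy (m - 1)
  calc x ^ (a - 1) * (1 - x) ^ (b - 1) ≤ x ^ (m - 1) * (1 - x) ^ (m - 1) := by gcongr
    _ = (x ^ (m - 1) * x) * (1 - x) ^ (m - 1) + ((1 - x) ^ (m - 1) * (1 - x)) * x ^ (m - 1) := by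
      ring
    _ ≤ 1 * (1 - x) ^ (m - 1) + 1 * x ^ (m - 1) := by gcongr
    _ = _ := by ring

theorem betaPDF_mul_le {α β x y : ℝ} (hα : 0 < α) (hβ : 0 < β) (hxy : x ≠ y) :
    betaPDF α β x * ENNReal.ofReal |x - y| ^ (-(3 / 4 * cappedMin α β)) ≤
      ENNReal.ofReal (1 / beta α β) *
        (unitPow (cappedMin α β / 4) x + unitPow (cappedMin α β / 4) (1 - x) +
          2 * (unitPow (cappedMin α β / 4) (x - y) + unitPow (cappedMin α β / 4) (y - x))) := by
  set m := cappedMin α β with hm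
  have hm0 : 0 < m := cappedMin_pos hα hβ
  have hd : 0 < |x - y| := abs_pos.2 (sub_ne_zero.2 hxy)
  have hB : 0 < 1 / beta α β := one_div_pos.2 (beta_pos hα hβ)
  rw [betaPDF, betaPDFReal]
  split_ifs with hx
  · have hu : unitPow (m / 4) |x - y| ≤ unitPow (m / 4) (x - y) + unitPow (m / 4) (y - x) := by
      rcases abs_cases (x - y) with ⟨h, _⟩ | ⟨h, _⟩
      · rw [h]
        exact le_self_add
      · rw [h, neg_sub]
        exact le_add_self
    have h1 := rpow_mul_rpow_le hx.1 hx.2 hd hm0 (min_le_right _ _)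
    have h2 := rpow_mul_rpow_le (x := 1 - x) (by linarith [hx.2]) (by linarith [hx.1]) hd hm0
      (min_le_right _ _)
    have h3 := rpow_mul_one_sub_rpow_le hx.1 hx.2 hm0
      ((min_le_left _ _).trans (min_le_left α β)) ((min_le_left _ _).trans (min_le_right α β))
    rw [ENNReal.ofReal_rpow_of_pos hd, mul_assoc, ENNReal.ofReal_mul hB.le, mul_assoc]
    refine mul_le_mul_right ?_ _
    rw [← ENNReal.ofReal_mul (mul_nonneg (Real.rpow_nonneg hx.1.le _)
      (Real.rpow_nonneg (by linarith [hx.2]) _))]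
    calc _ ≤ ENNReal.ofReal (x ^ (m - 1) * |x - y| ^ (-(3 / 4 * m)) +
          (1 - x) ^ (m - 1) * |x - y| ^ (-(3 / 4 * m))) := by
          rw [← add_mul]
          gcongr
      _ ≤ _ := ENNReal.ofReal_add_le
      _ ≤ _ := add_le_add h1 h2
      _ = unitPow (m / 4) x + unitPow (m / 4) (1 - x) + 2 * unitPow (m / 4) |x - y| := by ring
      _ ≤ _ := by gcongr
  · simp

/-- Six power integrals, each equal to 4/m, against the normalising constant of the density.
Uniformity in y is what permits iteration over successive differences. -/
theorem lintegral_diffKernel_le {α β : ℝ} (hα : 0 < α) (hβ : 0 < β) (y : ℝ) :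
    ∫⁻ x, ENNReal.ofReal |x - y| ^ (-(3 / 4 * cappedMin α β)) ∂betaMeasure α β ≤
      ENNReal.ofReal (24 * Real.exp (max (α - 1) 0 + max (β - 1) 0)) := by
  set m := cappedMin α β with hm
  have hm0 : 0 < m := cappedMin_pos hα hβ
  have hs : 0 < m / 4 := by linarith
  have hU := measurable_unitPow (m / 4)
  rw [betaMeasure, lintegral_withDensity_eq_lintegral_mul _ (measurable_betaPDF α β)
    (by fun_prop)]
  calc _ ≤ ∫⁻ x, ENNReal.ofReal (1 / beta α β) *
        (unitPow (m / 4) x + unitPow (m / 4) (1 - x) +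
          2 * (unitPow (m / 4) (x - y) + unitPow (m / 4) (y - x))) := by
        refine lintegral_mono_ae ?_
        have : ∀ᵐ x : ℝ, x ≠ y := by simp [ae_iff]
        filter_upwards [this] with x hx
        exact betaPDF_mul_le hα hβ hx
    _ = ENNReal.ofReal (1 / beta α β) * (ENNReal.ofReal (4 / m) * 6) := by
        rw [lintegral_const_mul _ (by fun_prop), lintegral_add_left (by fun_prop),
          lintegral_add_left (by fun_prop), lintegral_const_mul _ (by fun_prop),
          lintegral_add_left (by fun_prop), lintegral_sub_left_eq_self,
          lintegral_sub_left_eq_self, lintegral_sub_right_eq_self (fun x => unitPow (m / 4) x),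
          lintegral_unitPow hs, one_div_div]
        ring
    _ ≤ ENNReal.ofReal (m * Real.exp (max (α - 1) 0 + max (β - 1) 0)) *
          (ENNReal.ofReal (4 / m) * 6) := by
        gcongr
        exact one_div_beta_le hα hβ
    _ = _ := by
        rw [show (6 : ℝ≥0∞) = ENNReal.ofReal 6 by simp, ← ENNReal.ofReal_mul (by positivity),
          ← ENNReal.ofReal_mul (by positivity)]
        congr 1
        field_simp
        ring

/-- The first coordinate occurs in a single factor; integrating it out first costs at most H,
uniformly in the second coordinate, and the remaining product has the same shape. -/
theorem lintegral_pi_prod_le (P : Measure ℝ) [IsProbabilityMeasure P] {k : ℝ → ℝ → ℝ≥0∞}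
    (hk : Measurable (Function.uncurry k)) {H : ℝ≥0∞} (hH : ∀ y, ∫⁻ x, k y x ∂P ≤ H) (N : ℕ) :
    ∫⁻ x : Fin (N + 1) → ℝ, ∏ i : Fin N, k (x i.succ) (x i.castSucc) ∂(Measure.pi fun _ => P) ≤
      H ^ N := by
  have hmeas : ∀ N : ℕ, Measurable fun x : Fin (N + 1) → ℝ =>
      ∏ i : Fin N, k (x i.succ) (x i.castSucc) := fun N =>
    Finset.measurable_prod _ fun i _ =>
      hk.comp (g := Function.uncurry k) (f := fun x : Fin (N + 1) → ℝ => (x i.succ, x i.castSucc))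
        (by fun_prop)
  induction N with
  | zero => simp
  | succ N ih =>
    have hp := measurePreserving_piFinSuccAbove (fun _ : Fin (N + 2) => P) 0
    have hF : Measurable fun z : ℝ × (Fin (N + 1) → ℝ) =>
        k (z.2 0) z.1 * ∏ i : Fin N, k (z.2 i.succ) (z.2 i.castSucc) :=
      (hk.comp (((measurable_pi_apply _).comp measurable_snd).prodMk measurable_fst)).mul
        ((hmeas N).comp measurable_snd)
    calc _ = ∫⁻ x : Fin (N + 2) → ℝ, (fun z : ℝ × (Fin (N + 1) → ℝ) =>
          k (z.2 0) z.1 * ∏ i : Fin N, k (z.2 i.succ) (z.2 i.castSucc))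
            (MeasurableEquiv.piFinSuccAbove (fun _ => ℝ) 0 x) ∂(Measure.pi fun _ => P) := by
          refine lintegral_congr fun x => ?_
          rw [Fin.prod_univ_succ]
          rfl
      _ = ∫⁻ z, k (z.2 0) z.1 * ∏ i : Fin N, k (z.2 i.succ) (z.2 i.castSucc)
            ∂(P.prod (Measure.pi fun _ : Fin (N + 1) => P)) := hp.lintegral_comp hF
      _ = ∫⁻ v : Fin (N + 1) → ℝ, (∏ i : Fin N, k (v i.succ) (v i.castSucc)) *
            ∫⁻ x, k (v 0) x ∂P ∂(Measure.pi fun _ => P) := by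
          rw [lintegral_prod_symm' _ hF]
          refine lintegral_congr fun v => ?_
          have hv : Measurable fun x => k (v 0) x :=
            hk.comp (g := Function.uncurry k) (f := fun x : ℝ => (v 0, x)) (by fun_prop)
          change (∫⁻ x, k (v 0) x * ∏ i : Fin N, k (v i.succ) (v i.castSucc) ∂P) = _
          rw [lintegral_mul_const _ hv, mul_comm]
      _ ≤ ∫⁻ v : Fin (N + 1) → ℝ, (∏ i : Fin N, k (v i.succ) (v i.castSucc)) * H
            ∂(Measure.pi fun _ => P) := by
          gcongr
          exact hH _
      _ = (∫⁻ v : Fin (N + 1) → ℝ, (∏ i : Fin N, k (v i.succ) (v i.castSucc))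
            ∂(Measure.pi fun _ => P)) * H := lintegral_mul_const _ (hmeas N)
      _ ≤ H ^ (N + 1) := by
          rw [pow_succ]
          gcongr

/-- The product of the powers `|x (i + 1) - x i| ^ (-c)`, with value `∞` if a difference
vanishes. -/
noncomputable def diffProdInv (c : ℝ) {N : ℕ} (x : Fin (N + 1) → ℝ) : ℝ≥0∞ :=
  ∏ i : Fin N, ENNReal.ofReal |x i.succ - x i.castSucc| ^ (-c)

theorem measurable_diffProdInv (c : ℝ) (N : ℕ) :
    Measurable (diffProdInv c : (Fin (N + 1) → ℝ) → ℝ≥0∞) :=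
  Finset.measurable_prod _ fun i _ => by fun_prop

theorem diffProd_pos_of_diffProdInv_lt_top {c : ℝ} (hc : 0 < c) {N : ℕ} {x : Fin (N + 1) → ℝ}
    (h : diffProdInv c x < ∞) (i : Fin N) : 0 < |x i.succ - x i.castSucc| := by
  by_contra! hi
  refine h.ne ?_
  rw [diffProdInv, ← Finset.mul_prod_erase _ _ (Finset.mem_univ i), ENNReal.ofReal_of_nonpos hi,
    ENNReal.zero_rpow_of_neg (by linarith), ENNReal.top_mul]
  refine Finset.prod_ne_zero_iff.2 fun j _ => ?_
  simp [ENNReal.rpow_eq_zero_iff, hc.le]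

theorem diffProdInv_eq {c : ℝ} {N : ℕ} {x : Fin (N + 1) → ℝ}
    (h : ∀ i : Fin N, 0 < |x i.succ - x i.castSucc|) :
    diffProdInv c x = ENNReal.ofReal (diffProd x ^ (-c)) := by
  rw [diffProdInv, diffProd, ← Real.finsetProd_rpow _ _ fun i _ => (h i).le,
    ENNReal.ofReal_prod_of_nonneg fun i _ => (Real.rpow_pos_of_pos (h i) _).le]
  exact Finset.prod_congr rfl fun i _ => ENNReal.ofReal_rpow_of_pos (h i)

theorem ae_sample_mem_Ioo {Ω : Type*} [MeasurableSpace Ω] {μ : Measure Ω} {α β : ℝ} {n : ℕ}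
    {X : Fin n → Ω → ℝ} (hlaw : ∀ i, HasLaw (X i) (betaMeasure α β) μ) :
    ∀ᵐ ω ∂μ, ∀ i, 0 < X i ω ∧ X i ω < 1 :=
  ae_all_iff.2 fun i => ae_of_ae_map (p := fun x => 0 < x ∧ x < 1) (hlaw i).aemeasurable (by
    rw [(hlaw i).map_eq]
    exact ae_mem_Ioo_betaMeasure α β)

theorem lintegral_diffKernel_prod_le {Ω : Type*} [MeasurableSpace Ω] {μ : Measure Ω}
    [IsProbabilityMeasure μ] {α β : ℝ} (hα : 0 < α) (hβ : 0 < β) {N : ℕ}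
    {X : Fin (N + 1) → Ω → ℝ} (hlaw : ∀ i, HasLaw (X i) (betaMeasure α β) μ)
    (hind : iIndepFun X μ) :
    ∫⁻ ω, diffProdInv (3 / 4 * cappedMin α β) (fun i => X i ω) ∂μ ≤
      ENNReal.ofReal (24 * Real.exp (max (α - 1) 0 + max (β - 1) 0)) ^ N := by
  have := isProbabilityMeasureBeta hα hβ
  have hmap := (iIndepFun_iff_map_fun_eq_pi_map fun i => (hlaw i).aemeasurable).1 hind
  simp_rw [(hlaw _).map_eq] at hmap
  have hk : Measurable (Function.uncurry fun x y : ℝ =>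
      ENNReal.ofReal |x - y| ^ (-(3 / 4 * cappedMin α β))) := by
    unfold Function.uncurry
    fun_prop
  calc ∫⁻ ω, diffProdInv (3 / 4 * cappedMin α β) (fun i => X i ω) ∂μ
      = ∫⁻ x, diffProdInv (3 / 4 * cappedMin α β) x ∂(μ.map fun ω i => X i ω) :=
        (lintegral_map' (measurable_diffProdInv _ N).aemeasurable (aemeasurable_sample hlaw)).symm
    _ ≤ _ := by
        rw [hmap]
        refine lintegral_pi_prod_le (betaMeasure α β) hk (fun y => ?_) N
        simp_rw [abs_sub_comm y]
        exact lintegral_diffKernel_le hα hβ y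

/-- Hölder's inequality between the negative moment of the differences and the probability of A. The
exponent r = 4/(N c) turns the power 4/N of the error bound into the integrable power c. The moment
factor is then H to the power N r = 16/(3m), independent of N, and the lower bound on N gives r ≤
1/16, which preserves 15/16 of the exponential decay. -/
theorem setLIntegral_sq_error_le {Ω : Type*} [MeasurableSpace Ω] {μ : Measure Ω}
    [IsProbabilityMeasure μ] {α β : ℝ} (hα : 0 < α) (hβ : 0 < β) {N : ℕ}
    {X : Fin (N + 1) → Ω → ℝ} (hlaw : ∀ i, HasLaw (X i) (betaMeasure α β) μ)
    (hind : iIndepFun X μ) {a b : Ω → ℝ}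
    (hab : ∀ᵐ ω ∂μ, 0 < a ω ∧ 0 < b ω ∧ ∑ i, scoreComb (a ω) (b ω) 1 0 (X i ω) = 0 ∧
      ∑ i, scoreComb (a ω) (b ω) 0 1 (X i ω) = 0)
    (hN4 : 4 ≤ N) (hN : 256 / (3 * cappedMin α β) ≤ N) {A : Set Ω} {p : ℝ}
    (hp1 : p ≤ 1) (hA : μ.real A ≤ p) :
    ∫⁻ ω in A, ENNReal.ofReal ((a ω - α) ^ 2 + (b ω - β) ^ 2) ∂μ ≤
      ENNReal.ofReal ((484 + α ^ 2 + β ^ 2) *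
        (24 * Real.exp (max (α - 1) 0 + max (β - 1) 0)) ^ (16 / (3 * cappedMin α β)) *
          p ^ (15 / 16 : ℝ)) := by
  set m := cappedMin α β with hm
  have hm0 : 0 < m := cappedMin_pos hα hβ
  set c := 3 / 4 * m with hc
  have hc0 : 0 < c := by positivity
  set H := 24 * Real.exp (max (α - 1) 0 + max (β - 1) 0) with hH
  have hH0 : 0 < H := by positivity
  have hp0 : 0 ≤ p := measureReal_nonneg.trans hA
  have hNpos : (0 : ℝ) < N := by
    have : (4 : ℝ) ≤ N := by exact_mod_cast hN4
    linarith
  set r : ℝ := 4 / (N * c) with hr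
  have hr0 : 0 < r := by positivity
  have hr1 : r ≤ 1 / 16 := by
    rw [div_le_iff₀ (by positivity)] at hN
    rw [hr, div_le_div_iff₀ (by positivity) (by norm_num), hc]
    linarith
  set K : Ω → ℝ≥0∞ := fun ω => diffProdInv c fun i => X i ω with hK
  have hKm : AEMeasurable K μ :=
    (measurable_diffProdInv c N).comp_aemeasurable (aemeasurable_sample hlaw)
  have hKH : ∫⁻ ω, K ω ∂μ ≤ ENNReal.ofReal H ^ N := lintegral_diffKernel_prod_le hα hβ hlaw hind
  have hKfin : ∀ᵐ ω ∂μ, K ω < ∞ :=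
    ae_lt_top' hKm (ne_top_of_le_ne_top (ENNReal.pow_ne_top ENNReal.ofReal_ne_top) hKH)
  have hpt : ∀ᵐ ω ∂μ, ENNReal.ofReal ((a ω - α) ^ 2 + (b ω - β) ^ 2) ≤
      ENNReal.ofReal (484 + α ^ 2 + β ^ 2) * K ω ^ r := by
    filter_upwards [hab, hKfin, ae_sample_mem_Ioo hlaw] with ω ⟨ha, hb, h1, h2⟩ hfin hx
    have hd := diffProd_pos_of_diffProdInv_lt_top hc0 hfin
    have hD : 0 < diffProd fun i => X i ω := Finset.prod_pos fun i _ => hd i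
    have hexp : (diffProd fun i => X i ω) ^ (-(4 / N) : ℝ) =
        ((diffProd fun i => X i ω) ^ (-c)) ^ r := by
      rw [← Real.rpow_mul hD.le]
      congr 1
      rw [hr]
      field_simp
    rw [hK]
    simp only
    rw [diffProdInv_eq hd, ENNReal.ofReal_rpow_of_pos (Real.rpow_pos_of_pos hD _), ← hexp,
      ← ENNReal.ofReal_mul (by positivity)]
    exact ENNReal.ofReal_le_ofReal (sq_error_le_diffProd hN4 hx ha hb h1 h2 hD hα hβ)
  have hpq : (1 / r).HolderConjugate (1 / (1 - r)) := by
    rw [Real.holderConjugate_iff]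
    refine ⟨by rw [lt_div_iff₀ hr0]; linarith, ?_⟩
    simp
  have hhol := ENNReal.lintegral_mul_le_Lp_mul_Lq (μ.restrict A) hpq
    (f := fun ω => K ω ^ r) (g := fun _ => 1) (hKm.pow_const r).restrict aemeasurable_const
  simp only [Pi.mul_apply, mul_one, ENNReal.one_rpow, lintegral_const, one_mul,
    Measure.restrict_apply_univ, one_div_one_div, ← ENNReal.rpow_mul, mul_one_div_cancel hr0.ne',
    ENNReal.rpow_one] at hhol
  clear_value H
  have hμA : μ A ≤ ENNReal.ofReal p := by
    rw [← ofReal_measureReal]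
    exact ENNReal.ofReal_le_ofReal hA
  calc _ ≤ ∫⁻ ω in A, ENNReal.ofReal (484 + α ^ 2 + β ^ 2) * K ω ^ r ∂μ :=
        lintegral_mono_ae (ae_restrict_of_ae hpt)
    _ = ENNReal.ofReal (484 + α ^ 2 + β ^ 2) * ∫⁻ ω in A, K ω ^ r ∂μ :=
        lintegral_const_mul'' _ (hKm.pow_const r).restrict
    _ ≤ ENNReal.ofReal (484 + α ^ 2 + β ^ 2) *
          ((ENNReal.ofReal H ^ N) ^ r * ENNReal.ofReal p ^ (1 - r)) := by
        gcongr
        refine hhol.trans ?_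
        gcongr
        · exact (setLIntegral_le_lintegral _ _).trans hKH
        · linarith
    _ = ENNReal.ofReal ((484 + α ^ 2 + β ^ 2) * (H ^ (16 / (3 * m)) * p ^ (1 - r))) := by
        have e : N * r = 16 / (3 * m) := by
          rw [hr, hc]
          field_simp
          norm_num
        rw [ENNReal.ofReal_mul (by positivity), ENNReal.ofReal_mul (by positivity),
          ← ENNReal.rpow_natCast, ← ENNReal.rpow_mul, ENNReal.ofReal_rpow_of_pos hH0,
          ENNReal.ofReal_rpow_of_nonneg hp0 (by linarith), e]
    _ ≤ _ := by
        rw [mul_assoc]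
        have hpr : p ^ (1 - r) ≤ p ^ (15 / 16 : ℝ) := by
          rcases hp0.eq_or_lt with h | h
          · rw [← h, Real.zero_rpow (by linarith), Real.zero_rpow (by norm_num)]
          · exact Real.rpow_le_rpow_of_exponent_ge h hp1 (by linarith)
        exact ENNReal.ofReal_le_ofReal (by gcongr)

/-! ### The mean squared error -/

section

variable {Ω : Type*} [MeasurableSpace Ω] {μ : Measure Ω} [IsProbabilityMeasure μ] {α β : ℝ} {n : ℕ}
  {X : Fin n → Ω → ℝ} {θ : Ω → Plane}

/-- A bound for the squared error in mean on the event that the mean score is large. -/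
noncomputable def tailBound (α β : ℝ) (n : ℕ) : ℝ :=
  (484 + α ^ 2 + β ^ 2) *
    (24 * Real.exp (max (α - 1) 0 + max (β - 1) 0)) ^ (16 / (3 * cappedMin α β)) *
      (8 * Real.exp (-(0.0232 * (n / curvature α β ^ 2)))) ^ (15 / 16 : ℝ)

theorem tailBound_nonneg (α β : ℝ) (n : ℕ) : 0 ≤ tailBound α β n := by
  unfold tailBound
  positivity

theorem eight_mul_exp_le_one {z : ℝ} (hz : 2200 ≤ z) : 8 * Real.exp (-(0.0232 * z)) ≤ 1 := by
  have h1 : (9 : ℝ) ≤ Real.exp (0.0232 * z) := by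
    have := Real.add_one_le_exp (0.0232 * z)
    linarith
  rw [Real.exp_neg, ← div_eq_mul_inv, div_le_one (Real.exp_pos _)]
  linarith

/-- The expectation is split according to the size of the mean score: `goodMajorant` where it is
small, and Hölder's bound with the Chernoff probability where it is large. -/
theorem sq_error_bound (hα : 0 < α) (hβ : 0 < β)
    (hlaw : ∀ i, HasLaw (X i) (betaMeasure α β) μ) (hind : iIndepFun X μ)
    (hθ : AEMeasurable θ μ) (hmle : ∀ᵐ ω ∂μ, IsBetaMLE (fun i => X i ω) (θ ω))
    (hn : 2200 * curvature α β ^ 2 ≤ n) (hn5 : 5 ≤ n)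
    (hnm : 256 / (3 * cappedMin α β) + 1 ≤ n) :
    Integrable (fun ω => (θ ω 0 - α) ^ 2 + (θ ω 1 - β) ^ 2) μ ∧
      ∫ ω, ((θ ω 0 - α) ^ 2 + (θ ω 1 - β) ^ 2) ∂μ ≤ estTrace α β / n +
        11 * thirdRatio α β * (estTrace α β * √(estTrace α β)) / (n * √n) + tailBound α β n := by
  have hκ := curvature_pos hα hβ
  obtain ⟨ig, eg⟩ := integral_goodMajorant_le hα hβ hlaw hind hn
  set S : Ω → ℝ := fun ω => (θ ω 0 - α) ^ 2 + (θ ω 1 - β) ^ 2 with hS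
  have hS0 : ∀ ω, 0 ≤ S ω := fun ω => by positivity
  have hSm : AEMeasurable S μ := by
    have h0 : Measurable fun t : Plane => (t 0 - α) ^ 2 + (t 1 - β) ^ 2 := by fun_prop
    exact h0.comp_aemeasurable hθ
  set A : Set Ω := {ω | n ^ 2 * (1 / (4 * curvature α β) ^ 2) ≤ scoreDual α β fun i => X i ω}
    with hA
  have hbad : ∫⁻ ω in A, ENNReal.ofReal (S ω) ∂μ ≤ ENNReal.ofReal (tailBound α β n) := by
    -- A sample of n points has N = n - 1 successive differences.
    obtain ⟨N, rfl⟩ : ∃ N, n = N + 1 := ⟨n - 1, by omega⟩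
    refine setLIntegral_sq_error_le hα hβ hlaw hind (a := fun ω => θ ω 0) (b := fun ω => θ ω 1) ?_
      (by omega) ?_ (eight_mul_exp_le_one ?_) (measureReal_scoreDual_ge hα hβ hlaw hind)
    · filter_upwards [hmle, ae_sample_mem_Ioo hlaw] with ω h hx
      exact ⟨h.1.1, h.1.2, sum_scoreComb_eq_zero_of_isBetaMLE h hx 1 0,
        sum_scoreComb_eq_zero_of_isBetaMLE h hx 0 1⟩
    · push_cast at hnm
      linarith
    · rwa [le_div_iff₀ (by positivity)]
  have hgood : ∀ᵐ ω ∂μ, ω ∈ Aᶜ →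
      ENNReal.ofReal (S ω) ≤ ENNReal.ofReal (goodMajorant α β fun i => X i ω) := by
    filter_upwards [hmle, ae_sample_mem_Ioo hlaw] with ω h hx hω
    refine ENNReal.ofReal_le_ofReal (sq_error_le_goodMajorant hα hβ (by omega) ?_ ?_
      (fun c₁ c₂ => sum_scoreComb_eq_of_isBetaMLE h hx α β c₁ c₂) ?_)
    · simpa using h.1.1
    · simpa using h.1.2
    · exact not_le.1 hω
  have htot : ∫⁻ ω, ENNReal.ofReal (S ω) ∂μ ≤
      ENNReal.ofReal (∫ ω, goodMajorant α β (fun i => X i ω) ∂μ + tailBound α β n) := by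
    rw [ENNReal.ofReal_add (integral_nonneg fun ω => goodMajorant_nonneg hα hβ _)
      (tailBound_nonneg α β n), ofReal_integral_eq_lintegral_ofReal ig
      (Filter.Eventually.of_forall fun ω => goodMajorant_nonneg hα hβ _)]
    calc ∫⁻ ω, ENNReal.ofReal (S ω) ∂μ = ∫⁻ ω in Aᶜ ∪ A, ENNReal.ofReal (S ω) ∂μ := by
          rw [Set.compl_union_self, setLIntegral_univ]
      _ ≤ _ := lintegral_union_le _ _ _
      _ ≤ _ := by
        refine add_le_add ?_ hbad
        exact (setLIntegral_mono_ae ig.aemeasurable.ennreal_ofReal.restrict hgood).trans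
          (setLIntegral_le_lintegral _ _)
  have hint : Integrable S μ := by
    refine ⟨hSm.aestronglyMeasurable, ?_⟩
    rw [hasFiniteIntegral_iff_ofReal (Filter.Eventually.of_forall hS0)]
    exact htot.trans_lt ENNReal.ofReal_lt_top
  refine ⟨hint, ?_⟩
  have h2 : ∫ ω, S ω ∂μ ≤ ∫ ω, goodMajorant α β (fun i => X i ω) ∂μ + tailBound α β n := by
    rw [← ofReal_integral_eq_lintegral_ofReal hint (Filter.Eventually.of_forall hS0)] at htot
    refine (ENNReal.ofReal_le_ofReal_iff ?_).1 htot
    exact add_nonneg (integral_nonneg fun ω => goodMajorant_nonneg hα hβ _)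
      (tailBound_nonneg α β n)
  linarith

end

/-! ### Bounds for the asymptotic variances and the curvature -/

section

variable {x y : ℝ}

/-- `fisherDet_lower` carries the numerator of the variance as a factor, so it cancels. -/
theorem estVar_le (hx : 0 < x) (hy : 0 < y) : estVar x y ≤ 2 * x ^ 2 * (x + y) / y := by
  have h := fisherDet_lower hx hy
  rw [estVar, div_le_div_iff₀ (fisherDet_pos hx hy) hy]
  calc (hurwitzSum 2 y - hurwitzSum 2 (x + y)) * y =
        (hurwitzSum 2 y - hurwitzSum 2 (x + y)) * (y / (2 * x ^ 2 * (x + y))) *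
          (2 * x ^ 2 * (x + y)) := by field_simp
    _ ≤ fisherDet x y * (2 * x ^ 2 * (x + y)) := by gcongr
    _ = _ := by ring

theorem sq_ratio_mul_le (hx : 0 < x) (hy : 0 < y) :
    y ^ 2 / (x + y) ^ 2 * hurwitzSum 2 y ≤ hurwitzSum 2 (x + y) := by
  have h := sq_mul_hurwitzSum_two_mono hy (show y ≤ x + y by linarith)
  rw [div_mul_eq_mul_div, div_le_iff₀ (by positivity)]
  linarith

theorem hurwitzSum_two_sub_le (hx : 0 < x) (hy : 0 < y) :
    hurwitzSum 2 y - hurwitzSum 2 (x + y) ≤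
      hurwitzSum 2 y * (x * (x + 2 * y) / (x + y) ^ 2) := by
  have h := sq_ratio_mul_le hx hy
  have e : x * (x + 2 * y) / (x + y) ^ 2 = 1 - y ^ 2 / (x + y) ^ 2 := by
    field_simp
    ring
  rw [e]
  linarith

theorem fisherDet_le (hx : 0 < x) (hy : 0 < y) :
    fisherDet x y ≤ hurwitzSum 2 x * hurwitzSum 2 y * (2 * x * y / (x + y) ^ 2) := by
  have h1 := sq_ratio_mul_le hx hy
  have h2 := sq_ratio_mul_le hy hx
  rw [add_comm y x] at h2
  have hp := hurwitzSum_pos (j := 2) le_rfl hx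
  have hq := hurwitzSum_pos (j := 2) le_rfl hy
  have e : 2 * x * y / (x + y) ^ 2 = 1 - y ^ 2 / (x + y) ^ 2 - x ^ 2 / (x + y) ^ 2 := by
    field_simp
    ring
  rw [e, fisherDet]
  nlinarith [mul_le_mul_of_nonneg_left h1 hp.le, mul_le_mul_of_nonneg_left h2 hq.le]

/-- The bound of `2 * hurwitzSum 3 u` by a rational function. -/
noncomputable def cubeBound (u : ℝ) : ℝ := (u ^ 2 + 2 * u + 2) / (u ^ 3 * (u + 1))

theorem cubeBound_pos (hx : 0 < x) : 0 < cubeBound x := by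
  unfold cubeBound
  positivity

theorem hurwitzSum_three_mul_estVar_le (hx : 0 < x) (hy : 0 < y) :
    2 * hurwitzSum 3 x * estVar x y ≤
      hurwitzSum 2 y * (x * (x + 2 * y) / (x + y) ^ 2) * cubeBound x / fisherDet x y := by
  have hδ := fisherDet_pos hx hy
  rw [estVar, mul_div_assoc']
  refine div_le_div_of_nonneg_right ?_ hδ.le
  have h1 := two_mul_hurwitzSum_three_le hx
  have h2 := hurwitzSum_two_sub_le hx hy
  have h3 := hurwitzSum_two_add_lt' hx hy
  have h4 := hurwitzSum_pos (j := 3) (by norm_num) hx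
  have hB := cubeBound_pos hx
  calc 2 * hurwitzSum 3 x * (hurwitzSum 2 y - hurwitzSum 2 (x + y)) ≤
        cubeBound x * (hurwitzSum 2 y * (x * (x + 2 * y) / (x + y) ^ 2)) := by
        refine mul_le_mul h1 h2 (by linarith) hB.le
    _ = _ := by ring

/-- Writing p, q, w for the values of Ψ₁ at x, y, x + y, positivity of the determinant says w² < (p
- w)(q - w); hence 2w ≤ (p - w) + (q - w) by AM–GM. -/
theorem estVarSum_le (hx : 0 < x) (hy : 0 < y) : estVarSum x y ≤ 2 * estTrace x y := by
  have hδ := fisherDet_pos hx hy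
  rw [estTrace, estVar, estVar, estVarSum, fisherDet_comm y x, ← add_div, mul_div_assoc',
    add_comm y x]
  refine div_le_div_of_nonneg_right ?_ hδ.le
  have h1 := hurwitzSum_two_add_lt hx hy
  have h2 := hurwitzSum_two_add_lt' hx hy
  have hw := hurwitzSum_pos (j := 2) le_rfl (show 0 < x + y by linarith)
  rw [fisherDet_eq] at hδ
  nlinarith [sq_nonneg (hurwitzSum 2 x - hurwitzSum 2 y)]

theorem estVar_le_estVar (hx : 0 < x) (hxy : x ≤ y) : estVar x y ≤ estVar y x := by
  have hy := hx.trans_le hxy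
  have hδ := fisherDet_pos hx hy
  rw [estVar, estVar, fisherDet_comm y x, add_comm y x]
  refine div_le_div_of_nonneg_right ?_ hδ.le
  linarith [hurwitzSum_anti (j := 2) le_rfl hx hxy]

/-- Termwise, the left side is x y (x/(x + k))² (y + 2x + 2k)/(x + y + k)², and both the squared
ratio and the linear factor grow when x and y are exchanged. It serves to compare the variance of
the larger parameter, relative to its square, with the trace. -/
theorem cube_mul_hurwitzSum_two_sub_le (hx : 0 < x) (hxy : x ≤ y) :
    x ^ 3 * (hurwitzSum 2 x - hurwitzSum 2 (x + y)) ≤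
      y ^ 3 * (hurwitzSum 2 y - hurwitzSum 2 (x + y)) := by
  have hy := hx.trans_le hxy
  have s1 := summable_one_div_add_pow (j := 2) le_rfl hx
  have s2 := summable_one_div_add_pow (j := 2) le_rfl hy
  have s3 := summable_one_div_add_pow (j := 2) le_rfl (show 0 < x + y by linarith)
  rw [hurwitzSum, hurwitzSum, hurwitzSum, ← s1.tsum_sub s3, ← s2.tsum_sub s3, ← tsum_mul_left,
    ← tsum_mul_left]
  refine Summable.tsum_le_tsum (fun k => ?_) ((s1.sub s3).mul_left _) ((s2.sub s3).mul_left _)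
  have hk : (0 : ℝ) ≤ k := Nat.cast_nonneg k
  have e1 : x ^ 3 * (1 / (x + k) ^ 2 - 1 / (x + y + k) ^ 2) =
      x * y * (x ^ 2 * (y + 2 * x + 2 * k) / ((x + k) ^ 2 * (x + y + k) ^ 2)) := by
    field_simp
    ring
  have e2 : y ^ 3 * (1 / (y + k) ^ 2 - 1 / (x + y + k) ^ 2) =
      x * y * (y ^ 2 * (x + 2 * y + 2 * k) / ((y + k) ^ 2 * (x + y + k) ^ 2)) := by
    field_simp
    ring
  rw [e1, e2]
  have h1 : (x / (x + k)) ^ 2 ≤ (y / (y + k)) ^ 2 := by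
    refine pow_le_pow_left₀ (by positivity) ?_ 2
    rw [div_le_div_iff₀ (by positivity) (by positivity)]
    nlinarith
  have e3 : ∀ u v : ℝ, 0 < u → u ^ 2 * v / ((u + k) ^ 2 * (x + y + k) ^ 2) =
      (u / (u + k)) ^ 2 * (v / (x + y + k) ^ 2) := fun u v hu => by
    field_simp
  rw [e3 x _ hx, e3 y _ hy]
  gcongr _ * (?_ * (?_ / _))
  linarith

theorem two_mul_estVar_mul_sq_le (hx : 0 < x) (hxy : x ≤ y) :
    2 * (estVar y x * x ^ 2) ≤ estTrace x y * y ^ 2 := by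
  have hy := hx.trans_le hxy
  have hδ := fisherDet_pos hx hy
  have h := cube_mul_hurwitzSum_two_sub_le hx hxy
  have h1 := hurwitzSum_two_add_lt hx hy
  have h2 := hurwitzSum_two_add_lt' hx hy
  rw [estTrace, estVar, estVar, fisherDet_comm y x, ← add_div, add_comm y x, div_mul_eq_mul_div,
    div_mul_eq_mul_div, mul_div_assoc']
  refine div_le_div_of_nonneg_right ?_ hδ.le
  set a := hurwitzSum 2 x - hurwitzSum 2 (x + y) with ha
  set b := hurwitzSum 2 y - hurwitzSum 2 (x + y) with hb
  have ha0 : 0 < a := by linarith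
  have h3 : a * (2 * x ^ 2 * y - y ^ 3) ≤ a * x ^ 3 := by
    refine mul_le_mul_of_nonneg_left ?_ ha0.le
    have : 0 ≤ (y - x) * (y ^ 2 + x * y - x ^ 2) := by
      refine mul_nonneg (by linarith) ?_
      nlinarith
    nlinarith
  have h4 : y * (2 * (a * x ^ 2)) ≤ y * ((b + a) * y ^ 2) := by nlinarith
  exact le_of_mul_le_mul_left h4 hy

theorem curvature_sq_mul_le (hx : 0 < x) (hy : 0 < y) {D N : ℝ}
    (h1 : D * (20 / 17 * (hurwitzSum 3 x * (estVar x y * √(estVar x y)) +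
      hurwitzSum 3 y * (estVar y x * √(estVar y x)))) ^ 2 ≤ N)
    (h2 : D * ((20 / 17) ^ 2 * (hurwitzSum 3 (x + y) ^ 2 * estVarSum x y ^ 3)) ≤ N)
    (h3 : D * (100 / 9 * (estVar x y / x ^ 2)) ≤ N)
    (h4 : D * (100 / 9 * (estVar y x / y ^ 2)) ≤ N) :
    D * curvature x y ^ 2 ≤ N := by
  have va := estVar_pos hx hy
  have vb := estVar_pos hy hx
  have vs := estVarSum_pos hx hy
  unfold curvature
  rcases max_choice (max (20 / 17 * (hurwitzSum 3 x * (estVar x y * √(estVar x y)) +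
      hurwitzSum 3 y * (estVar y x * √(estVar y x))))
    (20 / 17 * (hurwitzSum 3 (x + y) * (estVarSum x y * √(estVarSum x y)))))
    (max (10 / 3 * √(estVar x y) / x) (10 / 3 * √(estVar y x) / y)) with h | h <;> rw [h]
  · rcases max_choice (20 / 17 * (hurwitzSum 3 x * (estVar x y * √(estVar x y)) +
      hurwitzSum 3 y * (estVar y x * √(estVar y x))))
      (20 / 17 * (hurwitzSum 3 (x + y) * (estVarSum x y * √(estVarSum x y)))) with h | h <;> rw [h]
    · exact h1
    · refine le_trans (le_of_eq ?_) h2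
      rw [mul_pow, mul_pow, mul_pow, Real.sq_sqrt vs.le]
      ring
  · rcases max_choice (10 / 3 * √(estVar x y) / x) (10 / 3 * √(estVar y x) / y) with h | h <;> rw [h]
    · refine le_trans (le_of_eq ?_) h3
      rw [div_pow, mul_pow, Real.sq_sqrt va.le]
      ring
    · refine le_trans (le_of_eq ?_) h4
      rw [div_pow, mul_pow, Real.sq_sqrt vb.le]
      ring

/-- The curvature is controlled by a linear combination `g` that dominates the third derivatives. -/
theorem curvature_sq_mul_le_of_le_mul (hx : 0 < x) (hxy : x ≤ y) {L g N : ℝ} (hL : 0 < L)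
    (hA : L * (20 / 17) * (hurwitzSum 2 y * (x * (x + 2 * y) / (x + y) ^ 2) * cubeBound x) ≤ g)
    (hB : L * (20 / 17) * (hurwitzSum 2 x * (y * (y + 2 * x) / (x + y) ^ 2) * cubeBound y) ≤ g)
    (hC : L * (20 / 17) * (cubeBound (x + y) * (hurwitzSum 2 x + hurwitzSum 2 y)) ≤ g)
    (hE : L * (10 / 3) * fisherDet x y ≤ x * g)
    (hN : estTrace x y / 2 * (g / fisherDet x y) ^ 2 ≤ N) : L ^ 2 * curvature x y ^ 2 ≤ N := by
  have hy := hx.trans_le hxy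
  have hs : 0 < x + y := by linarith
  have va := estVar_pos hx hy
  have vb := estVar_pos hy hx
  have vs := estVarSum_pos hx hy
  have hτ := estTrace_pos hx hy
  have hδ := fisherDet_pos hx hy
  have hp := hurwitzSum_pos (j := 2) le_rfl hx
  have hq := hurwitzSum_pos (j := 2) le_rfl hy
  have zx := hurwitzSum_pos (j := 3) (by norm_num) hx
  have zy := hurwitzSum_pos (j := 3) (by norm_num) hy
  have zs := hurwitzSum_pos (j := 3) (by norm_num) hs
  set G := g / fisherDet x y with hG
  have hA' : L * (20 / 17) * (2 * (hurwitzSum 3 x * estVar x y)) ≤ G := by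
    rw [hG, le_div_iff₀ hδ]
    have := hurwitzSum_three_mul_estVar_le hx hy
    rw [le_div_iff₀ hδ] at this
    nlinarith [mul_le_mul_of_nonneg_left this (show 0 ≤ L * (20 / 17) by positivity)]
  have hB' : L * (20 / 17) * (2 * (hurwitzSum 3 y * estVar y x)) ≤ G := by
    rw [hG, le_div_iff₀ hδ]
    have := hurwitzSum_three_mul_estVar_le hy hx
    rw [fisherDet_comm y x, add_comm y x, le_div_iff₀ hδ] at this
    nlinarith [mul_le_mul_of_nonneg_left this (show 0 ≤ L * (20 / 17) by positivity)]
  have hC' : L * (20 / 17) * (2 * (hurwitzSum 3 (x + y) * estVarSum x y)) ≤ G := by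
    rw [hG, le_div_iff₀ hδ]
    have h1 : estVarSum x y * fisherDet x y = hurwitzSum 2 x + hurwitzSum 2 y := by
      rw [estVarSum, div_mul_cancel₀ _ hδ.ne']
    have h2 := two_mul_hurwitzSum_three_le hs
    calc _ = L * (20 / 17) * (2 * hurwitzSum 3 (x + y) * (estVarSum x y * fisherDet x y)) := by ring
      _ ≤ L * (20 / 17) * (cubeBound (x + y) * (hurwitzSum 2 x + hurwitzSum 2 y)) := by
          rw [h1]
          gcongr
          exact h2
      _ ≤ g := hC
  have hE' : L * (10 / 3) ≤ x * G := by
    rw [hG, show x * (g / fisherDet x y) = x * g / fisherDet x y by ring, le_div_iff₀ hδ]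
    exact hE
  have hG0 : 0 < G := lt_of_lt_of_le (by positivity) hA'
  have hE2 : L ^ 2 * (100 / 9) ≤ x ^ 2 * G ^ 2 := by
    have := mul_self_le_mul_self (by positivity) hE'
    nlinarith
  have hτe : estTrace x y = estVar x y + estVar y x := rfl
  refine curvature_sq_mul_le hx hy (le_trans ?_ hN) (le_trans ?_ hN)
    (le_trans ?_ hN) (le_trans ?_ hN)
  · have h1 : (√(estVar x y) + √(estVar y x)) ^ 2 ≤ 2 * estTrace x y := by
      nlinarith [sq_nonneg (√(estVar x y) - √(estVar y x)), Real.sq_sqrt va.le,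
        Real.sq_sqrt vb.le]
    have h2 : L * (20 / 17 * (hurwitzSum 3 x * (estVar x y * √(estVar x y)) +
        hurwitzSum 3 y * (estVar y x * √(estVar y x)))) ≤
          G / 2 * (√(estVar x y) + √(estVar y x)) := by
      have k1 := mul_le_mul_of_nonneg_right hA' (Real.sqrt_nonneg (estVar x y))
      have k2 := mul_le_mul_of_nonneg_right hB' (Real.sqrt_nonneg (estVar y x))
      linarith
    calc _ = (L * (20 / 17 * (hurwitzSum 3 x * (estVar x y * √(estVar x y)) +
        hurwitzSum 3 y * (estVar y x * √(estVar y x))))) ^ 2 := by ring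
      _ ≤ (G / 2 * (√(estVar x y) + √(estVar y x))) ^ 2 := by
          refine pow_le_pow_left₀ (by positivity) h2 2
      _ = G ^ 2 / 4 * (√(estVar x y) + √(estVar y x)) ^ 2 := by ring
      _ ≤ G ^ 2 / 4 * (2 * estTrace x y) := by gcongr
      _ = _ := by ring
  · calc _ = (L * (20 / 17) * (2 * (hurwitzSum 3 (x + y) * estVarSum x y))) ^ 2 / 4 *
          estVarSum x y := by ring
      _ ≤ G ^ 2 / 4 * (2 * estTrace x y) := by
          gcongr
          exact estVarSum_le hx hy
      _ = _ := by ring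
  · have h := estVar_le_estVar hx hxy
    calc _ = L ^ 2 * (100 / 9) * estVar x y / x ^ 2 := by ring
      _ ≤ x ^ 2 * G ^ 2 * (estTrace x y / 2) / x ^ 2 := by
          gcongr
          linarith
      _ = _ := by field_simp
  · have h := two_mul_estVar_mul_sq_le hx hxy
    have h' : estVar y x / y ^ 2 ≤ estTrace x y / 2 / x ^ 2 := by
      rw [div_le_div_iff₀ (by positivity) (by positivity)]
      linarith
    calc _ = L ^ 2 * (100 / 9) * (estVar y x / y ^ 2) := by ring
      _ ≤ x ^ 2 * G ^ 2 * (estTrace x y / 2 / x ^ 2) := by gcongr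
      _ = _ := by field_simp

end

/-! ### The sample size dominates the curvature -/

section

variable {x y k : ℝ}

theorem mul_hurwitzSum_two_le (hx : 0 < x) (hxy : x ≤ y) :
    y / x * hurwitzSum 2 y ≤ hurwitzSum 2 x := by
  have := mul_hurwitzSum_two_anti hx hxy
  rw [div_mul_eq_mul_div, div_le_iff₀ hx]
  linarith

theorem sq_mul_hurwitzSum_two_le (hx : 0 < x) (hxy : x ≤ y) :
    (x / y) ^ 2 * hurwitzSum 2 x ≤ hurwitzSum 2 y := by
  have hy := hx.trans_le hxy
  have := sq_mul_hurwitzSum_two_mono hx hxy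
  rw [div_pow, div_mul_eq_mul_div, div_le_iff₀ (by positivity)]
  linarith

/-- A lower bound for the constants of the sample size condition, in terms of the ratio `k` of the
parameters. -/
noncomputable def ratioBound (x k : ℝ) : ℝ :=
  (1 + k) ^ 2 * (96 + 6 / (k - 1 / 2) ^ 4 + (12.98 * x + 7.26) * x ^ 3)

theorem ratioBound_pos (hx : 0 < x) (hk : 1 ≤ k) : 0 < ratioBound x k := by
  unfold ratioBound
  positivity

/-- With y = k x, p = Ψ₁(x) and q = Ψ₁(y), one has k q ≤ p ≤ k² q. Hence q c₁ + p c₂ dominates both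
q (c₁ + k c₂) and p (c₁ + k² c₂)/k², and `ratioBound` bounds c₁ + k c₂ from below up to explicit
factors. The polygamma values cancel, and four elementary conditions on x, k and L remain. -/
theorem curvature_sq_mul_le_of_ratioBound (hx : 0 < x) (hk : 1 ≤ k) {L c₁ c₂ N : ℝ} (hL : 0 < L)
    (hc₁ : 96 * k / x ^ 3 + 6.49 * (k * x) + 7.26 ≤ c₁)
    (hc₂ : 6 / (x ^ 3 * (k - 1 / 2) ^ 4) + 6.49 * x + 7.26 ≤ c₂)
    (hA : L * (60 / 17) * (2 + x ^ 2 / (x + 1)) ≤ ratioBound x k)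
    (hB : L * (20 / 17) * ((1 + 2 / k) * (2 + (k * x) ^ 2 / (k * x + 1))) ≤ ratioBound x k)
    (hC : L * (20 / 17) * (2 + (x + k * x) ^ 2 / (x + k * x + 1)) ≤ ratioBound x k)
    (hE : L * (20 / 3) * (1 + 2 * x ^ 2 / (2 * x + 1)) ≤ ratioBound x k)
    (hN : estTrace x (k * x) / 2 * ((hurwitzSum 2 (k * x) * c₁ + hurwitzSum 2 x * c₂) /
      fisherDet x (k * x)) ^ 2 ≤ N) : L ^ 2 * curvature x (k * x) ^ 2 ≤ N := by
  have hk0 : 0 < k := by linarith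
  have hxy : x ≤ k * x := by nlinarith
  have hy : 0 < k * x := by positivity
  have hp := hurwitzSum_pos (j := 2) le_rfl hx
  have hq := hurwitzSum_pos (j := 2) le_rfl hy
  have hk2 : 0 < k - 1 / 2 := by linarith
  have hc1 : 0 < c₁ := lt_of_lt_of_le (by positivity) hc₁
  have hc2 : 0 < c₂ := lt_of_lt_of_le (by positivity) hc₂
  have r1 := mul_hurwitzSum_two_le hx hxy
  have r2 := sq_mul_hurwitzSum_two_le hx hxy
  have e1 : k * x / x = k := by field_simp
  have e2 : x / (k * x) = 1 / k := by field_simp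
  rw [e1] at r1
  rw [e2] at r2
  set p := hurwitzSum 2 x
  set q := hurwitzSum 2 (k * x)
  have w1 : k * ratioBound x k / ((1 + k) ^ 2 * x ^ 3) ≤ c₁ + k * c₂ := by
    calc k * ratioBound x k / ((1 + k) ^ 2 * x ^ 3)
        = 96 * k / x ^ 3 + 6.49 * (k * x) +
            k * (6 / (x ^ 3 * (k - 1 / 2) ^ 4) + 6.49 * x + 7.26) := by
          unfold ratioBound
          field_simp
          ring
      _ ≤ (96 * k / x ^ 3 + 6.49 * (k * x) + 7.26) +
            k * (6 / (x ^ 3 * (k - 1 / 2) ^ 4) + 6.49 * x + 7.26) := by linarith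
      _ ≤ _ := by gcongr
  have w2 : c₁ + k * c₂ ≤ c₁ + k ^ 2 * c₂ := by
    have : 0 ≤ (k ^ 2 - k) * c₂ := mul_nonneg (by nlinarith) hc2.le
    linarith
  have g1 : q * (c₁ + k * c₂) ≤ q * c₁ + p * c₂ := by nlinarith
  have g2 : p * ((c₁ + k ^ 2 * c₂) / k ^ 2) ≤ q * c₁ + p * c₂ := by
    have : p * ((c₁ + k ^ 2 * c₂) / k ^ 2) = (1 / k) ^ 2 * p * c₁ + p * c₂ := by field_simp
    nlinarith
  have r3 : p + q ≤ p * (1 + 1 / k) := by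
    have : p * (1 + 1 / k) - (p + q) = (p - k * q) / k := by
      field_simp
      ring
    have : 0 ≤ (p - k * q) / k := div_nonneg (by linarith) hk0.le
    linarith
  have hW := ratioBound_pos hx hk
  set W := ratioBound x k with hWdef
  refine curvature_sq_mul_le_of_le_mul hx hxy hL (le_trans ?_ g1) (le_trans ?_ g2)
    (le_trans ?_ g2) (le_trans ?_ (mul_le_mul_of_nonneg_left g1 hx.le)) hN
  · calc _ = q * ((1 + 2 * k) * (L * (60 / 17) * (2 + x ^ 2 / (x + 1))) /
          (3 * ((1 + k) ^ 2 * x ^ 3))) := by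
          unfold cubeBound
          field_simp
          ring
      _ ≤ q * (3 * k * W / (3 * ((1 + k) ^ 2 * x ^ 3))) := by
          have : 1 + 2 * k ≤ 3 * k := by linarith
          gcongr
      _ = q * (k * W / ((1 + k) ^ 2 * x ^ 3)) := by
          congr 1
          field_simp
      _ ≤ _ := by gcongr
  · calc _ = p * ((L * (20 / 17) * ((1 + 2 / k) * (2 + (k * x) ^ 2 / (k * x + 1)))) /
          (k * (1 + k) ^ 2 * x ^ 3)) := by
          unfold cubeBound
          field_simp
          ring
      _ ≤ p * (W / (k * (1 + k) ^ 2 * x ^ 3)) := by gcongr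
      _ = p * ((k * W / ((1 + k) ^ 2 * x ^ 3)) / k ^ 2) := by
          congr 1
          field_simp
      _ ≤ _ := by
          gcongr
          exact w1.trans w2
  · calc _ ≤ L * (20 / 17) * (cubeBound (x + k * x) * (p * (1 + 1 / k))) := by
          have := cubeBound_pos (show 0 < x + k * x by linarith)
          gcongr
      _ = p * ((L * (20 / 17) * (2 + (x + k * x) ^ 2 / (x + k * x + 1))) /
          (k * (1 + k) ^ 2 * x ^ 3)) := by
          unfold cubeBound
          field_simp
          ring
      _ ≤ p * (W / (k * (1 + k) ^ 2 * x ^ 3)) := by gcongr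
      _ = p * ((k * W / ((1 + k) ^ 2 * x ^ 3)) / k ^ 2) := by
          congr 1
          field_simp
      _ ≤ _ := by
          gcongr
          exact w1.trans w2
  · calc _ ≤ L * (10 / 3) * ((1 / x ^ 2 + 2 / (2 * x + 1)) * q *
          (2 * x * (k * x) / (x + k * x) ^ 2)) := by
          gcongr
          refine (fisherDet_le hx hy).trans ?_
          gcongr
          exact hurwitzSum_two_le hx
      _ = x * (q * (k * (L * (20 / 3) * (1 + 2 * x ^ 2 / (2 * x + 1))) /
          ((1 + k) ^ 2 * x ^ 3))) := by
          field_simp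
          ring
      _ ≤ x * (q * (k * W / ((1 + k) ^ 2 * x ^ 3))) := by gcongr
      _ ≤ _ := by gcongr

end

/-! ### Elementary inequalities in the smaller parameter and the ratio of the parameters -/

section

variable {x k : ℝ}

/-- The part without x is smallest near k = 1.245; the hints are multiples of the square vanishing
there. -/
theorem le_ratioBound_const (hx : 0 < x) (hk : 1 ≤ k) : 580 ≤ ratioBound x k := by
  obtain ⟨u, rfl⟩ : ∃ u, k = 1 + u := ⟨k - 1, by ring⟩
  have hu : 0 ≤ u := by linarith
  have hj : 0 < u + 1 / 2 := by linarith
  have h0 : 580 * (u + 1 / 2) ^ 4 ≤ (2 + u) ^ 2 * (96 * (u + 1 / 2) ^ 4 + 6) := by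
    nlinarith [sq_nonneg (u - 0.245), mul_nonneg hu (sq_nonneg (u - 0.245)),
      mul_nonneg (pow_nonneg hu 2) (sq_nonneg (u - 0.245)),
      mul_nonneg (pow_nonneg hu 3) (sq_nonneg (u - 0.245)),
      mul_nonneg (pow_nonneg hu 4) (sq_nonneg (u - 0.245))]
  have h1 : 580 ≤ (2 + u) ^ 2 * (96 + 6 / (u + 1 / 2) ^ 4) := by
    have e : 96 + 6 / (u + 1 / 2) ^ 4 = (96 * (u + 1 / 2) ^ 4 + 6) / (u + 1 / 2) ^ 4 := by
      rw [add_div, mul_div_cancel_right₀ _ (by positivity)]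
    rw [e, mul_div_assoc', le_div_iff₀ (by positivity)]
    exact h0
  have h2 : 0 ≤ (2 + u) ^ 2 * ((12.98 * x + 7.26) * x ^ 3) := by positivity
  have e1 : 1 + (1 + u) = 2 + u := by ring
  have e2 : 1 + u - 1 / 2 = u + 1 / 2 := by ring
  rw [ratioBound, e1, e2]
  linarith

/-- The square root of 1 + u is replaced by a line that nearly touches it at u = 0.35, which reduces
the claim to a polynomial inequality. -/
theorem le_ratioBound_sqrt (hx : 0 < x) (hk : 1 ≤ k) :
    √k * (510 + 4 * ((12.98 * x + 7.26) * x ^ 3)) ≤ ratioBound x k := by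
  obtain ⟨u, rfl⟩ : ∃ u, k = 1 + u := ⟨k - 1, by ring⟩
  have hu : 0 ≤ u := by linarith
  have hj : 0 < u + 1 / 2 := by linarith
  have h0 : 510 * (u + 2.35) * (u + 1 / 2) ^ 4 ≤
      2.3237 * ((2 + u) ^ 2 * (96 * (u + 1 / 2) ^ 4 + 6)) := by
    have q := sq_nonneg (u - 0.357)
    linarith [mul_nonneg hu q, mul_nonneg (pow_nonneg hu 2) q, mul_nonneg (pow_nonneg hu 3) q,
      mul_nonneg (pow_nonneg hu 4) q]
  have hr0 := Real.sqrt_nonneg (1 + u)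
  have hr := Real.sq_sqrt (show 0 ≤ 1 + u by linarith)
  set r := √(1 + u) with hrdef
  have hr1 : 2.3237 * r ≤ u + 2.35 := by
    nlinarith [sq_nonneg (r - 1.16185)]
  have hr2 : 4 * r ≤ (2 + u) ^ 2 := by nlinarith [sq_nonneg (r - 1)]
  have h1 : 510 * r ≤ (2 + u) ^ 2 * (96 + 6 / (u + 1 / 2) ^ 4) := by
    have e : 96 + 6 / (u + 1 / 2) ^ 4 = (96 * (u + 1 / 2) ^ 4 + 6) / (u + 1 / 2) ^ 4 := by
      rw [add_div, mul_div_cancel_right₀ _ (by positivity)]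
    rw [e, mul_div_assoc', le_div_iff₀ (by positivity)]
    have h3 : 510 * (2.3237 * r) * (u + 1 / 2) ^ 4 ≤ 510 * (u + 2.35) * (u + 1 / 2) ^ 4 := by gcongr
    linarith
  have h2 : 4 * r * ((12.98 * x + 7.26) * x ^ 3) ≤
      (2 + u) ^ 2 * ((12.98 * x + 7.26) * x ^ 3) := by gcongr
  have e1 : 1 + (1 + u) = 2 + u := by ring
  have e2 : 1 + u - 1 / 2 = u + 1 / 2 := by ring
  rw [ratioBound, e1, e2]
  linarith

theorem le_ratioBound_linear (hx : 0 < x) (hk : 1 ≤ k) :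
    √k * (2 * (1 + k) * (96 + (12.98 * x + 7.26) * x ^ 3)) ≤ ratioBound x k := by
  have h : 2 * √k ≤ 1 + k := by
    nlinarith [Real.sq_sqrt (show 0 ≤ k by linarith), sq_nonneg (√k - 1)]
  have hj : 0 < k - 1 / 2 := by linarith
  calc √k * (2 * (1 + k) * (96 + (12.98 * x + 7.26) * x ^ 3))
      = 2 * √k * ((1 + k) * (96 + (12.98 * x + 7.26) * x ^ 3)) := by ring
    _ ≤ (1 + k) * ((1 + k) * (96 + (12.98 * x + 7.26) * x ^ 3)) := by gcongr
    _ ≤ (1 + k) * ((1 + k) * (96 + 6 / (k - 1 / 2) ^ 4 + (12.98 * x + 7.26) * x ^ 3)) := by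
        gcongr
        linarith [show 0 ≤ 6 / (k - 1 / 2) ^ 4 by positivity]
    _ = _ := by
        unfold ratioBound
        ring

/-- The factor by which the sample size exceeds the square of the curvature. -/
noncomputable def sampleDemand (x y : ℝ) : ℝ := max y 1 * (900 / min x 1 + 1300)

theorem sq_div_add_one_le {y : ℝ} (hy : 0 ≤ y) : y ^ 2 / (y + 1) ≤ y := by
  rw [div_le_iff₀ (by linarith)]
  nlinarith

theorem sq_div_add_one_le' {y : ℝ} (hy : 1 ≤ y) : y ^ 2 / (y + 1) ≤ y - 1 / 2 := by
  rw [div_le_iff₀ (by linarith)]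
  nlinarith

/-- The four conditions of `curvature_sq_mul_le_of_ratioBound`. -/
def RatioCond (x k L : ℝ) : Prop :=
  L * (60 / 17) * (2 + x ^ 2 / (x + 1)) ≤ ratioBound x k ∧
  L * (20 / 17) * ((1 + 2 / k) * (2 + (k * x) ^ 2 / (k * x + 1))) ≤ ratioBound x k ∧
  L * (20 / 17) * (2 + (x + k * x) ^ 2 / (x + k * x + 1)) ≤ ratioBound x k ∧
  L * (20 / 3) * (1 + 2 * x ^ 2 / (2 * x + 1)) ≤ ratioBound x k

theorem ratioCond_of_le_one (hx : 0.2 ≤ x) (hk : 1 ≤ k) (hy : k * x ≤ 1) {L : ℝ} (hL : 0 < L)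
    (hL2 : L ^ 2 = 900 / x + 1300) : RatioCond x k L := by
  have hx0 : 0 < x := by linarith
  have hk0 : 0 < k := by linarith
  have hx1 : x ≤ 1 := by nlinarith
  have hW := le_ratioBound_const hx0 hk
  -- AM–GM at L = 70, a value between √2200 and √5800, the extremes of L for x between 0.2 and 1.
  have h1 : L * x ≤ 45 / 7 + 44.286 * x := by
    have : L ^ 2 * x = 900 + 1300 * x := by
      rw [hL2]
      field_simp
    nlinarith [mul_nonneg hx0.le (sq_nonneg (L - 70))]
  refine ⟨le_trans ?_ hW, le_trans ?_ hW, le_trans ?_ hW, le_trans ?_ hW⟩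
  · have e : L * (60 / 17) * (2 + x ^ 2 / (x + 1)) =
        (60 / 17) * ((L * x) * (x ^ 2 + 2 * x + 2)) / (x * (x + 1)) := by
      field_simp
      ring
    rw [e, div_le_iff₀ (by positivity)]
    calc _ ≤ 60 / 17 * ((45 / 7 + 44.286 * x) * (x ^ 2 + 2 * x + 2)) := by gcongr
      _ ≤ _ := by nlinarith [mul_nonneg (sub_nonneg.2 hx) (sub_nonneg.2 hx1)]
  · have h2 : (1 + 2 / k) * (2 + (k * x) ^ 2 / (k * x + 1)) ≤ 6 + 1.5 * x := by
      have h3 : (k * x) ^ 2 / (k * x + 1) ≤ k * x / 2 := by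
        rw [div_le_iff₀ (by positivity)]
        nlinarith [mul_pos hk0 hx0]
      calc _ ≤ (1 + 2 / k) * (2 + k * x / 2) := by gcongr
        _ = 2 + x + (4 / k + k * x / 2) := by
            field_simp
            ring
        _ ≤ 2 + x + (4 + x / 2) := by
            have : 4 / k + k * x / 2 - (4 + x / 2) = (k - 1) * (k * x - 8) / (2 * k) := by
              field_simp
              ring
            have : (k - 1) * (k * x - 8) / (2 * k) ≤ 0 :=
              div_nonpos_of_nonpos_of_nonneg
                (mul_nonpos_of_nonneg_of_nonpos (by linarith) (by linarith)) (by positivity)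
            linarith
        _ = _ := by ring
    have h4 : x * (L * (20 / 17) * (6 + 1.5 * x)) ≤ x * 580 := by
      calc _ = (L * x) * (20 / 17) * (6 + 1.5 * x) := by ring
        _ ≤ (45 / 7 + 44.286 * x) * (20 / 17) * (6 + 1.5 * x) := by gcongr
        _ ≤ _ := by nlinarith [mul_nonneg (sub_nonneg.2 hx) (sub_nonneg.2 hx1)]
    have h5 := le_of_mul_le_mul_left h4 hx0
    refine le_trans ?_ h5
    gcongr
  · have h3 : (x + k * x) ^ 2 / (x + k * x + 1) ≤ 4 / 3 := by
      rw [div_le_iff₀ (by positivity)]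
      have : 0 < k * x := by positivity
      nlinarith
    have h4 : L ≤ 80 := by
      have : L * x ≤ 80 * x := by linarith
      exact le_of_mul_le_mul_right this hx0
    calc _ ≤ 80 * (20 / 17) * (2 + 4 / 3 : ℝ) := by gcongr
      _ ≤ _ := by norm_num
  · have e : L * (20 / 3) * (1 + 2 * x ^ 2 / (2 * x + 1)) =
        (20 / 3) * ((L * x) * (2 * x ^ 2 + 2 * x + 1)) / (x * (2 * x + 1)) := by
      field_simp
      ring
    rw [e, div_le_iff₀ (by positivity)]
    calc _ ≤ 20 / 3 * ((45 / 7 + 44.286 * x) * (2 * x ^ 2 + 2 * x + 1)) := by gcongr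
      _ ≤ _ := by
        nlinarith [mul_nonneg (sub_nonneg.2 hx) (sub_nonneg.2 hx1),
          mul_nonneg hx0.le (mul_nonneg (sub_nonneg.2 hx) (sub_nonneg.2 hx1))]

/-- For k x ≥ 1 the demand is proportional to k, so L carries a factor √k. It cancels against the
same factor in the lower bounds of `ratioBound`, and the remaining conditions involve x alone. -/
theorem ratioCond_of_one_le (hx : 0 < x) (hk : 1 ≤ k) (hy : 1 ≤ k * x) {M E : ℝ} (hM : 0 < M)
    (hE : E = (12.98 * x + 7.26) * x ^ 3)
    (h1 : M * (60 / 17) * (2 + x ^ 2 / (x + 1)) ≤ 510 + 4 * E)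
    (h2 : M * (20 / 3) * (1 + 2 * x ^ 2 / (2 * x + 1)) ≤ 510 + 4 * E)
    (h3 : M * (20 / 17) * x ≤ 96 + E)
    (h4 : M * (20 / 17) * (2 * x + 9 / 2) ≤ 351 + 3 * E)
    (h5 : M * (20 / 17) * (2 + x) ≤ 192 + 2 * E) : RatioCond x k (√k * M) := by
  have hk0 : 0 < k := by linarith
  have hr : 0 < √k := Real.sqrt_pos.2 hk0
  have W1 := le_ratioBound_sqrt hx hk
  have W2 := le_ratioBound_linear hx hk
  rw [← hE] at W1 W2
  refine ⟨le_trans ?_ W1, ?_, le_trans ?_ W2, le_trans ?_ W1⟩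
  · calc _ = √k * (M * (60 / 17) * (2 + x ^ 2 / (x + 1))) := by ring
      _ ≤ _ := by gcongr
  · have e : (1 + 2 / k) * (2 + (k * x) ^ 2 / (k * x + 1)) ≤ k * x + (2 * x + 9 / 2) := by
      calc _ ≤ (1 + 2 / k) * (2 + (k * x - 1 / 2)) := by
            gcongr
            exact sq_div_add_one_le' hy
        _ = k * x + 2 * x + 3 / 2 + 3 * (1 / k) := by
            field_simp
            ring
        _ ≤ k * x + 2 * x + 3 / 2 + 3 * 1 := by
            gcongr
            rw [div_le_one hk0]
            exact hk
        _ = _ := by ring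
    calc _ ≤ √k * M * (20 / 17) * (k * x + (2 * x + 9 / 2)) := by gcongr
      _ = √k * (k * (M * (20 / 17) * x) + M * (20 / 17) * (2 * x + 9 / 2)) := by ring
      _ ≤ √k * (k * (96 + E) + (351 + 3 * E)) := by gcongr
      _ ≤ _ := by linarith
  · calc _ ≤ √k * M * (20 / 17) * (2 + (x + k * x)) := by
          gcongr
          exact sq_div_add_one_le (by positivity)
      _ = √k * (k * (M * (20 / 17) * x) + M * (20 / 17) * (2 + x)) := by ring
      _ ≤ √k * (k * (96 + E) + (192 + 2 * E)) := by gcongr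
      _ ≤ √k * (2 * (1 + k) * (96 + E)) := by
          have : 0 ≤ E := by
            rw [hE]
            positivity
          gcongr
          nlinarith
  · calc _ = √k * (M * (20 / 3) * (1 + 2 * x ^ 2 / (2 * x + 1))) := by ring
      _ ≤ _ := by gcongr

theorem ratioCond_of_le_one_of_one_le (hx : 0.2 ≤ x) (hx1 : x ≤ 1) (hk : 1 ≤ k)
    (hy : 1 ≤ k * x) {M : ℝ} (hM : 0 < M) (hM2 : M ^ 2 = 900 + 1300 * x) :
    RatioCond x k (√k * M) := by
  have hx0 : 0 < x := by linarith
  -- AM–GM at M = 46, with rounded coefficients.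
  have hM1 : M ≤ 32.79 + 14.14 * x := by nlinarith [sq_nonneg (M - 46)]
  have hx3 : 0 ≤ x ^ 3 := by positivity
  have hx4 : 0 ≤ x ^ 4 := by positivity
  have hd : 0 ≤ (x - 0.2) * (1 - x) := mul_nonneg (by linarith) (by linarith)
  refine ratioCond_of_one_le hx0 hk hy hM rfl ?_ ?_ ?_ ?_ ?_
  · calc _ ≤ (32.79 + 14.14 * x) * (60 / 17) * (2 + 1 / 2) := by
          have : x ^ 2 / (x + 1) ≤ 1 / 2 := by
            rw [div_le_iff₀ (by linarith)]
            nlinarith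
          gcongr
      _ ≤ _ := by nlinarith
  · have e : (32.79 + 14.14 * x) * (20 / 3) * (1 + 2 * x ^ 2 / (2 * x + 1)) =
        (32.79 + 14.14 * x) * (20 / 3) * (2 * x ^ 2 + 2 * x + 1) / (2 * x + 1) := by
      field_simp
      ring
    calc _ ≤ (32.79 + 14.14 * x) * (20 / 3) * (1 + 2 * x ^ 2 / (2 * x + 1)) := by gcongr
      _ ≤ _ := by
        rw [e, div_le_iff₀ (by linarith)]
        nlinarith [mul_nonneg hx0.le hd, mul_nonneg hx3 hx0.le]
  · nlinarith
  · nlinarith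
  · nlinarith

/-- The constant satisfies 46.91² > 2200. The substitution x = (1 + u)² removes the square root and
leaves polynomial inequalities in u ≥ 0. -/
theorem ratioCond_of_one_le_of_one_le (hx : 1 ≤ x) (hk : 1 ≤ k) :
    RatioCond x k (√k * (46.91 * √x)) := by
  obtain ⟨u, hu, rfl⟩ : ∃ u, 0 ≤ u ∧ x = (1 + u) ^ 2 :=
    ⟨√x - 1, sub_nonneg.2 (Real.one_le_sqrt.2 hx), by
      rw [add_sub_cancel, Real.sq_sqrt (by linarith)]⟩
  have h1u : 0 < 1 + u := by linarith
  rw [Real.sqrt_sq h1u.le]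
  have p1 := pow_nonneg hu 2
  have p2 := pow_nonneg hu 3
  have p3 := pow_nonneg hu 4
  have p4 := pow_nonneg hu 5
  have p5 := pow_nonneg hu 6
  have p6 := pow_nonneg hu 7
  have p7 := pow_nonneg hu 8
  have p8 := pow_nonneg hu 9
  have p9 := pow_nonneg hu 10
  refine ratioCond_of_one_le (by positivity) hk (by nlinarith) (by positivity) rfl ?_ ?_ ?_ ?_ ?_
  · have e : 46.91 * (1 + u) * (60 / 17) * (2 + ((1 + u) ^ 2) ^ 2 / ((1 + u) ^ 2 + 1)) =
        46.91 * (1 + u) * (60 / 17) * ((1 + u) ^ 4 + 2 * (1 + u) ^ 2 + 2) / ((1 + u) ^ 2 + 1) := by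
      field_simp
      ring
    rw [e, div_le_iff₀ (by positivity)]
    nlinarith
  · have e : 46.91 * (1 + u) * (20 / 3) * (1 + 2 * ((1 + u) ^ 2) ^ 2 / (2 * (1 + u) ^ 2 + 1)) =
        46.91 * (1 + u) * (20 / 3) * (2 * (1 + u) ^ 4 + 2 * (1 + u) ^ 2 + 1) /
          (2 * (1 + u) ^ 2 + 1) := by
      field_simp
      ring
    rw [e, div_le_iff₀ (by positivity)]
    have q := sq_nonneg (u - 0.13)
    linarith [mul_nonneg p1 q, mul_nonneg p2 q, mul_nonneg p3 q, mul_nonneg p4 q,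
      mul_nonneg p5 q, mul_nonneg p6 q, mul_nonneg p7 q, mul_nonneg hu q]
  · nlinarith
  · nlinarith
  · nlinarith

end

section

variable {x k : ℝ}

theorem ratioBound_ge_sq (hx : 0 < x) (hk : 1 ≤ k) : 96 * (1 + k) ^ 2 ≤ ratioBound x k := by
  have hj : 0 < k - 1 / 2 := by linarith
  have : 0 ≤ 6 / (k - 1 / 2) ^ 4 + (12.98 * x + 7.26) * x ^ 3 := by positivity
  unfold ratioBound
  nlinarith [mul_nonneg (sq_nonneg (1 + k)) this]

theorem ratioCond_of_small_of_le_one (hx : 0 < x) (hx2 : x ≤ 0.2) (hy : 0.3 ≤ k * x)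
    (hy1 : k * x ≤ 1) {L : ℝ} (hL : 0 < L) (hL2 : L ^ 2 = 900 / x + 1300) : RatioCond x k L := by
  have hk : 1.5 ≤ k := by
    by_contra h
    nlinarith
  have hk0 : 0 < k := by linarith
  have hW := ratioBound_ge_sq hx (show 1 ≤ k by linarith)
  have hxk : 6.5 ≤ x * (1 + k) ^ 4 := by
    have h1 : 1.2 * x ≤ (x + k * x) ^ 2 := by nlinarith [sq_nonneg (x - 0.3)]
    have h2 : (1.2 * x) ^ 2 ≤ ((x + k * x) ^ 2) ^ 2 := by gcongr
    have h3 : x ^ 3 * 6.5 ≤ x ^ 3 * (x * (1 + k) ^ 4) := by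
      calc _ = x ^ 2 * (6.5 * x) := by ring
        _ ≤ x ^ 2 * 1.44 := by
            gcongr
            linarith
        _ = (1.2 * x) ^ 2 := by ring
        _ ≤ _ := h2
        _ = _ := by ring
    exact le_of_mul_le_mul_left h3 (by positivity)
  have hLk : 7.18 * L ≤ 96 * (1 + k) ^ 2 := by
    refine (pow_le_pow_iff_left₀ (by positivity) (by positivity) two_ne_zero).1 ?_
    have : x * ((7.18 * L) ^ 2) ≤ x * ((96 * (1 + k) ^ 2) ^ 2) := by
      have e : x * ((7.18 * L) ^ 2) = 7.18 ^ 2 * (900 + 1300 * x) := by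
        rw [mul_pow, hL2]
        field_simp
      rw [e]
      nlinarith
    exact le_of_mul_le_mul_left this hx
  have hg := hLk.trans hW
  have hA : x ^ 2 / (x + 1) ≤ 0.0334 := by
    rw [div_le_iff₀ (by linarith)]
    nlinarith
  have hB : (k * x) ^ 2 / (k * x + 1) ≤ 0.5 := by
    rw [div_le_iff₀ (by linarith)]
    nlinarith
  have hC : (x + k * x) ^ 2 / (x + k * x + 1) ≤ 0.66 := by
    rw [div_le_iff₀ (by linarith)]
    nlinarith
  have hE : 2 * x ^ 2 / (2 * x + 1) ≤ 0.0572 := by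
    rw [div_le_iff₀ (by linarith)]
    nlinarith
  have hB' : 2 / k ≤ 4 / 3 := by
    rw [div_le_iff₀ (by linarith)]
    linarith
  refine ⟨le_trans ?_ hg, le_trans ?_ hg, le_trans ?_ hg, le_trans ?_ hg⟩
  · calc _ ≤ L * (60 / 17) * (2 + 0.0334) := by gcongr
      _ ≤ _ := by linarith
  · calc _ ≤ L * (20 / 17) * ((1 + 4 / 3) * (2 + 0.5)) := by gcongr
      _ ≤ _ := by linarith
  · calc _ ≤ L * (20 / 17) * (2 + 0.66) := by gcongr
      _ ≤ _ := by linarith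
  · calc _ ≤ L * (20 / 3) * (1 + 0.0572) := by gcongr
      _ ≤ _ := by linarith

theorem ratioCond_of_small_of_one_le (hx : 0 < x) (hx2 : x ≤ 0.2) (hy1 : 1 ≤ k * x)
    {M : ℝ} (hM : 0 < M) (hM2 : M ^ 2 = 900 + 1300 * x) : RatioCond x k (√k * M) := by
  have hk : 5 ≤ k := by
    by_contra h
    nlinarith
  have hk0 : 0 < k := by linarith
  have hr : 0 < √k := Real.sqrt_pos.2 hk0
  have hM1 : M ≤ 34.06 := by nlinarith
  have hW : √k * (192 * (1 + k)) ≤ ratioBound x k := by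
    refine le_trans ?_ (le_ratioBound_linear hx (by linarith))
    have : 0 ≤ (12.98 * x + 7.26) * x ^ 3 := by positivity
    refine mul_le_mul_of_nonneg_left ?_ hr.le
    nlinarith
  have hA : x ^ 2 / (x + 1) ≤ 0.0334 := by
    rw [div_le_iff₀ (by linarith)]
    nlinarith
  have hE : 2 * x ^ 2 / (2 * x + 1) ≤ 0.0572 := by
    rw [div_le_iff₀ (by linarith)]
    nlinarith
  have hB' : 2 / k ≤ 0.4 := by
    rw [div_le_iff₀ (by linarith)]
    linarith
  have hkx : k * x ≤ 0.2 * k := by nlinarith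
  refine ⟨le_trans ?_ hW, le_trans ?_ hW, le_trans ?_ hW, le_trans ?_ hW⟩
  · calc _ = √k * (M * (60 / 17) * (2 + x ^ 2 / (x + 1))) := by ring
      _ ≤ √k * (34.06 * (60 / 17) * (2 + 0.0334)) := by gcongr
      _ ≤ _ := by
        refine mul_le_mul_of_nonneg_left ?_ hr.le
        linarith
  · calc _ = √k * (M * (20 / 17) * ((1 + 2 / k) * (2 + (k * x) ^ 2 / (k * x + 1)))) := by ring
      _ ≤ √k * (34.06 * (20 / 17) * ((1 + 0.4) * (2 + k * x))) := by
        gcongr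
        exact sq_div_add_one_le (by positivity)
      _ ≤ _ := by
        refine mul_le_mul_of_nonneg_left ?_ hr.le
        linarith
  · calc _ = √k * (M * (20 / 17) * (2 + (x + k * x) ^ 2 / (x + k * x + 1))) := by ring
      _ ≤ √k * (34.06 * (20 / 17) * (2 + (x + k * x))) := by
        gcongr
        exact sq_div_add_one_le (by positivity)
      _ ≤ _ := by
        refine mul_le_mul_of_nonneg_left ?_ hr.le
        linarith
  · calc _ = √k * (M * (20 / 3) * (1 + 2 * x ^ 2 / (2 * x + 1))) := by ring
      _ ≤ √k * (34.06 * (20 / 3) * (1 + 0.0572)) := by gcongr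
      _ ≤ _ := by
        refine mul_le_mul_of_nonneg_left ?_ hr.le
        linarith

theorem inv_cube_lower (hk : 1 ≤ k) :
    5 / k ^ 3 + 20 / k ^ 5 ≤ 6 / (k - 1 / 2) ^ 4 + 6 / (k + 1 / 2) ^ 3 := by
  obtain ⟨u, rfl⟩ : ∃ u, k = 1 + u := ⟨k - 1, by ring⟩
  have hu : 0 ≤ u := by linarith
  have e1 : 1 + u - 1 / 2 = (1 + 2 * u) / 2 := by ring
  have e2 : 1 + u + 1 / 2 = (3 + 2 * u) / 2 := by ring
  have e3 : 5 / (1 + u) ^ 3 + 20 / (1 + u) ^ 5 = (5 * (1 + u) ^ 2 + 20) / (1 + u) ^ 5 := by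
    field_simp
  have e4 : 6 / ((1 + 2 * u) / 2) ^ 4 + 6 / ((3 + 2 * u) / 2) ^ 3 =
      (96 * (3 + 2 * u) ^ 3 + 48 * (1 + 2 * u) ^ 4) / ((1 + 2 * u) ^ 4 * (3 + 2 * u) ^ 3) := by
    field_simp
    ring
  rw [e1, e2, e3, e4, div_le_div_iff₀ (by positivity) (by positivity), ← sub_nonneg]
  ring_nf
  positivity

theorem mul_hurwitzSum_two_of_small (hx : 0 < x) (hx2 : x ≤ 0.2) {y : ℝ} (hy : 0 < y)
    (hy3 : y ≤ 0.3) : hurwitzSum 2 x * hurwitzSum 2 y ≤ 1.18 / (x ^ 2 * y ^ 2) := by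
  have h1 : hurwitzSum 2 x ≤ 1.0572 / x ^ 2 := by
    refine (hurwitzSum_two_le hx).trans ?_
    rw [div_add_div _ _ (by positivity) (by positivity), div_le_div_iff₀ (by positivity)
      (by positivity)]
    have : 1 * (2 * x + 1) + x ^ 2 * 2 ≤ 1.0572 * (2 * x + 1) := by nlinarith
    nlinarith [mul_le_mul_of_nonneg_right this (sq_nonneg x)]
  have h2 : hurwitzSum 2 y ≤ 1.1125 / y ^ 2 := by
    refine (hurwitzSum_two_le hy).trans ?_
    rw [div_add_div _ _ (by positivity) (by positivity), div_le_div_iff₀ (by positivity)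
      (by positivity)]
    have : 1 * (2 * y + 1) + y ^ 2 * 2 ≤ 1.1125 * (2 * y + 1) := by nlinarith
    nlinarith [mul_le_mul_of_nonneg_right this (sq_nonneg y)]
  calc _ ≤ 1.0572 / x ^ 2 * (1.1125 / y ^ 2) :=
        mul_le_mul h1 h2 (hurwitzSum_pos le_rfl hy).le (by positivity)
    _ = 1.0572 * 1.1125 / (x ^ 2 * y ^ 2) := by
        field_simp
    _ ≤ _ := by
        gcongr
        norm_num

theorem cubeBound_eq (hx : 0 < x) : cubeBound x = (2 + x ^ 2 / (x + 1)) / x ^ 3 := by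
  unfold cubeBound
  field_simp
  ring

/-- The product z² v³ is grouped as (2 z v)² v / 4: the bound on z v serves two powers of the
variance, and the cruder bound on v alone the third. -/
theorem sq_cube_le_first {p q δ z v c : ℝ} (hx : 0 < x) (hk : 1 ≤ k) (hq : 0 < q) (hδ : 0 < δ)
    (hz : 0 < z) (hv : 0 < v) (hq2 : q ^ 2 ≤ p * q / k) (hc : c ≤ 2.0334 / x ^ 3)
    (h : 2 * z * v ≤ q * (x * (x + 2 * (k * x)) / (x + k * x) ^ 2) * c / δ)
    (hv2 : v ≤ 2 * x ^ 2 * (1 + k) / k) :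
    1160 / x * (2 * ((20 / 17) ^ 2 * (z ^ 2 * v ^ 3))) ≤
      6640 * ((1 + 2 * k) ^ 2 / (1 + k) ^ 3) / k ^ 2 * (p * q) / (x ^ 5 * δ ^ 2) := by
  have hk0 : 0 < k := by linarith
  have h1 : 2 * z * v ≤ q * (x * (x + 2 * (k * x)) / (x + k * x) ^ 2) * (2.0334 / x ^ 3) / δ := by
    refine h.trans ?_
    gcongr
  calc _ = 1160 / x * (2 * ((20 / 17) ^ 2 * ((2 * z * v) ^ 2 * v / 4))) := by ring
    _ ≤ 1160 / x * (2 * ((20 / 17) ^ 2 * ((q * (x * (x + 2 * (k * x)) / (x + k * x) ^ 2) *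
          (2.0334 / x ^ 3) / δ) ^ 2 * (2 * x ^ 2 * (1 + k) / k) / 4))) := by gcongr
    _ = 1160 * (20 / 17) ^ 2 * 2.0334 ^ 2 * ((1 + 2 * k) ^ 2 / (1 + k) ^ 3) / k * q ^ 2 /
          (x ^ 5 * δ ^ 2) := by
        field_simp
        ring
    _ ≤ 6640 * ((1 + 2 * k) ^ 2 / (1 + k) ^ 3) / k * (p * q / k) / (x ^ 5 * δ ^ 2) := by
        gcongr
        norm_num
    _ = _ := by
        field_simp

theorem sq_cube_le_second {p q δ z v c : ℝ} (hx : 0 < x) (hk : 1 ≤ k) (hp : 0 < p) (hδ : 0 < δ)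
    (hz : 0 < z) (hv : 0 < v) (hp2 : p ^ 2 ≤ k ^ 2 * (p * q)) (hc : c ≤ 2.0693 / (k * x) ^ 3)
    (h : 2 * z * v ≤ p * (k * x * (k * x + 2 * x) / (k * x + x) ^ 2) * c / δ)
    (hv2 : v ≤ 2 * k ^ 2 * x ^ 2 * (1 + k)) :
    1160 / x * (2 * ((20 / 17) ^ 2 * (z ^ 2 * v ^ 3))) ≤
      6876 * ((k + 2) ^ 2 / (1 + k) ^ 3) * (p * q) / (x ^ 5 * δ ^ 2) := by
  have hk0 : 0 < k := by linarith
  have h1 : 2 * z * v ≤ p * (k * x * (k * x + 2 * x) / (k * x + x) ^ 2) *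
      (2.0693 / (k * x) ^ 3) / δ := by
    refine h.trans ?_
    gcongr
  calc _ = 1160 / x * (2 * ((20 / 17) ^ 2 * ((2 * z * v) ^ 2 * v / 4))) := by ring
    _ ≤ 1160 / x * (2 * ((20 / 17) ^ 2 * ((p * (k * x * (k * x + 2 * x) / (k * x + x) ^ 2) *
          (2.0693 / (k * x) ^ 3) / δ) ^ 2 * (2 * k ^ 2 * x ^ 2 * (1 + k)) / 4))) := by gcongr
    _ = 1160 * (20 / 17) ^ 2 * 2.0693 ^ 2 * ((k + 2) ^ 2 / (1 + k) ^ 3) / k ^ 2 * p ^ 2 /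
          (x ^ 5 * δ ^ 2) := by
        field_simp
        ring
    _ ≤ 6876 * ((k + 2) ^ 2 / (1 + k) ^ 3) / k ^ 2 * (k ^ 2 * (p * q)) / (x ^ 5 * δ ^ 2) := by
        gcongr
        norm_num
    _ = _ := by
        field_simp

theorem sq_cube_le_third {p q δ z S c : ℝ} (hx : 0 < x) (hk : 1 ≤ k) (hp : 0 < p) (hq : 0 < q)
    (hδ : 0 < δ) (hz : 0 < z) (hp2 : p ^ 2 ≤ k ^ 2 * (p * q)) (hq2 : q ^ 2 ≤ p * q / k)
    (hc : c ≤ (2 + 1 / 6) / (x + k * x) ^ 3) (h : 2 * z ≤ c) (hS0 : S = (p + q) / δ)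
    (hS : S ≤ 4 * (x ^ 2 * (1 + k) * (1 + k ^ 3) / k)) :
    1160 / x * ((20 / 17) ^ 2 * (z ^ 2 * S ^ 3)) ≤
      7540 / k * (p * q) / (x ^ 5 * δ ^ 2) := by
  have hk0 : 0 < k := by linarith
  have hpq : (p + q) ^ 2 ≤ (1 + k) ^ 2 * (p * q) := by
    have : p * q / k ≤ p * q := div_le_self (by positivity) hk
    nlinarith [mul_pos hp hq]
  have hk3 : 1 + k ^ 3 ≤ (1 + k) ^ 3 := by nlinarith [sq_nonneg k]
  have hS1 : 0 < S := by
    rw [hS0]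
    positivity
  calc _ = 1160 / x * ((20 / 17) ^ 2 * ((2 * z) ^ 2 * ((p + q) ^ 2 / δ ^ 2 * S) / 4)) := by
        rw [← div_pow, ← hS0]
        ring
    _ ≤ 1160 / x * ((20 / 17) ^ 2 * (((2 + 1 / 6) / (x + k * x) ^ 3) ^ 2 *
          ((1 + k) ^ 2 * (p * q) / δ ^ 2 * (4 * (x ^ 2 * (1 + k) * (1 + k ^ 3) / k))) / 4)) := by
        have := h.trans hc
        gcongr
    _ = 1160 * (20 / 17) ^ 2 * (2 + 1 / 6) ^ 2 * ((1 + k ^ 3) / (1 + k) ^ 3) / k * (p * q) /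
          (x ^ 5 * δ ^ 2) := by
        field_simp
    _ ≤ 7540 * 1 / k * (p * q) / (x ^ 5 * δ ^ 2) := by
        gcongr
        · norm_num
        · rw [div_le_one (by positivity)]
          exact hk3
    _ = _ := by rw [mul_one]

/-- This introduces the squared determinant into those entries of `curvature` that are bounded
without it, so that they can be compared with a sample size bound having it in the denominator. -/
theorem one_le_of_fisherDet_le {P δ : ℝ} (hx : 0 < x) (hk : 1 ≤ k) (hP : 0 < P) (hδ : 0 < δ)
    (h1 : δ ≤ P * (2 * x * (k * x) / (x + k * x) ^ 2)) (h2 : P ≤ 1.18 / (x ^ 2 * (k * x) ^ 2)) :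
    x ^ 4 * (1 + k) ^ 4 ≤ 4.72 * P / δ ^ 2 := by
  have hk0 : 0 < k := by linarith
  rw [le_div_iff₀ (by positivity)]
  calc _ ≤ x ^ 4 * (1 + k) ^ 4 * (P * (2 * x * (k * x) / (x + k * x) ^ 2)) ^ 2 := by gcongr
    _ = P * (P * (4 * k ^ 2 * x ^ 4)) := by
        field_simp
        ring
    _ ≤ P * (1.18 / (x ^ 2 * (k * x) ^ 2) * (4 * k ^ 2 * x ^ 4)) := by gcongr
    _ = _ := by
        field_simp
        ring

/-- Every entry of the squared curvature is brought to the form F P / (x⁵ δ²); the missing factor x²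
is supplied by k x ≤ 0.3. -/
theorem le_of_demand {D N B F P δ : ℝ} (hx : 0 < x) (hk : 1 ≤ k) (hx2k : x ^ 2 ≤ 0.09 / k ^ 2)
    (hP : 0 < P) (hδ : 0 < δ) (hD : D ≤ 1160 / x) (hB : 0 ≤ B)
    (h1 : 1160 / x * B ≤ F * P / (x ^ 5 * δ ^ 2)) (h2 : F * 0.09 ≤ 480 + 1920 / k ^ 2)
    (hF : 0 ≤ F) (hN : 96 * (5 / k ^ 2 + 20 / k ^ 4) * P / (x ^ 7 * δ ^ 2) ≤ N) :
    D * B ≤ N := by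
  have hk0 : 0 < k := by linarith
  have h3 : F * x ^ 2 ≤ 96 * (5 / k ^ 2 + 20 / k ^ 4) := by
    calc F * x ^ 2 ≤ F * (0.09 / k ^ 2) := by gcongr
      _ = F * 0.09 / k ^ 2 := by ring
      _ ≤ (480 + 1920 / k ^ 2) / k ^ 2 := by gcongr
      _ = _ := by
          field_simp
          ring
  calc D * B ≤ 1160 / x * B := by gcongr
    _ ≤ F * P / (x ^ 5 * δ ^ 2) := h1
    _ = (F * x ^ 2) * P / (x ^ 7 * δ ^ 2) := by field_simp
    _ ≤ (96 * (5 / k ^ 2 + 20 / k ^ 4)) * P / (x ^ 7 * δ ^ 2) := by gcongr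
    _ ≤ N := hN

theorem sq_div_add_one_mono {y c : ℝ} (hy : 0 ≤ y) (h : y ≤ c) :
    y ^ 2 / (y + 1) ≤ c ^ 2 / (c + 1) := by
  rw [div_le_div_iff₀ (by linarith) (by linarith)]
  nlinarith [mul_nonneg hy (sub_nonneg.2 h), mul_nonneg (mul_nonneg hy (sub_nonneg.2 h)) (hy.trans h)]

theorem first_condition (hk : 1 ≤ k) :
    (6640 * ((1 + 2 * k) ^ 2 / (1 + k) ^ 3) / k ^ 2 + 6876 * ((k + 2) ^ 2 / (1 + k) ^ 3)) * 0.09 ≤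
      480 + 1920 / k ^ 2 := by
  have h1 : (1 + 2 * k) ^ 2 / (1 + k) ^ 3 ≤ 9 / 8 := by
    rw [div_le_iff₀ (by positivity)]
    nlinarith [sq_nonneg (k - 1), mul_nonneg (sub_nonneg.2 hk) (sq_nonneg k)]
  have h2 : (k + 2) ^ 2 / (1 + k) ^ 3 ≤ 9 / 4 / (1 + k) := by
    rw [div_le_div_iff₀ (by positivity) (by positivity)]
    have : (k + 2) ^ 2 ≤ 9 / 4 * (1 + k) ^ 2 := by nlinarith
    nlinarith [mul_le_mul_of_nonneg_right this (show 0 ≤ 1 + k by linarith)]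
  have h3 : 1393 / (1 + k) ≤ 480 + 1247 / k ^ 2 := by
    rw [← sub_nonneg]
    have e : 480 + 1247 / k ^ 2 - 1393 / (1 + k) =
        (480 * k ^ 3 - 913 * k ^ 2 + 1247 * k + 1247) / (k ^ 2 * (1 + k)) := by
      field_simp
      ring
    rw [e]
    have : 0 ≤ k * (480 * k ^ 2 - 913 * k + 1247) :=
      mul_nonneg (by linarith) (by nlinarith [sq_nonneg (k - 0.95)])
    exact div_nonneg (by linarith) (by positivity)
  calc _ ≤ (6640 * (9 / 8) / k ^ 2 + 6876 * (9 / 4 / (1 + k))) * 0.09 := by gcongr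
    _ = 672.3 * (1 / k ^ 2) + 1392.39 * (1 / (1 + k)) := by ring
    _ ≤ 673 * (1 / k ^ 2) + 1393 * (1 / (1 + k)) := by
        gcongr <;> norm_num
    _ = 673 / k ^ 2 + 1393 / (1 + k) := by ring
    _ ≤ 673 / k ^ 2 + (480 + 1247 / k ^ 2) := by gcongr
    _ = _ := by ring

theorem second_condition (hk : 1 ≤ k) : 7540 / k * 0.09 ≤ 480 + 1920 / k ^ 2 := by
  have hk0 : 0 < k := by linarith
  have e : 480 + 1920 / k ^ 2 - 7540 / k * 0.09 = (480 * k ^ 2 - 678.6 * k + 1920) / k ^ 2 := by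
    field_simp
    ring
  have : 0 ≤ (480 * k ^ 2 - 678.6 * k + 1920) / k ^ 2 :=
    div_nonneg (by nlinarith [sq_nonneg (k - 0.7)]) (by positivity)
  linarith

theorem third_condition (hk : 1 ≤ k) {j : ℝ} (hj : j ≤ k ^ 2) :
    121700 * j / (1 + k) ^ 3 * 0.09 ≤ (480 + 1920 / k ^ 2) * k ^ 2 := by
  have hk0 : 0 < k := by linarith
  have e : (480 + 1920 / k ^ 2) * k ^ 2 = 480 * k ^ 2 + 1920 := by field_simp
  rw [e, div_mul_eq_mul_div, div_le_iff₀ (by positivity)]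
  have : 6.75 * k ^ 2 ≤ (1 + k) ^ 3 := by
    have := mul_nonneg (show 0 ≤ 4 * k + 1 by linarith) (sq_nonneg (k - 2))
    nlinarith
  nlinarith [mul_nonneg (sq_nonneg k) (pow_nonneg (show 0 ≤ 1 + k by linarith) 3)]

theorem sq_le_of_ratio {p q : ℝ} (hk : 1 ≤ k) (hp : 0 < p) (hq : 0 < q) (r1 : k * q ≤ p)
    (r2 : (1 / k) ^ 2 * p ≤ q) : p ^ 2 ≤ k ^ 2 * (p * q) ∧ q ^ 2 ≤ p * q / k := by
  have hk0 : 0 < k := by linarith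
  have h : p ≤ k ^ 2 * q := by
    calc p = k ^ 2 * ((1 / k) ^ 2 * p) := by field_simp
      _ ≤ _ := by gcongr
  constructor
  · nlinarith
  · rw [le_div_iff₀ hk0]
    nlinarith

/-- When both parameters are small, the lower bound for the sample size comes from the product of
the two G terms (`betaG_mul_le`) instead of the drift. -/
theorem sampleDemand_mul_curvature_sq_le_of_small (hx : 0 < x) (hx2 : x ≤ 0.2) (hk : 1 ≤ k)
    (hy3 : k * x ≤ 0.3) {D N : ℝ} (hD : D ≤ 1160 / x)
    (hN : 96 * (5 / k ^ 2 + 20 / k ^ 4) * (hurwitzSum 2 x * hurwitzSum 2 (k * x)) /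
      (x ^ 7 * fisherDet x (k * x) ^ 2) ≤ N) : D * curvature x (k * x) ^ 2 ≤ N := by
  have hk0 : 0 < k := by linarith
  have hxy : x ≤ k * x := by nlinarith
  have hy : 0 < k * x := by positivity
  have hs : 0 < x + k * x := by positivity
  have hp := hurwitzSum_pos (j := 2) le_rfl hx
  have hq := hurwitzSum_pos (j := 2) le_rfl hy
  have hδ := fisherDet_pos hx hy
  have va := estVar_pos hx hy
  have vb := estVar_pos hy hx
  have za := hurwitzSum_pos (j := 3) (by norm_num) hx
  have zb := hurwitzSum_pos (j := 3) (by norm_num) hy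
  have zs := hurwitzSum_pos (j := 3) (by norm_num) hs
  have r1 := mul_hurwitzSum_two_le hx hxy
  have r2 := sq_mul_hurwitzSum_two_le hx hxy
  have e1 : k * x / x = k := by field_simp
  have e2 : x / (k * x) = 1 / k := by field_simp
  rw [e1] at r1
  rw [e2] at r2
  have va_le : estVar x (k * x) ≤ 2 * x ^ 2 * (1 + k) / k := by
    refine (estVar_le hx hy).trans_eq ?_
    field_simp
  have vb_le : estVar (k * x) x ≤ 2 * k ^ 2 * x ^ 2 * (1 + k) := by
    refine (estVar_le hy hx).trans_eq ?_
    field_simp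
    ring
  have a_le := hurwitzSum_three_mul_estVar_le hx hy
  have b_le := hurwitzSum_three_mul_estVar_le hy hx
  have c_le := two_mul_hurwitzSum_three_le hs
  have pq_le := mul_hurwitzSum_two_of_small hx hx2 hy hy3
  have δ_le := fisherDet_le hx hy
  have S_le := estVarSum_le hx hy
  have hcx : cubeBound x ≤ 2.0334 / x ^ 3 := by
    rw [cubeBound_eq hx]
    gcongr
    linarith [sq_div_add_one_mono hx.le hx2]
  have hcy : cubeBound (k * x) ≤ 2.0693 / (k * x) ^ 3 := by
    rw [cubeBound_eq hy]
    gcongr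
    linarith [sq_div_add_one_mono hy.le hy3]
  have hcs : cubeBound (x + k * x) ≤ (2 + 1 / 6) / (x + k * x) ^ 3 := by
    rw [cubeBound_eq hs]
    refine div_le_div_of_nonneg_right ?_ (by positivity)
    linarith [sq_div_add_one_mono hs.le (show x + k * x ≤ 0.5 by linarith)]
  have hx2k : x ^ 2 ≤ 0.09 / k ^ 2 := by
    have : (k * x) ^ 2 ≤ 0.3 ^ 2 := by gcongr
    rw [le_div_iff₀ (by positivity)]
    linarith
  set p := hurwitzSum 2 x with hpdef
  set q := hurwitzSum 2 (k * x) with hqdef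
  set δ := fisherDet x (k * x) with hδdef
  obtain ⟨hp2, hq2⟩ := sq_le_of_ratio hk hp hq r1 r2
  have hP : 0 < p * q := mul_pos hp hq
  have hone := one_le_of_fisherDet_le hx hk hP hδ δ_le pq_le
  have hx5 : 0 < x ^ 5 := by positivity
  refine curvature_sq_mul_le hx hy ?_ ?_ ?_ ?_
  · set a := hurwitzSum 3 x
    set b := hurwitzSum 3 (k * x)
    set v := estVar x (k * x)
    set w := estVar (k * x) x
    have ha := sq_cube_le_first hx hk hq hδ za va hq2 hcx a_le va_le
    rw [fisherDet_comm] at b_le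
    have hb := sq_cube_le_second hx hk hp hδ zb vb hp2 hcy b_le vb_le
    have hsq : (20 / 17 * (a * (v * √v) + b * (w * √w))) ^ 2 ≤
        2 * ((20 / 17) ^ 2 * (a ^ 2 * v ^ 3)) + 2 * ((20 / 17) ^ 2 * (b ^ 2 * w ^ 3)) := by
      have e1 : (a * (v * √v)) ^ 2 = a ^ 2 * v ^ 3 := by
        rw [mul_pow, mul_pow, Real.sq_sqrt va.le]
        ring
      have e2 : (b * (w * √w)) ^ 2 = b ^ 2 * w ^ 3 := by
        rw [mul_pow, mul_pow, Real.sq_sqrt vb.le]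
        ring
      rw [← e1, ← e2]
      linarith [sq_nonneg (a * (v * √v) - b * (w * √w))]
    have hB : 1160 / x * (20 / 17 * (a * (v * √v) + b * (w * √w))) ^ 2 ≤
        (6640 * ((1 + 2 * k) ^ 2 / (1 + k) ^ 3) / k ^ 2 + 6876 * ((k + 2) ^ 2 / (1 + k) ^ 3)) *
          (p * q) / (x ^ 5 * δ ^ 2) := by
      calc _ ≤ 1160 / x * (2 * ((20 / 17) ^ 2 * (a ^ 2 * v ^ 3)) +
            2 * ((20 / 17) ^ 2 * (b ^ 2 * w ^ 3))) := by gcongr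
        _ ≤ _ := by
            rw [mul_add, add_mul, add_div]
            exact add_le_add ha hb
    exact le_of_demand hx hk hx2k hP hδ hD (sq_nonneg _) hB (first_condition hk) (by positivity) hN
  · have hS : 0 < estVarSum x (k * x) := by
      unfold estVarSum
      positivity
    have hS2 : estVarSum x (k * x) ≤ 4 * (x ^ 2 * (1 + k) * (1 + k ^ 3) / k) := by
      refine S_le.trans ?_
      have e : 4 * (x ^ 2 * (1 + k) * (1 + k ^ 3) / k) =
          2 * (2 * x ^ 2 * (1 + k) / k + 2 * k ^ 2 * x ^ 2 * (1 + k)) := by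
        field_simp
        ring
      rw [e, estTrace]
      gcongr
    refine le_of_demand hx hk hx2k hP hδ hD (by positivity)
      (sq_cube_le_third hx hk hp hq hδ zs hp2 hq2 hcs ?_ rfl hS2) (second_condition hk)
      (by positivity) hN
    exact c_le
  · refine le_of_demand (F := 121700 * k / (1 + k) ^ 3 / k ^ 2) hx hk hx2k hP hδ hD
      (by positivity) ?_ ?_ (by positivity) hN
    · calc 1160 / x * (100 / 9 * (estVar x (k * x) / x ^ 2))
          ≤ 1160 / x * (100 / 9 * ((2 * x ^ 2 * (1 + k) / k) / x ^ 2)) := by gcongr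
        _ = 1160 * (100 / 9) * 2 / (k * (1 + k) ^ 3) * (x ^ 4 * (1 + k) ^ 4) / x ^ 5 := by
            field_simp
        _ ≤ 1160 * (100 / 9) * 2 / (k * (1 + k) ^ 3) * (4.72 * (p * q) / δ ^ 2) / x ^ 5 := by
            gcongr
        _ = 1160 * (100 / 9) * 2 * 4.72 * k / (1 + k) ^ 3 / k ^ 2 * (p * q) / (x ^ 5 * δ ^ 2) := by
            field_simp
        _ ≤ _ := by
            gcongr
            norm_num
    · have := third_condition hk (show k ≤ k ^ 2 by nlinarith)
      rw [div_mul_eq_mul_div, div_le_iff₀ (by positivity)]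
      exact this
  · refine le_of_demand (F := 121700 * k ^ 2 / (1 + k) ^ 3 / k ^ 2) hx hk hx2k hP hδ hD
      (by positivity) ?_ ?_ (by positivity) hN
    · calc 1160 / x * (100 / 9 * (estVar (k * x) x / (k * x) ^ 2))
          ≤ 1160 / x * (100 / 9 * ((2 * k ^ 2 * x ^ 2 * (1 + k)) / (k * x) ^ 2)) := by gcongr
        _ = 1160 * (100 / 9) * 2 / (1 + k) ^ 3 * (x ^ 4 * (1 + k) ^ 4) / x ^ 5 := by
            field_simp
        _ ≤ 1160 * (100 / 9) * 2 / (1 + k) ^ 3 * (4.72 * (p * q) / δ ^ 2) / x ^ 5 := by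
            gcongr
        _ = 1160 * (100 / 9) * 2 * 4.72 * k ^ 2 / (1 + k) ^ 3 / k ^ 2 * (p * q) /
              (x ^ 5 * δ ^ 2) := by
            field_simp
        _ ≤ _ := by
            gcongr
            norm_num
    · have := third_condition hk (le_refl (k ^ 2))
      rw [div_mul_eq_mul_div, div_le_iff₀ (by positivity)]
      exact this

/-- The cases are separated by x = 0.2, x = 1, y = 0.3 and y = 1. Only the corner x < 0.2, y < 0.3
uses `hT`; in every other case `hK` suffices, with L² at least the demand. -/
theorem sampleDemand_mul_curvature_sq_le {y c₁ c₂ N : ℝ} (hx : 0 < x) (hxy : x ≤ y)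
    (hc₁ : 96 * y / x ^ 4 + 6.49 * y + 7.26 ≤ c₁)
    (hc₂ : 6 * x / (y - x / 2) ^ 4 + 6.49 * x + 6 / (y + x / 2) ^ 3 + 7.26 ≤ c₂)
    (hK : estTrace x y / 2 * ((hurwitzSum 2 y * c₁ + hurwitzSum 2 x * c₂) / fisherDet x y) ^ 2 ≤ N)
    (hT : hurwitzSum 2 y * c₁ * (hurwitzSum 2 x * c₂) / (x * fisherDet x y ^ 2) ≤ N) :
    sampleDemand x y * curvature x y ^ 2 ≤ N := by
  obtain ⟨k, hk, rfl⟩ : ∃ k, 1 ≤ k ∧ y = k * x :=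
    ⟨y / x, (one_le_div hx).2 hxy, (div_mul_cancel₀ y hx.ne').symm⟩
  have hk0 : 0 < k := by linarith
  have hy : 0 < k * x := by positivity
  have hj : 0 < k - 1 / 2 := by linarith
  have hc₁' : 96 * k / x ^ 3 + 6.49 * (k * x) + 7.26 ≤ c₁ := by
    convert hc₁ using 3
    field_simp
  have e2 : 6 * x / (k * x - x / 2) ^ 4 = 6 / (x ^ 3 * (k - 1 / 2) ^ 4) := by
    rw [show k * x - x / 2 = x * (k - 1 / 2) by ring]
    field_simp
  have e3 : 6 / (k * x + x / 2) ^ 3 = 6 / (k + 1 / 2) ^ 3 / x ^ 3 := by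
    rw [show k * x + x / 2 = x * (k + 1 / 2) by ring]
    field_simp
  rw [e2, e3] at hc₂
  have hpos : 0 ≤ 6 / (k + 1 / 2) ^ 3 / x ^ 3 := by positivity
  have hc₂' : 6 / (x ^ 3 * (k - 1 / 2) ^ 4) + 6.49 * x + 7.26 ≤ c₂ := by linarith
  have fin : ∀ L : ℝ, 0 < L → L ^ 2 = sampleDemand x (k * x) → RatioCond x k L →
      sampleDemand x (k * x) * curvature x (k * x) ^ 2 ≤ N := by
    intro L hL hL2 h
    rw [← hL2]
    exact curvature_sq_mul_le_of_ratioBound hx hk hL hc₁' hc₂' h.1 h.2.1 h.2.2.1 h.2.2.2 hK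
  by_cases h1 : k * x ≤ 1
  · have hx1 : x ≤ 1 := by linarith
    have hsd : sampleDemand x (k * x) = 900 / x + 1300 := by
      rw [sampleDemand, max_eq_right h1, min_eq_left hx1, one_mul]
    have hpos : 0 < 900 / x + 1300 := by positivity
    have hL2 : √(900 / x + 1300) ^ 2 = 900 / x + 1300 := Real.sq_sqrt hpos.le
    by_cases h2 : 0.2 ≤ x
    · exact fin _ (Real.sqrt_pos.2 hpos) (hL2.trans hsd.symm)
        (ratioCond_of_le_one h2 hk h1 (Real.sqrt_pos.2 hpos) hL2)
    rw [not_le] at h2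
    by_cases h3 : 0.3 ≤ k * x
    · exact fin _ (Real.sqrt_pos.2 hpos) (hL2.trans hsd.symm)
        (ratioCond_of_small_of_le_one hx h2.le h3 h1 (Real.sqrt_pos.2 hpos) hL2)
    rw [not_le] at h3
    refine sampleDemand_mul_curvature_sq_le_of_small hx h2.le hk h3.le ?_ (le_trans ?_ hT)
    · rw [hsd, le_div_iff₀ hx, add_mul, div_mul_cancel₀ _ hx.ne']
      linarith
    · have hp := hurwitzSum_pos (j := 2) le_rfl hx
      have hq := hurwitzSum_pos (j := 2) le_rfl hy
      have hδ := fisherDet_pos hx hy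
      have a1 : 96 * k / x ^ 3 ≤ c₁ := by linarith
      have a2 : (5 / k ^ 3 + 20 / k ^ 5) / x ^ 3 ≤ c₂ := by
        have := div_le_div_of_nonneg_right (inv_cube_lower hk) (show 0 ≤ x ^ 3 by positivity)
        rw [add_div (6 / (k - 1 / 2) ^ 4), div_div, mul_comm ((k - 1 / 2) ^ 4)] at this
        linarith
      have hc1 : 0 ≤ c₁ := le_trans (by positivity) a1
      calc _ = hurwitzSum 2 (k * x) * (96 * k / x ^ 3) *
            (hurwitzSum 2 x * ((5 / k ^ 3 + 20 / k ^ 5) / x ^ 3)) /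
            (x * fisherDet x (k * x) ^ 2) := by
            field_simp
        _ ≤ _ := by gcongr
  · rw [not_le] at h1
    have hr : 0 < √k := Real.sqrt_pos.2 hk0
    by_cases h2 : x ≤ 1
    · have hsd : sampleDemand x (k * x) = k * (900 + 1300 * x) := by
        rw [sampleDemand, max_eq_left h1.le, min_eq_left h2]
        field_simp
      have hpos : 0 < 900 + 1300 * x := by positivity
      have hM := Real.sq_sqrt hpos.le
      have hL2 : (√k * √(900 + 1300 * x)) ^ 2 = sampleDemand x (k * x) := by
        rw [mul_pow, Real.sq_sqrt hk0.le, hM, hsd]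
      have hMp := Real.sqrt_pos.2 hpos
      by_cases h3 : 0.2 ≤ x
      · exact fin _ (by positivity) hL2
          (ratioCond_of_le_one_of_one_le h3 h2 hk h1.le hMp hM)
      · exact fin _ (by positivity) hL2
          (ratioCond_of_small_of_one_le hx (not_le.1 h3).le h1.le hMp hM)
    · rw [not_le] at h2
      have h := ratioCond_of_one_le_of_one_le h2.le hk
      have hLp : 0 < √k * (46.91 * √x) := by positivity
      refine le_trans ?_ (curvature_sq_mul_le_of_ratioBound hx hk hLp hc₁' hc₂' h.1 h.2.1 h.2.2.1
        h.2.2.2 hK)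
      gcongr
      rw [sampleDemand, max_eq_left h1.le, min_eq_right h2.le, mul_pow, mul_pow,
        Real.sq_sqrt hk0.le, Real.sq_sqrt hx.le]
      nlinarith

end

section

variable {x y : ℝ}

theorem one_div_hurwitzSum_two_le_estVar (hx : 0 < x) (hy : 0 < y) :
    1 / hurwitzSum 2 x ≤ estVar x y := by
  have hδ := fisherDet_pos hx hy
  have hp := hurwitzSum_pos (j := 2) le_rfl hx
  have hw := hurwitzSum_pos (j := 2) le_rfl (show 0 < x + y by linarith)
  have h2 := hurwitzSum_two_add_lt' hx hy
  rw [estVar, div_le_div_iff₀ hp hδ, fisherDet_eq]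
  nlinarith

theorem fisherDet_le_half (hx : 0 < x) (hy : 0 < y) :
    2 * fisherDet x y ≤ hurwitzSum 2 x * hurwitzSum 2 y := by
  have h := fisherDet_le hx hy
  have hpq := mul_pos (hurwitzSum_pos (j := 2) le_rfl hx) (hurwitzSum_pos (j := 2) le_rfl hy)
  have : 2 * x * y / (x + y) ^ 2 ≤ 1 / 2 := by
    rw [div_le_iff₀ (by positivity)]
    nlinarith [sq_nonneg (x - y)]
  nlinarith

theorem two_mul_hurwitzSum_three_le_add (hx : 0 < x) :
    2 * hurwitzSum 3 x ≤ 2 / x ^ 3 + 1 / x ^ 2 := by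
  refine (two_mul_hurwitzSum_three_le hx).trans ?_
  rw [div_add_div _ _ (by positivity) (by positivity), div_le_div_iff₀ (by positivity)
    (by positivity)]
  have h : (x ^ 2 + 2 * x + 2) ≤ (2 + x) * (x + 1) := by nlinarith
  have : 0 < x ^ 5 := by positivity
  nlinarith [mul_le_mul_of_nonneg_right h this.le]

/-! ### The curvature and the trace -/

/-- An upper bound by the trace, needed only for the exponentially small tail; hence the generous
constant. -/
theorem curvature_sq_le (hx : 0 < x) (hxy : x ≤ y) :
    curvature x y ^ 2 ≤ 200 * estTrace x y * (max y 1 / min x 1) ^ 2 := by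
  have hy := hx.trans_le hxy
  have hs : 0 < x + y := by linarith
  have va := estVar_pos hx hy
  have vb := estVar_pos hy hx
  have za := hurwitzSum_pos (j := 3) (by norm_num) hx
  have zb := hurwitzSum_pos (j := 3) (by norm_num) hy
  have zs := hurwitzSum_pos (j := 3) (by norm_num) hs
  have hx1 : 0 < min x 1 := lt_min hx one_pos
  have hy1 : 1 ≤ max y 1 := le_max_right _ _
  have hR1 : 1 ≤ max y 1 / min x 1 := by
    rw [one_le_div hx1]
    exact (min_le_right _ _).trans hy1
  have hRx : 1 / x ≤ max y 1 / min x 1 := by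
    gcongr
    exact min_le_left _ _
  have hRy : 1 + 2 / x + y / x ≤ 4 * (max y 1 / min x 1) := by
    have h : y / x ≤ max y 1 / min x 1 := by
      gcongr
      · exact le_max_left _ _
      · exact min_le_left _ _
    have : 2 / x = 2 * (1 / x) := by ring
    linarith
  set R := max y 1 / min x 1 with hR
  have hR0 : 0 < R := by linarith
  have va_le : estVar x y ≤ 4 * x ^ 2 := by
    refine (estVar_le hx hy).trans ?_
    rw [div_le_iff₀ hy]
    nlinarith [mul_nonneg (sq_nonneg x) (sub_nonneg.2 hxy)]
  have vb_le : estVar y x ≤ 2 * y ^ 2 * (x + y) / x := by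
    have := estVar_le hy hx
    rwa [add_comm y x] at this
  have a_le := two_mul_hurwitzSum_three_le_add hx
  have b_le := two_mul_hurwitzSum_three_le_add hy
  have c_le := two_mul_hurwitzSum_three_le_add hs
  have hτ : 0 < estTrace x y := estTrace_pos hx hy
  have hA : hurwitzSum 3 x * estVar x y ≤ 6 * R := by
    calc _ = 2 * hurwitzSum 3 x * estVar x y / 2 := by ring
      _ ≤ (2 / x ^ 3 + 1 / x ^ 2) * (4 * x ^ 2) / 2 := by gcongr
      _ = 4 * (1 / x) + 2 := by
          field_simp
          ring
      _ ≤ _ := by linarith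
  have hB' : hurwitzSum 3 y * estVar y x ≤ 2 * (1 / x) + 2 / y + 1 + y / x := by
    calc _ = 2 * hurwitzSum 3 y * estVar y x / 2 := by ring
      _ ≤ (2 / y ^ 3 + 1 / y ^ 2) * (2 * y ^ 2 * (x + y) / x) / 2 := by gcongr
      _ = _ := by
          field_simp
          ring
  have h2y : 2 / y ≤ 2 * (1 / x) := by
    rw [← mul_one_div]
    gcongr
  have hB : hurwitzSum 3 y * estVar y x ≤ 6 * R := by
    have : 2 / x = 2 * (1 / x) := by ring
    linarith
  have hS : 0 < estVarSum x y := by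
    have hp := hurwitzSum_pos (j := 2) le_rfl hx
    have hq := hurwitzSum_pos (j := 2) le_rfl hy
    have hδ := fisherDet_pos hx hy
    unfold estVarSum
    positivity
  have hS2 := estVarSum_le hx hy
  have hC : hurwitzSum 3 (x + y) * estVarSum x y ≤ 8 * R := by
    have hy_s : y ^ 2 / (x + y) ^ 2 ≤ 1 := by
      rw [div_le_one (by positivity)]
      gcongr
      linarith
    have hy_s' : y ^ 2 / (x + y) ≤ y := by
      rw [div_le_iff₀ hs]
      nlinarith
    have hx_s : x ^ 2 / (x + y) ^ 2 ≤ 1 / 4 := by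
      rw [div_le_div_iff₀ (by positivity) (by positivity)]
      nlinarith
    have hx_s' : 2 / (x + y) ≤ 1 / x := by
      rw [div_le_div_iff₀ hs hx]
      linarith
    calc _ = 2 * hurwitzSum 3 (x + y) * estVarSum x y / 2 := by ring
      _ ≤ (2 / (x + y) ^ 3 + 1 / (x + y) ^ 2) *
            (2 * (4 * x ^ 2 + 2 * y ^ 2 * (x + y) / x)) / 2 := by
          gcongr
          refine hS2.trans ?_
          rw [estTrace]
          gcongr
      _ = 4 * (x ^ 2 / (x + y) ^ 2) * (2 / (x + y) + 1) +
            (4 * (y ^ 2 / (x + y) ^ 2) + 2 * (y ^ 2 / (x + y))) * (1 / x) := by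
          field_simp
          ring
      _ ≤ 4 * (1 / 4) * (1 / x + 1) + (4 * 1 + 2 * y) * (1 / x) := by gcongr
      _ = 5 * (1 / x) + 1 + 2 * (y / x) := by ring
      _ ≤ _ := by
          have : 2 / x = 2 * (1 / x) := by ring
          have h : y / x ≤ R := by
            rw [hR]
            gcongr
            · exact le_max_left _ _
            · exact min_le_left _ _
          linarith
  rw [← one_mul (curvature x y ^ 2)]
  refine curvature_sq_mul_le hx hy ?_ ?_ ?_ ?_
  · have ha : √(estVar x y) ≤ √(estTrace x y) := Real.sqrt_le_sqrt (by rw [estTrace]; linarith)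
    have hb : √(estVar y x) ≤ √(estTrace x y) := Real.sqrt_le_sqrt (by rw [estTrace]; linarith)
    calc _ = (20 / 17) ^ 2 * (hurwitzSum 3 x * estVar x y * √(estVar x y) +
          hurwitzSum 3 y * estVar y x * √(estVar y x)) ^ 2 := by ring
      _ ≤ (20 / 17) ^ 2 * (6 * R * √(estTrace x y) + 6 * R * √(estTrace x y)) ^ 2 := by gcongr
      _ = (20 / 17) ^ 2 * 144 * √(estTrace x y) ^ 2 * R ^ 2 := by ring
      _ ≤ 200 * √(estTrace x y) ^ 2 * R ^ 2 := by
          gcongr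
          norm_num
      _ = _ := by rw [Real.sq_sqrt hτ.le]
  · calc _ = (20 / 17) ^ 2 * (hurwitzSum 3 (x + y) * estVarSum x y) ^ 2 * estVarSum x y := by ring
      _ ≤ (20 / 17) ^ 2 * (8 * R) ^ 2 * (2 * estTrace x y) := by gcongr
      _ = (20 / 17) ^ 2 * 128 * estTrace x y * R ^ 2 := by ring
      _ ≤ _ := by
          gcongr
          norm_num
  · calc _ = 100 / 9 * estVar x y * (1 / x) ^ 2 := by ring
      _ ≤ 200 * estTrace x y * R ^ 2 := by
          gcongr
          · norm_num
          · rw [estTrace]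
            linarith
  · have : 1 / y ≤ R := (one_div_le_one_div_of_le hx hxy).trans hRx
    calc _ = 100 / 9 * estVar y x * (1 / y) ^ 2 := by ring
      _ ≤ 200 * estTrace x y * R ^ 2 := by
          gcongr
          · norm_num
          · rw [estTrace]
            linarith

/-! ### The remainder of third order -/

theorem thirdOrder_const_le {k : ℝ} (hx : 0 < x) (hk : 1 ≤ k) (hk2 : k ≤ 2) :
    52.3 * (1 + 1 / k + x) ≤
      96 * k + 6 * k / (k - 1 / 2) ^ 4 + 12.98 * k * x ^ 4 + 7.26 * (1 + k) * x ^ 3 := by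
  have h1 : 52.3 * (1 + 1 / k) + 40 ≤ 96 * k + 6 * k / (k - 1 / 2) ^ 4 := by
    obtain ⟨u, rfl⟩ : ∃ u, k = 1 + u := ⟨k - 1, by ring⟩
    have hu : 0 ≤ u := by linarith
    have e1 : 1 + u - 1 / 2 = u + 1 / 2 := by ring
    rw [e1, ← sub_nonneg]
    have e : 96 * (1 + u) + 6 * (1 + u) / (u + 1 / 2) ^ 4 - (52.3 * (1 + 1 / (1 + u)) + 40) =
        ((96 * u ^ 2 + 99.7 * u - 48.6) * (u + 1 / 2) ^ 4 + 6 * (1 + u) ^ 2) /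
          ((1 + u) * (u + 1 / 2) ^ 4) := by
      field_simp
      ring
    rw [e]
    refine div_nonneg ?_ (by positivity)
    have q := sq_nonneg (u - 0.22)
    nlinarith [mul_nonneg hu q, mul_nonneg (pow_nonneg hu 2) q, mul_nonneg (pow_nonneg hu 3) q,
      mul_nonneg (pow_nonneg hu 4) q]
  have h2 : 52.3 * x ≤ 40 + 12.98 * x ^ 4 + 14.52 * x ^ 3 := by
    nlinarith [sq_nonneg (x - 0.9), mul_nonneg hx.le (sq_nonneg (x - 0.9)), sq_nonneg (x ^ 2 - 0.81)]
  have h3 : 12.98 * x ^ 4 ≤ 12.98 * k * x ^ 4 := by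
    have : 0 ≤ x ^ 4 := by positivity
    nlinarith
  have h4 : 14.52 * x ^ 3 ≤ 7.26 * (1 + k) * x ^ 3 := by
    have : 0 ≤ x ^ 3 := by positivity
    nlinarith
  linarith

theorem thirdOrder_const_le' {k : ℝ} (hx : 0 < x) (hk2 : 2 ≤ k) :
    98 + 110.5 * x ≤
      96 * k + 6 * k / (k - 1 / 2) ^ 4 + 12.98 * k * x ^ 4 + 7.26 * (1 + k) * x ^ 3 := by
  have h1 : 0 ≤ 6 * k / (k - 1 / 2) ^ 4 := by
    have : 0 ≤ (k - 1 / 2) ^ 4 := by positivity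
    positivity
  have h2 : 98 + 110.5 * x ≤ 192 + 25.96 * x ^ 4 + 21.78 * x ^ 3 := by
    nlinarith [sq_nonneg (x - 0.9), mul_nonneg hx.le (sq_nonneg (x - 0.9)), sq_nonneg (x ^ 2 - 0.81)]
  have h3 : 25.96 * x ^ 4 ≤ 12.98 * k * x ^ 4 := by
    have : 0 ≤ x ^ 4 := by positivity
    nlinarith
  have h4 : 21.78 * x ^ 3 ≤ 7.26 * (1 + k) * x ^ 3 := by
    have : 0 ≤ x ^ 3 := by positivity
    nlinarith
  linarith

/-- The constant 52.3 is 11 · √2 · (40/17) / 0.7 rounded up: the third-order remainder is to use at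
most seven tenths of the drift. -/
theorem thirdRatio_numerator_le {k c₁ c₂ : ℝ} (hx : 0 < x) (hk : 1 ≤ k)
    (hc₁ : 96 * k / x ^ 3 + 6.49 * (k * x) + 7.26 ≤ c₁)
    (hc₂ : 6 / (x ^ 3 * (k - 1 / 2) ^ 4) + 6.49 * x + 7.26 ≤ c₂) :
    52.3 * (hurwitzSum 2 (k * x) * max (hurwitzSum 3 x) (2 * hurwitzSum 3 (x + k * x)) +
      hurwitzSum 2 x * max (hurwitzSum 3 (k * x)) (2 * hurwitzSum 3 (x + k * x))) ≤
      hurwitzSum 2 (k * x) * c₁ + hurwitzSum 2 x * c₂ := by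
  have hk0 : 0 < k := by linarith
  have hxy : x ≤ k * x := by nlinarith
  have hy : 0 < k * x := by positivity
  have hs : 0 < x + k * x := by linarith
  have hj : 0 < k - 1 / 2 := by linarith
  have hx3 : 0 < x ^ 3 := by positivity
  have hp := hurwitzSum_pos (j := 2) le_rfl hx
  have hq := hurwitzSum_pos (j := 2) le_rfl hy
  have r1 := mul_hurwitzSum_two_le hx hxy
  have r2 := sq_mul_hurwitzSum_two_le hx hxy
  rw [show k * x / x = k by field_simp] at r1
  rw [show x / (k * x) = 1 / k by field_simp] at r2
  have a_le := two_mul_hurwitzSum_three_le_add hx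
  have b_le := two_mul_hurwitzSum_three_le_add hy
  have s_le := two_mul_hurwitzSum_three_le_add hs
  have hc2 : 0 ≤ c₂ := le_trans (by positivity) hc₂
  set A := max (hurwitzSum 3 x) (2 * hurwitzSum 3 (x + k * x))
  set B := max (hurwitzSum 3 (k * x)) (2 * hurwitzSum 3 (x + k * x)) with hBdef
  have hB0 : 0 ≤ B := le_max_of_le_left (hurwitzSum_pos (by norm_num) hy).le
  have es : 2 / (x + k * x) ^ 3 + 1 / (x + k * x) ^ 2 =
      (2 / (1 + k) ^ 3 + x / (1 + k) ^ 2) / x ^ 3 := by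
    field_simp
  have ex : 2 / x ^ 3 + 1 / x ^ 2 = 2 * (1 + x / 2) / x ^ 3 := by
    field_simp
  have ey : 2 / (k * x) ^ 3 + 1 / (k * x) ^ 2 = 2 * (1 / k + x / 2) / k ^ 2 / x ^ 3 := by
    field_simp
  rw [es] at s_le
  rw [ex, le_div_iff₀ hx3] at a_le
  rw [ey, le_div_iff₀ hx3] at b_le
  rw [le_div_iff₀ hx3] at s_le
  have hA : A * x ^ 3 ≤ 1 + x / 2 := by
    rw [max_mul_of_nonneg _ _ hx3.le]
    refine max_le (by linarith) (s_le.trans ?_)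
    have h1 : 2 / (1 + k) ^ 3 ≤ 1 := by
      rw [div_le_one (by positivity)]
      nlinarith [pow_le_pow_left₀ zero_le_two (show 2 ≤ 1 + k by linarith) 3]
    have h2 : x / (1 + k) ^ 2 ≤ x / 2 := by
      gcongr
      nlinarith
    linarith
  have key : 52.3 * (A + k ^ 2 * B) ≤ c₁ + k * c₂ := by
    have h0 : 96 * k + 6 * k / (k - 1 / 2) ^ 4 + 12.98 * k * x ^ 4 + 7.26 * (1 + k) * x ^ 3 ≤
        (c₁ + k * c₂) * x ^ 3 := by
      calc _ = ((96 * k / x ^ 3 + 6.49 * (k * x) + 7.26) +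
            k * (6 / (x ^ 3 * (k - 1 / 2) ^ 4) + 6.49 * x + 7.26)) * x ^ 3 := by
            field_simp
            ring
        _ ≤ _ := by gcongr
    refine le_of_mul_le_mul_right (le_trans ?_ h0) hx3
    have hB1 : k ^ 2 * (hurwitzSum 3 (k * x) * x ^ 3) ≤ 1 / k + x / 2 := by
      have : k ^ 2 * (2 * (1 / k + x / 2) / k ^ 2) = 2 * (1 / k + x / 2) := by field_simp
      nlinarith [mul_le_mul_of_nonneg_left b_le (sq_nonneg k)]
    have hB2 : k ^ 2 * (2 * hurwitzSum 3 (x + k * x) * x ^ 3) ≤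
        2 * k ^ 2 / (1 + k) ^ 3 + x * (k ^ 2 / (1 + k) ^ 2) := by
      have : k ^ 2 * (2 / (1 + k) ^ 3 + x / (1 + k) ^ 2) =
          2 * k ^ 2 / (1 + k) ^ 3 + x * (k ^ 2 / (1 + k) ^ 2) := by ring
      rw [← this]
      gcongr
    have eB : k ^ 2 * B * x ^ 3 = max (k ^ 2 * (hurwitzSum 3 (k * x) * x ^ 3))
        (k ^ 2 * (2 * hurwitzSum 3 (x + k * x) * x ^ 3)) := by
      rw [← mul_max_of_nonneg _ _ (sq_nonneg k), ← max_mul_of_nonneg _ _ hx3.le, ← hBdef]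
      ring
    rcases le_total k 2 with hk2 | hk2
    · refine le_trans ?_ (thirdOrder_const_le hx hk hk2)
      have hB : k ^ 2 * B * x ^ 3 ≤ 1 / k + x / 2 := by
        rw [eB]
        refine max_le hB1 (hB2.trans ?_)
        have h1 : 2 * k ^ 2 / (1 + k) ^ 3 ≤ 1 / k := by
          rw [div_le_div_iff₀ (by positivity) hk0]
          have := pow_le_pow_left₀ (by positivity) (show 1.5 * k ≤ 1 + k by linarith) 3
          have hk3 : 0 < k ^ 3 := by positivity
          linarith
        have h2 : k ^ 2 / (1 + k) ^ 2 ≤ 1 / 2 := by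
          rw [div_le_div_iff₀ (by positivity) (by positivity)]
          have := pow_le_pow_left₀ (by positivity) (show 1.5 * k ≤ 1 + k by linarith) 2
          have hk3 : 0 < k ^ 2 := by positivity
          linarith
        linarith [mul_le_mul_of_nonneg_left h2 hx.le]
      linarith
    · refine le_trans ?_ (thirdOrder_const_le' hx hk2)
      have hB : k ^ 2 * B * x ^ 3 ≤ 1 / 2 + x := by
        rw [eB]
        refine max_le (hB1.trans ?_) (hB2.trans ?_)
        · have : 1 / k ≤ 1 / 2 := one_div_le_one_div_of_le two_pos hk2
          linarith
        · have h1 : 2 * k ^ 2 / (1 + k) ^ 3 ≤ 1 / 2 := by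
            rw [div_le_div_iff₀ (by positivity) (by positivity)]
            linarith [mul_nonneg hk0.le (sq_nonneg (k - 1)), sq_nonneg k]
          have h2 : k ^ 2 / (1 + k) ^ 2 ≤ 1 := by
            rw [div_le_one (by positivity)]
            gcongr
            linarith
          linarith [mul_le_mul_of_nonneg_left h2 hx.le]
      linarith
  have h3 : hurwitzSum 2 x ≤ k ^ 2 * hurwitzSum 2 (k * x) := by
    calc hurwitzSum 2 x = k ^ 2 * ((1 / k) ^ 2 * hurwitzSum 2 x) := by field_simp
      _ ≤ _ := by gcongr
  calc _ ≤ 52.3 * (hurwitzSum 2 (k * x) * A + k ^ 2 * hurwitzSum 2 (k * x) * B) := by gcongr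
    _ = hurwitzSum 2 (k * x) * (52.3 * (A + k ^ 2 * B)) := by ring
    _ ≤ hurwitzSum 2 (k * x) * (c₁ + k * c₂) := by gcongr
    _ = hurwitzSum 2 (k * x) * c₁ + k * hurwitzSum 2 (k * x) * c₂ := by ring
    _ ≤ _ := by gcongr

/-! ### The exponential tail -/

/-- The tangent bound z ≤ 1500 exp(z/1500 - 1) raised to the power 3/2; 1500 √1500 is just below
58095. -/
theorem mul_sqrt_le_exp (z : ℝ) : z * √z ≤ 58096 * Real.exp (0.001 * z - 1.5) := by
  have h1 : z ≤ 1500 * Real.exp (z / 1500 - 1) := by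
    have := Real.add_one_le_exp (z / 1500 - 1)
    linarith
  have h2 : √z ≤ 38.73 * Real.exp ((z / 1500 - 1) / 2) := by
    refine Real.sqrt_le_iff.2 ⟨by positivity, h1.trans ?_⟩
    rw [mul_pow, ← Real.exp_nat_mul]
    have : ((2 : ℕ) : ℝ) * ((z / 1500 - 1) / 2) = z / 1500 - 1 := by
      push_cast
      ring
    rw [this]
    gcongr
    norm_num
  calc z * √z ≤ (1500 * Real.exp (z / 1500 - 1)) * (38.73 * Real.exp ((z / 1500 - 1) / 2)) := by
        gcongr
    _ = 58095 * Real.exp (0.001 * z - 1.5) := by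
        rw [mul_mul_mul_comm, ← Real.exp_add]
        congr 1
        · norm_num
        · congr 1
          ring
    _ ≤ _ := by
        gcongr
        norm_num

theorem exp_three_add_lower : 24 ≤ Real.exp 3.18 := by
  have h1 : (2.7182818283 : ℝ) ^ 3 ≤ Real.exp 3 := by
    rw [show (3 : ℝ) = ((3 : ℕ) : ℝ) * 1 by norm_num, Real.exp_nat_mul]
    gcongr
    exact Real.exp_one_gt_d9.le
  have h2 := Real.quadratic_le_exp_of_nonneg (show (0 : ℝ) ≤ 0.18 by norm_num)
  have e : Real.exp 3.18 = Real.exp 3 * Real.exp 0.18 := by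
    rw [← Real.exp_add]
    norm_num
  rw [e]
  calc (24 : ℝ) ≤ 2.7182818283 ^ 3 * (1 + 0.18 + 0.18 ^ 2 / 2) := by norm_num
    _ ≤ _ := by gcongr

theorem exp_const_lower : (1.51e12 : ℝ) ≤ Real.exp 28.65 := by
  have h1 : (2.7182818283 : ℝ) ^ 28 ≤ Real.exp 28 := by
    rw [show (28 : ℝ) = ((28 : ℕ) : ℝ) * 1 by norm_num, Real.exp_nat_mul]
    gcongr
    exact Real.exp_one_gt_d9.le
  have h2 := Real.add_one_le_exp (0.65 : ℝ)
  have e : Real.exp 28.65 = Real.exp 28 * Real.exp 0.65 := by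
    rw [← Real.exp_add]
    norm_num
  rw [e]
  calc (1.51e12 : ℝ) ≤ 2.7182818283 ^ 28 * (0.65 + 1) := by norm_num
    _ ≤ _ := by gcongr

theorem cube_le_exp {u : ℝ} (hu : 0 ≤ u) : u ^ 3 ≤ Real.exp (1.5 * u) := by
  have h : u ≤ Real.exp (0.5 * u) := by
    refine le_trans ?_ (Real.quadratic_le_exp_of_nonneg (by positivity))
    nlinarith [sq_nonneg (u - 2)]
  calc u ^ 3 ≤ Real.exp (0.5 * u) ^ 3 := by gcongr
    _ = _ := by
        rw [← Real.exp_nat_mul]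
        congr 1
        push_cast
        ring

theorem pow_five_le_exp {Y : ℝ} (hY : 0 ≤ Y) : Y ^ 5 ≤ Real.exp (5 * (Y - 1)) := by
  have h : Y ≤ Real.exp (Y - 1) := by linarith [Real.add_one_le_exp (Y - 1)]
  calc Y ^ 5 ≤ Real.exp (Y - 1) ^ 5 := by gcongr
    _ = _ := by
        rw [← Real.exp_nat_mul]
        push_cast
        rfl

/-- The prefactor of the tail grows exponentially in 1/X and Y/X, with X and Y the capped minimum
and maximum of the parameters. `sampleDemand` grows like Y/X so that the Chernoff exponent outweighs
this. -/
theorem tailBound_mul_le {n : ℕ} {κ K : ℝ} (hx : 0 < x) (hxy : x ≤ y) (hκ : curvature x y = κ)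
    (hn : sampleDemand x y * κ ^ 2 ≤ n) (hK : √(2 * estTrace x y) ≤ K) :
    tailBound x y n * ((n : ℝ) * √(n : ℝ)) ≤ 0.3 * (estTrace x y * K) := by
  have hy := hx.trans_le hxy
  have hτ := estTrace_pos hx hy
  have hκ0 : 0 < κ := hκ ▸ curvature_pos hx hy
  have hκ2 := curvature_sq_le hx hxy
  rw [hκ] at hκ2
  have hx1 : 0 < min x 1 := lt_min hx one_pos
  have hx1' : min x 1 ≤ 1 := min_le_right _ _
  have hY : 1 ≤ max y 1 := le_max_right _ _
  have hxY : x ≤ max y 1 := hxy.trans (le_max_left _ _)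
  have hyY : y ≤ max y 1 := le_max_left _ _
  have hcap : cappedMin x y = min x 1 := by rw [cappedMin, min_eq_left hxy]
  have hsd : sampleDemand x y = max y 1 * (900 / min x 1 + 1300) := rfl
  set Y := max y 1
  set X := min x 1
  have hu : 1 ≤ 1 / X := (one_le_div hx1).2 hx1'
  have hK0 : 0 ≤ K := (Real.sqrt_nonneg _).trans hK
  have hκ3 : κ ^ 3 ≤ 2000 * (estTrace x y * K) * (Y / X) ^ 3 := by
    have h1 : κ ≤ 10 * K * (Y / X) := by
      have : κ ≤ √(200 * estTrace x y * (Y / X) ^ 2) := Real.le_sqrt_of_sq_le hκ2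
      rw [show 200 * estTrace x y * (Y / X) ^ 2 = (10 * (Y / X)) ^ 2 * (2 * estTrace x y) by ring,
        Real.sqrt_mul (sq_nonneg _), Real.sqrt_sq (by positivity)] at this
      calc κ ≤ _ := this
        _ ≤ 10 * (Y / X) * K := by gcongr
        _ = _ := by ring
    calc κ ^ 3 = κ ^ 2 * κ := by ring
      _ ≤ 200 * estTrace x y * (Y / X) ^ 2 * (10 * K * (Y / X)) := by gcongr
      _ = _ := by ring
  set z := (n : ℝ) / κ ^ 2 with hz
  have hzD : Y * (900 / X + 1300) ≤ z := by
    rw [hz, le_div_iff₀ (by positivity), ← hsd]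
    exact hn
  have hz0 : 0 ≤ z := by positivity
  have hnz : (n : ℝ) * √(n : ℝ) = z * √z * κ ^ 3 := by
    have : (n : ℝ) = z * κ ^ 2 := by rw [hz, div_mul_cancel₀ _ (by positivity)]
    rw [this, Real.sqrt_mul hz0, Real.sqrt_sq hκ0.le]
    ring
  have h1 : 484 + x ^ 2 + y ^ 2 ≤ 486 * Y ^ 2 := by nlinarith
  have h2 : (24 * Real.exp (max (x - 1) 0 + max (y - 1) 0)) ^ (16 / (3 * X)) ≤
      Real.exp (16.96 / X + 11 * (Y - 1) / X) := by
    have ha : max (x - 1) 0 + max (y - 1) 0 ≤ 2 * (Y - 1) := by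
      have := max_le (show x - 1 ≤ Y - 1 by linarith) (show 0 ≤ Y - 1 by linarith)
      have := max_le (show y - 1 ≤ Y - 1 by linarith) (show 0 ≤ Y - 1 by linarith)
      linarith
    calc _ ≤ (Real.exp 3.18 * Real.exp (2 * (Y - 1))) ^ (16 / (3 * X)) := by
          gcongr
          exact exp_three_add_lower
      _ = Real.exp ((3.18 + 2 * (Y - 1)) * (16 / (3 * X))) := by
          rw [← Real.exp_add, ← Real.exp_mul]
      _ ≤ _ := by
          rw [Real.exp_le_exp]
          have e : (3.18 + 2 * (Y - 1)) * (16 / (3 * X)) =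
              (16.96 + (32 / 3) * (Y - 1)) / X := by
            field_simp
            ring
          rw [e, ← add_div]
          gcongr
          norm_num
  have h3 : (8 * Real.exp (-(0.0232 * z))) ^ (15 / 16 : ℝ) ≤ 8 * Real.exp (-(0.02175 * z)) := by
    rw [Real.mul_rpow (by norm_num) (Real.exp_pos _).le, ← Real.exp_mul]
    have e : -(0.0232 * z) * (15 / 16 : ℝ) = -(0.02175 * z) := by ring
    rw [e]
    gcongr
    calc (8 : ℝ) ^ (15 / 16 : ℝ) ≤ 8 ^ (1 : ℝ) :=
          Real.rpow_le_rpow_of_exponent_le (by norm_num) (by norm_num)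
      _ = 8 := Real.rpow_one 8
  have h4 := mul_sqrt_le_exp z
  have hτK : 0 ≤ estTrace x y * K := by positivity
  have h5 : Y ^ 5 ≤ Real.exp (5 * (Y - 1)) := pow_five_le_exp (by linarith)
  have h6 : (1 / X) ^ 3 ≤ Real.exp (1.5 * (1 / X)) := cube_le_exp (by positivity)
  -- At X = Y = 1 and z = 2200 the left side is -0.04, so the constants 900 and 1300 of the demand
  -- are nearly used up here.
  have hexp : (16.96 / X + 11 * (Y - 1) / X) + (-(0.02175 * z) + (0.001 * z - 1.5)) +
      (5 * (Y - 1) + 1.5 * (1 / X)) + 28.65 ≤ 0 := by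
    have e1 : 16.96 / X + 11 * (Y - 1) / X = (16.96 + 11 * (Y - 1)) * (1 / X) := by
      field_simp
    have e2 : Y * (900 / X + 1300) = Y * (900 * (1 / X) + 1300) := by
      field_simp
    rw [e2] at hzD
    rw [e1]
    nlinarith [mul_nonneg (sub_nonneg.2 hY) (sub_nonneg.2 hu)]
  rw [tailBound, hκ, hcap, hnz, ← hz]
  calc _ ≤ 486 * Y ^ 2 * Real.exp (16.96 / X + 11 * (Y - 1) / X) *
        (8 * Real.exp (-(0.02175 * z))) *
        (58096 * Real.exp (0.001 * z - 1.5) * (2000 * (estTrace x y * K) * (Y / X) ^ 3)) := by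
        gcongr
    _ = 486 * 8 * 58096 * 2000 * (estTrace x y * K) * (Y ^ 5 * (1 / X) ^ 3 *
          (Real.exp (16.96 / X + 11 * (Y - 1) / X) *
            (Real.exp (-(0.02175 * z)) * Real.exp (0.001 * z - 1.5)))) := by
        field_simp
    _ ≤ 486 * 8 * 58096 * 2000 * (estTrace x y * K) *
          (Real.exp (5 * (Y - 1)) * Real.exp (1.5 * (1 / X)) *
          (Real.exp (16.96 / X + 11 * (Y - 1) / X) *
            (Real.exp (-(0.02175 * z)) * Real.exp (0.001 * z - 1.5)))) := by
        gcongr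
    _ = 0.3 * (estTrace x y * K) * (1.505848320e12 * (Real.exp (5 * (Y - 1) + 1.5 * (1 / X) +
          (16.96 / X + 11 * (Y - 1) / X + (-(0.02175 * z) + (0.001 * z - 1.5)))))) := by
        rw [← Real.exp_add, ← Real.exp_add, ← Real.exp_add, ← Real.exp_add]
        ring
    _ ≤ 0.3 * (estTrace x y * K) * (Real.exp 28.65 * (Real.exp (5 * (Y - 1) + 1.5 * (1 / X) +
          (16.96 / X + 11 * (Y - 1) / X + (-(0.02175 * z) + (0.001 * z - 1.5)))))) := by
        gcongr
        exact le_trans (by norm_num) exp_const_lower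
    _ ≤ 0.3 * (estTrace x y * K) * 1 := by
        gcongr
        rw [← Real.exp_add, Real.exp_le_one_iff]
        linarith
    _ = _ := by ring

end

/-! ### From the drift and the threshold to the sample size requirements -/

section

variable {x y : ℝ}

theorem curvature_sq_ge (hx : 0 < x) (hy : 0 < y) :
    100 / 9 * (estVar x y / x ^ 2) ≤ curvature x y ^ 2 := by
  have va := estVar_pos hx hy
  have h : 10 / 3 * √(estVar x y) / x ≤ curvature x y :=
    (le_max_left _ _).trans (le_max_right _ _)
  calc _ = (10 / 3 * √(estVar x y) / x) ^ 2 := by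
        rw [div_pow, mul_pow, Real.sq_sqrt va.le]
        ring
    _ ≤ _ := by gcongr

theorem ninetySix_mul_le (hx : 0 < x) (hxy : x ≤ y) : 96 / x ^ 3 ≤ 96 * y / x ^ 4 := by
  rw [div_le_div_iff₀ (by positivity) (by positivity)]
  calc 96 * x ^ 4 = 96 * x * x ^ 3 := by ring
    _ ≤ _ := by gcongr

theorem hurwitzSum_two_le_majorant (hx : 0 < x) (hxy : x ≤ y) :
    hurwitzSum 2 x ≤ 96 * y / x ^ 4 + 6.49 * y + 7.26 := by
  have hy := hx.trans_le hxy
  have hp_le : hurwitzSum 2 x ≤ 1 / x ^ 2 + 5 / 3 := hurwitzSum_two_le_inv_sq hx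
  have h2 : 1 / x ^ 2 ≤ 96 / x ^ 3 + 1 := by
    rw [div_le_iff₀ (by positivity)]
    have e : (96 / x ^ 3 + 1) * x ^ 2 = 96 * (1 / x) + x ^ 2 := by field_simp
    have h : x * (1 / x) = 1 := mul_one_div_cancel hx.ne'
    have h0 : 0 < 1 / x := by positivity
    rw [e]
    rcases le_total x 1 with h1 | h1 <;> nlinarith
  linarith [ninetySix_mul_le hx hxy]

theorem twentyFive_le_majorant (hx : 1 ≤ x) (hxy : x ≤ y) :
    25 ≤ 96 * y / x ^ 4 + 6.49 * y + 7.26 := by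
  have h2 : 18 ≤ 96 / x ^ 3 + 6.49 * x := by
    rw [div_add' _ _ _ (by positivity), le_div_iff₀ (by positivity)]
    nlinarith [sq_nonneg (x ^ 2 - 1.387 * x), sq_nonneg (x ^ 2 - 4)]
  linarith [ninetySix_mul_le (by linarith) hxy]

theorem le_estVar_div_sq (hx : 0 < x) (hx1 : x ≤ 1) (hy : 0 < y) :
    3 / 8 ≤ estVar x y / x ^ 2 := by
  have hp := hurwitzSum_pos (j := 2) le_rfl hx
  have hp_le : hurwitzSum 2 x ≤ 1 / x ^ 2 + 5 / 3 := hurwitzSum_two_le_inv_sq hx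
  rw [le_div_iff₀ (by positivity)]
  refine le_trans ?_ (one_div_hurwitzSum_two_le_estVar hx hy)
  rw [le_div_iff₀ hp]
  have e : 3 / 8 * x ^ 2 * (1 / x ^ 2 + 5 / 3) = 3 / 8 + 5 / 8 * x ^ 2 := by
    field_simp
  calc _ ≤ 3 / 8 * x ^ 2 * (1 / x ^ 2 + 5 / 3) := by gcongr
    _ ≤ 1 := by
      rw [e]
      nlinarith

theorem hurwitzSum_two_le_of_one_le (hx : 1 ≤ x) : hurwitzSum 2 x ≤ 5 / 3 := by
  refine (hurwitzSum_two_le (by linarith)).trans ?_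
  have h1 : 1 / x ^ 2 ≤ 1 := by
    rw [div_le_one (by positivity)]
    nlinarith
  have h2 : 2 / (2 * x + 1) ≤ 2 / 3 := by
    gcongr
    linarith
  linarith

/-- Passing from the trace to half of it costs √2 < 1.41422, and 11 · 1.41422 is below 0.7 · 52.3 ·
17/40. -/
theorem thirdRatio_mul_sqrt_le {c₁ c₂ : ℝ} (hx : 0 < x) (hxy : x ≤ y)
    (hc₁ : 96 * y / x ^ 4 + 6.49 * y + 7.26 ≤ c₁)
    (hc₂ : 6 * x / (y - x / 2) ^ 4 + 6.49 * x + 6 / (y + x / 2) ^ 3 + 7.26 ≤ c₂) :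
    11 * thirdRatio x y * √(estTrace x y) ≤ 0.7 * (√(estTrace x y / 2) *
      ((hurwitzSum 2 y * c₁ + hurwitzSum 2 x * c₂) / fisherDet x y)) := by
  have hy := hx.trans_le hxy
  have hδ := fisherDet_pos hx hy
  have hτ := estTrace_pos hx hy
  obtain ⟨k, hk, hkx⟩ : ∃ k, 1 ≤ k ∧ y = k * x :=
    ⟨y / x, (one_le_div hx).2 hxy, (div_mul_cancel₀ y hx.ne').symm⟩
  have hk0 : 0 < k := by linarith
  have hj : 0 < k - 1 / 2 := by linarith
  have hnum : 52.3 * (hurwitzSum 2 y * max (hurwitzSum 3 x) (2 * hurwitzSum 3 (x + y)) +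
      hurwitzSum 2 x * max (hurwitzSum 3 y) (2 * hurwitzSum 3 (x + y))) ≤
      hurwitzSum 2 y * c₁ + hurwitzSum 2 x * c₂ := by
    subst hkx
    refine thirdRatio_numerator_le hx hk ?_ ?_
    · convert hc₁ using 3
      field_simp
    · have e2 : 6 * x / (k * x - x / 2) ^ 4 = 6 / (x ^ 3 * (k - 1 / 2) ^ 4) := by
        rw [show k * x - x / 2 = x * (k - 1 / 2) by ring]
        field_simp
      rw [e2] at hc₂
      have : 0 < 6 / (k * x + x / 2) ^ 3 := by positivity
      linarith
  set Q := (hurwitzSum 2 y * c₁ + hurwitzSum 2 x * c₂) / fisherDet x y with hQ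
  have hQJ : 52.3 * (17 / 40) * thirdRatio x y ≤ Q := by
    rw [thirdRatio, hQ, mul_div_assoc']
    gcongr
    linarith
  have hsq : √(estTrace x y) ≤ 1.41422 * √(estTrace x y / 2) := by
    refine Real.sqrt_le_iff.2 ⟨by positivity, ?_⟩
    rw [mul_pow, Real.sq_sqrt (by positivity)]
    linarith
  have hJ0 := thirdRatio_pos hx hy
  have hs0 : 0 < √(estTrace x y / 2) := Real.sqrt_pos.2 (by positivity)
  calc 11 * thirdRatio x y * √(estTrace x y)
      ≤ 11 * thirdRatio x y * (1.41422 * √(estTrace x y / 2)) := by gcongr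
    _ ≤ 0.7 * (√(estTrace x y / 2) * (52.3 * (17 / 40) * thirdRatio x y)) := by
        linarith [mul_pos hJ0 hs0]
    _ ≤ 0.7 * (√(estTrace x y / 2) * Q) := by gcongr

/-- K stands for the drift; positivity of ω is used here only through K ≤ √n. In the last estimate K
is spent as 0.7 K on the third-order remainder and 0.3 K on the tail. -/
theorem sample_size_bounds {n : ℕ} {c₁ c₂ K : ℝ} (hx : 0 < x) (hxy : x ≤ y)
    (hc₁ : 96 * y / x ^ 4 + 6.49 * y + 7.26 ≤ c₁)
    (hc₂ : 6 * x / (y - x / 2) ^ 4 + 6.49 * x + 6 / (y + x / 2) ^ 3 + 7.26 ≤ c₂)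
    (hK : √(estTrace x y / 2) * ((hurwitzSum 2 y * c₁ + hurwitzSum 2 x * c₂) / fisherDet x y) ≤ K)
    (hKn : K ≤ √(n : ℝ))
    (hT : hurwitzSum 2 y * c₁ * (hurwitzSum 2 x * c₂) / (x * fisherDet x y ^ 2) ≤ n) :
    2200 * curvature x y ^ 2 ≤ n ∧ 5 ≤ n ∧ 256 / (3 * cappedMin x y) + 1 ≤ n ∧
      2 * estTrace x y ≤ n ∧
      estTrace x y / n + 11 * thirdRatio x y * (estTrace x y * √(estTrace x y)) / (n * √(n : ℝ)) +
        tailBound x y n ≤ estTrace x y / n * (1 + K / √(n : ℝ)) := by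
  have hy := hx.trans_le hxy
  have hp := hurwitzSum_pos (j := 2) le_rfl hx
  have hq := hurwitzSum_pos (j := 2) le_rfl hy
  have hδ := fisherDet_pos hx hy
  have hτ := estTrace_pos hx hy
  have va := estVar_pos hx hy
  have vb := estVar_pos hy hx
  have hyx : 0 < y - x / 2 := by linarith
  have hc₁0 : 0 < c₁ := lt_of_lt_of_le (by positivity) hc₁
  have hc₂0 : 0 < c₂ := lt_of_lt_of_le (by positivity) hc₂
  set Q := (hurwitzSum 2 y * c₁ + hurwitzSum 2 x * c₂) / fisherDet x y with hQ
  have hQ0 : 0 ≤ Q := by positivity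
  have hK0 : 0 ≤ K := le_trans (by positivity) hK
  have hK2 : estTrace x y / 2 * Q ^ 2 ≤ n := by
    calc _ = (√(estTrace x y / 2) * Q) ^ 2 := by
          rw [mul_pow, Real.sq_sqrt (by positivity)]
      _ ≤ √(n : ℝ) ^ 2 := by
          gcongr
          exact hK.trans hKn
      _ = n := Real.sq_sqrt n.cast_nonneg
  have hD := sampleDemand_mul_curvature_sq_le hx hxy hc₁ hc₂ hK2 hT
  have hx1 : 0 < min x 1 := lt_min hx one_pos
  have hX : 1 ≤ 1 / min x 1 := (one_le_div hx1).2 (min_le_right _ _)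
  have hsd : 900 * (1 / min x 1) + 1300 ≤ sampleDemand x y := by
    rw [sampleDemand]
    have : 1 ≤ max y 1 := le_max_right _ _
    have h9 : 900 / min x 1 = 900 * (1 / min x 1) := by ring
    rw [h9]
    nlinarith
  have hQc : 2 * c₁ / hurwitzSum 2 x ≤ Q := by
    have h := fisherDet_le_half hx hy
    rw [hQ, div_le_div_iff₀ hp hδ]
    nlinarith [mul_pos hp hc₂0]
  have hcp : hurwitzSum 2 x ≤ c₁ := (hurwitzSum_two_le_majorant hx hxy).trans hc₁
  -- This turns the drift bound into √(2τ) ≤ K, which yields 2τ ≤ n as well as the comparison needed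
  -- for the tail.
  have hQ2 : 2 ≤ Q := by
    refine le_trans ?_ hQc
    rw [le_div_iff₀ hp]
    linarith
  have hKτ : √(2 * estTrace x y) ≤ K := by
    refine le_trans ?_ hK
    calc √(2 * estTrace x y) = √(estTrace x y / 2) * 2 := by
          rw [show 2 * estTrace x y = estTrace x y / 2 * 2 ^ 2 by ring,
            Real.sqrt_mul (by positivity), Real.sqrt_sq zero_le_two]
      _ ≤ _ := by gcongr
  -- The constant exceeds 256/3 + 1. For x ≤ 1 the squared curvature is at least 1 and the demand
  -- applies; for x ≥ 1 the drift bound is used directly.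
  have hn90 : 86.4 * (1 / min x 1) ≤ n := by
    rcases le_total x 1 with h | h
    · rw [min_eq_left h] at hsd ⊢
      have hκ := curvature_sq_ge hx hy
      have h2 := le_estVar_div_sq hx h hy
      have hκ1 : 1 ≤ curvature x y ^ 2 := by linarith
      have hpos : 0 < 1 / x := by positivity
      calc 86.4 * (1 / x) ≤ sampleDemand x y * 1 := by linarith
        _ ≤ sampleDemand x y * curvature x y ^ 2 := by
            gcongr
            linarith
        _ ≤ n := hD
    · rw [min_eq_right h]
      have hp1 := hurwitzSum_two_le_of_one_le h
      have hc25 : 25 ≤ c₁ := (twentyFive_le_majorant h hxy).trans hc₁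
      have h1 := one_div_hurwitzSum_two_le_estVar hx hy
      have h2 : 3 / 5 ≤ estTrace x y := by
        have : 3 / 5 ≤ 1 / hurwitzSum 2 x := by
          rw [le_div_iff₀ hp]
          linarith
        rw [estTrace]
        linarith
      have h3 : 30 ≤ Q := by
        refine le_trans ?_ hQc
        rw [le_div_iff₀ hp]
        linarith
      calc 86.4 * (1 / 1) ≤ (3 / 5 : ℝ) / 2 * 30 ^ 2 := by norm_num
        _ ≤ estTrace x y / 2 * Q ^ 2 := by gcongr
        _ ≤ n := hK2
  have hcap : cappedMin x y = min x 1 := by rw [cappedMin, min_eq_left hxy]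
  have hn1 : (5 : ℝ) ≤ n := by linarith
  have hn0 : (0 : ℝ) < n := by linarith
  refine ⟨?_, by exact_mod_cast hn1, ?_, ?_, ?_⟩
  · refine le_trans ?_ hD
    gcongr
    linarith
  · rw [hcap]
    have : 256 / (3 * min x 1) = 256 / 3 * (1 / min x 1) := by
      field_simp
    linarith
  · calc 2 * estTrace x y = √(2 * estTrace x y) ^ 2 := (Real.sq_sqrt (by positivity)).symm
      _ ≤ √(n : ℝ) ^ 2 := pow_le_pow_left₀ (Real.sqrt_nonneg _) (hKτ.trans hKn) 2
      _ = n := Real.sq_sqrt hn0.le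
  · have hsn : 0 < √(n : ℝ) := Real.sqrt_pos.2 hn0
    have htail := tailBound_mul_le hx hxy rfl hD hKτ
    have hJ : 11 * thirdRatio x y * √(estTrace x y) ≤ 0.7 * K :=
      (thirdRatio_mul_sqrt_le hx hxy hc₁ hc₂).trans (by gcongr)
    have e : estTrace x y / n * (1 + K / √(n : ℝ)) =
        estTrace x y / n + 0.7 * K * estTrace x y / (n * √(n : ℝ)) +
          0.3 * (estTrace x y * K) / (n * √(n : ℝ)) := by
      field_simp
      ring
    rw [e]
    refine add_le_add (add_le_add le_rfl ?_) ?_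
    · gcongr ?_ / _
      nlinarith
    · rw [le_div_iff₀ (by positivity)]
      exact htail

end

/-! ### The constants of the statement in terms of the Fisher information -/

section

variable {α β : ℝ}

theorem estTrace_comm (α β : ℝ) : estTrace α β = estTrace β α := add_comm _ _

theorem thirdRatio_comm (α β : ℝ) : thirdRatio α β = thirdRatio β α := by
  rw [thirdRatio, thirdRatio, fisherDet_comm α β, add_comm β α]
  ring

theorem cappedMin_comm (α β : ℝ) : cappedMin α β = cappedMin β α := by
  rw [cappedMin, cappedMin, min_comm α β]

theorem tailBound_comm (α β : ℝ) (n : ℕ) : tailBound α β n = tailBound β α n := by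
  rw [tailBound, tailBound, curvature_comm α β, cappedMin_comm α β,
    add_comm (max (α - 1) 0) (max (β - 1) 0)]
  ring_nf

theorem betaC₂_pos (hα : 0 < α) (hβ : 0 < β) : 0 < betaC₂ α β := by
  have hs : 0 < α + β := by linarith
  rw [betaC₂, polygamma_one hα, polygamma_one hs]
  have := hurwitzSum_two_add_lt hα hβ
  have := Real.sqrt_nonneg (betaDelta α β)
  linarith

/-- The sum of the two C₂ is the trace of the information plus twice the root of its determinant,
and trace over determinant is the trace of the inverse. -/
theorem betaDC_eq (hα : 0 < α) (hβ : 0 < β) : betaDC α β =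
    fisherDet α β ^ 2 * estTrace α β + 2 * (fisherDet α β * √(fisherDet α β)) := by
  have hs : 0 < α + β := by linarith
  have hδ := (fisherDet_pos hα hβ).ne'
  rw [betaDC, betaC₂, betaC₂, betaDelta_eq_fisherDet hα hβ, betaDelta_eq_fisherDet hβ hα,
    polygamma_one hα, polygamma_one hβ, add_comm β α, polygamma_one hs, estTrace, estVar, estVar,
    fisherDet_comm β α, add_comm β α]
  field_simp
  ring

theorem betaDC_pos (hα : 0 < α) (hβ : 0 < β) : 0 < betaDC α β := by
  have := fisherDet_pos hα hβ
  have := estTrace_pos hα hβ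
  rw [betaDC_eq hα hβ]
  positivity

/-- AM–GM for the eigenvalues: twice the root of the determinant is at most the trace. -/
theorem betaDC_le (hα : 0 < α) (hβ : 0 < β) :
    betaDC α β ≤ 2 * fisherDet α β ^ 2 * estTrace α β := by
  have hδ := fisherDet_pos hα hβ
  have hr : 0 < √(fisherDet α β) := Real.sqrt_pos.2 hδ
  have hτ := estTrace_pos hα hβ
  have hr2 := Real.sq_sqrt hδ.le
  rw [betaDC_eq hα hβ]
  have h : 2 * √(fisherDet α β) ≤ fisherDet α β * estTrace α β := by
    have e : fisherDet α β * estTrace α β = (hurwitzSum 2 α - hurwitzSum 2 (α + β)) +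
        (hurwitzSum 2 β - hurwitzSum 2 (α + β)) := by
      rw [estTrace, estVar, estVar, fisherDet_comm β α, add_comm β α]
      field_simp
      ring
    have h1 := hurwitzSum_two_add_lt hα hβ
    have h2 := hurwitzSum_two_add_lt' hα hβ
    rw [e]
    refine (pow_le_pow_iff_left₀ (by positivity) (by linarith) two_ne_zero).1 ?_
    rw [mul_pow, hr2, fisherDet_eq]
    nlinarith [sq_nonneg (hurwitzSum 2 α - hurwitzSum 2 β), sq_nonneg (hurwitzSum 2 (α + β))]
  nlinarith

/-- Both diagonal entries of the information are at most the entry belonging to the smaller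
parameter. -/
theorem estTrace_le_two_mul_betaM (hα : 0 < α) (hβ : 0 < β) :
    estTrace α β ≤ 2 * betaM α β := by
  have hs : 0 < α + β := by linarith
  have hδ := fisherDet_pos hα hβ
  rw [betaM, betaDelta_eq_fisherDet hα hβ, polygamma_one (lt_min hα hβ), polygamma_one hs,
    estTrace, estVar, estVar, fisherDet_comm β α, ← add_div, one_div_mul_eq_div, mul_div_assoc',
    add_comm β α]
  gcongr
  have h := le_max_right (hurwitzSum 2 (α + β))
    (hurwitzSum 2 (min α β) - hurwitzSum 2 (α + β))
  rcases le_total α β with hab | hab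
  · rw [min_eq_left hab] at h ⊢
    linarith [hurwitzSum_anti (j := 2) le_rfl hα hab]
  · rw [min_eq_right hab] at h ⊢
    linarith [hurwitzSum_anti (j := 2) le_rfl hβ hab]

theorem betaM_pos (hα : 0 < α) (hβ : 0 < β) : 0 < betaM α β := by
  linarith [estTrace_le_two_mul_betaM hα hβ, estTrace_pos hα hβ]

theorem le_pi_pow_four : 97.35 ≤ Real.pi ^ 4 := by
  calc (97.35 : ℝ) ≤ 3.1415 ^ 4 := by norm_num
    _ ≤ _ := by
        gcongr
        exact Real.pi_gt_d4.le

/-- With ε = x/2 the first term has 6 · 2⁴ = 96, and 6.49 is a lower bound for π⁴/15. -/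
theorem betaC₄_lower_fst {x y : ℝ} (hx : 0 < x) (hxy : x ≤ y) :
    96 * y / x ^ 4 + 6.49 * y + 7.26 ≤ betaC₄ (x / 2) y x := by
  have hy := hx.trans_le hxy
  have h1 : 6 * y / (x - x / 2) ^ 4 = 96 * y / x ^ 4 := by
    rw [show x - x / 2 = x / 2 by ring]
    field_simp
    norm_num
  have h2 : 0 < y + x - x / 2 := by linarith
  have h3 : 0 < 6 / (y + x - x / 2) ^ 3 := by positivity
  have h4 : 6.49 * y ≤ y * Real.pi ^ 4 / 15 := by
    nlinarith [le_pi_pow_four]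
  rw [betaC₄, h1]
  linarith

theorem betaC₄_lower_snd {x y : ℝ} (hx : 0 < x) :
    6 * x / (y - x / 2) ^ 4 + 6.49 * x + 6 / (y + x / 2) ^ 3 + 7.26 ≤ betaC₄ (x / 2) x y := by
  have h4 : 6.49 * x ≤ x * Real.pi ^ 4 / 15 := by
    nlinarith [le_pi_pow_four]
  rw [betaC₄, show x + y - x / 2 = y + x / 2 by ring]
  linarith

/-- The factor `K` of `ω = 1 - 8 M / (n ε²) - K / √n`. -/
noncomputable def betaDrift (α β : ℝ) : ℝ :=
  2 * betaM α β * (betaG (min α β / 2) α β + betaG (min α β / 2) β α) / √(betaDC α β)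

theorem betaC₄_min_pos (hα : 0 < α) (hβ : 0 < β) : 0 < betaC₄ (min α β / 2) α β := by
  have h1 : min α β ≤ β := min_le_right _ _
  have h2 : 0 < min α β := lt_min hα hβ
  have h3 : 0 < α + β - min α β / 2 := by linarith
  have h4 : 0 < β - min α β / 2 := by linarith
  unfold betaC₄
  positivity

theorem betaG_min_ge (hα : 0 < α) (hβ : 0 < β) :
    hurwitzSum 2 β * betaC₄ (min α β / 2) β α ≤ betaG (min α β / 2) α β := by
  have h := betaC₄_min_pos hβ hα
  rw [min_comm] at h
  rw [betaG, polygamma_one hβ]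
  gcongr
  linarith [Real.sqrt_nonneg (betaDelta α β)]

theorem betaG_min_pos (hα : 0 < α) (hβ : 0 < β) : 0 < betaG (min α β / 2) α β := by
  have h := betaC₄_min_pos hβ hα
  rw [min_comm] at h
  exact lt_of_lt_of_le (mul_pos (hurwitzSum_pos le_rfl hβ) h) (betaG_min_ge hα hβ)

theorem betaG_min_pos' (hα : 0 < α) (hβ : 0 < β) : 0 < betaG (min α β / 2) β α := by
  have h := betaG_min_pos hβ hα
  rwa [min_comm] at h

theorem betaG_min_ge' (hα : 0 < α) (hβ : 0 < β) :
    hurwitzSum 2 α * betaC₄ (min α β / 2) α β ≤ betaG (min α β / 2) β α := by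
  have h := betaG_min_ge hβ hα
  rwa [min_comm] at h

theorem betaDrift_pos (hα : 0 < α) (hβ : 0 < β) : 0 < betaDrift α β := by
  have h1 := betaG_min_pos hα hβ
  have h2 := betaG_min_pos' hα hβ
  have h3 := betaM_pos hα hβ
  have h4 := betaDC_pos hα hβ
  unfold betaDrift
  positivity

theorem betaOmega_eq (α β : ℝ) (n : ℕ) : betaOmega n (min α β / 2) α β =
    1 - 8 * betaM α β / (n * (min α β / 2) ^ 2) - betaDrift α β / √(n : ℝ) := by
  rw [betaOmega, betaDrift, Real.sqrt_mul n.cast_nonneg, div_div,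
    mul_comm (√(betaDC α β)) (√(n : ℝ))]

theorem betaDrift_div_le (hα : 0 < α) (hβ : 0 < β) (n : ℕ) :
    betaDrift α β / √(n : ℝ) ≤ 1 - betaOmega n (min α β / 2) α β := by
  have h3 := betaM_pos hα hβ
  have : 0 ≤ 8 * betaM α β / (n * (min α β / 2) ^ 2) := by positivity
  rw [betaOmega_eq]
  linarith

/-- The constants M and Δ of the drift are replaced by the trace and the determinant, through
`estTrace_le_two_mul_betaM` and `betaDC_le`. -/
theorem sqrt_half_mul_le_betaDrift (hα : 0 < α) (hβ : 0 < β) :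
    √(estTrace α β / 2) * ((betaG (min α β / 2) α β + betaG (min α β / 2) β α) /
      fisherDet α β) ≤ betaDrift α β := by
  have h1 := betaG_min_pos hα hβ
  have h2 := betaG_min_pos' hα hβ
  have hδ := fisherDet_pos hα hβ
  have hτ := estTrace_pos hα hβ
  have hDC := betaDC_pos hα hβ
  have hr : 0 < √(estTrace α β / 2) := Real.sqrt_pos.2 (by positivity)
  have hsq : √(betaDC α β) ≤ 2 * fisherDet α β * √(estTrace α β / 2) := by
    refine Real.sqrt_le_iff.2 ⟨by positivity, ?_⟩
    rw [mul_pow, Real.sq_sqrt (by positivity)]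
    linarith [betaDC_le hα hβ]
  have hr2 : estTrace α β = 2 * √(estTrace α β / 2) ^ 2 := by
    rw [Real.sq_sqrt (by positivity)]
    ring
  set r := √(estTrace α β / 2)
  set G := betaG (min α β / 2) α β + betaG (min α β / 2) β α with hG
  have hG0 : 0 < G := by positivity
  have hsp : 0 < √(betaDC α β) := Real.sqrt_pos.2 hDC
  calc r * (G / fisherDet α β) = 2 * r ^ 2 * G / (2 * fisherDet α β * r) := by
        field_simp
    _ ≤ 2 * r ^ 2 * G / √(betaDC α β) := by gcongr
    _ ≤ 2 * betaM α β * G / √(betaDC α β) := by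
        rw [← hr2]
        gcongr
        exact estTrace_le_two_mul_betaM hα hβ
    _ = _ := rfl

/-- Two lower bounds for √n are multiplied: the threshold gives 2 G₂/(m √Δ), from the G₂ part of P
alone, and the drift gives τ G₁/√Δ. Then Δ ≤ 2δ²τ removes the trace. -/
theorem betaG_mul_le (hα : 0 < α) (hβ : 0 < β) {n : ℕ} (hn : betaThreshold α β ≤ n)
    (hK : betaDrift α β ≤ √(n : ℝ)) :
    betaG (min α β / 2) α β * betaG (min α β / 2) β α / (min α β * fisherDet α β ^ 2) ≤ n := by
  have h1 := betaG_min_pos hα hβ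
  have h2 := betaG_min_pos' hα hβ
  have hδ := fisherDet_pos hα hβ
  have hτ := estTrace_pos hα hβ
  have hDC := betaDC_pos hα hβ
  have hM := betaM_pos hα hβ
  have hm : 0 < min α β := lt_min hα hβ
  have hsp : 0 < √(betaDC α β) := Real.sqrt_pos.2 hDC
  have hP : betaG (min α β / 2) β α / (2 * √(betaDC α β)) ≤ betaThresholdTerm α β := by
    rw [betaThresholdTerm]
    gcongr
    have : 0 ≤ min α β * betaM α β * betaG (min α β / 2) α β := by positivity
    linarith
  set P := betaThresholdTerm α β
  set G₁ := betaG (min α β / 2) α β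
  set G₂ := betaG (min α β / 2) β α
  have hP0 : 0 ≤ P := le_trans (by positivity) hP
  have hA : 2 * G₂ / (min α β * √(betaDC α β)) ≤ √(n : ℝ) := by
    have h3 : 4 * P / min α β ≤ √(n : ℝ) := by
      refine Real.le_sqrt_of_sq_le (le_trans ?_ hn)
      rw [betaThreshold]
      have h5 : P ≤ √(P ^ 2 + 8 * betaM α β) := Real.le_sqrt_of_sq_le (by linarith)
      calc (4 * P / min α β) ^ 2 = 4 / min α β ^ 2 * (P + P) ^ 2 := by
            field_simp
            ring
        _ ≤ _ := by gcongr
    refine le_trans ?_ h3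
    calc _ = 4 * (G₂ / (2 * √(betaDC α β))) / min α β := by
          field_simp
          norm_num
      _ ≤ _ := by gcongr
  have hB : estTrace α β * G₁ / √(betaDC α β) ≤ √(n : ℝ) := by
    refine le_trans ?_ hK
    rw [betaDrift]
    gcongr
    · exact estTrace_le_two_mul_betaM hα hβ
    · exact le_add_of_nonneg_right h2.le
  calc _ = 2 * estTrace α β * G₁ * G₂ / (min α β * (2 * fisherDet α β ^ 2 * estTrace α β)) := by
        field_simp
    _ ≤ 2 * estTrace α β * G₁ * G₂ / (min α β * betaDC α β) := by
        gcongr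
        exact betaDC_le hα hβ
    _ = (2 * G₂ / (min α β * √(betaDC α β))) * (estTrace α β * G₁ / √(betaDC α β)) := by
        rw [div_mul_div_comm, mul_assoc (min α β), Real.mul_self_sqrt hDC.le]
        ring
    _ ≤ √(n : ℝ) * √(n : ℝ) := by gcongr
    _ = n := Real.mul_self_sqrt n.cast_nonneg

theorem betaOmega_pos_drift (hα : 0 < α) (hβ : 0 < β) {n : ℕ}
    (hω : 0 < betaOmega n (min α β / 2) α β) (hn0 : 0 < n) : betaDrift α β ≤ √(n : ℝ) := by
  have h := betaDrift_div_le hα hβ n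
  have : betaDrift α β / √(n : ℝ) ≤ 1 := by linarith
  rwa [div_le_one (Real.sqrt_pos.2 (by exact_mod_cast hn0))] at this

theorem betaThreshold_pos (hα : 0 < α) (hβ : 0 < β) : 0 < betaThreshold α β := by
  have h1 := betaG_min_pos hα hβ
  have h2 := betaG_min_pos' hα hβ
  have hDC := betaDC_pos hα hβ
  have hM := betaM_pos hα hβ
  have hm : 0 < min α β := lt_min hα hβ
  have hP : 0 < betaThresholdTerm α β := by
    unfold betaThresholdTerm
    positivity
  unfold betaThreshold
  positivity

/-- `sample_size_bounds` needs the smaller parameter first; the bounds derived from the threshold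
and the drift are symmetric, so the other order follows by exchange. -/
theorem sample_size_bounds_of_threshold (hα : 0 < α) (hβ : 0 < β) {n : ℕ}
    (hn : betaThreshold α β ≤ n) (hω : 0 < betaOmega n (min α β / 2) α β) :
    2200 * curvature α β ^ 2 ≤ n ∧ 5 ≤ n ∧ 256 / (3 * cappedMin α β) + 1 ≤ n ∧
      2 * estTrace α β ≤ n ∧
      estTrace α β / n + 11 * thirdRatio α β * (estTrace α β * √(estTrace α β)) / (n * √(n : ℝ)) +
        tailBound α β n ≤ estTrace α β / n * (1 + betaDrift α β / √(n : ℝ)) := by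
  have hn0 : 0 < n := by
    have := (betaThreshold_pos hα hβ).trans_le hn
    exact_mod_cast this
  have hKn := betaOmega_pos_drift hα hβ hω hn0
  have hT := betaG_mul_le hα hβ hn hKn
  have hK := sqrt_half_mul_le_betaDrift hα hβ
  have g1 := betaG_min_ge hα hβ
  have g2 := betaG_min_ge' hα hβ
  have hδ := fisherDet_pos hα hβ
  have hp := hurwitzSum_pos (j := 2) le_rfl hα
  have hq := hurwitzSum_pos (j := 2) le_rfl hβ
  have p1 := betaC₄_min_pos hα hβ
  have p2 : 0 < betaC₄ (min α β / 2) β α := by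
    have := betaC₄_min_pos hβ hα
    rwa [min_comm] at this
  have hG1 := betaG_min_pos hα hβ
  have hm : 0 < min α β := lt_min hα hβ
  have hK' : √(estTrace α β / 2) * ((hurwitzSum 2 β * betaC₄ (min α β / 2) β α +
      hurwitzSum 2 α * betaC₄ (min α β / 2) α β) / fisherDet α β) ≤ betaDrift α β := by
    refine le_trans ?_ hK
    gcongr
  have hT' : hurwitzSum 2 β * betaC₄ (min α β / 2) β α *
      (hurwitzSum 2 α * betaC₄ (min α β / 2) α β) / (min α β * fisherDet α β ^ 2) ≤ n := by
    refine le_trans ?_ hT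
    gcongr
  rcases le_total α β with hab | hab
  · have e := min_eq_left hab
    rw [e] at hK' hT'
    exact sample_size_bounds hα hab (betaC₄_lower_fst hα hab) (betaC₄_lower_snd hα) hK' hKn hT'
  · have e := min_eq_right hab
    rw [e, fisherDet_comm α β] at hK' hT'
    rw [add_comm, estTrace_comm α β] at hK'
    rw [mul_comm (hurwitzSum 2 β * _)] at hT'
    rw [curvature_comm, cappedMin_comm, estTrace_comm, thirdRatio_comm, tailBound_comm]
    exact sample_size_bounds hβ hab (betaC₄_lower_fst hβ hab) (betaC₄_lower_snd hβ) hK' hKn hT'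

/-- The last summand of γ is the trace of the inverse information, and the summands with V₁ and V₂
are nonnegative. -/
theorem betaGamma_ge (hα : 0 < α) (hβ : 0 < β) (n : ℕ) : estTrace α β ≤ betaGamma n α β := by
  have hs : 0 < α + β := by linarith
  have hδ := fisherDet_pos hα hβ
  have hDC := betaDC_pos hα hβ
  have hM := betaM_pos hα hβ
  have h1 : 0 ≤ 4 * betaM α β / (√n * betaDC α β) * betaV₁ α β := by
    unfold betaV₁
    positivity
  have h2 : 0 ≤ betaM α β * √24 / (√n * betaDC α β) * betaV₂ α β := by
    unfold betaV₂
    positivity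
  have h3 : (polygamma 1 β + polygamma 1 α - 2 * polygamma 1 (α + β)) / betaDelta α β =
      estTrace α β := by
    rw [betaDelta_eq_fisherDet hα hβ, polygamma_one hα, polygamma_one hβ, polygamma_one hs,
      estTrace, estVar, estVar, fisherDet_comm β α, add_comm β α]
    ring
  rw [betaGamma, h3]
  linarith

/-- With t = K/√n ≤ 1 - ω one has (1 + t) ω ≤ 1 - t² ≤ 1, which gives the bound by γ/(nω). The bound
by 1 follows from t ≤ 1 and 2τ ≤ n. -/
theorem betaMLE_mse_bound {Ω : Type*} [MeasurableSpace Ω] {μ : Measure Ω} [IsProbabilityMeasure μ]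
    (hα : 0 < α) (hβ : 0 < β) {n : ℕ}
    {X : Fin n → Ω → ℝ} (hlaw : ∀ i, HasLaw (X i) (betaMeasure α β) μ) (hind : iIndepFun X μ)
    {θ : Ω → Plane} (hθ : AEMeasurable θ μ)
    (hmle : ∀ᵐ ω ∂μ, IsBetaMLE (fun i => X i ω) (θ ω))
    (hn : betaThreshold α β ≤ n) (hω : 0 < betaOmega n (min α β / 2) α β) :
    Integrable (fun ω => (θ ω 0 - α) ^ 2 + (θ ω 1 - β) ^ 2) μ ∧
      ∫ ω, (θ ω 0 - α) ^ 2 + (θ ω 1 - β) ^ 2 ∂μ ≤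
        betaGamma n α β / (n * betaOmega n (min α β / 2) α β) ∧
      ∫ ω, (θ ω 0 - α) ^ 2 + (θ ω 1 - β) ^ 2 ∂μ ≤ 1 := by
  obtain ⟨h1, h2, h3, h4, h5⟩ := sample_size_bounds_of_threshold hα hβ hn hω
  obtain ⟨hint, hle⟩ := sq_error_bound hα hβ hlaw hind hθ hmle h1 h2 h3
  have hn0 : (0 : ℝ) < n := by
    have : 0 < n := by omega
    exact_mod_cast this
  have hτ := estTrace_pos hα hβ
  have hγ := betaGamma_ge hα hβ n
  have hγ0 := hτ.trans_le hγ
  have ht := betaDrift_div_le hα hβ n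
  have hK := betaDrift_pos hα hβ
  have ht0 : 0 < betaDrift α β / √(n : ℝ) := by positivity
  have hle' := hle.trans h5
  refine ⟨hint, hle'.trans ?_, hle'.trans ?_⟩
  · have h6 : 1 + betaDrift α β / √(n : ℝ) ≤ 1 / betaOmega n (min α β / 2) α β := by
      rw [le_div_iff₀ hω]
      nlinarith
    calc _ ≤ betaGamma n α β / n * (1 / betaOmega n (min α β / 2) α β) := by gcongr
      _ = _ := by
          rw [div_mul_div_comm, mul_one]
  · calc _ ≤ estTrace α β / n * (1 + 1) := by
          gcongr
          linarith
      _ = 2 * estTrace α β / n := by ring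
      _ ≤ 1 := (div_le_one hn0).2 h4

end

/-! ### Taylor's formula -/

section

/-- A mean value inequality that never integrates the derivative, since the third derivative of a
test function need not be continuous. -/
theorem abs_le_of_hasDerivAt_le {f f' B B' : ℝ → ℝ} (hf : ∀ t, HasDerivAt f (f' t) t)
    (hB : ∀ t, HasDerivAt B (B' t) t) (hf0 : f 0 = 0) (hB0 : B 0 = 0)
    (h : ∀ t ∈ Set.Icc (0 : ℝ) 1, |f' t| ≤ B' t) : ∀ t ∈ Set.Icc (0 : ℝ) 1, |f t| ≤ B t := by
  intro t ht
  exact image_norm_le_of_norm_deriv_right_le_deriv_boundary (a := 0) (b := 1)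
    (fun s _ => (hf s).continuousAt.continuousWithinAt) (fun s _ => (hf s).hasDerivWithinAt)
    (by rw [hf0, hB0, norm_zero]) hB (fun s hs => h s ⟨hs.1, hs.2.le⟩) ht

/-- Taylor's formula of third order for a function that is merely three times differentiable. -/
theorem abs_taylor_sub_le {φ φ₁ φ₂ φ₃ : ℝ → ℝ} {C : ℝ} (h1 : ∀ t, HasDerivAt φ (φ₁ t) t)
    (h2 : ∀ t, HasDerivAt φ₁ (φ₂ t) t) (h3 : ∀ t, HasDerivAt φ₂ (φ₃ t) t)
    (hC : ∀ t, |φ₃ t| ≤ C) : |φ 1 - (φ 0 + φ₁ 0 + φ₂ 0 / 2)| ≤ C / 6 := by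
  have hid : ∀ t : ℝ, HasDerivAt (fun t : ℝ => t) 1 t := hasDerivAt_id
  have hsq : ∀ t : ℝ, HasDerivAt (fun t : ℝ => t ^ 2 / 2) t t := fun t =>
    ((hasDerivAt_pow 2 t).div_const 2).congr_deriv (by norm_num)
  have hcu : ∀ t : ℝ, HasDerivAt (fun t : ℝ => t ^ 3 / 6) (t ^ 2 / 2) t := fun t =>
    ((hasDerivAt_pow 3 t).div_const 6).congr_deriv (by norm_num; ring)
  have s2 := abs_le_of_hasDerivAt_le (f := fun t => φ₂ t - φ₂ 0) (B := fun t => C * t)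
    (B' := fun _ => C) (fun t => (h3 t).sub_const (φ₂ 0))
    (fun t => by simpa using (hid t).const_mul C) (by simp) (by simp) (fun t _ => hC t)
  have s1 := abs_le_of_hasDerivAt_le (f := fun t => φ₁ t - φ₁ 0 - φ₂ 0 * t)
    (B := fun t => C * (t ^ 2 / 2)) (B' := fun t => C * t)
    (fun t => (((h2 t).sub_const (φ₁ 0)).sub ((hid t).const_mul (φ₂ 0))).congr_deriv (by ring))
    (fun t => (hsq t).const_mul C) (by simp) (by simp) s2
  have s0 := abs_le_of_hasDerivAt_le (f := fun t => φ t - φ 0 - φ₁ 0 * t - φ₂ 0 * (t ^ 2 / 2))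
    (B := fun t => C * (t ^ 3 / 6)) (B' := fun t => C * (t ^ 2 / 2))
    (fun t => ((((h1 t).sub_const (φ 0)).sub ((hid t).const_mul (φ₁ 0))).sub
      ((hsq t).const_mul (φ₂ 0))).congr_deriv (by ring))
    (fun t => (hcu t).const_mul C) (by simp) (by simp) s1
  have := s0 1 ⟨zero_le_one, le_rfl⟩
  convert this using 1
  · congr 1
    ring
  · ring

variable {h : Plane → ℝ}

theorem plane_eq (y : Plane) :
    y = y 0 • EuclideanSpace.single 0 1 + y 1 • EuclideanSpace.single 1 1 := by
  ext i
  fin_cases i <;> simp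

theorem fderiv_apply_eq (x y : Plane) :
    fderiv ℝ h x y = y 0 * partialDeriv 0 h x + y 1 * partialDeriv 1 h x := by
  conv_lhs => rw [plane_eq y]
  simp [partialDeriv]

theorem fderiv_fderiv_apply (h2 : Differentiable ℝ (fderiv ℝ h)) (x y : Plane) (i : Fin 2) :
    fderiv ℝ (partialDeriv i h) x y = fderiv ℝ (fderiv ℝ h) x y (EuclideanSpace.single i 1) := by
  unfold partialDeriv
  rw [fderiv_clm_apply (h2 x) (by fun_prop)]
  simp

/-- The second derivative in the direction `y`. -/
noncomputable def secondDeriv (h : Plane → ℝ) (y x : Plane) : ℝ :=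
  y 0 ^ 2 * partialDeriv 0 (partialDeriv 0 h) x +
    y 0 * y 1 * (partialDeriv 1 (partialDeriv 0 h) x + partialDeriv 0 (partialDeriv 1 h) x) +
    y 1 ^ 2 * partialDeriv 1 (partialDeriv 1 h) x

theorem IsTestFunction.differentiable_partialDeriv (hh : IsTestFunction h) (i : Fin 2) :
    Differentiable ℝ (partialDeriv i h) := by
  have := hh.differentiable_two
  unfold partialDeriv
  fun_prop

theorem IsTestFunction.differentiable_partialDeriv₂ (hh : IsTestFunction h) (i j : Fin 2) :
    Differentiable ℝ (partialDeriv j (partialDeriv i h)) := by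
  have h3 := hh.differentiable_three
  have : partialDeriv j (partialDeriv i h) = fun x => fderiv ℝ (fderiv ℝ h) x
      (EuclideanSpace.single j 1) (EuclideanSpace.single i 1) := by
    ext x
    exact fderiv_fderiv_apply hh.differentiable_two x _ i
  rw [this]
  fun_prop

theorem hasDerivAt_comp_line {g : Plane → ℝ} (hg : Differentiable ℝ g) (x y : Plane) (t : ℝ) :
    HasDerivAt (fun t : ℝ => g (x + t • y))
      (y 0 * partialDeriv 0 g (x + t • y) + y 1 * partialDeriv 1 g (x + t • y)) t := by
  have h1 : HasDerivAt (fun t : ℝ => x + t • y) y t := by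
    simpa using ((hasDerivAt_id t).smul_const y).const_add x
  rw [← fderiv_apply_eq]
  exact (hg _).hasFDerivAt.comp_hasDerivAt t h1

theorem abs_combo_le {a b u v M : ℝ} (hu : |u| ≤ M) (hv : |v| ≤ M) :
    |a * u + b * v| ≤ (|a| + |b|) * M := by
  calc |a * u + b * v| ≤ |a| * |u| + |b| * |v| := by
        rw [← abs_mul, ← abs_mul]
        exact abs_add_le _ _
    _ ≤ |a| * M + |b| * M := by gcongr
    _ = _ := by ring

theorem abs_sub_le_of_partialDeriv_le (h1 : Differentiable ℝ h) {M : ℝ}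
    (hM : ∀ i x, |partialDeriv i h x| ≤ M) (x y : Plane) :
    |h (x + y) - h x| ≤ M * (|y 0| + |y 1|) := by
  have s := abs_le_of_hasDerivAt_le (f := fun t => h (x + t • y) - h x)
    (B := fun t => (|y 0| + |y 1|) * M * t) (B' := fun _ => (|y 0| + |y 1|) * M)
    (fun t => (hasDerivAt_comp_line h1 x y t).sub_const (h x))
    (fun t => by simpa using (hasDerivAt_id t).const_mul ((|y 0| + |y 1|) * M))
    (by simp) (by simp) (fun t _ => abs_combo_le (hM 0 _) (hM 1 _))
    1 ⟨zero_le_one, le_rfl⟩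
  simpa [mul_comm] using s

/-- On the line through x the third derivative is a cubic form in y with coefficients at most M.
Both mixed second derivatives are kept, so their symmetry is not needed. -/
theorem IsTestFunction.abs_taylor_sub_le (hh : IsTestFunction h) {M : ℝ}
    (hM : ∀ i j k x, |partialDeriv i (partialDeriv j (partialDeriv k h)) x| ≤ M) (x y : Plane) :
    |h (x + y) - (h x + (y 0 * partialDeriv 0 h x + y 1 * partialDeriv 1 h x) +
      secondDeriv h y x / 2)| ≤ M * (|y 0| + |y 1|) ^ 3 / 6 := by
  have h1 := hasDerivAt_comp_line hh.differentiable_one x y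
  have h2 : ∀ t, HasDerivAt (fun t : ℝ => y 0 * partialDeriv 0 h (x + t • y) +
      y 1 * partialDeriv 1 h (x + t • y)) (secondDeriv h y (x + t • y)) t := by
    intro t
    refine (((hasDerivAt_comp_line (hh.differentiable_partialDeriv 0) x y t).const_mul (y 0)).add
      ((hasDerivAt_comp_line (hh.differentiable_partialDeriv 1) x y t).const_mul (y 1))).congr_deriv
      ?_
    rw [secondDeriv]
    ring
  have d := fun i j t => hasDerivAt_comp_line (hh.differentiable_partialDeriv₂ i j) x y t
  have h3 := fun t => (((d 0 0 t).const_mul (y 0 ^ 2)).add (((d 0 1 t).add (d 1 0 t)).const_mul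
    (y 0 * y 1))).add ((d 1 1 t).const_mul (y 1 ^ 2))
  have := _root_.abs_taylor_sub_le (C := M * (|y 0| + |y 1|) ^ 3) h1 h2 h3 ?_
  · simpa using this
  · intro t
    have e := fun i j => abs_combo_le (a := y 0) (b := y 1) (hM 0 i j (x + t • y))
      (hM 1 i j (x + t • y))
    set N := (|y 0| + |y 1|) * M with hN
    have hN0 : 0 ≤ N := (abs_nonneg _).trans (e 0 0)
    refine (abs_add_three _ _ _).trans ?_
    rw [abs_mul, abs_mul, abs_mul (y 1 ^ 2), abs_pow, abs_pow, abs_mul]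
    calc _ ≤ |y 0| ^ 2 * N + |y 0| * |y 1| * (N + N) + |y 1| ^ 2 * N := by
          gcongr
          · exact e 0 0
          · exact (abs_add_le _ _).trans (add_le_add (e 1 0) (e 0 1))
          · exact e 1 1
      _ = _ := by
          rw [hN]
          ring

/-! ### Lindeberg's replacement -/

/-- A probability measure with mean zero, identity covariance and third absolute moment at most
`c`. -/
structure IsStandardised (ρ : Measure Plane) (c : ℝ) : Prop where
  integrable_fst : ∀ i, Integrable (fun y : Plane => y i) ρ
  integral_fst : ∀ i, ∫ y : Plane, y i ∂ρ = 0
  integrable_snd : ∀ i j, Integrable (fun y : Plane => y i * y j) ρ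
  integral_snd : ∀ i j, ∫ y : Plane, y i * y j ∂ρ = if i = j then 1 else 0
  integrable_cube : Integrable (fun y : Plane => (|y 0| + |y 1|) ^ 3) ρ
  integral_cube_le : ∫ y : Plane, (|y 0| + |y 1|) ^ 3 ∂ρ ≤ c

theorem IsTestFunction.continuous (hh : IsTestFunction h) : Continuous h :=
  hh.differentiable_one.continuous

theorem integrable_of_abs_le {ρ : Measure Plane} [IsFiniteMeasure ρ] (hc : Continuous h) {H : ℝ}
    (hH : ∀ x, |h x| ≤ H) : Integrable h ρ :=
  Integrable.of_bound hc.aestronglyMeasurable H (Filter.Eventually.of_forall hH)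

/-- Mean zero and identity covariance reduce the integrated Taylor polynomial to h and its
Laplacian. This is the same for all standardised measures, so two of them differ only at third
order. -/
theorem IsTestFunction.abs_integral_step_le (hh : IsTestFunction h) {M H c s : ℝ}
    (hM : ∀ i j k x, |partialDeriv i (partialDeriv j (partialDeriv k h)) x| ≤ M)
    (hH : ∀ x, |h x| ≤ H) (hs : 0 ≤ s)
    {ρ : Measure Plane} [IsProbabilityMeasure ρ] (hρ : IsStandardised ρ c) (x : Plane) :
    |∫ y, h (x + s • y) ∂ρ - (h x + s ^ 2 / 2 * (partialDeriv 0 (partialDeriv 0 h) x +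
      partialDeriv 1 (partialDeriv 1 h) x))| ≤ M * s ^ 3 * c / 6 := by
  have hM0 : 0 ≤ M := (abs_nonneg _).trans (hM 0 0 0 0)
  have hcont := hh.continuous
  have hint : Integrable (fun y => h (x + s • y)) ρ :=
    integrable_of_abs_le (by fun_prop) (fun y => hH _)
  set a₀ := partialDeriv 0 h x
  set a₁ := partialDeriv 1 h x
  set b₀ := partialDeriv 0 (partialDeriv 0 h) x with hb₀
  set b₁ := partialDeriv 1 (partialDeriv 0 h) x + partialDeriv 0 (partialDeriv 1 h) x with hb₁
  set b₂ := partialDeriv 1 (partialDeriv 1 h) x with hb₂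
  have i0 := (hρ.integrable_fst 0).const_mul (s * a₀)
  have i1 := (hρ.integrable_fst 1).const_mul (s * a₁)
  have i2 := (hρ.integrable_snd 0 0).const_mul (s ^ 2 / 2 * b₀)
  have i3 := (hρ.integrable_snd 0 1).const_mul (s ^ 2 / 2 * b₁)
  have i4 := (hρ.integrable_snd 1 1).const_mul (s ^ 2 / 2 * b₂)
  have ic : Integrable (fun _ : Plane => h x) ρ := integrable_const _
  have j1 : Integrable (fun y : Plane => h x + s * a₀ * y 0) ρ := ic.add i0
  have j2 : Integrable (fun y : Plane => h x + s * a₀ * y 0 + s * a₁ * y 1) ρ := j1.add i1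
  have j3 : Integrable (fun y : Plane => h x + s * a₀ * y 0 + s * a₁ * y 1 +
      s ^ 2 / 2 * b₀ * (y 0 * y 0)) ρ := j2.add i2
  have j4 : Integrable (fun y : Plane => h x + s * a₀ * y 0 + s * a₁ * y 1 +
      s ^ 2 / 2 * b₀ * (y 0 * y 0) + s ^ 2 / 2 * b₁ * (y 0 * y 1)) ρ := j3.add i3
  have j5 : Integrable (fun y : Plane => h x + s * a₀ * y 0 + s * a₁ * y 1 +
      s ^ 2 / 2 * b₀ * (y 0 * y 0) + s ^ 2 / 2 * b₁ * (y 0 * y 1) +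
      s ^ 2 / 2 * b₂ * (y 1 * y 1)) ρ := j4.add i4
  have hquad : ∫ y : Plane, (h x + s * a₀ * y 0 + s * a₁ * y 1 + s ^ 2 / 2 * b₀ * (y 0 * y 0) +
      s ^ 2 / 2 * b₁ * (y 0 * y 1) + s ^ 2 / 2 * b₂ * (y 1 * y 1)) ∂ρ =
      h x + s ^ 2 / 2 * (b₀ + b₂) := by
    rw [integral_add j4 i4, integral_add j3 i3, integral_add j2 i2, integral_add j1 i1,
      integral_add ic i0, integral_const_mul, integral_const_mul,
      integral_const_mul, integral_const_mul, integral_const_mul, hρ.integral_fst,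
      hρ.integral_fst, hρ.integral_snd, hρ.integral_snd, hρ.integral_snd]
    simp
    ring
  rw [← hquad, ← integral_sub hint j5]
  have hb : ∀ y : Plane, |h (x + s • y) - (h x + s * a₀ * y 0 + s * a₁ * y 1 +
      s ^ 2 / 2 * b₀ * (y 0 * y 0) + s ^ 2 / 2 * b₁ * (y 0 * y 1) +
      s ^ 2 / 2 * b₂ * (y 1 * y 1))| ≤ M * s ^ 3 / 6 * (|y 0| + |y 1|) ^ 3 := by
    intro y
    have := hh.abs_taylor_sub_le hM x (s • y)
    simp only [secondDeriv, PiLp.smul_apply, smul_eq_mul, ← hb₀, ← hb₁, ← hb₂] at this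
    convert this using 1
    · congr 1
      ring
    · rw [abs_mul, abs_mul, abs_of_nonneg hs]
      ring
  rw [← Real.norm_eq_abs]
  refine (norm_integral_le_of_norm_le (hρ.integrable_cube.const_mul (M * s ^ 3 / 6))
    (Filter.Eventually.of_forall hb)).trans ?_
  rw [integral_const_mul]
  calc _ ≤ M * s ^ 3 / 6 * c := by
        gcongr
        exact hρ.integral_cube_le
    _ = _ := by ring

/-- The convolution powers of a measure. -/
noncomputable def convPow (ρ : Measure Plane) : ℕ → Measure Plane
  | 0 => Measure.dirac 0
  | k + 1 => ρ ∗ convPow ρ k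

instance isProbabilityMeasure_convPow (ρ : Measure Plane) [IsProbabilityMeasure ρ] (k : ℕ) :
    IsProbabilityMeasure (convPow ρ k) := by
  induction k with
  | zero => exact Measure.dirac.isProbabilityMeasure
  | succ k ih =>
    unfold convPow
    infer_instance

theorem abs_integral_conv_sub_le (hc : Continuous h) {H C : ℝ} (hH : ∀ x, |h x| ≤ H)
    {ρ σ : Measure Plane} [IsProbabilityMeasure ρ] [IsProbabilityMeasure σ]
    (hC : ∀ x, |∫ y, h (x + y) ∂ρ - ∫ y, h (x + y) ∂σ| ≤ C)
    (π : Measure Plane) [IsProbabilityMeasure π] :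
    |∫ y, h y ∂(π ∗ ρ) - ∫ y, h y ∂(π ∗ σ)| ≤ C := by
  have hi : ∀ (τ : Measure Plane) [IsProbabilityMeasure τ],
      Integrable (fun x => ∫ y, h (x + y) ∂τ) π := by
    intro τ _
    have : Integrable (fun p : Plane × Plane => h (p.1 + p.2)) (π.prod τ) :=
      Integrable.of_bound (by fun_prop) H (Filter.Eventually.of_forall fun p => hH _)
    exact this.integral_prod_left
  rw [integral_conv (integrable_of_abs_le hc hH), integral_conv (integrable_of_abs_le hc hH),
    ← integral_sub (hi ρ) (hi σ)]
  have := norm_integral_le_of_norm_le_const (μ := π) (C := C)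
    (f := fun x => ∫ y, h (x + y) ∂ρ - ∫ y, h (x + y) ∂σ) (Filter.Eventually.of_forall hC)
  simpa using this

/-- One factor is exchanged at a time. The measure π collects the factors not being exchanged, which
is why the induction runs over all π, and commutativity of convolution moves the next factor into
place. -/
theorem abs_integral_conv_convPow_sub_le (hc : Continuous h) {H C : ℝ} (hH : ∀ x, |h x| ≤ H)
    {ρ σ : Measure Plane} [IsProbabilityMeasure ρ] [IsProbabilityMeasure σ]
    (hC : ∀ x, |∫ y, h (x + y) ∂ρ - ∫ y, h (x + y) ∂σ| ≤ C) (k : ℕ)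
    (π : Measure Plane) [IsProbabilityMeasure π] :
    |∫ y, h y ∂(π ∗ convPow ρ k) - ∫ y, h y ∂(π ∗ convPow σ k)| ≤ k * C := by
  induction k generalizing π with
  | zero => simp [convPow]
  | succ k ih =>
    have h1 := ih (π ∗ ρ)
    have h2 := abs_integral_conv_sub_le hc hH hC (π ∗ convPow σ k)
    have e1 : π ∗ convPow ρ (k + 1) = (π ∗ ρ) ∗ convPow ρ k := (Measure.conv_assoc _ _ _).symm
    have e2 : π ∗ convPow σ (k + 1) = (π ∗ convPow σ k) ∗ σ := by
      rw [convPow, Measure.conv_comm σ, Measure.conv_assoc]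
    have e3 : (π ∗ ρ) ∗ convPow σ k = (π ∗ convPow σ k) ∗ ρ := by
      rw [Measure.conv_assoc, Measure.conv_comm ρ, Measure.conv_assoc]
    rw [e1, e2]
    rw [e3] at h1
    push_cast
    calc _ ≤ _ := abs_sub_le _ (∫ y, h y ∂((π ∗ convPow σ k) ∗ ρ)) _
      _ ≤ k * C + C := add_le_add h1 h2
      _ = _ := by ring

/-- Lindeberg's bound for the normal approximation of a standardised sum. -/
theorem IsTestFunction.abs_integral_convPow_sub_le (hh : IsTestFunction h) {M H c c' : ℝ}
    (hM : ∀ i j k x, |partialDeriv i (partialDeriv j (partialDeriv k h)) x| ≤ M)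
    (hH : ∀ x, |h x| ≤ H) {ρ σ : Measure Plane} [IsProbabilityMeasure ρ] [IsProbabilityMeasure σ]
    (hρ : IsStandardised ρ c) (hσ : IsStandardised σ c') {n : ℕ} (hn : 0 < n) :
    |∫ y, h y ∂(convPow (ρ.map fun y => (1 / √(n : ℝ)) • y) n) -
      ∫ y, h y ∂(convPow (σ.map fun y => (1 / √(n : ℝ)) • y) n)| ≤ M * (c + c') / (6 * √(n : ℝ)) := by
  have hn0 : (0 : ℝ) < n := by exact_mod_cast hn
  set s := 1 / √(n : ℝ) with hs
  have hs0 : 0 ≤ s := by positivity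
  have hcont := hh.continuous
  have hmeas : Measurable fun y : Plane => s • y := by fun_prop
  have := Measure.isProbabilityMeasure_map (μ := ρ) hmeas.aemeasurable
  have := Measure.isProbabilityMeasure_map (μ := σ) hmeas.aemeasurable
  have key := abs_integral_conv_convPow_sub_le (C := M * s ^ 3 * (c + c') / 6) hcont hH
    (ρ := ρ.map fun y => s • y) (σ := σ.map fun y => s • y) ?_ n (Measure.dirac 0)
  · rw [Measure.dirac_zero_conv, Measure.dirac_zero_conv] at key
    refine key.trans_eq ?_
    rw [hs, div_pow, pow_succ √(n : ℝ), Real.sq_sqrt hn0.le]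
    field_simp
  · intro x
    have hm : Continuous fun y => h (x + y) := by fun_prop
    rw [integral_map hmeas.aemeasurable hm.aestronglyMeasurable,
      integral_map hmeas.aemeasurable hm.aestronglyMeasurable]
    have h1 := hh.abs_integral_step_le hM hH hs0 hρ x
    have h2 := hh.abs_integral_step_le hM hH hs0 hσ x
    rw [abs_sub_comm] at h2
    calc _ ≤ _ := abs_sub_le _ _ _
      _ ≤ _ := add_le_add h1 h2
      _ = _ := by ring

end

section

theorem map_sum_eq_convPow {Ω ι : Type*} [MeasurableSpace Ω] {μ : Measure Ω}
    [IsProbabilityMeasure μ] {W : ι → Ω → Plane} (hind : iIndepFun W μ)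
    (hW : ∀ i, AEMeasurable (W i) μ) {ρ : Measure Plane} (hρ : ∀ i, μ.map (W i) = ρ)
    (s : Finset ι) : μ.map (∑ i ∈ s, W i) = convPow ρ s.card := by
  classical
  induction s using Finset.induction_on with
  | empty =>
    rw [Finset.sum_empty, Finset.card_empty, convPow]
    have : (0 : Ω → Plane) = fun _ => 0 := rfl
    rw [this, Measure.map_const, measure_univ, one_smul]
  | insert a s ha ih =>
    rw [Finset.sum_insert ha, Finset.card_insert_of_notMem ha, convPow,
      IndepFun.map_add_eq_map_conv_map₀ (hW a) (Finset.aemeasurable_sum _ fun i _ => hW i)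
        (hind.indepFun_finsetSum_of_notMem₀ hW ha).symm, hρ, ih]

theorem charFun_convPow (ρ : Measure Plane) [IsProbabilityMeasure ρ] (k : ℕ) (t : Plane) :
    charFun (convPow ρ k) t = charFun ρ t ^ k := by
  induction k with
  | zero => simp [convPow]
  | succ k ih => rw [convPow, charFun_conv, ih, pow_succ']

/-- Stability of the Gaussian law, checked on characteristic functions. -/
theorem convPow_stdGaussian {n : ℕ} (hn : 0 < n) :
    convPow ((stdGaussian Plane).map fun y => (1 / √(n : ℝ)) • y) n = stdGaussian Plane := by
  have hn0 : (0 : ℝ) < n := by exact_mod_cast hn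
  have hmeas : Measurable fun y : Plane => (1 / √(n : ℝ)) • y := by fun_prop
  have := Measure.isProbabilityMeasure_map (μ := stdGaussian Plane) hmeas.aemeasurable
  refine Measure.ext_of_charFun ?_
  ext t
  rw [charFun_convPow, charFun_map_smul, charFun_stdGaussian, charFun_stdGaussian,
    ← Complex.exp_nat_mul]
  congr 1
  rw [norm_smul, Real.norm_of_nonneg (by positivity)]
  have h : (((1 / √(n : ℝ) * ‖t‖ : ℝ)) : ℂ) ^ 2 = ((‖t‖ ^ 2 / n : ℝ) : ℂ) := by
    rw [← Complex.ofReal_pow, mul_pow, div_pow, Real.sq_sqrt hn0.le]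
    congr 1
    ring
  have hnC : (n : ℂ) ≠ 0 := by exact_mod_cast hn.ne'
  rw [h]
  push_cast
  field_simp

/-! ### Moments of the standard normal distribution -/

theorem integrable_pow_gaussian (j : ℕ) : Integrable (fun x : ℝ => x ^ j) (gaussianReal 0 1) :=
  integrable_pow_of_mem_interior_integrableExpSet (X := id)
    (by rw [integrableExpSet_id_gaussianReal, interior_univ]; trivial) j

theorem integral_sq_gaussian : ∫ x : ℝ, x ^ 2 ∂(gaussianReal 0 1) = 1 := by
  have h := variance_id_gaussianReal (μ := 0) (v := 1)
  rw [variance_eq_integral measurable_id.aemeasurable] at h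
  simpa [integral_id_gaussianReal] using h

theorem exp_half_le : Real.exp (1 / 2) ≤ 2 := by
  have h1 := Real.exp_one_lt_d9
  have h2 : Real.exp (1 / 2) ^ 2 = Real.exp 1 := by
    rw [← Real.exp_nat_mul]
    norm_num
  nlinarith [Real.exp_pos (1 / 2)]

/-- The mean of cosh is exp(1/2) ≤ 2, and three terms of its series leave 24 (2 - 3/2) = 12; the
true value 3 is not needed. -/
theorem integral_pow_four_gaussian_le : ∫ x : ℝ, x ^ 4 ∂(gaussianReal 0 1) ≤ 12 := by
  have hm : ∀ t : ℝ, ∫ x : ℝ, Real.exp (t * x) ∂(gaussianReal 0 1) = Real.exp (t ^ 2 / 2) := by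
    intro t
    have := congrFun (mgf_id_gaussianReal (μ := 0) (v := 1)) t
    simpa [mgf] using this
  have e1 := integrable_exp_mul_gaussianReal (μ := 0) (v := 1) 1
  have e2 := integrable_exp_mul_gaussianReal (μ := 0) (v := 1) (-1)
  have h1 := hm 1
  have h2 := hm (-1)
  have hsum : ∫ x : ℝ, (1 / 2 * Real.exp (1 * x) + 1 / 2 * Real.exp (-1 * x)) ∂(gaussianReal 0 1) =
      Real.exp (1 / 2) := by
    rw [integral_add (e1.const_mul _) (e2.const_mul _), integral_const_mul, integral_const_mul,
      h1, h2]
    norm_num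
    ring
  have i2 := (integrable_pow_gaussian 2).const_mul (1 / 2)
  have i4 := (integrable_pow_gaussian 4).const_mul (1 / 24)
  have ic : Integrable (fun _ : ℝ => (1 : ℝ)) (gaussianReal 0 1) := integrable_const _
  have i12 : Integrable (fun x : ℝ => 1 + 1 / 2 * x ^ 2) (gaussianReal 0 1) := ic.add i2
  have hle : ∫ x : ℝ, (1 + 1 / 2 * x ^ 2 + 1 / 24 * x ^ 4) ∂(gaussianReal 0 1) ≤
      ∫ x : ℝ, (1 / 2 * Real.exp (1 * x) + 1 / 2 * Real.exp (-1 * x)) ∂(gaussianReal 0 1) := by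
    refine integral_mono (i12.add i4) ((e1.const_mul _).add (e2.const_mul _)) fun x => ?_
    have := one_add_sq_add_pow_four_le_cosh x
    rw [Real.cosh_eq] at this
    simp only [one_mul, neg_mul]
    linarith
  rw [integral_add i12 i4, integral_add ic i2, integral_const_mul, integral_const_mul,
    integral_sq_gaussian, hsum] at hle
  have := exp_half_le
  simp at hle
  linarith

theorem abs_cube_le (x : ℝ) : |x| ^ 3 ≤ 1 / 2 * x ^ 2 + 1 / 2 * x ^ 4 := by
  rw [← sq_abs x, ← Even.pow_abs (by decide : Even 4) x]
  nlinarith [mul_nonneg (sq_nonneg |x|) (sq_nonneg (|x| - 1))]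

theorem add_cube_le {x y : ℝ} (hx : 0 ≤ x) (hy : 0 ≤ y) :
    (x + y) ^ 3 ≤ 4 * x ^ 3 + 4 * y ^ 3 := by
  nlinarith [mul_nonneg (add_nonneg hx hy) (sq_nonneg (x - y))]

theorem map_eval_stdGaussian (i : Fin 2) :
    (stdGaussian Plane).map (fun y => y i) = gaussianReal 0 1 := by
  rw [← map_pi_eq_stdGaussian, Measure.map_map (by fun_prop) (by fun_prop)]
  exact (measurePreserving_eval (fun _ : Fin 2 => gaussianReal 0 1) i).map_eq

theorem integrable_comp_eval_stdGaussian {f : ℝ → ℝ} (hf : Integrable f (gaussianReal 0 1))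
    (i : Fin 2) : Integrable (fun y : Plane => f (y i)) (stdGaussian Plane) := by
  rw [← map_eval_stdGaussian i] at hf
  exact hf.comp_measurable (by fun_prop)

theorem integral_comp_eval_stdGaussian {f : ℝ → ℝ} (hf : Integrable f (gaussianReal 0 1))
    (i : Fin 2) : ∫ y : Plane, f (y i) ∂(stdGaussian Plane) = ∫ x, f x ∂(gaussianReal 0 1) := by
  rw [← map_eval_stdGaussian i] at hf ⊢
  rw [integral_map (by fun_prop) hf.aestronglyMeasurable]

theorem indepFun_eval_stdGaussian {i j : Fin 2} (hij : i ≠ j) :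
    IndepFun (fun y : Plane => y i) (fun y : Plane => y j) (stdGaussian Plane) := by
  have h := (iIndepFun_pi (μ := fun _ : Fin 2 => gaussianReal 0 1) (X := fun _ x => x)
    (fun _ => aemeasurable_id)).indepFun hij
  rw [← map_pi_eq_stdGaussian]
  rw [indepFun_iff_map_prod_eq_prod_map_map (measurable_pi_apply i).aemeasurable
    (measurable_pi_apply j).aemeasurable] at h
  rw [indepFun_iff_map_prod_eq_prod_map_map (by fun_prop) (by fun_prop)]
  rw [Measure.map_map (by fun_prop) (by fun_prop), Measure.map_map (by fun_prop) (by fun_prop),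
    Measure.map_map (by fun_prop) (by fun_prop)]
  exact h

/-- The constant is 52 = 2 · 4 · 13/2, from (a + b)³ ≤ 4a³ + 4b³ and |x|³ ≤ (x² + x⁴)/2. -/
theorem isStandardised_stdGaussian : IsStandardised (stdGaussian Plane) 52 where
  integrable_fst i := by
    simpa using integrable_comp_eval_stdGaussian (integrable_pow_gaussian 1) i
  integral_fst i := by
    have := integral_comp_eval_stdGaussian (integrable_pow_gaussian 1) i
    simpa [integral_id_gaussianReal] using this
  integrable_snd i j := by
    have hf := fun i => integrable_comp_eval_stdGaussian (integrable_pow_gaussian 1) i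
    by_cases hij : i = j
    · subst hij
      simpa [pow_two] using integrable_comp_eval_stdGaussian (integrable_pow_gaussian 2) i
    · exact (indepFun_eval_stdGaussian hij).integrable_mul (by simpa using hf i)
        (by simpa using hf j)
  integral_snd i j := by
    by_cases hij : i = j
    · subst hij
      have := integral_comp_eval_stdGaussian (integrable_pow_gaussian 2) i
      rw [integral_sq_gaussian] at this
      simpa [pow_two] using this
    · rw [if_neg hij]
      have h := (indepFun_eval_stdGaussian hij).integral_fun_mul_eq_mul_integral
        (by fun_prop) (by fun_prop)
      have := integral_comp_eval_stdGaussian (integrable_pow_gaussian 1) i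
      simp only [pow_one, integral_id_gaussianReal] at this
      rw [h, this, zero_mul]
  integrable_cube := by
    have h : ∀ i : Fin 2, Integrable (fun y : Plane => 4 * |y i| ^ 3) (stdGaussian Plane) := by
      intro i
      have := (integrable_pow_gaussian 3).abs
      simp only [abs_pow] at this
      exact (integrable_comp_eval_stdGaussian this i).const_mul 4
    refine ((h 0).add (h 1)).mono' (by fun_prop) (Filter.Eventually.of_forall fun y => ?_)
    rw [Real.norm_of_nonneg (by positivity)]
    exact add_cube_le (abs_nonneg _) (abs_nonneg _)
  integral_cube_le := by
    have hi : Integrable (fun x : ℝ => 1 / 2 * x ^ 2 + 1 / 2 * x ^ 4) (gaussianReal 0 1) :=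
      ((integrable_pow_gaussian 2).const_mul _).add ((integrable_pow_gaussian 4).const_mul _)
    have hv : ∀ i : Fin 2, ∫ y : Plane, (1 / 2 * (y i) ^ 2 + 1 / 2 * (y i) ^ 4)
        ∂(stdGaussian Plane) ≤ 13 / 2 := by
      intro i
      rw [integral_comp_eval_stdGaussian hi i, integral_add
        ((integrable_pow_gaussian 2).const_mul _) ((integrable_pow_gaussian 4).const_mul _),
        integral_const_mul, integral_const_mul, integral_sq_gaussian]
      linarith [integral_pow_four_gaussian_le]
    have hj := fun i => integrable_comp_eval_stdGaussian hi i
    calc ∫ y : Plane, (|y 0| + |y 1|) ^ 3 ∂(stdGaussian Plane)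
        ≤ ∫ y : Plane, (4 * (1 / 2 * (y 0) ^ 2 + 1 / 2 * (y 0) ^ 4) +
          4 * (1 / 2 * (y 1) ^ 2 + 1 / 2 * (y 1) ^ 4)) ∂(stdGaussian Plane) := by
          refine integral_mono_of_nonneg (Filter.Eventually.of_forall fun y => by positivity)
            (((hj 0).const_mul 4).add ((hj 1).const_mul 4))
            (Filter.Eventually.of_forall fun y => ?_)
          refine (add_cube_le (abs_nonneg _) (abs_nonneg _)).trans ?_
          dsimp only
          gcongr
          · exact abs_cube_le _
          · exact abs_cube_le _
      _ ≤ 52 := by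
          rw [integral_add ((hj 0).const_mul 4) ((hj 1).const_mul 4), integral_const_mul,
            integral_const_mul]
          linarith [hv 0, hv 1]

end

/-! ### The standardised score and its moments -/

section

variable {α β : ℝ}

/-- The score of one observation, multiplied by the inverse square root of the information. -/
noncomputable def stdScore (α β x : ℝ) : Plane :=
  !₂[scoreComb α β (1 / √(betaDC α β) * betaC₂ β α) (1 / √(betaDC α β) * polygamma 1 (α + β)) x,
    scoreComb α β (1 / √(betaDC α β) * polygamma 1 (α + β)) (1 / √(betaDC α β) * betaC₂ α β) x]

theorem measurable_stdScore (α β : ℝ) : Measurable (stdScore α β) := by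
  refine (WithLp.measurable_toLp 2 (Fin 2 → ℝ)).comp (measurable_pi_lambda _ fun i => ?_)
  fin_cases i <;> exact measurable_scoreComb _ _ _ _

theorem stdScore_fst (α β x : ℝ) : stdScore α β x 0 = 1 / √(betaDC α β) *
    (betaC₂ β α * scoreComb α β 1 0 x + polygamma 1 (α + β) * scoreComb α β 0 1 x) :=
  (scoreComb_eq _ _ _ _ _).trans (by ring)

theorem stdScore_snd (α β x : ℝ) : stdScore α β x 1 = 1 / √(betaDC α β) *
    (polygamma 1 (α + β) * scoreComb α β 1 0 x + betaC₂ α β * scoreComb α β 0 1 x) :=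
  (scoreComb_eq _ _ _ _ _).trans (by ring)

theorem abs_combo_le_of_nonneg {a b u v : ℝ} (ha : 0 ≤ a) (hb : 0 ≤ b) :
    |a * u + b * v| ≤ a * |u| + b * |v| := by
  refine (abs_add_le _ _).trans_eq ?_
  rw [abs_mul, abs_mul, abs_of_nonneg ha, abs_of_nonneg hb]

theorem integrable_scoreComb_mul (hα : 0 < α) (hβ : 0 < β) (c₁ c₂ d₁ d₂ : ℝ) :
    Integrable (fun x => scoreComb α β c₁ c₂ x * scoreComb α β d₁ d₂ x) (betaMeasure α β) := by
  have h : ∀ c₁ c₂, MemLp (scoreComb α β c₁ c₂) 2 (betaMeasure α β) := fun c₁ c₂ => by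
    exact_mod_cast memLp_scoreComb hα hβ c₁ c₂ 2
  exact (h c₁ c₂).integrable_mul (h d₁ d₂)

theorem integral_scoreComb_mul_scoreComb (hα : 0 < α) (hβ : 0 < β) (c₁ c₂ d₁ d₂ : ℝ) :
    ∫ x, scoreComb α β c₁ c₂ x * scoreComb α β d₁ d₂ x ∂betaMeasure α β =
      c₁ * d₁ * (hurwitzSum 2 α - hurwitzSum 2 (α + β)) +
        c₂ * d₂ * (hurwitzSum 2 β - hurwitzSum 2 (α + β)) -
        (c₁ * d₂ + c₂ * d₁) * hurwitzSum 2 (α + β) := by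
  have h0 := (moments_scoreComb hα hβ 1 0).2.1
  have h1 := (moments_scoreComb hα hβ 0 1).2.1
  have h2 := integral_scoreComb_mul hα hβ
  have i0 := (integrable_scoreComb_pow hα hβ 1 0 2).const_mul (c₁ * d₁)
  have i1 := (integrable_scoreComb_pow hα hβ 0 1 2).const_mul (c₂ * d₂)
  have i2 := (integrable_scoreComb_mul hα hβ 1 0 0 1).const_mul (c₁ * d₂ + c₂ * d₁)
  have i01 : Integrable (fun x => c₁ * d₁ * scoreComb α β 1 0 x ^ 2 +
    c₂ * d₂ * scoreComb α β 0 1 x ^ 2) (betaMeasure α β) := i0.add i1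
  have e : ∀ x, scoreComb α β c₁ c₂ x * scoreComb α β d₁ d₂ x =
      c₁ * d₁ * scoreComb α β 1 0 x ^ 2 + c₂ * d₂ * scoreComb α β 0 1 x ^ 2 +
        (c₁ * d₂ + c₂ * d₁) * (scoreComb α β 1 0 x * scoreComb α β 0 1 x) := by
    intro x
    rw [scoreComb_eq α β c₁, scoreComb_eq α β d₁]
    ring
  simp_rw [e]
  rw [integral_add i01 i2, integral_add i0 i1, integral_const_mul, integral_const_mul,
    integral_const_mul, h0, h1, h2]
  simp only [hurwitzForm]
  ring_nf

theorem betaC₂_eq (hα : 0 < α) (hβ : 0 < β) :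
    betaC₂ α β = hurwitzSum 2 α - hurwitzSum 2 (α + β) + √(fisherDet α β) := by
  rw [betaC₂, polygamma_one hα, polygamma_one (by linarith), betaDelta_eq_fisherDet hα hβ]

theorem betaC₂_eq' (hα : 0 < α) (hβ : 0 < β) :
    betaC₂ β α = hurwitzSum 2 β - hurwitzSum 2 (α + β) + √(fisherDet α β) := by
  rw [betaC₂_eq hβ hα, add_comm β α, fisherDet_comm]

theorem betaDC_eq' (hα : 0 < α) (hβ : 0 < β) :
    betaDC α β = fisherDet α β * (betaC₂ α β + betaC₂ β α) := by
  rw [betaDC, betaDelta_eq_fisherDet hα hβ]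

/-- The rows of the inverse square root of the information. -/
theorem betaC₂_sq_mul_add (hα : 0 < α) (hβ : 0 < β) :
    betaC₂ β α ^ 2 * (hurwitzSum 2 α - hurwitzSum 2 (α + β)) +
      hurwitzSum 2 (α + β) ^ 2 * (hurwitzSum 2 β - hurwitzSum 2 (α + β)) -
      2 * betaC₂ β α * hurwitzSum 2 (α + β) ^ 2 = betaDC α β := by
  have hr := Real.sq_sqrt (fisherDet_pos hα hβ).le
  have hd := fisherDet_eq α β
  rw [betaDC_eq' hα hβ, betaC₂_eq hα hβ, betaC₂_eq' hα hβ]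
  set r := √(fisherDet α β)
  rw [← hr] at hd ⊢
  generalize hurwitzSum 2 α - hurwitzSum 2 (α + β) = P at *
  generalize hurwitzSum 2 β - hurwitzSum 2 (α + β) = Q at *
  generalize hurwitzSum 2 (α + β) = w at *
  have hw : w ^ 2 = P * Q - r ^ 2 := by linarith
  rw [hw]
  ring

/-- Orthogonality of the two rows of the inverse square root with respect to the information, after
removal of a common factor Ψ₁(α + β). -/
theorem betaC₂_mul_betaC₂ (hα : 0 < α) (hβ : 0 < β) :
    betaC₂ β α * (hurwitzSum 2 α - hurwitzSum 2 (α + β)) +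
      betaC₂ α β * (hurwitzSum 2 β - hurwitzSum 2 (α + β)) -
      (betaC₂ β α * betaC₂ α β + hurwitzSum 2 (α + β) ^ 2) = 0 := by
  have hr := Real.sq_sqrt (fisherDet_pos hα hβ).le
  have hd := fisherDet_eq α β
  rw [betaC₂_eq hα hβ, betaC₂_eq' hα hβ]
  set r := √(fisherDet α β)
  rw [← hr] at hd
  linarith

/-- The bracket of the third-order term. -/
noncomputable def betaCubic (α β : ℝ) : ℝ :=
  (betaC₂ β α ^ 3 + polygamma 1 (α + β) ^ 3) * betaC₁ α β ^ (3 / 4 : ℝ) +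
    (betaC₂ α β ^ 3 + polygamma 1 (α + β) ^ 3) * betaC₁ β α ^ (3 / 4 : ℝ)

theorem betaC₁_eq (hα : 0 < α) (hβ : 0 < β) : betaC₁ α β =
    6 * hurwitzSum 4 α + 6 * hurwitzSum 4 (α + β) + 3 * hurwitzSum 2 α ^ 2 +
      3 * hurwitzSum 2 (α + β) ^ 2 := by
  have hs : 0 < α + β := by linarith
  rw [betaC₁, polygamma_three hα, polygamma_three hs, polygamma_one hα, polygamma_one hs]

theorem sq_le_betaC₁ (hα : 0 < α) (hβ : 0 < β) : hurwitzSum 2 α ^ 2 ≤ betaC₁ α β := by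
  have h4 := hurwitzSum_pos (j := 4) (by norm_num) hα
  have h5 := hurwitzSum_pos (j := 4) (by norm_num) (show 0 < α + β by linarith)
  rw [betaC₁_eq hα hβ]
  nlinarith [sq_nonneg (hurwitzSum 2 α), sq_nonneg (hurwitzSum 2 (α + β))]

theorem betaC₁_pos (hα : 0 < α) (hβ : 0 < β) : 0 < betaC₁ α β :=
  lt_of_lt_of_le (pow_pos (hurwitzSum_pos le_rfl hα) 2) (sq_le_betaC₁ hα hβ)

theorem mul_sqrt_le_betaC₁_rpow (hα : 0 < α) (hβ : 0 < β) :
    hurwitzSum 2 α * √(hurwitzSum 2 α) ≤ betaC₁ α β ^ (3 / 4 : ℝ) := by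
  have hp := hurwitzSum_pos (j := 2) le_rfl hα
  calc hurwitzSum 2 α * √(hurwitzSum 2 α) = (hurwitzSum 2 α ^ 2) ^ (3 / 4 : ℝ) := by
        rw [← Real.rpow_natCast, ← Real.rpow_mul hp.le, Real.sqrt_eq_rpow]
        nth_rw 1 [← Real.rpow_one (hurwitzSum 2 α)]
        rw [← Real.rpow_add hp]
        norm_num
    _ ≤ _ := Real.rpow_le_rpow (sq_nonneg _) (sq_le_betaC₁ hα hβ) (by norm_num)

/-- One of the two squares is at least D/2, and that one alone suffices. -/
theorem cube_add_cube_ge {X Y D : ℝ} (hX : 0 ≤ X) (hY : 0 ≤ Y) (hD : 0 ≤ D)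
    (h : D ≤ X ^ 2 + Y ^ 2) : D * √D / 4 ≤ X ^ 3 + Y ^ 3 := by
  have hr := Real.sqrt_nonneg D
  have hr2 := Real.sq_sqrt hD
  have aux : ∀ Z : ℝ, 0 ≤ Z → D / 2 ≤ Z ^ 2 → D * √D / 4 ≤ Z ^ 3 := by
    intro Z hZ hZ2
    have h1 : √D / 2 ≤ Z := by
      rw [← Real.sqrt_sq hZ]
      calc √D / 2 = √(D / 4) := by
            rw [Real.sqrt_div hD, show (4 : ℝ) = 2 ^ 2 by norm_num, Real.sqrt_sq zero_le_two]
        _ ≤ _ := Real.sqrt_le_sqrt (by linarith)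
    calc D * √D / 4 = D / 2 * (√D / 2) := by ring
      _ ≤ Z ^ 2 * Z := by gcongr
      _ = Z ^ 3 := by ring
  rcases le_total (D / 2) (X ^ 2) with h1 | h1
  · linarith [aux X hX h1, pow_nonneg hY 3]
  · linarith [aux Y hY (by linarith), pow_nonneg hX 3]

theorem betaDC_comm (hα : 0 < α) (hβ : 0 < β) : betaDC α β = betaDC β α := by
  rw [betaDC_eq' hα hβ, betaDC_eq' hβ hα, fisherDet_comm, add_comm]

/-- The unit variance of a row of the standardised score gives Δ ≤ C₂(β,α)² Ψ₁(α) + Ψ₁(α+β)² Ψ₁(β),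
and the 3/4 power of C₁ dominates the 3/2 power of Ψ₁. The lower bound makes the bracket large
enough to absorb the third moment of the Gaussian. -/
theorem betaCubic_row_ge (hα : 0 < α) (hβ : 0 < β) :
    betaDC α β * √(betaDC α β) / 4 ≤ betaC₂ β α ^ 3 * betaC₁ α β ^ (3 / 4 : ℝ) +
      polygamma 1 (α + β) ^ 3 * betaC₁ β α ^ (3 / 4 : ℝ) := by
  have hs : 0 < α + β := by linarith
  have hp := hurwitzSum_pos (j := 2) le_rfl hα
  have hq := hurwitzSum_pos (j := 2) le_rfl hβ
  have hw := hurwitzSum_pos (j := 2) le_rfl hs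
  have ha := betaC₂_pos hβ hα
  have e : ∀ c p : ℝ, 0 ≤ p → (c * √p) ^ 3 = c ^ 3 * (p * √p) := by
    intro c p h
    rw [mul_pow, pow_succ √p 2, Real.sq_sqrt h]
  have h1 := betaC₂_sq_mul_add hα hβ
  have h := cube_add_cube_ge (X := betaC₂ β α * √(hurwitzSum 2 α))
    (Y := hurwitzSum 2 (α + β) * √(hurwitzSum 2 β)) (D := betaDC α β) (by positivity)
    (by positivity) (betaDC_pos hα hβ).le (by
      rw [mul_pow, mul_pow, Real.sq_sqrt hp.le, Real.sq_sqrt hq.le, ← h1]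
      nlinarith [mul_pos (pow_pos ha 2) hw, pow_pos hw 3, mul_pos ha (pow_pos hw 2)])
  rw [polygamma_one hs]
  rw [e _ _ hp.le, e _ _ hq.le] at h
  refine h.trans ?_
  gcongr
  · exact mul_sqrt_le_betaC₁_rpow hα hβ
  · exact mul_sqrt_le_betaC₁_rpow hβ hα

theorem betaCubic_ge (hα : 0 < α) (hβ : 0 < β) :
    betaDC α β * √(betaDC α β) / 2 ≤ betaCubic α β := by
  have h1 := betaCubic_row_ge hα hβ
  have h2 := betaCubic_row_ge hβ hα
  rw [← betaDC_comm hα hβ, add_comm β α] at h2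
  rw [betaCubic]
  linarith

theorem rpow_three_halves {D : ℝ} (hD : 0 < D) : D ^ (3 / 2 : ℝ) = D * √D := by
  rw [Real.sqrt_eq_rpow]
  nth_rw 2 [← Real.rpow_one D]
  rw [← Real.rpow_add hD]
  norm_num

theorem cube_le_of_pos {u s : ℝ} (hs : 0 < s) : u ^ 3 ≤ 3 / 4 * u ^ 4 / s + s ^ 3 / 4 := by
  rw [div_add' _ _ _ hs.ne', le_div_iff₀ hs]
  nlinarith [mul_nonneg (sq_nonneg (u - s)) (show 0 ≤ 3 * u ^ 2 + 2 * u * s + s ^ 2 by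
    nlinarith [sq_nonneg (u + s)])]

theorem integrable_abs_scoreComb_cube (hα : 0 < α) (hβ : 0 < β) (c₁ c₂ : ℝ) :
    Integrable (fun x => |scoreComb α β c₁ c₂ x| ^ 3) (betaMeasure α β) := by
  have := (integrable_scoreComb_pow hα hβ c₁ c₂ 3).abs
  simpa only [abs_pow] using this

theorem isProbabilityMeasure_betaMeasure' (hα : 0 < α) (hβ : 0 < β) :
    IsProbabilityMeasure (betaMeasure α β) := isProbabilityMeasureBeta hα hβ

/-- Lyapunov's inequality, obtained from Young's inequality `cube_le_of_pos` with the optimal s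
equal to the fourth root of C. -/
theorem integral_abs_cube_le (hα : 0 < α) (hβ : 0 < β) {c₁ c₂ C : ℝ} (hC : 0 < C)
    (h : ∫ x, scoreComb α β c₁ c₂ x ^ 4 ∂betaMeasure α β ≤ C) :
    ∫ x, |scoreComb α β c₁ c₂ x| ^ 3 ∂betaMeasure α β ≤ C ^ (3 / 4 : ℝ) := by
  have := isProbabilityMeasure_betaMeasure' hα hβ
  set s := C ^ (1 / 4 : ℝ) with hs
  have hs0 : 0 < s := Real.rpow_pos_of_pos hC _
  have hs4 : s ^ 4 = C := by
    rw [hs, ← Real.rpow_natCast, ← Real.rpow_mul hC.le]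
    norm_num
  have hs3 : s ^ 3 = C ^ (3 / 4 : ℝ) := by
    rw [hs, ← Real.rpow_natCast, ← Real.rpow_mul hC.le]
    norm_num
  have i4 := (integrable_scoreComb_pow hα hβ c₁ c₂ 4).const_mul (3 / 4 / s)
  calc ∫ x, |scoreComb α β c₁ c₂ x| ^ 3 ∂betaMeasure α β
      ≤ ∫ x, (3 / 4 / s * scoreComb α β c₁ c₂ x ^ 4 + s ^ 3 / 4) ∂betaMeasure α β := by
        refine integral_mono (integrable_abs_scoreComb_cube hα hβ c₁ c₂)
          (i4.add (integrable_const _)) fun x => ?_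
        have := cube_le_of_pos (u := |scoreComb α β c₁ c₂ x|) hs0
        rw [Even.pow_abs (by decide : Even 4)] at this
        refine this.trans_eq ?_
        ring
    _ = 3 / 4 / s * ∫ x, scoreComb α β c₁ c₂ x ^ 4 ∂betaMeasure α β + s ^ 3 / 4 := by
        rw [integral_add i4 (integrable_const _), integral_const_mul]
        simp
    _ ≤ 3 / 4 / s * s ^ 4 + s ^ 3 / 4 := by
        rw [hs4]
        gcongr
    _ = s ^ 3 := by
        field_simp
        ring
    _ = _ := hs3

theorem integral_abs_score_cube_le (hα : 0 < α) (hβ : 0 < β) :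
    ∫ x, |scoreComb α β 1 0 x| ^ 3 ∂betaMeasure α β ≤ betaC₁ α β ^ (3 / 4 : ℝ) ∧
      ∫ x, |scoreComb α β 0 1 x| ^ 3 ∂betaMeasure α β ≤ betaC₁ β α ^ (3 / 4 : ℝ) := by
  have hs : 0 < α + β := by linarith
  have hw := hurwitzSum_pos (j := 2) le_rfl hs
  have hw4 := hurwitzSum_pos (j := 4) (by norm_num) hs
  have h1 := hurwitzSum_two_add_lt hα hβ
  have h2 := hurwitzSum_two_add_lt' hα hβ
  constructor
  · refine integral_abs_cube_le hα hβ (betaC₁_pos hα hβ) ?_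
    rw [(moments_scoreComb hα hβ 1 0).2.2, betaC₁_eq hα hβ]
    simp only [hurwitzForm]
    norm_num
    nlinarith
  · refine integral_abs_cube_le hα hβ (betaC₁_pos hβ hα) ?_
    rw [(moments_scoreComb hα hβ 0 1).2.2, betaC₁_eq hβ hα, add_comm β α]
    simp only [hurwitzForm]
    norm_num
    nlinarith

/-- The covariance is the identity because the rows of the inverse square root are orthonormal for
the information. The factor 16 comes from two nested uses of (a + b)³ ≤ 4a³ + 4b³. -/
theorem isStandardised_stdScore (hα : 0 < α) (hβ : 0 < β) :
    IsStandardised ((betaMeasure α β).map (stdScore α β))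
      (16 * betaCubic α β / betaDC α β ^ (3 / 2 : ℝ)) := by
  have hs : 0 < α + β := by linarith
  have hm := measurable_stdScore α β
  have hw := hurwitzSum_pos (j := 2) le_rfl hs
  have ha := betaC₂_pos hβ hα
  have hb := betaC₂_pos hα hβ
  have hDC := betaDC_pos hα hβ
  have hc : ∀ i : Fin 2, ∃ c₁ c₂ : ℝ, ∀ x, stdScore α β x i = scoreComb α β c₁ c₂ x := by
    intro i
    fin_cases i
    · exact ⟨_, _, fun x => rfl⟩
    · exact ⟨_, _, fun x => rfl⟩
  have ht : (1 / √(betaDC α β)) ^ 2 * betaDC α β = 1 := by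
    rw [div_pow, Real.sq_sqrt hDC.le]
    field_simp
  have ht3 : (1 / √(betaDC α β)) ^ 3 = 1 / betaDC α β ^ (3 / 2 : ℝ) := by
    rw [rpow_three_halves hDC, div_pow, pow_succ √(betaDC α β) 2, Real.sq_sqrt hDC.le, one_pow]
  have ht0 : 0 < 1 / √(betaDC α β) := by positivity
  have hcube : ∀ x, (|stdScore α β x 0| + |stdScore α β x 1|) ^ 3 ≤
      16 / betaDC α β ^ (3 / 2 : ℝ) *
        ((betaC₂ β α ^ 3 + polygamma 1 (α + β) ^ 3) * |scoreComb α β 1 0 x| ^ 3 +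
          (betaC₂ α β ^ 3 + polygamma 1 (α + β) ^ 3) * |scoreComb α β 0 1 x| ^ 3) := by
    intro x
    rw [polygamma_one hs, ← mul_one_div, ← ht3]
    set t := 1 / √(betaDC α β) with htdef
    set u := |scoreComb α β 1 0 x|
    set v := |scoreComb α β 0 1 x|
    set w := hurwitzSum 2 (α + β)
    have hu : 0 ≤ u := abs_nonneg _
    have hv : 0 ≤ v := abs_nonneg _
    have e0 : |stdScore α β x 0| ≤ t * (betaC₂ β α * u + w * v) := by
      rw [stdScore_fst, polygamma_one hs, abs_mul, abs_of_pos ht0]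
      gcongr
      exact abs_combo_le_of_nonneg ha.le hw.le
    have e1 : |stdScore α β x 1| ≤ t * (w * u + betaC₂ α β * v) := by
      rw [stdScore_snd, polygamma_one hs, abs_mul, abs_of_pos ht0]
      gcongr
      exact abs_combo_le_of_nonneg hw.le hb.le
    set A := betaC₂ β α * u
    set B := w * v
    set A' := w * u
    set B' := betaC₂ α β * v
    have hA : 0 ≤ A := by positivity
    have hB : 0 ≤ B := by positivity
    have hA' : 0 ≤ A' := by positivity
    have hB' : 0 ≤ B' := by positivity
    have c1 := add_cube_le hA hB
    have c2 := add_cube_le hA' hB'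
    have c3 := add_cube_le (add_nonneg hA hB) (add_nonneg hA' hB')
    calc _ ≤ (t * (A + B) + t * (A' + B')) ^ 3 := by gcongr
      _ = t ^ 3 * ((A + B) + (A' + B')) ^ 3 := by ring
      _ ≤ t ^ 3 * (16 * (A ^ 3 + B ^ 3 + A' ^ 3 + B' ^ 3)) := by
          gcongr
          linarith
      _ = 16 * t ^ 3 * (A ^ 3 + B ^ 3 + A' ^ 3 + B' ^ 3) := by ring
      _ = _ := by
          simp only [A, B, A', B']
          ring
  have j0 := integrable_abs_scoreComb_cube hα hβ 1 0
  have j1 := integrable_abs_scoreComb_cube hα hβ 0 1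
  have hdom : Integrable (fun x => 16 / betaDC α β ^ (3 / 2 : ℝ) *
        ((betaC₂ β α ^ 3 + polygamma 1 (α + β) ^ 3) * |scoreComb α β 1 0 x| ^ 3 +
          (betaC₂ α β ^ 3 + polygamma 1 (α + β) ^ 3) * |scoreComb α β 0 1 x| ^ 3))
      (betaMeasure α β) := ((j0.const_mul _).add (j1.const_mul _)).const_mul _
  refine ⟨fun i => ?_, fun i => ?_, fun i j => ?_, fun i j => ?_, ?_, ?_⟩
  · obtain ⟨c₁, c₂, h⟩ := hc i
    rw [integrable_map_measure (by fun_prop) hm.aemeasurable]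
    refine (integrable_scoreComb_pow hα hβ c₁ c₂ 1).congr (Filter.Eventually.of_forall fun x => ?_)
    simp [h]
  · obtain ⟨c₁, c₂, h⟩ := hc i
    rw [integral_map hm.aemeasurable (by fun_prop)]
    simp_rw [h]
    exact (moments_scoreComb hα hβ c₁ c₂).1
  · obtain ⟨c₁, c₂, h⟩ := hc i
    obtain ⟨d₁, d₂, h'⟩ := hc j
    rw [integrable_map_measure (by fun_prop) hm.aemeasurable]
    refine (integrable_scoreComb_mul hα hβ c₁ c₂ d₁ d₂).congr
      (Filter.Eventually.of_forall fun x => ?_)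
    simp [h, h']
  · rw [integral_map hm.aemeasurable (by fun_prop)]
    have r1 := betaC₂_sq_mul_add hα hβ
    have r2 := betaC₂_sq_mul_add hβ hα
    have r3 := betaC₂_mul_betaC₂ hα hβ
    rw [← betaDC_comm hα hβ, add_comm β α] at r2
    have E := integral_scoreComb_mul_scoreComb hα hβ
    fin_cases i <;> fin_cases j
    · refine (E _ _ _ _).trans ?_
      rw [polygamma_one hs, if_pos rfl]
      linear_combination (1 / √(betaDC α β)) ^ 2 * r1 + ht
    · refine (E _ _ _ _).trans ?_
      rw [polygamma_one hs, if_neg (by decide)]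
      linear_combination (1 / √(betaDC α β)) ^ 2 * hurwitzSum 2 (α + β) * r3
    · refine (E _ _ _ _).trans ?_
      rw [polygamma_one hs, if_neg (by decide)]
      linear_combination (1 / √(betaDC α β)) ^ 2 * hurwitzSum 2 (α + β) * r3
    · refine (E _ _ _ _).trans ?_
      rw [polygamma_one hs, if_pos rfl]
      linear_combination (1 / √(betaDC α β)) ^ 2 * r2 + ht
  · rw [integrable_map_measure (by fun_prop) hm.aemeasurable]
    refine hdom.mono' (by
      have h3 : Measurable fun y : Plane => (|y 0| + |y 1|) ^ 3 := by fun_prop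
      exact (h3.comp hm).aestronglyMeasurable) (Filter.Eventually.of_forall fun x => ?_)
    rw [Real.norm_of_nonneg (by simp only [Function.comp_apply]; positivity)]
    exact hcube x
  · rw [integral_map hm.aemeasurable (by fun_prop)]
    obtain ⟨k0, k1⟩ := integral_abs_score_cube_le hα hβ
    calc _ ≤ ∫ x, 16 / betaDC α β ^ (3 / 2 : ℝ) *
          ((betaC₂ β α ^ 3 + polygamma 1 (α + β) ^ 3) * |scoreComb α β 1 0 x| ^ 3 +
          (betaC₂ α β ^ 3 + polygamma 1 (α + β) ^ 3) * |scoreComb α β 0 1 x| ^ 3)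
            ∂betaMeasure α β :=
          integral_mono_of_nonneg (Filter.Eventually.of_forall fun x => by positivity) hdom
            (Filter.Eventually.of_forall hcube)
      _ ≤ 16 / betaDC α β ^ (3 / 2 : ℝ) * betaCubic α β := by
          rw [integral_const_mul, integral_add (j0.const_mul _) (j1.const_mul _),
            integral_const_mul, integral_const_mul, betaCubic, polygamma_one hs]
          gcongr
      _ = _ := by ring

end

/-! ### Normal approximation of the normalised score sum -/

section

variable {α β : ℝ}

/-- The normalised sum of the standardised scores of a sample. -/
noncomputable def stdScoreSum {n : ℕ} (α β : ℝ) (x : Fin n → ℝ) : Plane :=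
  ∑ i, (1 / √(n : ℝ)) • stdScore α β (x i)

theorem measurable_stdScoreSum {n : ℕ} (α β : ℝ) :
    Measurable (stdScoreSum α β : (Fin n → ℝ) → Plane) :=
  Finset.measurable_sum _ fun i _ =>
    ((measurable_stdScore α β).comp (measurable_pi_apply i)).const_smul (1 / √(n : ℝ))

theorem map_stdScoreSum {Ω : Type*} [MeasurableSpace Ω] {μ : Measure Ω} [IsProbabilityMeasure μ]
    {n : ℕ} {X : Fin n → Ω → ℝ} (hlaw : ∀ i, HasLaw (X i) (betaMeasure α β) μ)
    (hind : iIndepFun X μ) :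
    μ.map (fun ω => stdScoreSum α β fun i => X i ω) =
      convPow (((betaMeasure α β).map (stdScore α β)).map fun y => (1 / √(n : ℝ)) • y) n := by
  have hm : Measurable fun y : Plane => (1 / √(n : ℝ)) • y := by fun_prop
  have hg : Measurable fun x => (1 / √(n : ℝ)) • stdScore α β x :=
    hm.comp (measurable_stdScore α β)
  have hi : iIndepFun (fun i ω => (1 / √(n : ℝ)) • stdScore α β (X i ω)) μ :=
    hind.comp (fun _ x => (1 / √(n : ℝ)) • stdScore α β x) fun _ => hg
  have h := map_sum_eq_convPow hi (fun i => hg.comp_aemeasurable (hlaw i).aemeasurable)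
    (ρ := ((betaMeasure α β).map (stdScore α β)).map fun y => (1 / √(n : ℝ)) • y)
    (fun i => by
      rw [Measure.map_map hm (measurable_stdScore α β), ← (hlaw i).map_eq]
      exact (AEMeasurable.map_map_of_aemeasurable hg.aemeasurable (hlaw i).aemeasurable).symm) Finset.univ
  rw [Finset.card_univ, Fintype.card_fin] at h
  rw [← h]
  congr 1
  ext ω : 1
  simp [stdScoreSum]

theorem two_le_eight_rpow : 2 ≤ (8 : ℝ) ^ (3 / 4 : ℝ) := by
  calc (2 : ℝ) = 8 ^ (1 / 3 : ℝ) := by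
        rw [show (8 : ℝ) = 2 ^ (3 : ℝ) by norm_num, ← Real.rpow_mul (by norm_num)]
        norm_num
    _ ≤ 8 ^ (3 / 4 : ℝ) := Real.rpow_le_rpow_of_exponent_le (by norm_num) (by norm_num)

/-- Lindeberg's bound is M (16 A + 52)/(6√n) with A the normalised bracket. As A ≥ 1/2, the 52 is at
most 104 A, and 120 A ≤ 64 · 8^(3/4) A since 8^(3/4) ≥ 2. -/
theorem IsTestFunction.abs_integral_stdScoreSum_sub_le {h : Plane → ℝ} (hh : IsTestFunction h)
    {M H : ℝ} (hM : ∀ i j k x, |partialDeriv i (partialDeriv j (partialDeriv k h)) x| ≤ M)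
    (hH : ∀ x, |h x| ≤ H) (hα : 0 < α) (hβ : 0 < β) {Ω : Type*} [MeasurableSpace Ω]
    {μ : Measure Ω} [IsProbabilityMeasure μ] {n : ℕ} (hn : 0 < n) {X : Fin n → Ω → ℝ}
    (hlaw : ∀ i, HasLaw (X i) (betaMeasure α β) μ) (hind : iIndepFun X μ) :
    |∫ ω, h (stdScoreSum α β fun i => X i ω) ∂μ - ∫ z, h z ∂stdGaussian Plane| ≤
      32 * (8 : ℝ) ^ (3 / 4 : ℝ) / (3 * √n * betaDC α β ^ (3 / 2 : ℝ)) * betaCubic α β * M := by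
  have := isProbabilityMeasure_betaMeasure' hα hβ
  have := Measure.isProbabilityMeasure_map (μ := betaMeasure α β)
    (measurable_stdScore α β).aemeasurable
  have hm : AEMeasurable (fun ω => stdScoreSum α β fun i => X i ω) μ :=
    (measurable_stdScoreSum α β).comp_aemeasurable
      (aemeasurable_pi_lambda _ fun i => (hlaw i).aemeasurable)
  have key := hh.abs_integral_convPow_sub_le hM hH (isStandardised_stdScore hα hβ)
    isStandardised_stdGaussian hn
  rw [convPow_stdGaussian hn, ← map_stdScoreSum hlaw hind,
    integral_map hm hh.continuous.aestronglyMeasurable] at key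
  refine key.trans ?_
  have hM0 : 0 ≤ M := (abs_nonneg _).trans (hM 0 0 0 0)
  have hD := betaDC_pos hα hβ
  have hD3 : 0 < betaDC α β ^ (3 / 2 : ℝ) := Real.rpow_pos_of_pos hD _
  have hn0 : 0 < √(n : ℝ) := Real.sqrt_pos.2 (by exact_mod_cast hn)
  have hA : 1 / 2 ≤ betaCubic α β / betaDC α β ^ (3 / 2 : ℝ) := by
    rw [le_div_iff₀ hD3, rpow_three_halves hD]
    linarith [betaCubic_ge hα hβ]
  have e8 := two_le_eight_rpow
  have e1 : 16 * betaCubic α β / betaDC α β ^ (3 / 2 : ℝ) =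
      16 * (betaCubic α β / betaDC α β ^ (3 / 2 : ℝ)) := by ring
  have e2 : 32 * (8 : ℝ) ^ (3 / 4 : ℝ) / (3 * √n * betaDC α β ^ (3 / 2 : ℝ)) * betaCubic α β * M =
      M * (64 * (8 : ℝ) ^ (3 / 4 : ℝ) * (betaCubic α β / betaDC α β ^ (3 / 2 : ℝ))) /
        (6 * √n) := by
    field_simp
    ring
  rw [e1, e2]
  gcongr
  nlinarith

end

/-! ### Linearisation of the estimator near the true parameter -/

section

variable {α β : ℝ}

/-- Only the first term is sensitive to d; the others are compared with the cubic series at 1, since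
x + k + 1 and x + k + 1 + d both exceed 1 + k. -/
theorem two_mul_digammaRem_le {x d : ℝ} (hx : 0 < x) (hd : 0 < x + d) :
    2 * digammaRem x d ≤ 2 / (x ^ 2 * (x + d)) + 5 / 2 := by
  have hs := summable_digammaRem hx hd
  have h3 := two_mul_hurwitzSum_three_le one_pos
  norm_num at h3
  have h : digammaRem x d ≤ 1 / (x ^ 2 * (x + d)) + hurwitzSum 3 1 := by
    rw [digammaRem, hs.tsum_eq_zero_add]
    simp only [Nat.cast_zero, add_zero]
    gcongr
    refine ((summable_nat_add_iff 1).2 hs).tsum_le_tsum (fun k => ?_)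
      (summable_one_div_add_pow (j := 3) (by norm_num) one_pos)
    push_cast
    have hk : (0 : ℝ) ≤ k := k.cast_nonneg
    have : (1 + (k : ℝ)) ^ 3 = (1 + k) ^ 2 * (1 + k) := by ring
    refine one_div_le_one_div_of_le (by positivity) ?_
    rw [this]
    exact mul_le_mul (pow_le_pow_left₀ (by positivity) (by linarith) 2) (by linarith)
      (by positivity) (by positivity)
  have e : 2 / (x ^ 2 * (x + d)) = 2 * (1 / (x ^ 2 * (x + d))) := by ring
  linarith

/-- With y = α - m/2, the quantity 1/y³ is covered by the β/y⁴ part of C₄ when y ≤ 3β and by its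
1/(y + β)³ part otherwise. -/
theorem half_betaC₄_ge (hα : 0 < α) (hβ : 0 < β) :
    1 / (α ^ 2 * (α - min α β / 2)) + 5 / 4 ≤ betaC₄ (min α β / 2) β α / 2 := by
  have hm : 0 < min α β := lt_min hα hβ
  have hmα := min_le_left α β
  have hy : 0 < α - min α β / 2 := by linarith
  have hpi := le_pi_pow_four
  rw [betaC₄, add_comm β α, show α + β - min α β / 2 = α - min α β / 2 + β by ring]
  have hyα : α - min α β / 2 ≤ α := by linarith
  generalize α - min α β / 2 = y at hy hyα ⊢
  have h1 : 1 / (α ^ 2 * y) ≤ 1 / y ^ 3 := by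
    rw [show y ^ 3 = y ^ 2 * y by ring]
    gcongr
  have h2 : 1 / y ^ 3 ≤ 3 * β / y ^ 4 + 3 / (y + β) ^ 3 := by
    rcases le_total y (3 * β) with h | h
    · have : 1 / y ^ 3 ≤ 3 * β / y ^ 4 := by
        rw [div_le_div_iff₀ (by positivity) (by positivity)]
        nlinarith [pow_pos hy 3]
      have : 0 < 3 / (y + β) ^ 3 := by positivity
      linarith
    · have : 1 / y ^ 3 ≤ 3 / (y + β) ^ 3 := by
        rw [div_le_div_iff₀ (by positivity) (by positivity)]
        have : (y + β) ^ 3 ≤ (4 / 3 * y) ^ 3 := by gcongr; linarith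
        nlinarith [pow_pos hy 3]
      have : 0 < 3 * β / y ^ 4 := by positivity
      linarith
  have h3 : 0 ≤ β * Real.pi ^ 4 / 15 := by positivity
  have e1 : 6 * β / y ^ 4 = 2 * (3 * β / y ^ 4) := by ring
  have e2 : 6 / (y + β) ^ 3 = 2 * (3 / (y + β) ^ 3) := by ring
  rw [e1, e2]
  linarith

/-- With s = α + β and e = m/2 one has s ≥ 4e, and then 3s²(s - 2e) ≥ 2(s - e)³. -/
theorem half_betaC₄_ge' (hα : 0 < α) (hβ : 0 < β) :
    2 / ((α + β) ^ 2 * (α + β - min α β)) + 5 / 2 ≤ betaC₄ (min α β / 2) β α / 2 := by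
  have hm : 0 < min α β := lt_min hα hβ
  have hmα := min_le_left α β
  have hmβ := min_le_right α β
  have hy : 0 < α - min α β / 2 := by linarith
  rw [betaC₄, add_comm β α]
  have h1 : 0 ≤ 6 * β / (α - min α β / 2) ^ 4 := by positivity
  have h3 : 0 ≤ β * Real.pi ^ 4 / 15 := by positivity
  have h2 : 2 / ((α + β) ^ 2 * (α + β - min α β)) ≤ 3 / (α + β - min α β / 2) ^ 3 := by
    set s := α + β with hs
    set e := min α β / 2 with he
    have e4 : 4 * e ≤ s := by linarith
    have e0 : 0 < e := by positivity
    rw [show s - min α β = s - 2 * e by rw [he]; ring]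
    have q1 : 0 < s - 2 * e := by linarith
    have q2 : 0 < s - e := by linarith
    have q3 : 0 < s := by linarith
    rw [div_le_div_iff₀ (by positivity) (by positivity)]
    have : 3 * (s ^ 2 * (s - 2 * e)) - 2 * (s - e) ^ 3 = s * (s ^ 2 - 6 * e ^ 2) + 2 * e ^ 3 := by
      ring
    have : 0 ≤ s * (s ^ 2 - 6 * e ^ 2) := mul_nonneg q3.le (by nlinarith)
    have : 0 < e ^ 3 := by positivity
    linarith
  have e2 : 6 / (α + β - min α β / 2) ^ 3 = 2 * (3 / (α + β - min α β / 2) ^ 3) := by ring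
  rw [e2]
  linarith

/-- The remainder in the linearisation of the likelihood equation, near the true parameter. -/
theorem abs_scoreShift_sub_le_betaC₄ (hα : 0 < α) (hβ : 0 < β) {d₁ d₂ : ℝ}
    (h1 : |d₁| < min α β / 2) (h2 : |d₂| < min α β / 2) :
    |scoreShift α β 1 0 d₁ d₂ - (hurwitzSum 2 α * d₁ - hurwitzSum 2 (α + β) * (d₁ + d₂))| ≤
      betaC₄ (min α β / 2) β α / 2 * (d₁ ^ 2 + d₂ ^ 2) := by
  have hm : 0 < min α β := lt_min hα hβ
  have hmα := min_le_left α β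
  have hmβ := min_le_right α β
  obtain ⟨l1, -⟩ := abs_lt.1 h1
  obtain ⟨l2, -⟩ := abs_lt.1 h2
  have hs : 0 < α + β := by linarith
  have p1 : 0 < α - min α β / 2 := by linarith
  have p2 : 0 < α + β - min α β := by linarith
  refine abs_scoreShift_sub_le hα hβ (by linarith) (by linarith) ?_ ?_
  · refine le_trans ?_ (half_betaC₄_ge hα hβ)
    have r := two_mul_digammaRem_le (d := d₁) hα (by linarith)
    have : 2 / (α ^ 2 * (α + d₁)) ≤ 2 / (α ^ 2 * (α - min α β / 2)) := by
      gcongr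
      linarith
    have e : 2 / (α ^ 2 * (α - min α β / 2)) = 2 * (1 / (α ^ 2 * (α - min α β / 2))) := by ring
    linarith
  · refine le_trans ?_ (half_betaC₄_ge' hα hβ)
    have r := two_mul_digammaRem_le (d := d₁ + d₂) hs (by linarith)
    have : 2 / ((α + β) ^ 2 * (α + β + (d₁ + d₂))) ≤ 2 / ((α + β) ^ 2 * (α + β - min α β)) := by
      gcongr
      linarith
    linarith

theorem betaStandardise_apply (hα : 0 < α) (hβ : 0 < β) (n : ℕ) (t : Plane) :
    betaStandardise n !₂[α, β] t 0 = √n * (1 / √(betaC₂ α β + betaC₂ β α) *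
      (betaC₂ α β * (t 0 - α) - hurwitzSum 2 (α + β) * (t 1 - β))) ∧
    betaStandardise n !₂[α, β] t 1 = √n * (1 / √(betaC₂ α β + betaC₂ β α) *
      (-hurwitzSum 2 (α + β) * (t 0 - α) + betaC₂ β α * (t 1 - β))) := by
  have hp := hurwitzSum_two_add_lt hα hβ
  have hq := hurwitzSum_two_add_lt' hα hβ
  have hdet : (hurwitzSum 2 α - hurwitzSum 2 (α + β)) * (hurwitzSum 2 β - hurwitzSum 2 (α + β)) -
      (-hurwitzSum 2 (α + β)) ^ 2 = fisherDet α β := by rw [fisherDet_eq]; ring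
  have hsq := sqrt_fin_two (a := hurwitzSum 2 α - hurwitzSum 2 (α + β))
    (b := -hurwitzSum 2 (α + β)) (c := hurwitzSum 2 β - hurwitzSum 2 (α + β))
    (by linarith) (by linarith) (by rw [hdet]; exact fisherDet_pos hα hβ)
  rw [hdet] at hsq
  have e1 : hurwitzSum 2 α - hurwitzSum 2 (α + β) + (hurwitzSum 2 β - hurwitzSum 2 (α + β)) +
      2 * √(fisherDet α β) = betaC₂ α β + betaC₂ β α := by
    rw [betaC₂_eq hα hβ, betaC₂_eq' hα hβ]; ring
  rw [e1, ← betaC₂_eq hα hβ, ← betaC₂_eq' hα hβ] at hsq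
  rw [betaStandardise, betaFisherInfo_eq hα hβ, hsq]
  constructor <;>
  · simp [Matrix.toEuclideanLin, Matrix.toLpLin_apply, Matrix.vecHead, Matrix.vecTail]
    ring

/-- The score sum is n times an increment with linear part I d. Since the inverse square root of I
times I is its square root, the linear part reproduces the standardised estimator, and only the
image of the Taylor remainders is left. -/
theorem stdScoreSum_sub_betaStandardise (hα : 0 < α) (hβ : 0 < β) {n : ℕ} (hn : 0 < n)
    {x : Fin n → ℝ} {θ : Plane} (h : IsBetaMLE x θ) (hx : ∀ i, 0 < x i ∧ x i < 1) {R₁ R₂ : ℝ}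
    (hR₁ : R₁ = scoreShift α β 1 0 (θ 0 - α) (θ 1 - β) -
      (hurwitzSum 2 α * (θ 0 - α) - hurwitzSum 2 (α + β) * (θ 0 - α + (θ 1 - β))))
    (hR₂ : R₂ = scoreShift α β 0 1 (θ 0 - α) (θ 1 - β) -
      (hurwitzSum 2 β * (θ 1 - β) - hurwitzSum 2 (α + β) * (θ 0 - α + (θ 1 - β)))) :
    stdScoreSum α β x 0 - betaStandardise n !₂[α, β] θ 0 =
      √n / √(betaDC α β) * (betaC₂ β α * R₁ + hurwitzSum 2 (α + β) * R₂) ∧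
    stdScoreSum α β x 1 - betaStandardise n !₂[α, β] θ 1 =
      √n / √(betaDC α β) * (hurwitzSum 2 (α + β) * R₁ + betaC₂ α β * R₂) := by
  have hs : 0 < α + β := by linarith
  have hn0 : (0 : ℝ) < n := by exact_mod_cast hn
  have s1 := sum_scoreComb_eq_of_isBetaMLE h hx α β 1 0
  have s2 := sum_scoreComb_eq_of_isBetaMLE h hx α β 0 1
  obtain ⟨w1, w2⟩ := betaStandardise_apply hα hβ n θ
  have hδ := fisherDet_pos hα hβ
  have hr : 0 < √(fisherDet α β) := Real.sqrt_pos.2 hδ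
  have hr2 := Real.sq_sqrt hδ.le
  have hd := fisherDet_eq α β
  have hC : 0 < √(betaC₂ α β + betaC₂ β α) :=
    Real.sqrt_pos.2 (add_pos (betaC₂_pos hα hβ) (betaC₂_pos hβ hα))
  have hDC : √(betaDC α β) = √(fisherDet α β) * √(betaC₂ α β + betaC₂ β α) := by
    rw [betaDC_eq' hα hβ, Real.sqrt_mul hδ.le]
  have hsn : 0 < √(n : ℝ) := Real.sqrt_pos.2 hn0
  have v0 : stdScoreSum α β x 0 = √n / √(betaDC α β) *
      (betaC₂ β α * scoreShift α β 1 0 (θ 0 - α) (θ 1 - β) +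
        hurwitzSum 2 (α + β) * scoreShift α β 0 1 (θ 0 - α) (θ 1 - β)) := by
    have : stdScoreSum α β x 0 = ∑ i, 1 / √(n : ℝ) * stdScore α β (x i) 0 := by
      simp [stdScoreSum]
    simp_rw [this, stdScore_fst]
    rw [← Finset.mul_sum, ← Finset.mul_sum, Finset.sum_add_distrib, ← Finset.mul_sum,
      ← Finset.mul_sum, s1, s2, polygamma_one hs]
    field_simp
    rw [Real.sq_sqrt hn0.le]
  have v1 : stdScoreSum α β x 1 = √n / √(betaDC α β) *
      (hurwitzSum 2 (α + β) * scoreShift α β 1 0 (θ 0 - α) (θ 1 - β) +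
        betaC₂ α β * scoreShift α β 0 1 (θ 0 - α) (θ 1 - β)) := by
    have : stdScoreSum α β x 1 = ∑ i, 1 / √(n : ℝ) * stdScore α β (x i) 1 := by
      simp [stdScoreSum]
    simp_rw [this, stdScore_snd]
    rw [← Finset.mul_sum, ← Finset.mul_sum, Finset.sum_add_distrib, ← Finset.mul_sum,
      ← Finset.mul_sum, s1, s2, polygamma_one hs]
    field_simp
    rw [Real.sq_sqrt hn0.le]
  have hw : ∀ u : ℝ, √(n : ℝ) * (1 / √(betaC₂ α β + betaC₂ β α) * u) =
      √n / √(betaDC α β) * (√(fisherDet α β) * u) := by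
    intro u
    rw [hDC]
    field_simp
  rw [v0, v1, w1, w2, hw, hw, ← mul_sub, ← mul_sub, hR₁, hR₂, betaC₂_eq hα hβ, betaC₂_eq' hα hβ]
  constructor <;> congr 1
  · linear_combination (-(θ 0 - α)) * (hr2.trans hd)
  · linear_combination (-(θ 1 - β)) * (hr2.trans hd)

/-- The distance of the standardised estimator from the standardised score. -/
theorem abs_stdScoreSum_sub_betaStandardise_le (hα : 0 < α) (hβ : 0 < β) {n : ℕ} (hn : 0 < n)
    {x : Fin n → ℝ} {θ : Plane} (h : IsBetaMLE x θ) (hx : ∀ i, 0 < x i ∧ x i < 1)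
    (h1 : |θ 0 - α| < min α β / 2) (h2 : |θ 1 - β| < min α β / 2) :
    |stdScoreSum α β x 0 - betaStandardise n !₂[α, β] θ 0| +
      |stdScoreSum α β x 1 - betaStandardise n !₂[α, β] θ 1| ≤
      √n / (2 * √(betaDC α β)) * (betaG (min α β / 2) α β + betaG (min α β / 2) β α) *
        ((θ 0 - α) ^ 2 + (θ 1 - β) ^ 2) := by
  obtain ⟨e1, e2⟩ := stdScoreSum_sub_betaStandardise hα hβ hn h hx rfl rfl
  have b1 := abs_scoreShift_sub_le_betaC₄ hα hβ h1 h2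
  have b2 := abs_scoreShift_sub_le_betaC₄ hβ hα (by rwa [min_comm]) (by rwa [min_comm]) (d₁ := θ 1 - β)
    (d₂ := θ 0 - α)
  rw [← scoreShift_comm, add_comm β α, add_comm (θ 1 - β), min_comm] at b2
  rw [e1, e2]
  generalize scoreShift α β 1 0 (θ 0 - α) (θ 1 - β) -
      (hurwitzSum 2 α * (θ 0 - α) - hurwitzSum 2 (α + β) * (θ 0 - α + (θ 1 - β))) = R₁ at *
  generalize scoreShift α β 0 1 (θ 0 - α) (θ 1 - β) -
      (hurwitzSum 2 β * (θ 1 - β) - hurwitzSum 2 (α + β) * (θ 0 - α + (θ 1 - β))) = R₂ at *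
  have hs : 0 < α + β := by linarith
  have hw := (hurwitzSum_pos (j := 2) le_rfl hs).le
  have c1 := (betaC₂_pos hα hβ).le
  have c2 := (betaC₂_pos hβ hα).le
  have hq : 0 ≤ √(n : ℝ) / √(betaDC α β) := by positivity
  rw [abs_mul, abs_mul, abs_of_nonneg hq]
  -- The two G are the column sums of the unnormalised inverse square root, times the remainder
  -- constants of the two score equations.
  have g1 : betaG (min α β / 2) α β = (betaC₂ β α + hurwitzSum 2 (α + β)) *
      betaC₄ (min α β / 2) β α := by
    rw [betaG, betaC₂_eq' hα hβ, polygamma_one hβ, betaDelta_eq_fisherDet hα hβ]; ring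
  have g2 : betaG (min α β / 2) β α = (betaC₂ α β + hurwitzSum 2 (α + β)) *
      betaC₄ (min α β / 2) α β := by
    rw [betaG, betaC₂_eq hα hβ, polygamma_one hα, betaDelta_eq_fisherDet hβ hα, fisherDet_comm]
    ring
  have k1 := abs_combo_le_of_nonneg (u := R₁) (v := R₂) c2 hw
  have k2 := abs_combo_le_of_nonneg (u := R₁) (v := R₂) hw c1
  have m1 := mul_le_mul_of_nonneg_left b1 (add_nonneg c2 hw)
  have m2 := mul_le_mul_of_nonneg_left b2 (add_nonneg c1 hw)
  calc _ = √n / √(betaDC α β) * (|betaC₂ β α * R₁ + hurwitzSum 2 (α + β) * R₂| +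
        |hurwitzSum 2 (α + β) * R₁ + betaC₂ α β * R₂|) := by ring
    _ ≤ √n / √(betaDC α β) * ((betaG (min α β / 2) α β + betaG (min α β / 2) β α) / 2 *
        ((θ 0 - α) ^ 2 + (θ 1 - β) ^ 2)) := by
        refine mul_le_mul_of_nonneg_left ?_ hq
        rw [g1, g2]
        linarith
    _ = _ := by
        have : 0 < √(betaDC α β) := Real.sqrt_pos.2 (betaDC_pos hα hβ)
        field_simp

end

/-! ### Expectations of test functions at the estimator and at the score -/

section

variable {α β : ℝ} {h : Plane → ℝ}

theorem abs_le_toReal_of_supNorm_le {g : Plane → ℝ} {S : ℝ≥0∞} (hg : supNorm g ≤ S) (hS : S ≠ ∞)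
    (x : Plane) : |g x| ≤ S.toReal := by
  rw [← Real.norm_eq_abs, ← toReal_enorm]
  exact ENNReal.toReal_mono hS ((le_iSup (fun x => ‖g x‖ₑ) x).trans hg)

theorem continuous_betaStandardise (n : ℕ) (θ₀ : Plane) : Continuous (betaStandardise n θ₀) :=
  ((LinearMap.continuous_of_finiteDimensional _).comp (continuous_id.sub continuous_const)).const_smul
    (√(n : ℝ))

/-- Pointwise, the difference is at most a constant times the squared error: through the Lipschitz
bound and the quadratic remainder near the truth, and through the bound 2H away from it. -/
theorem IsTestFunction.abs_integral_betaStandardise_sub_le (hh : IsTestFunction h) {M H : ℝ}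
    (hM : ∀ i x, |partialDeriv i h x| ≤ M) (hH : ∀ x, |h x| ≤ H) (hα : 0 < α) (hβ : 0 < β)
    {Ω : Type*} [MeasurableSpace Ω] {μ : Measure Ω} [IsProbabilityMeasure μ] {n : ℕ} (hn : 0 < n)
    {X : Fin n → Ω → ℝ} (hlaw : ∀ i, HasLaw (X i) (betaMeasure α β) μ) {θ : Ω → Plane}
    (hθ : AEMeasurable θ μ) (hmle : ∀ᵐ ω ∂μ, IsBetaMLE (fun i => X i ω) (θ ω))
    (hint : Integrable (fun ω => (θ ω 0 - α) ^ 2 + (θ ω 1 - β) ^ 2) μ) :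
    |∫ ω, h (betaStandardise n !₂[α, β] (θ ω)) ∂μ -
        ∫ ω, h (stdScoreSum α β fun i => X i ω) ∂μ| ≤
      (8 * H / min α β ^ 2 + M * (√n / (2 * √(betaDC α β)) *
        (betaG (min α β / 2) α β + betaG (min α β / 2) β α))) *
        ∫ ω, (θ ω 0 - α) ^ 2 + (θ ω 1 - β) ^ 2 ∂μ := by
  have hm : 0 < min α β := lt_min hα hβ
  have hM0 : 0 ≤ M := (abs_nonneg _).trans (hM 0 0)
  have hH0 : 0 ≤ H := (abs_nonneg _).trans (hH 0)
  have hG := (add_pos (betaG_min_pos hα hβ) (betaG_min_pos' hα hβ)).le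
  have i1 : Integrable (fun ω => h (betaStandardise n !₂[α, β] (θ ω))) μ :=
    Integrable.of_bound ((hh.continuous.comp (continuous_betaStandardise n _)).measurable.comp_aemeasurable
      hθ).aestronglyMeasurable H (Filter.Eventually.of_forall fun _ => hH _)
  have i2 : Integrable (fun ω => h (stdScoreSum α β fun i => X i ω)) μ :=
    Integrable.of_bound ((hh.continuous.measurable.comp
      (measurable_stdScoreSum α β)).comp_aemeasurable
      (aemeasurable_sample hlaw)).aestronglyMeasurable H (Filter.Eventually.of_forall fun _ => hH _)
  rw [← integral_sub i1 i2, ← integral_const_mul]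
  refine (abs_integral_le_integral_abs).trans
    (integral_mono_ae (i1.sub i2).abs (hint.const_mul _) ?_)
  filter_upwards [hmle, ae_sample_mem_Ioo hlaw] with ω hω hx
  set D := (θ ω 0 - α) ^ 2 + (θ ω 1 - β) ^ 2 with hD
  have hD0 : 0 ≤ D := by positivity
  have hK : 0 ≤ √n / (2 * √(betaDC α β)) *
      (betaG (min α β / 2) α β + betaG (min α β / 2) β α) := by positivity
  rw [add_mul]
  by_cases hd : |θ ω 0 - α| < min α β / 2 ∧ |θ ω 1 - β| < min α β / 2
  · have b := abs_stdScoreSum_sub_betaStandardise_le hα hβ hn hω hx hd.1 hd.2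
    set V := stdScoreSum α β fun i => X i ω
    set W := betaStandardise n !₂[α, β] (θ ω)
    have t := abs_sub_le_of_partialDeriv_le hh.differentiable_one hM W (V - W)
    rw [add_sub_cancel, abs_sub_comm] at t
    have t2 := t.trans (mul_le_mul_of_nonneg_left b hM0)
    have : 0 ≤ 8 * H / min α β ^ 2 * D := by positivity
    linarith
  · have hge : (min α β / 2) ^ 2 ≤ D := by
      rw [hD, ← sq_abs (θ ω 0 - α), ← sq_abs (θ ω 1 - β)]
      rcases not_and_or.1 hd with hd | hd
      · have := pow_le_pow_left₀ (by positivity) (not_lt.1 hd) 2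
        nlinarith [sq_nonneg |θ ω 1 - β|]
      · have := pow_le_pow_left₀ (by positivity) (not_lt.1 hd) 2
        nlinarith [sq_nonneg |θ ω 0 - α|]
    have t1 := hH (betaStandardise n !₂[α, β] (θ ω))
    have t3 := hH (stdScoreSum α β fun i => X i ω)
    have t := abs_sub (h (betaStandardise n !₂[α, β] (θ ω))) (h (stdScoreSum α β fun i => X i ω))
    -- As in Markov's inequality: away from the truth D is at least m²/4.
    have t2 : 2 * H ≤ 8 * H / min α β ^ 2 * D := by
      rw [div_mul_eq_mul_div, le_div_iff₀ (by positivity)]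
      nlinarith
    have := mul_nonneg (mul_nonneg hM0 hK) hD0
    linarith

end

/-! ### The theorem -/

theorem mainTheorem3 {Ω : Type*} [MeasurableSpace Ω] (μ : Measure Ω) [IsProbabilityMeasure μ]
    (α β : ℝ) (hα : 0 < α) (hβ : 0 < β) (n : ℕ)
    (X : Fin n → Ω → ℝ) (hlaw : ∀ i, HasLaw (X i) (betaMeasure α β) μ) (hind : iIndepFun X μ)
    (θhat : (Fin n → ℝ) → Plane) (hmeas : Measurable θhat)
    (hmle : ∀ᵐ ω ∂μ, IsBetaMLE (fun i => X i ω) (θhat fun i => X i ω))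
    (hn : betaThreshold α β ≤ n) (hω : 0 < betaOmega n (min α β / 2) α β) :
    (Integrable (fun ω => ∑ j, (θhat (fun i => X i ω) j - !₂[α, β] j) ^ 2) μ ∧
      √(∫ ω, ∑ j, (θhat (fun i => X i ω) j - !₂[α, β] j) ^ 2 ∂μ) ≤
        √(betaGamma n α β / (n * betaOmega n (min α β / 2) α β)) ∧
      ∫ ω, ∑ j, (θhat (fun i => X i ω) j - !₂[α, β] j) ^ 2 ∂μ ≤
        √(betaGamma n α β / (n * betaOmega n (min α β / 2) α β))) ∧
    ∀ h : Plane → ℝ, IsTestFunction h →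
      ENNReal.ofReal |(∫ ω, h (betaStandardise n !₂[α, β] (θhat fun i => X i ω)) ∂μ) -
          ∫ z, h z ∂(stdGaussian Plane)| ≤
        ENNReal.ofReal (2 / (√n * betaDC α β) * betaV₁ α β) * supNorm₂ h +
        ENNReal.ofReal (√6 / (√n * betaDC α β) * betaV₂ α β) * supNorm₂ h +
        ENNReal.ofReal (32 * (8 : ℝ) ^ (3 / 4 : ℝ) / (3 * √n * betaDC α β ^ (3 / 2 : ℝ)) *
          ((betaC₂ β α ^ 3 + polygamma 1 (α + β) ^ 3) * betaC₁ α β ^ (3 / 4 : ℝ) +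
            (betaC₂ α β ^ 3 + polygamma 1 (α + β) ^ 3) * betaC₁ β α ^ (3 / 4 : ℝ))) *
          supNorm₃ h +
        ENNReal.ofReal (8 * betaGamma n α β /
          (n * min α β ^ 2 * betaOmega n (min α β / 2) α β)) * supNorm h +
        ENNReal.ofReal (betaGamma n α β *
          (betaG (min α β / 2) α β + betaG (min α β / 2) β α) /
          (2 * √n * betaOmega n (min α β / 2) α β * √(betaDC α β))) * supNorm₁ h := by
  have hθ : AEMeasurable (fun ω => θhat fun i => X i ω) μ :=
    hmeas.comp_aemeasurable (aemeasurable_sample hlaw)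
  have hn5 := (sample_size_bounds_of_threshold hα hβ hn hω).2.1
  have hn0 : 0 < n := by omega
  have hnr : (0 : ℝ) < n := by exact_mod_cast hn0
  have hγ : 0 < betaGamma n α β := (estTrace_pos hα hβ).trans_le (betaGamma_ge hα hβ n)
  have hm : 0 < min α β := lt_min hα hβ
  obtain ⟨hint, hB, h1⟩ := betaMLE_mse_bound hα hβ hlaw hind hθ hmle hn hω
  have hsum : ∀ ω, ∑ j, (θhat (fun i => X i ω) j - !₂[α, β] j) ^ 2 =
      (θhat (fun i => X i ω) 0 - α) ^ 2 + (θhat (fun i => X i ω) 1 - β) ^ 2 := fun ω => by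
    simp [Fin.sum_univ_two]
  have hnonneg : 0 ≤ ∫ ω, (θhat (fun i => X i ω) 0 - α) ^ 2 + (θhat (fun i => X i ω) 1 - β) ^ 2 ∂μ :=
    integral_nonneg fun ω => by positivity
  simp_rw [hsum]
  refine ⟨⟨hint, Real.sqrt_le_sqrt hB, Real.le_sqrt_of_sq_le ?_⟩, fun h hh => ?_⟩
  -- The mean squared error is at most 1, so its square is at most itself and hence at most γ/(nω).
  · nlinarith
  · by_cases hH : supNorm h = ∞
    -- For unbounded h the right-hand side is ∞ because the coefficient of the supremum norm is
    -- strictly positive; the product 0 · ∞ would be 0.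
    · have hpos : 0 < 8 * betaGamma n α β / (n * min α β ^ 2 * betaOmega n (min α β / 2) α β) := by
        positivity
      rw [hH, ENNReal.mul_top (ENNReal.ofReal_pos.2 hpos).ne', add_top, top_add]
      exact le_top
    · have hH' := abs_le_toReal_of_supNorm_le le_rfl hH
      have hM1 : ∀ i x, |partialDeriv i h x| ≤ (supNorm₁ h).toReal := fun i =>
        abs_le_toReal_of_supNorm_le (le_iSup (fun i => supNorm (partialDeriv i h)) i)
          hh.bounded_one.ne
      have hM3 : ∀ i j k x, |partialDeriv i (partialDeriv j (partialDeriv k h)) x| ≤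
          (supNorm₃ h).toReal := fun i j k =>
        abs_le_toReal_of_supNorm_le
          ((le_iSup (fun k => supNorm (partialDeriv i (partialDeriv j (partialDeriv k h)))) k).trans
            ((le_iSup (fun j => ⨆ k, supNorm (partialDeriv i (partialDeriv j (partialDeriv k h))))
              j).trans (le_iSup (fun i => ⨆ j, ⨆ k,
                supNorm (partialDeriv i (partialDeriv j (partialDeriv k h)))) i)))
          hh.bounded_three.ne
      have b1 := hh.abs_integral_betaStandardise_sub_le hM1 hH' hα hβ hn0 hlaw hθ hmle hint
      have b2 := hh.abs_integral_stdScoreSum_sub_le hM3 hH' hα hβ hn0 hlaw hind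
      rw [← ENNReal.ofReal_toReal hH, ← ENNReal.ofReal_toReal hh.bounded_one.ne,
        ← ENNReal.ofReal_toReal hh.bounded_three.ne]
      have n0 : 0 ≤ (supNorm h).toReal := ENNReal.toReal_nonneg
      have n1 : 0 ≤ (supNorm₁ h).toReal := ENNReal.toReal_nonneg
      have n3 : 0 ≤ (supNorm₃ h).toReal := ENNReal.toReal_nonneg
      generalize (supNorm h).toReal = H at *
      generalize (supNorm₁ h).toReal = M₁ at *
      generalize (supNorm₃ h).toReal = M₃ at *
      have hG := (add_pos (betaG_min_pos hα hβ) (betaG_min_pos' hα hβ)).le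
      have hD := betaDC_pos hα hβ
      have hD3 : 0 < betaDC α β ^ (3 / 2 : ℝ) := Real.rpow_pos_of_pos hD _
      have hcub : 0 ≤ betaCubic α β := le_trans (by positivity) (betaCubic_ge hα hβ)
      rw [← betaCubic, ← ENNReal.ofReal_mul' n0, ← ENNReal.ofReal_mul' n1, ← ENNReal.ofReal_mul' n3,
        add_assoc, add_assoc]
      -- The two terms with second derivatives are dropped; the other three already suffice.
      refine le_trans ?_ le_add_self
      rw [← ENNReal.ofReal_add (by positivity) (by positivity),
        ← ENNReal.ofReal_add (by positivity) (by positivity)]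
      refine ENNReal.ofReal_le_ofReal ?_
      refine (abs_sub_le _ (∫ ω, h (stdScoreSum α β fun i => X i ω) ∂μ) _).trans ?_
      have b3 := b1.trans (mul_le_mul_of_nonneg_left hB (by positivity))
      have e : (8 * H / min α β ^ 2 + M₁ * (√n / (2 * √(betaDC α β)) *
          (betaG (min α β / 2) α β + betaG (min α β / 2) β α))) *
          (betaGamma n α β / (n * betaOmega n (min α β / 2) α β)) =
          8 * betaGamma n α β / (n * min α β ^ 2 * betaOmega n (min α β / 2) α β) * H +
          betaGamma n α β * (betaG (min α β / 2) α β + betaG (min α β / 2) β α) /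
            (2 * √n * betaOmega n (min α β / 2) α β * √(betaDC α β)) * M₁ := by
        have hD2 : 0 < √(betaDC α β) := Real.sqrt_pos.2 hD
        have hs : 0 < √(n : ℝ) := Real.sqrt_pos.2 hnr
        have hnn : (n : ℝ) = √n * √n := (Real.mul_self_sqrt hnr.le).symm
        have e1 : √(n : ℝ) / n = 1 / √n := by
          rw [div_eq_div_iff hnr.ne' hs.ne']
          linarith
        calc _ = 8 * betaGamma n α β / (n * min α β ^ 2 * betaOmega n (min α β / 2) α β) * H +
              √n / n * (betaGamma n α β * (betaG (min α β / 2) α β + betaG (min α β / 2) β α) /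
                (2 * betaOmega n (min α β / 2) α β * √(betaDC α β)) * M₁) := by
              field_simp
          _ = _ := by
              rw [e1]
              field_simp
      rw [e] at b3
      linarith
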